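/- **Conventions.** Let $V$ be a complex vector space, $t$ a formal variable. All maps below with values in power series in $t$ are extended $\mathbb{C}[[t]]$-linearly and $t$-adically continuously, and linearly over the functions of the variables. For rational-type singularities, $i_{x;y}$ denotes the expansion in the region $|x|>|y|$, with values in series in $V((x))((y))[[t]]$; superscripts such as $12$ say on which tensor factors a map acts. **Definition.** An $H_D$-quantum vertex algebra is a space $V$ with an endomorphism $D$, a vector $1\in V$, and linear maps $$X_{z_1,z_2}\colon V^{\otimes 2}\to V[[z_1,z_2]][z_1^{-1},(z_1-z_2)^{-1}][[t]],$$ $$S^{(\tau)}_{z_1,z_2}\colon V^{\otimes 2}\to V^{\otimes 2}[z_1^{\pm1},z_2^{\pm1},(z_1-z_2)^{-1}][[t]],$$ $$S^{(\gamma)}_{z_1,z_2}\colon V^{\otimes 2}\to V^{\otimes 2}[z_1^{\pm1},z_2,(z_1-z_2)^{-1},(z_1+\gamma)^{\pm1},z_2+\gamma][[t]],$$ such that, writing $Y(a,z)b=Y_z(a\otimes b)=X_{z,0}(a\otimes b)\in V((z))[[t]]$, for all $a,b,c\in V$: 1. (Vacuum) $X_{z_1,z_2}(a\otimes 1)=e^{z_1D}a$,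 $X_{z_1,z_2}(1\otimes a)=e^{z_2D}a$, $S^{(\tau)}_{z_1,z_2}(a\otimes 1)=a\otimes 1$, $S^{(\tau)}_{z_1,z_2}(1\otimes a)=1\otimes a$. 2. ($H_D$-covariance) $X_{z_1,z_2}(a\otimes Db)=\partial_{z_2}X_{z_1,z_2}(a\otimes b)$. 3. (Braided commutativity) $X_{z_1,z_2}(a\otimes b)=X_{z_2,z_1}\circ S^{(\tau)}_{z_2,z_1}(b\otimes a)$. 4. (Broken translation covariance) $e^{\gamma D}X_{z_1,z_2}\circ S^{(\gamma)}_{z_1,z_2}(a\otimes b)=X_{z_1+\gamma,z_2+\gamma}(a\otimes b)$. 5. (Unitarity) $S^{(\tau)}_{z_1,z_2}\circ\tau\circ S^{(\tau)}_{z_2,z_1}\circ\tau=1$, where $\tau(a\otimes b)=b\otimes a$. 6. (Yang–Baxter) $S^{(\tau),12}_{z_1,z_2}S^{(\tau),13}_{z_1,z_3}S^{(\tau),23}_{z_2,z_3}=S^{(\tau),23}_{z_2,z_3}S^{(\tau),13}_{z_1,z_3}S^{(\tau),12}_{z_1,z_2}$. 7. (Hexagon) $S^{(\tau)}_{z_1,z_2}(X_{w_1,w_2}\otimes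 1)=(X_{w_1,w_2}\otimes 1)\,i_{z_1;w_1,w_2}S^{(\tau),23}_{z_1+w_2,z_2}S^{(\tau),13}_{z_1+w_1,z_2}$ on $V^{\otimes 3}$, where $i_{z_1;w_1,w_2}$ is the expansion in nonnegative powers of $w_1,w_2$. 8. (Locality) For all $a,b\in V$ and $K\ge 0$ there is $N\ge 0$ such that for all $c\in V$, modulo $t^K$, $$(z_1-z_2)^N\,Y(a,z_1)Y(b,z_2)c\equiv(z_1-z_2)^N\,Y_{z_2}(1\otimes Y_{z_1})\,i_{z_2;z_1}S^{(\tau),12}_{z_2,z_1}(b\otimes a\otimes c).$$ **Theorem.** Let $V$ be an $H_D$-quantum vertex algebra. There exists a linear map $$X_{z_1,z_2,z_3}\colon V^{\otimes 3}\to V[[z_1,z_2,z_3]][z_1^{-1},z_2^{-1},(z_1-z_2)^{-1},(z_1-z_3)^{-1},(z_2-z_3)^{-1}][[t]]$$ such that $$i_{z_1;z_2,z_3}X_{z_1,z_2,z_3}=X_{z_1,0}(1\otimes X_{z_2,z_3}),$$ where $i_{z_1;z_2,z_3}$ is the expansion in the region $|z_1|>|z_2|,|z_3|$, with values in $V((z_1))[[z_2,z_3]][z_2^{-1},(z_2-z_3)^{-1}][[t]]$.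 Moreover, for every such map and all $A=a\otimes b\otimes c$ with $a,b,c\in V$, $$i_{z_1;z_2}X_{z_1,z_2,0}(A)=Y(a,z_1)Y(b,z_2)c,$$ $$i_{z_2;z_1}X_{z_1,z_2,0}(A)=Y_{z_2}(1\otimes Y_{z_1})\,i_{z_2;z_1}S^{(\tau),12}_{z_2,z_1}(b\otimes a\otimes c),$$ $$i_{z_2;z_3}X_{z_2+z_3,z_2,0}(A)=Y_{z_2}(Y_{z_3}\otimes 1)\,i_{z_2;z_3}S^{(z_2),12}_{z_3,0}(a\otimes b\otimes c),$$ where $S^{(z_2)}_{z_3,0}$ is $S^{(\gamma)}_{z_1,z_2}$ with $z_1=z_3$, $z_2=0$, $\gamma=z_2$. -/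

import Mathlib

open scoped TensorProduct
noncomputable section
namespace HDQVA

/-- Formal power series in `n` variables with coefficients in `W`, i.e. `W[[z_0, …, z_{n-1}]]`. -/
def PS (n : ℕ) (W : Type*) : Type _ := (Fin n →₀ ℕ) → W

section PS
variable {n : ℕ} {W : Type*} [AddCommGroup W]

instance : AddCommGroup (PS n W) := inferInstanceAs (AddCommGroup ((Fin n →₀ ℕ) → W))

instance {K : Type*} [Semiring K] [Module K W] : Module K (PS n W) :=
  inferInstanceAs (Module K ((Fin n →₀ ℕ) → W))

/-- Power series with coefficients in a ring of operators on `W` act on `W[[z]]` by the Cauchy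
product. -/
instance psModule {R : Type*} [Semiring R] [Module R W] :
    Module (MvPowerSeries (Fin n) R) (PS n W) where
  smul p F := fun m => ∑ x ∈ Finset.HasAntidiagonal.antidiagonal m, MvPowerSeries.coeff x.1 p • F x.2
  one_smul F := by
    classical
    funext m
    change ∑ x ∈ Finset.HasAntidiagonal.antidiagonal m, MvPowerSeries.coeff x.1 (1 : MvPowerSeries (Fin n) R) • F x.2
      = F m
    rw [Finset.sum_eq_single (0, m)]
    · simp
    · rintro ⟨i, j⟩ hij hne
      have : i ≠ 0 := by
        rintro rfl
        apply hne
        simpa using hij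
      simp [MvPowerSeries.coeff_one, this]
    · simp
  mul_smul p q F := by
    classical
    funext m
    change ∑ x ∈ Finset.HasAntidiagonal.antidiagonal m, MvPowerSeries.coeff x.1 (p * q) • F x.2
      = ∑ x ∈ Finset.HasAntidiagonal.antidiagonal m, MvPowerSeries.coeff x.1 p •
        ∑ y ∈ Finset.HasAntidiagonal.antidiagonal x.2, MvPowerSeries.coeff y.1 q • F y.2
    simp only [MvPowerSeries.coeff_mul, Finset.sum_smul, Finset.smul_sum, Finset.sum_sigma']
    apply Finset.sum_nbij' (fun ⟨⟨_i, j⟩, ⟨k, l⟩⟩ ↦ ⟨(k, l + j), (l, j)⟩)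
      (fun ⟨⟨i, _j⟩, ⟨k, l⟩⟩ ↦ ⟨(i + k, l), (i, k)⟩)
    · rintro ⟨⟨a, b⟩, ⟨c, d⟩⟩ h
      simp only [Finset.mem_sigma, Finset.HasAntidiagonal.mem_antidiagonal] at h ⊢
      refine ⟨?_, trivial⟩
      rw [← h.1, ← h.2, add_assoc]
    · rintro ⟨⟨a, b⟩, ⟨c, d⟩⟩ h
      simp only [Finset.mem_sigma, Finset.HasAntidiagonal.mem_antidiagonal] at h ⊢
      refine ⟨?_, trivial⟩
      rw [← h.1, ← h.2, add_assoc]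
    · rintro ⟨⟨a, b⟩, ⟨c, d⟩⟩ h
      simp only [Finset.mem_sigma, Finset.HasAntidiagonal.mem_antidiagonal] at h
      simp [h.2]
    · rintro ⟨⟨a, b⟩, ⟨c, d⟩⟩ h
      simp only [Finset.mem_sigma, Finset.HasAntidiagonal.mem_antidiagonal] at h
      simp [h.2]
    · rintro ⟨⟨a, b⟩, ⟨c, d⟩⟩ h
      exact mul_smul _ _ _
  smul_zero p := by
    funext m
    exact Finset.sum_eq_zero fun x _ => smul_zero _
  zero_smul F := by
    funext m
    exact Finset.sum_eq_zero fun x _ => by simp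
  smul_add p F G := by
    funext m
    change ∑ x ∈ Finset.HasAntidiagonal.antidiagonal m, MvPowerSeries.coeff x.1 p • (F x.2 + G x.2) = _
    simp only [smul_add, Finset.sum_add_distrib]
    rfl
  add_smul p q F := by
    funext m
    change ∑ x ∈ Finset.HasAntidiagonal.antidiagonal m, MvPowerSeries.coeff x.1 (p + q) • F x.2 = _
    simp only [map_add, add_smul, Finset.sum_add_distrib]
    rfl

theorem ps_smul_apply {R : Type*} [Semiring R] [Module R W] (p : MvPowerSeries (Fin n) R)
    (F : PS n W) (m : Fin n →₀ ℕ) :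
    (p • F) m = ∑ x ∈ Finset.HasAntidiagonal.antidiagonal m, MvPowerSeries.coeff x.1 p • F x.2 := rfl

/-- The action of polynomials on `W[[z]]` by multiplication. -/
instance polyModule {K : Type*} [CommRing K] [Module K W] :
    Module (MvPolynomial (Fin n) K) (PS n W) :=
  Module.compHom _ (MvPolynomial.coeToMvPowerSeries.ringHom (σ := Fin n) (R := K))

variable {K : Type*} [CommRing K] [Module K W]

theorem poly_smul_eq (p : MvPolynomial (Fin n) K) (F : PS n W) :
    p • F = (p : MvPowerSeries (Fin n) K) • F := rfl

theorem C_smul_apply (k : K) (F : PS n W) (m : Fin n →₀ ℕ) :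
    ((MvPolynomial.C k : MvPolynomial (Fin n) K) • F) m = k • F m := by
  classical
  rw [poly_smul_eq, ps_smul_apply, Finset.sum_eq_single (0, m)]
  · simp
  · rintro ⟨i, j⟩ hij hne
    have : i ≠ 0 := by
      rintro rfl
      apply hne
      simpa using hij
    simp [MvPowerSeries.coeff_C, this]
  · simp

theorem X_smul_apply (i : Fin n) (F : PS n W) (m : Fin n →₀ ℕ) :
    ((MvPolynomial.X i : MvPolynomial (Fin n) K) • F) m
      = if m i = 0 then 0 else F (m - Finsupp.single i 1) := by
  classical
  rw [poly_smul_eq, ps_smul_apply]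
  split_ifs with h
  · apply Finset.sum_eq_zero
    rintro ⟨a, b⟩ hab
    have : Finsupp.single i 1 ≠ a := by
      rintro rfl
      rw [Finset.HasAntidiagonal.mem_antidiagonal] at hab
      rw [← hab] at h
      simp at h
    simp [MvPowerSeries.coeff_X, this.symm]
  · have hle : Finsupp.single i 1 ≤ m := by
      rw [Finsupp.single_le_iff]; omega
    rw [Finset.sum_eq_single (Finsupp.single i 1, m - Finsupp.single i 1)]
    · simp
    · rintro ⟨a, b⟩ hab hne
      have : Finsupp.single i 1 ≠ a := by
        rintro rfl
        apply hne
        rw [Finset.HasAntidiagonal.mem_antidiagonal] at hab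
        rw [← hab]; simp
      simp [MvPowerSeries.coeff_X, this.symm]
    · intro hh
      exact absurd (Finset.HasAntidiagonal.mem_antidiagonal.2 (add_tsub_cancel_of_le hle)) hh

instance {k : Type*} [CommSemiring k] [Algebra k K] [Module k W] [IsScalarTower k K W] :
    IsScalarTower k (MvPolynomial (Fin n) K) (PS n W) where
  smul_assoc k p F := by
    rw [← algebraMap_smul K k p, MvPolynomial.smul_eq_C_mul, mul_smul]
    funext m
    rw [C_smul_apply, algebraMap_smul]; rfl

theorem PS.sum_apply {ι : Type*} (s : Finset ι) (f : ι → PS n W) (m : Fin n →₀ ℕ) :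
    (∑ j ∈ s, f j) m = ∑ j ∈ s, f j m :=
  Finset.sum_apply m s (fun j => (f j : (Fin n →₀ ℕ) → W))

/-- An additive map that is compatible with constants and with the variables is semilinear over
the polynomial ring. -/
def semilin {R' N : Type*} [CommRing R'] [AddCommGroup N] [Module R' N]
    (φ : MvPolynomial (Fin n) K →+* R') (f : PS n W →+ N)
    (hC : ∀ k F, f ((MvPolynomial.C k : MvPolynomial (Fin n) K) • F) = φ (MvPolynomial.C k) • f F)
    (hX : ∀ i F, f ((MvPolynomial.X i : MvPolynomial (Fin n) K) • F) = φ (MvPolynomial.X i) • f F) :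
    PS n W →ₛₗ[φ] N where
  toFun := f
  map_add' := f.map_add
  map_smul' p := by
    induction p using MvPolynomial.induction_on with
    | C k => exact hC k
    | add p q hp hq => intro F; rw [add_smul, map_add, hp, hq, map_add, add_smul]
    | mul_X p i hp => intro F; rw [mul_smul, hp, hX, ← mul_smul, ← map_mul]

/-- Multiplication by a power series of operators commuting with the scalars. -/
def psMul {R : Type*} [Semiring R] [Module R W] [SMulCommClass R K W]
    (p : MvPowerSeries (Fin n) R) : PS n W →ₗ[MvPolynomial (Fin n) K] PS n W where
  toFun F := p • F
  map_add' := smul_add p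
  map_smul' q F := by
    classical
    funext m
    rw [RingHom.id_apply, poly_smul_eq, poly_smul_eq]
    simp only [ps_smul_apply, Finset.smul_sum, Finset.sum_sigma']
    apply Finset.sum_nbij' (fun ⟨⟨i, _j⟩, ⟨k, l⟩⟩ ↦ ⟨(k, i + l), (i, l)⟩)
      (fun ⟨⟨i, _j⟩, ⟨k, l⟩⟩ ↦ ⟨(k, i + l), (i, l)⟩)
    · rintro ⟨⟨a, b⟩, ⟨c, d⟩⟩ h
      simp only [Finset.mem_sigma, Finset.HasAntidiagonal.mem_antidiagonal] at h ⊢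
      refine ⟨?_, trivial⟩
      rw [← h.1, ← h.2]; abel
    · rintro ⟨⟨a, b⟩, ⟨c, d⟩⟩ h
      simp only [Finset.mem_sigma, Finset.HasAntidiagonal.mem_antidiagonal] at h ⊢
      refine ⟨?_, trivial⟩
      rw [← h.1, ← h.2]; abel
    · rintro ⟨⟨a, b⟩, ⟨c, d⟩⟩ h
      simp only [Finset.mem_sigma, Finset.HasAntidiagonal.mem_antidiagonal] at h
      simp [h.2]
    · rintro ⟨⟨a, b⟩, ⟨c, d⟩⟩ h
      simp only [Finset.mem_sigma, Finset.HasAntidiagonal.mem_antidiagonal] at h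
      simp [h.2]
    · rintro ⟨⟨a, b⟩, ⟨c, d⟩⟩ h
      exact smul_comm _ _ _

end PS

section Sing

/-- The denominators generated by a set `D` of polynomials. -/
abbrev dens {n : ℕ} {K : Type*} [CommRing K] (D : Set (MvPolynomial (Fin n) K)) :
    Submonoid (MvPolynomial (Fin n) K) := Submonoid.closure D

/-- The ring `K[z_0, …, z_{n-1}][d⁻¹ : d ∈ D]`. -/
abbrev Rat {n : ℕ} {K : Type*} [CommRing K] (D : Set (MvPolynomial (Fin n) K)) : Type _ :=
  Localization (dens D)

/-- The module `W[[z_0, …, z_{n-1}]][d⁻¹ : d ∈ D]`. -/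
abbrev Sing {n : ℕ} {K : Type*} [CommRing K] (D : Set (MvPolynomial (Fin n) K))
    (W : Type*) [AddCommGroup W] [Module K W] : Type _ :=
  LocalizedModule (dens D) (PS n W)

variable {n m : ℕ} {K : Type*} [CommRing K] {W : Type*} [AddCommGroup W] [Module K W]


/-- A power series as an element of the localized module. -/
def PS.toSing (D : Set (MvPolynomial (Fin n) K)) (F : PS n W) : Sing D W :=
  LocalizedModule.mk F 1

theorem locLift_unit {R R' N : Type*} [CommRing R] [CommRing R'] [AddCommGroup N] [Module R' N]
    (φ : R →+* R') (D : Set R) (h : ∀ d ∈ D, IsUnit (algebraMap R' (Module.End R' N) (φ d)))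
    (s : Submonoid.closure D) :
    letI : Module R N := Module.compHom N φ
    IsUnit (algebraMap R (Module.End R N) s) := by
  have key : ∀ s ∈ Submonoid.closure D, IsUnit (algebraMap R' (Module.End R' N) (φ s)) := by
    intro s hs
    induction hs using Submonoid.closure_induction with
    | mem d hd => exact h d hd
    | one => simp
    | mul x y _ _ hx hy => rw [map_mul, map_mul]; exact hx.mul hy
  have hs := key s s.2
  let : Module R N := Module.compHom N φ
  rw [Module.End.isUnit_iff] at hs ⊢
  exact hs

/-- A semilinear map whose target inverts the images of the denominators extends to the localized
module (uniquely). -/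
def locLift {R R' M N : Type*} [CommRing R] [CommRing R'] [AddCommGroup M] [Module R M]
    [AddCommGroup N] [Module R' N] {φ : R →+* R'} (D : Set R) (f : M →ₛₗ[φ] N)
    (h : ∀ d ∈ D, IsUnit (algebraMap R' (Module.End R' N) (φ d))) :
    LocalizedModule (Submonoid.closure D) M →ₛₗ[φ] N :=
  letI : Module R N := Module.compHom N φ
  let g : M →ₗ[R] N := { toFun := f, map_add' := f.map_add, map_smul' := f.map_smulₛₗ }
  let l := LocalizedModule.lift (Submonoid.closure D) g (locLift_unit φ D h)
  { toFun := l, map_add' := l.map_add, map_smul' := l.map_smul }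

section locLift
variable {R R' M N : Type*} [CommRing R] [CommRing R'] [AddCommGroup M] [Module R M]
    [AddCommGroup N] [Module R' N] {φ : R →+* R'} (D : Set R) (f : M →ₛₗ[φ] N)
    (h : ∀ d ∈ D, IsUnit (algebraMap R' (Module.End R' N) (φ d)))

theorem locLift_mk_one (x : M) : locLift D f h (LocalizedModule.mk x 1) = f x := by
  let : Module R N := Module.compHom N φ
  let g : M →ₗ[R] N := { toFun := f, map_add' := f.map_add, map_smul' := f.map_smulₛₗ }
  exact DFunLike.congr_fun
    (LocalizedModule.lift_comp (Submonoid.closure D) g (locLift_unit φ D h)) x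

theorem locLift_mk (x : M) (s : Submonoid.closure D) :
    φ s • locLift D f h (LocalizedModule.mk x s) = f x := by
  rw [← map_smulₛₗ, LocalizedModule.smul'_mk, ← locLift_mk_one D f h]
  congr 1
  exact LocalizedModule.mk_cancel s x

theorem locLift_unique (x : M) (s : Submonoid.closure D) (y : N) (hy : φ s • y = f x) :
    y = locLift D f h (LocalizedModule.mk x s) := by
  let : Module R N := Module.compHom N φ
  have hs := locLift_unit φ D h s
  rw [Module.End.isUnit_iff] at hs
  apply hs.1
  change φ s • y = φ s • locLift D f h _
  rw [locLift_mk, hy]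

end locLift

/-- The extension `locLift` as a linear map over a ring of constants `k`. -/
def locLiftLin {k R R' M N : Type*} [CommRing k] [CommRing R] [Algebra k R] [CommRing R']
    [Algebra k R'] [AddCommGroup M] [Module R M] [Module k M] [IsScalarTower k R M]
    [AddCommGroup N] [Module R' N] [Module k N] [IsScalarTower k R' N]
    (D : Set R) (φ : R →ₐ[k] R') (f : M →ₛₗ[φ.toRingHom] N)
    (h : ∀ d ∈ D, IsUnit (algebraMap R' (Module.End R' N) (φ d))) :
    LocalizedModule (Submonoid.closure D) M →ₗ[k] N where
  toFun := locLift D f h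
  map_add' := (locLift D f h).map_add
  map_smul' c x := by
    rw [← algebraMap_smul R c x, (locLift D f h).map_smulₛₗ, RingHom.id_apply,
      ← algebraMap_smul R' c (locLift D f h x)]
    congr 1
    exact φ.commutes c

/-- A linear form `∑ j, M i j z_j` substituted for each of the variables. -/
def lin (M : Fin n → Fin m → K) : MvPolynomial (Fin n) K →ₐ[K] MvPolynomial (Fin m) K :=
  MvPolynomial.aeval fun i => ∑ j, MvPolynomial.C (M i j) * MvPolynomial.X j

/-- The image of the monomial `z^a` under the linear substitution `M`. -/
def linMon (M : Fin n → Fin m → K) (a : Fin n →₀ ℕ) : MvPolynomial (Fin m) K :=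
  lin M (MvPolynomial.monomial a 1)

theorem linMon_hom (M : Fin n → Fin m → K) (a : Fin n →₀ ℕ) :
    (linMon M a).IsHomogeneous a.degree := by
  rw [linMon, lin, MvPolynomial.aeval_monomial, map_one, one_mul]
  rw [Finsupp.degree, Finsupp.prod]
  apply MvPolynomial.IsHomogeneous.prod
  intro i _
  have := (MvPolynomial.IsHomogeneous.sum Finset.univ
    (fun j => MvPolynomial.C (M i j) * (MvPolynomial.X j : MvPolynomial (Fin m) K)) 1
    (fun j _ => by
      simpa using (MvPolynomial.isHomogeneous_C (Fin m) (M i j)).mul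
        (MvPolynomial.isHomogeneous_X K j)))
  simpa using this.pow (a i)

theorem finite_degree (n d : ℕ) : {a : Fin n →₀ ℕ | a.degree = d}.Finite := by
  refine (Finset.finite_toSet (Finset.finsuppAntidiag (Finset.univ : Finset (Fin n)) d)).subset ?_
  intro a ha
  simp only [Finset.mem_coe, Finset.mem_finsuppAntidiag]
  refine ⟨?_, by simp⟩
  rw [← ha, Finsupp.degree_eq_sum]

theorem subst_fin (M : Fin n → Fin m → K) (F : PS n W) (b : Fin m →₀ ℕ) :
    (Function.support fun a => (linMon M a).coeff b • F a).Finite := by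
  refine (finite_degree n b.degree).subset ?_
  intro a ha
  by_contra hne
  apply ha
  have : (linMon M a).coeff b = 0 := (linMon_hom M a).coeff_eq_zero (fun h => hne h.symm)
  simp [this]

/-- The coefficients of a power series after the substitution `z_i ↦ ∑ j, M i j z_j`; each of the
sums is finite, because the substitution preserves the degree. -/
def substFun (M : Fin n → Fin m → K) (F : PS n W) : PS m W :=
  fun b => ∑ᶠ a, (linMon M a).coeff b • F a

theorem substFun_C (M : Fin n → Fin m → K) (k : K) (F : PS n W) :
    substFun M ((MvPolynomial.C k : MvPolynomial (Fin n) K) • F)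
      = (lin M).toRingHom (MvPolynomial.C k) • substFun M F := by
  have : (lin M).toRingHom (MvPolynomial.C k) = MvPolynomial.C k := by
    simp [lin, MvPolynomial.algebraMap_eq]
  rw [this]
  funext b
  rw [C_smul_apply, substFun, substFun, smul_finsum' k (subst_fin M F b)]
  apply finsum_congr
  intro a
  rw [C_smul_apply, smul_comm]

theorem linMon_add_single (M : Fin n → Fin m → K) (a : Fin n →₀ ℕ) (i : Fin n) :
    linMon M (a + Finsupp.single i 1)
      = ∑ j, MvPolynomial.C (M i j) * (linMon M a * MvPolynomial.X j) := by
  have : (MvPolynomial.monomial (a + Finsupp.single i 1) (1 : K))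
      = MvPolynomial.monomial a 1 * MvPolynomial.X i := by
    rw [MvPolynomial.X, MvPolynomial.monomial_mul, one_mul]
  rw [linMon, this, map_mul, linMon]
  conv_lhs => rw [lin, MvPolynomial.aeval_X, Finset.mul_sum]
  apply Finset.sum_congr rfl
  intro j _
  rw [lin]; ring

theorem substFun_X (M : Fin n → Fin m → K) (i : Fin n) (F : PS n W) :
    substFun M ((MvPolynomial.X i : MvPolynomial (Fin n) K) • F)
      = (lin M).toRingHom (MvPolynomial.X i) • substFun M F := by
  classical
  have : (lin M).toRingHom (MvPolynomial.X i)
      = ∑ j, MvPolynomial.C (M i j) * MvPolynomial.X j := by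
    simp [lin]
  rw [this]
  funext b
  rw [Finset.sum_smul, PS.sum_apply]
  have h1 : ∀ j, ((MvPolynomial.C (M i j) * MvPolynomial.X j : MvPolynomial (Fin m) K)
      • substFun M F) b
      = ∑ᶠ a, (MvPolynomial.C (M i j) * (linMon M a * MvPolynomial.X j)).coeff b • F a := by
    intro j
    rw [mul_smul, C_smul_apply, X_smul_apply]
    simp only [MvPolynomial.coeff_C_mul, MvPolynomial.coeff_mul_X', Finsupp.mem_support_iff,
      mul_smul]
    by_cases hb : b j = 0
    · simp [hb]
    · simp only [hb, if_false, ne_eq, not_false_eq_true, if_true]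
      rw [substFun, smul_finsum' _ (subst_fin M F _)]
  rw [Finset.sum_congr rfl fun j _ => h1 j, ← finsum_sum_comm]
  · have h2 : ∀ a, ∑ j, (MvPolynomial.C (M i j) * (linMon M a * MvPolynomial.X j)).coeff b • F a
        = (linMon M (a + Finsupp.single i 1)).coeff b •
          ((MvPolynomial.X i : MvPolynomial (Fin n) K) • F) (a + Finsupp.single i 1) := by
      intro a
      rw [linMon_add_single, MvPolynomial.coeff_sum, Finset.sum_smul, X_smul_apply]
      simp
    rw [finsum_congr h2, substFun]
    rw [← finsum_mem_range
      (f := fun a => (linMon M a).coeff b • ((MvPolynomial.X i : MvPolynomial (Fin n) K) • F) a)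
      (add_left_injective (Finsupp.single i 1))]
    conv_lhs => rw [← finsum_mem_univ]
    apply finsum_mem_inter_support_eq
    ext a
    simp only [Set.univ_inter, Set.mem_inter_iff, Set.mem_range, Function.mem_support]
    constructor
    · intro ha
      refine ⟨⟨a - Finsupp.single i 1, ?_⟩, ha⟩
      by_cases h : a i = 0
      · exact absurd (by rw [X_smul_apply, if_pos h, smul_zero]) ha
      · apply tsub_add_cancel_of_le
        rw [Finsupp.single_le_iff]; omega
    · exact fun h => h.2
  · intro j _
    simp only [MvPolynomial.coeff_C_mul, MvPolynomial.coeff_mul_X', Finsupp.mem_support_iff,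
      mul_smul]
    by_cases hb : b j = 0
    · simp [hb, Function.HasFiniteSupport]
    · simp only [hb, ne_eq, not_false_eq_true, if_true]
      refine (subst_fin M F (b - Finsupp.single j 1)).subset ?_
      intro a ha h0
      apply ha
      exact (congrArg (M i j • ·) h0).trans (smul_zero _)

/-- Linear substitution `z_i ↦ ∑ j, M i j z_j` in a power series. -/
def PS.subst (M : Fin n → Fin m → K) : PS n W →ₛₗ[(lin M).toRingHom] PS m W :=
  semilin _
    { toFun := substFun M
      map_zero' := by
        funext b
        exact finsum_eq_zero_of_forall_eq_zero fun a => smul_zero _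
      map_add' := fun F G => by
        funext b
        change ∑ᶠ a, (linMon M a).coeff b • (F a + G a) = _
        simp only [smul_add]
        exact finsum_add_distrib (subst_fin M F b) (subst_fin M G b) }
    (fun k F => substFun_C M k F) (fun i F => substFun_X M i F)

/-- An algebra homomorphism which inverts `D` extends to `K[z][D⁻¹]`. -/
def ratLift {B : Type*} [CommRing B] [Algebra K B] (D : Set (MvPolynomial (Fin n) K))
    (f : MvPolynomial (Fin n) K →ₐ[K] B) (h : ∀ d ∈ D, IsUnit (f d)) : Rat D →ₐ[K] B :=
  IsLocalization.liftAlgHom (M := dens D) (S := Rat D) (f := f) (by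
    intro s
    have key : dens D ≤ (IsUnit.submonoid B).comap f := Submonoid.closure_le.2 h
    exact key s.2)

/-- The substitution `M` maps the denominators in `D` to invertible elements. -/
def Adm (M : Fin n → Fin m → K) (D : Set (MvPolynomial (Fin n) K))
    (D' : Set (MvPolynomial (Fin m) K)) : Prop :=
  ∀ d ∈ D, IsUnit (algebraMap (MvPolynomial (Fin m) K) (Rat D') (lin M d))

theorem isUnit_end_sing {D' : Set (MvPolynomial (Fin m) K)} {p : MvPolynomial (Fin m) K}
    (h : IsUnit (algebraMap (MvPolynomial (Fin m) K) (Rat D') p)) :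
    IsUnit (algebraMap (MvPolynomial (Fin m) K) (Module.End (MvPolynomial (Fin m) K) (Sing D' W)) p) := by
  rw [Module.End.isUnit_iff]
  have h2 := (h.map (algebraMap (Rat D') (Module.End (Rat D') (Sing D' W))))
  rw [Module.End.isUnit_iff] at h2
  convert h2 using 1
  funext x
  exact (algebraMap_smul (Rat D') p x).symm

/-- Linear substitution in elements of `W[[z]][D⁻¹]`. -/
def Sing.subst (M : Fin n → Fin m → K) {D : Set (MvPolynomial (Fin n) K)}
    {D' : Set (MvPolynomial (Fin m) K)} (h : Adm M D D') : Sing D W →ₗ[K] Sing D' W :=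
  locLiftLin D (lin M) ((LocalizedModule.mkLinearMap (dens D') (PS m W)).comp (PS.subst M))
    (fun d hd => isUnit_end_sing (W := W) (h d hd))

/-- Linear substitution in rational functions. -/
def Rat.subst (M : Fin n → Fin m → K) {D : Set (MvPolynomial (Fin n) K)}
    {D' : Set (MvPolynomial (Fin m) K)} (h : Adm M D D') : Rat D →ₐ[K] Rat D' :=
  ratLift D ((IsScalarTower.toAlgHom K (MvPolynomial (Fin m) K) (Rat D')).comp (lin M)) h

end Sing

section Laurent
variable {n : ℕ} {K : Type*} [CommRing K] {W : Type*} [AddCommGroup W] [Module K W]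

/-- Constants in Laurent series (this takes precedence over the instance through `A⟦X⟧`). -/
instance lauAlgebra {R A : Type*} [CommSemiring R] [CommRing A] [Algebra R A] :
    Algebra R (LaurentSeries A) := HahnSeries.instAlgebra

/-- Laurent series `W((z))`, a module over `K((z))`. -/
abbrev Lau (K W : Type*) [CommRing K] [AddCommGroup W] [Module K W] : Type _ := HahnModule ℤ K W

/-- The coefficient of `z^k` in a Laurent series. -/
def Lau.coeff (F : Lau K W) (k : ℤ) : W := ((HahnModule.of K).symm F).coeff k

/-- The Laurent series `∑_{k ≥ 0} g k z^k`. -/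
def Lau.ofNat (K : Type*) {W : Type*} [CommRing K] [AddCommGroup W] [Module K W] (g : ℕ → W) :
    Lau K W :=
  HahnModule.of K (HahnSeries.ofSuppBddBelow (fun k : ℤ => if 0 ≤ k then g k.toNat else 0)
    ⟨0, by
      intro k hk
      by_contra h
      exact hk (if_neg h)⟩)

theorem Lau.coeff_ofNat (g : ℕ → W) (k : ℤ) :
    (Lau.ofNat K g).coeff k = if 0 ≤ k then g k.toNat else 0 := rfl

theorem Lau.ext {F G : Lau K W} (h : ∀ k, F.coeff k = G.coeff k) : F = G :=
  HahnModule.ext F G (funext h)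

/-- The variable `z` of `K((z))`. -/
def Lau.T (K : Type*) [CommRing K] : LaurentSeries K := HahnSeries.single 1 1

theorem Lau.coeff_T_smul (F : Lau K W) (k : ℤ) : (Lau.T K • F).coeff k = F.coeff (k - 1) := by
  have := HahnModule.coeff_single_smul_vadd (Γ := ℤ) (Γ' := ℤ) (r := (1 : K)) (x := F)
    (a := k - 1) (b := 1)
  rw [one_smul] at this
  rw [Lau.coeff, Lau.coeff, ← this, Lau.T]
  congr 1
  simp

theorem Lau.coeff_C_smul (r : K) (F : Lau K W) (k : ℤ) :
    ((algebraMap K (LaurentSeries K) r) • F).coeff k = r • F.coeff k := by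
  rw [HahnSeries.algebraMap_apply]
  exact HahnModule.coeff_single_zero_smul

/-- `K[z_0, z_1, …, z_n] → K((z_0))[z_1, …, z_n]`. -/
def peelRing (n : ℕ) (K : Type*) [CommRing K] :
    MvPolynomial (Fin (n + 1)) K →ₐ[K] MvPolynomial (Fin n) (LaurentSeries K) :=
  MvPolynomial.aeval (Fin.cases (MvPolynomial.C (Lau.T K)) MvPolynomial.X)

/-- The coefficients of a power series, as a power series in the last variables with coefficients
in Laurent series in the first one. -/
def peelFun (K : Type*) [CommRing K] [Module K W] (F : PS (n + 1) W) : PS n (Lau K W) :=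
  fun m => Lau.ofNat K fun k => F (Finsupp.cons k m)

theorem peelFun_coeff (F : PS (n + 1) W) (m : Fin n →₀ ℕ) (k : ℤ) :
    Lau.coeff (peelFun K F m) k = if 0 ≤ k then F (Finsupp.cons k.toNat m) else 0 := rfl

/-- The embedding `W[[z_0, z_1, …, z_n]] → W((z_0))[[z_1, …, z_n]]`. -/
def peel (n : ℕ) : PS (n + 1) W →ₛₗ[(peelRing n K).toRingHom] PS n (Lau K W) :=
  semilin _
    { toFun := peelFun K
      map_zero' := by
        funext m
        apply Lau.ext
        intro k
        rw [peelFun_coeff]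
        exact ite_self 0
      map_add' := fun F G => by
        funext m
        apply Lau.ext
        intro k
        change _ = (peelFun K F m).coeff k + (peelFun K G m).coeff k
        simp only [peelFun_coeff]
        split_ifs
        · rfl
        · simp }
    (by
      intro r F
      have : (peelRing n K).toRingHom (MvPolynomial.C r)
          = MvPolynomial.C (algebraMap K (LaurentSeries K) r) :=
        (peelRing n K).commutes r
      rw [this]
      funext m
      apply Lau.ext
      intro k
      rw [C_smul_apply, Lau.coeff_C_smul]
      change Lau.coeff (peelFun K _ m) k = r • Lau.coeff (peelFun K F m) k
      simp only [peelFun_coeff, C_smul_apply]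
      split_ifs <;> simp)
    (by
      intro i F
      have : (peelRing n K).toRingHom (MvPolynomial.X i)
          = Fin.cases (motive := fun _ => MvPolynomial (Fin n) (LaurentSeries K))
            (MvPolynomial.C (Lau.T K)) MvPolynomial.X i := by
        simp [peelRing]
      rw [this]
      funext m
      apply Lau.ext
      intro k
      refine Fin.cases ?_ (fun i => ?_) i
      · simp only [Fin.cases_zero]
        rw [C_smul_apply, Lau.coeff_T_smul]
        change Lau.coeff (peelFun K _ m) k = Lau.coeff (peelFun K F m) (k - 1)
        simp only [peelFun_coeff, X_smul_apply, Finsupp.cons_zero]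
        by_cases h0 : 0 ≤ k
        · by_cases h1 : k = 0
          · simp [h1]
          · have h2 : 0 ≤ k - 1 := by omega
            have h3 : k.toNat ≠ 0 := by omega
            rw [if_pos h0, if_pos h2]
            refine (if_neg h3).trans ?_
            congr 1
            ext j
            refine Fin.cases ?_ (fun j => ?_) j
            · simp
            · simp
        · have h2 : ¬ 0 ≤ k - 1 := by omega
          rw [if_neg h0, if_neg h2]
      · simp only [Fin.cases_succ]
        rw [X_smul_apply]
        change Lau.coeff (peelFun K _ m) k
          = Lau.coeff (if m i = 0 then 0 else peelFun K F (m - Finsupp.single i 1)) k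
        simp only [peelFun_coeff, X_smul_apply, Finsupp.cons_succ]
        by_cases hm : m i = 0
        · simp only [hm, if_true]
          rw [ite_self]; rfl
        · simp only [hm, if_false]
          rw [peelFun_coeff]
          congr 2
          ext j
          refine Fin.cases ?_ (fun j => ?_) j
          · simp
          · simp [Finsupp.single_apply])

/-- `K[z] → K((z))`. -/
def flatRing (K : Type*) [CommRing K] : MvPolynomial (Fin 1) K →ₐ[K] LaurentSeries K :=
  MvPolynomial.aeval fun _ => Lau.T K

/-- A power series in one variable as a Laurent series. -/
def flatFun (K : Type*) [CommRing K] [Module K W] (F : PS 1 W) : Lau K W :=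
  Lau.ofNat K fun k => F (Finsupp.single 0 k)

theorem flatFun_coeff (F : PS 1 W) (k : ℤ) :
    Lau.coeff (flatFun K F) k = if 0 ≤ k then F (Finsupp.single 0 k.toNat) else 0 := rfl

/-- The embedding `W[[z]] → W((z))`. -/
def flat : PS 1 W →ₛₗ[(flatRing K).toRingHom] Lau K W :=
  semilin _
    { toFun := flatFun K
      map_zero' := by
        apply Lau.ext
        intro k
        rw [flatFun_coeff]
        exact ite_self 0
      map_add' := fun F G => by
        apply Lau.ext
        intro k
        change _ = Lau.coeff (flatFun K F) k
          + Lau.coeff (flatFun K G) k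
        simp only [flatFun_coeff]
        split_ifs
        · rfl
        · simp }
    (by
      intro r F
      have : (flatRing K).toRingHom (MvPolynomial.C r) = algebraMap K (LaurentSeries K) r :=
        (flatRing K).commutes r
      rw [this]
      apply Lau.ext
      intro k
      rw [Lau.coeff_C_smul]
      change Lau.coeff (flatFun K _) k = r • Lau.coeff (flatFun K F) k
      simp only [flatFun_coeff, C_smul_apply]
      split_ifs <;> simp)
    (by
      intro i F
      have : (flatRing K).toRingHom (MvPolynomial.X i) = Lau.T K := by
        simp [flatRing]
      rw [this]
      apply Lau.ext
      intro k
      rw [Lau.coeff_T_smul]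
      change Lau.coeff (flatFun K _) k = Lau.coeff (flatFun K F) (k - 1)
      have hi : i = 0 := Subsingleton.elim _ _
      subst hi
      simp only [flatFun_coeff, X_smul_apply, Finsupp.single_eq_same]
      by_cases h0 : 0 ≤ k
      · by_cases h1 : k = 0
        · simp [h1]
        · have h2 : 0 ≤ k - 1 := by omega
          have h3 : k.toNat ≠ 0 := by omega
          rw [if_pos h0, if_neg h3, if_pos h2]
          congr 1
          rw [← Finsupp.single_tsub]
          congr 1
          omega
      · have h2 : ¬ 0 ≤ k - 1 := by omega
        rw [if_neg h0, if_neg h2])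

end Laurent

section Sing2
variable {n : ℕ} {K : Type*} [CommRing K] {W : Type*} [AddCommGroup W] [Module K W]

/-- A polynomial which is invertible as a power series acts invertibly on `W[[z]][D⁻¹]`. -/
theorem isUnit_end_of_ps {D : Set (MvPolynomial (Fin n) K)} {p : MvPolynomial (Fin n) K}
    (h : IsUnit (p : MvPowerSeries (Fin n) K)) :
    IsUnit (algebraMap (MvPolynomial (Fin n) K)
      (Module.End (MvPolynomial (Fin n) K) (Sing D W)) p) := by
  obtain ⟨u, hu⟩ := h
  have h1 : ∀ F : PS n W, p • (((u⁻¹ : (MvPowerSeries (Fin n) K)ˣ) : MvPowerSeries (Fin n) K) • F)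
      = F := by
    intro F
    rw [poly_smul_eq, ← hu, ← mul_smul, Units.mul_inv, one_smul]
  have h2 : ∀ F : PS n W, ((u⁻¹ : (MvPowerSeries (Fin n) K)ˣ) : MvPowerSeries (Fin n) K) • (p • F)
      = F := by
    intro F
    rw [poly_smul_eq, ← hu, ← mul_smul, Units.inv_mul, one_smul]
  rw [Module.End.isUnit_iff]
  constructor
  · intro x y
    induction x, y using LocalizedModule.induction_on₂ with
    | _ F G s t =>
      intro hxy
      change p • LocalizedModule.mk F s = p • LocalizedModule.mk G t at hxy
      rw [LocalizedModule.smul'_mk, LocalizedModule.smul'_mk, LocalizedModule.mk_eq] at hxy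
      rw [LocalizedModule.mk_eq]
      obtain ⟨w, hw⟩ := hxy
      refine ⟨w, ?_⟩
      have h3 : p • w • t • F = p • w • s • G := by
        rw [smul_comm p w, smul_comm p t, smul_comm p w, smul_comm p s]
        exact hw
      have h4 := congrArg (fun F : PS n W =>
        ((u⁻¹ : (MvPowerSeries (Fin n) K)ˣ) : MvPowerSeries (Fin n) K) • F) h3
      simp only [h2] at h4
      exact h4
  · intro x
    induction x using LocalizedModule.induction_on with
    | _ F s =>
      refine ⟨LocalizedModule.mk
        (((u⁻¹ : (MvPowerSeries (Fin n) K)ˣ) : MvPowerSeries (Fin n) K) • F) s, ?_⟩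
      change p • (LocalizedModule.mk _ s : Sing D W) = _
      rw [LocalizedModule.smul'_mk, h1]

/-- An endomorphism of `W[[z]]` which is linear over the polynomials extends to `W[[z]][D⁻¹]`. -/
def endLoc (D : Set (MvPolynomial (Fin n) K)) :
    Module.End (MvPolynomial (Fin n) K) (PS n W) →+*
      Module.End (MvPolynomial (Fin n) K) (Sing D W) where
  toFun f := IsLocalizedModule.map (dens D) (LocalizedModule.mkLinearMap (dens D) (PS n W))
    (LocalizedModule.mkLinearMap (dens D) (PS n W)) f
  map_one' := IsLocalizedModule.map_id _ _
  map_mul' f g := IsLocalizedModule.map_comp' (dens D) (LocalizedModule.mkLinearMap (dens D) (PS n W))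
    (LocalizedModule.mkLinearMap (dens D) (PS n W))
    (LocalizedModule.mkLinearMap (dens D) (PS n W)) g f
  map_zero' := map_zero _
  map_add' := map_add _

/-- Power series with coefficients in operators commuting with the scalars act on `W[[z]]` by
maps linear over the polynomials. -/
def psEnd {R : Type*} [Semiring R] [Module R W] [SMulCommClass R K W] :
    MvPowerSeries (Fin n) R →+* Module.End (MvPolynomial (Fin n) K) (PS n W) where
  toFun := psMul
  map_one' := by ext1 F; exact one_smul (MvPowerSeries (Fin n) R) F
  map_mul' p q := by ext1 F; exact mul_smul p q F
  map_zero' := by ext1 F; exact zero_smul (MvPowerSeries (Fin n) R) F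
  map_add' p q := by ext1 F; exact add_smul p q F

/-- Power series act on `W[[z]][D⁻¹]` by multiplication. -/
instance singPSModule {D : Set (MvPolynomial (Fin n) K)} :
    Module (MvPowerSeries (Fin n) K) (Sing D W) :=
  Module.compHom _ ((endLoc D).comp (psEnd (n := n) (K := K) (W := W) (R := K)))

theorem singPS_smul_mk {D : Set (MvPolynomial (Fin n) K)} (p : MvPowerSeries (Fin n) K)
    (F : PS n W) (s : dens D) :
    p • (LocalizedModule.mk F s : Sing D W) = LocalizedModule.mk (p • F) s :=
  IsLocalizedModule.map_LocalizedModules (dens D) (psMul p) F s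

theorem smul_mk_const {k : Type*} [CommRing k] [Algebra k K] [Module k W] [IsScalarTower k K W]
    {D : Set (MvPolynomial (Fin n) K)} (r : k) (F : PS n W) (s : dens D) :
    r • (LocalizedModule.mk F s : Sing D W) = LocalizedModule.mk (r • F) s := by
  rw [← algebraMap_smul (MvPolynomial (Fin n) K) r, LocalizedModule.smul'_mk, algebraMap_smul]

instance {k : Type*} [CommRing k] [Algebra k K] [Module k W] [IsScalarTower k K W]
    {D : Set (MvPolynomial (Fin n) K)} :
    IsScalarTower k (MvPowerSeries (Fin n) K) (Sing D W) where
  smul_assoc r p x := by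
    induction x using LocalizedModule.induction_on with
    | _ F s =>
      rw [singPS_smul_mk, singPS_smul_mk, smul_mk_const]
      congr 1
      funext m
      change _ = r • (p • F) m
      rw [ps_smul_apply, ps_smul_apply, Finset.smul_sum]
      apply Finset.sum_congr rfl
      intro x _
      rw [← smul_assoc]
      rfl

/-- The coefficientwise application of a linear map to power series. -/
def PS.map {k : Type*} [CommRing k] [Algebra k K] {V : Type*} [AddCommGroup V] [Module k V]
    [Module k W] [IsScalarTower k K W] (f : V →ₗ[k] W) :
    PS n V →ₛₗ[(MvPolynomial.mapAlgHom (Algebra.ofId k K) :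
      MvPolynomial (Fin n) k →ₐ[k] MvPolynomial (Fin n) K).toRingHom] PS n W :=
  semilin _
    { toFun := fun F m => f (F m)
      map_zero' := by funext m; exact map_zero f
      map_add' := fun F G => by funext m; exact map_add f _ _ }
    (by
      intro r F
      funext m
      have : (MvPolynomial.mapAlgHom (Algebra.ofId k K) :
          MvPolynomial (Fin n) k →ₐ[k] MvPolynomial (Fin n) K).toRingHom (MvPolynomial.C r)
          = MvPolynomial.C (algebraMap k K r) := by
        simp
      rw [this, C_smul_apply, algebraMap_smul]
      change f ((MvPolynomial.C r • F) m) = r • f (F m)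
      rw [C_smul_apply, map_smul])
    (by
      intro i F
      funext m
      have : (MvPolynomial.mapAlgHom (Algebra.ofId k K) :
          MvPolynomial (Fin n) k →ₐ[k] MvPolynomial (Fin n) K).toRingHom (MvPolynomial.X i)
          = MvPolynomial.X i := by
        simp
      rw [this, X_smul_apply]
      change f ((MvPolynomial.X i • F) m) = if m i = 0 then 0 else f (F _)
      rw [X_smul_apply]
      split_ifs <;> simp)

/-- The coefficientwise application of a linear map `V → W` to elements of `V[[z]][D⁻¹]`, with
values in `W[[z]][D'⁻¹]`; here `W` is a module over a larger ring of constants. -/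
def singMap {k : Type*} [CommRing k] [Algebra k K] {V : Type*} [AddCommGroup V] [Module k V]
    [Module k W] [IsScalarTower k K W] {D : Set (MvPolynomial (Fin n) k)}
    {D' : Set (MvPolynomial (Fin n) K)}
    (h : ∀ d ∈ D, IsUnit (algebraMap _ (Rat D')
      ((MvPolynomial.mapAlgHom (Algebra.ofId k K) :
        MvPolynomial (Fin n) k →ₐ[k] MvPolynomial (Fin n) K) d))) :
    (V →ₗ[k] W) →ₗ[k] Sing D V →ₗ[k] Sing D' W where
  toFun f := locLiftLin D _ ((LocalizedModule.mkLinearMap (dens D') (PS n W)).comp (PS.map f))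
    (fun d hd => isUnit_end_sing (W := W) (h d hd))
  map_add' f g := by
    have hu := fun d hd => isUnit_end_sing (W := W) (h d hd)
    ext x
    induction x using LocalizedModule.induction_on with
    | _ F s =>
      refine (locLift_unique D _ hu F s _ ?_).symm
      rw [LinearMap.add_apply, smul_add]
      refine (congrArg₂ (· + ·) (locLift_mk D _ hu F s) (locLift_mk D _ hu F s)).trans ?_
      exact (map_add (LocalizedModule.mkLinearMap (dens D') (PS n W)) _ _).symm
  map_smul' r f := by
    have hu := fun d hd => isUnit_end_sing (W := W) (h d hd)
    ext x
    induction x using LocalizedModule.induction_on with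
    | _ F s =>
      refine (locLift_unique D _ hu F s _ ?_).symm
      rw [LinearMap.smul_apply, smul_comm]
      refine (congrArg (r • ·) (locLift_mk D _ hu F s)).trans ?_
      exact smul_mk_const r _ 1

end Sing2

section Expansions
open MvPolynomial
variable (𝕜 : Type*) [Field 𝕜]

/-- Poles of the singular multiplication: `z_1` and `z_1 - z_2`. -/
def polesX (R : Type*) [CommRing R] : Set (MvPolynomial (Fin 2) R) := {X 0, X 0 - X 1}

/-- Poles of the braiding: `z_1`, `z_2` and `z_1 - z_2`. -/
def polesS : Set (MvPolynomial (Fin 2) 𝕜) := {X 0, X 1, X 0 - X 1}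

/-- The denominators `x`, `y`, `x + y`. -/
def polesA : Set (MvPolynomial (Fin 2) 𝕜) := {X 0, X 1, X 0 + X 1}

/-- Poles of the translation map in the variables `z_1, z_2, γ`: `z_1`, `z_1 - z_2`, `z_1 + γ`. -/
def polesT : Set (MvPolynomial (Fin 3) 𝕜) := {X 0, X 0 - X 1, X 0 + X 2}

/-- Poles of the triple product: `z_1`, `z_2` and `z_i - z_j` for `1 ≤ i < j ≤ 3`. -/
def poles3 : Set (MvPolynomial (Fin 3) 𝕜) := {X 0, X 1, X 0 - X 1, X 0 - X 2, X 1 - X 2}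

/-- All the denominators `z_i` and `z_i - z_j` in three variables. -/
def polesYB : Set (MvPolynomial (Fin 3) 𝕜) :=
  {X 0, X 1, X 2, X 0 - X 1, X 0 - X 2, X 1 - X 2}

/-- The pole of a Laurent series in one variable. -/
def poles1 : Set (MvPolynomial (Fin 1) 𝕜) := {X 0}

theorem isUnit_rat {n : ℕ} {D : Set (MvPolynomial (Fin n) 𝕜)} {p : MvPolynomial (Fin n) 𝕜}
    (d : MvPolynomial (Fin n) 𝕜) (hd : d ∈ D) (h : p = d ∨ p = -d) :
    IsUnit (algebraMap (MvPolynomial (Fin n) 𝕜) (Rat D) p) := by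
  have := IsLocalization.map_units (Rat D) (⟨d, Submonoid.subset_closure hd⟩ : dens D)
  rcases h with rfl | rfl
  · exact this
  · rw [map_neg]; exact this.neg

/-- `ℂ((x))((y))`. -/
abbrev L2Ring : Type _ := LaurentSeries (LaurentSeries 𝕜)

/-- The elements `x` and `y` of `ℂ((x))((y))`. -/
def L2Ring.x : L2Ring 𝕜 := algebraMap (LaurentSeries 𝕜) (L2Ring 𝕜) (Lau.T 𝕜)
def L2Ring.y : L2Ring 𝕜 := Lau.T (LaurentSeries 𝕜)

section
variable (V : Type*) [AddCommGroup V] [Module 𝕜 V]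

/-- `V((x))((y))`. -/
abbrev L2 : Type _ := Lau (LaurentSeries 𝕜) (Lau 𝕜 V)

instance : Module 𝕜 (L2 𝕜 V) := Module.compHom _ (algebraMap 𝕜 (LaurentSeries 𝕜))

theorem L2_smul_def (c : 𝕜) (F : L2 𝕜 V) : c • F = (algebraMap 𝕜 (LaurentSeries 𝕜) c) • F := rfl

instance : IsScalarTower 𝕜 (LaurentSeries 𝕜) (Lau 𝕜 V) where
  smul_assoc c f F := by
    rw [Algebra.smul_def, mul_smul]
    exact Lau.ext fun k => Lau.coeff_C_smul _ _ _

instance : IsScalarTower 𝕜 (L2Ring 𝕜) (L2 𝕜 V) where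
  smul_assoc c f F := by
    have h : c • f = algebraMap 𝕜 (L2Ring 𝕜) c * f := Algebra.smul_def c f
    refine (congrArg (fun g : L2Ring 𝕜 => g • F) h).trans ?_
    refine (mul_smul (algebraMap 𝕜 (L2Ring 𝕜) c) f F).trans ?_
    exact Lau.ext fun k => Lau.coeff_C_smul _ _ _

end

/-- `ℂ[x, y] → ℂ((x))((y))`. -/
def expandRing : MvPolynomial (Fin 2) 𝕜 →ₐ[𝕜] L2Ring 𝕜 :=
  ((flatRing (LaurentSeries 𝕜)).restrictScalars 𝕜).comp (peelRing 1 𝕜)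

theorem expandRing_X0 : expandRing 𝕜 (X 0) = L2Ring.x 𝕜 := by
  simp [expandRing, peelRing, flatRing, L2Ring.x]

theorem expandRing_X1 : expandRing 𝕜 (X 1) = L2Ring.y 𝕜 := by
  have : peelRing 1 𝕜 (X 1) = X 0 := by
    rw [peelRing, aeval_X]; rfl
  simp [expandRing, this, flatRing, L2Ring.y]

variable {V : Type*} [AddCommGroup V] [Module 𝕜 V]

/-- The rational functions in `D⁻¹`, expanded in the region `|x| > |y|`. -/
def Rat.expand (D : Set (MvPolynomial (Fin 2) 𝕜)) (h : ∀ d ∈ D, expandRing 𝕜 d ≠ 0) :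
    Rat D →ₐ[𝕜] L2Ring 𝕜 :=
  ratLift D (expandRing 𝕜) fun d hd => (h d hd).isUnit

/-- The expansion `i_{x;y}` of elements of `V[[x, y]][D⁻¹]` in the region `|x| > |y|`, with values
in `V((x))((y))`. -/
def Sing.expand (D : Set (MvPolynomial (Fin 2) 𝕜)) (h : ∀ d ∈ D, expandRing 𝕜 d ≠ 0) :
    Sing D V →ₗ[𝕜] L2 𝕜 V :=
  letI : RingHomCompTriple (peelRing 1 𝕜).toRingHom (flatRing (LaurentSeries 𝕜)).toRingHom
    (expandRing 𝕜).toRingHom := ⟨rfl⟩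
  locLiftLin D (expandRing 𝕜)
    ((flat (K := LaurentSeries 𝕜) (W := Lau 𝕜 V)).comp (peel (K := 𝕜) (W := V) 1))
    fun d hd => ((h d hd).isUnit.map (algebraMap (L2Ring 𝕜) (Module.End (L2Ring 𝕜) (L2 𝕜 V))))

variable {𝕜}

/-- The Laurent series in `V((z))` given by an element of `V[[z]][z⁻¹]`. -/
def Sing.flat : Sing (poles1 𝕜) V →ₗ[𝕜] Lau 𝕜 V :=
  locLiftLin (poles1 𝕜) (flatRing 𝕜) (HDQVA.flat (K := 𝕜) (W := V)) fun d hd => by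
    have hT : flatRing 𝕜 d ≠ 0 := by
      rw [poles1, Set.mem_singleton_iff] at hd
      subst hd
      rw [flatRing, aeval_X, Lau.T]
      exact HahnSeries.single_ne_zero one_ne_zero
    exact hT.isUnit.map (algebraMap (LaurentSeries 𝕜) (Module.End (LaurentSeries 𝕜) (Lau 𝕜 V)))

theorem peelRing_unit : ∀ d ∈ poles3 𝕜, IsUnit (algebraMap (MvPolynomial (Fin 2) (LaurentSeries 𝕜))
    (Module.End (MvPolynomial (Fin 2) (LaurentSeries 𝕜))
      (Sing (polesX (LaurentSeries 𝕜)) (Lau 𝕜 V))) (peelRing 2 𝕜 d)) := by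
  have hT : IsUnit (Lau.T 𝕜) := by
    rw [isUnit_iff_ne_zero, Lau.T]
    exact HahnSeries.single_ne_zero one_ne_zero
  have h0 : peelRing 2 𝕜 (X 0) = C (Lau.T 𝕜) := by rw [peelRing, aeval_X]; rfl
  have h1 : peelRing 2 𝕜 (X 1) = X 0 := by rw [peelRing, aeval_X]; rfl
  have h2 : peelRing 2 𝕜 (X 2) = X 1 := by rw [peelRing, aeval_X]; rfl
  have hu : ∀ d ∈ polesX (LaurentSeries 𝕜), IsUnit (algebraMap
      (MvPolynomial (Fin 2) (LaurentSeries 𝕜)) (Rat (polesX (LaurentSeries 𝕜))) d) :=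
    fun d hd => IsLocalization.map_units (Rat (polesX (LaurentSeries 𝕜)))
      (⟨d, Submonoid.subset_closure hd⟩ : dens (polesX (LaurentSeries 𝕜)))
  intro d hd
  simp only [poles3, Set.mem_insert_iff, Set.mem_singleton_iff] at hd
  rcases hd with rfl | rfl | rfl | rfl | rfl
  · rw [h0]
    refine isUnit_end_of_ps ?_
    rw [MvPowerSeries.isUnit_iff_constantCoeff]
    simpa using hT
  · rw [h1]
    exact isUnit_end_sing (hu _ (by simp [polesX]))
  · rw [map_sub, h0, h1]
    refine isUnit_end_of_ps ?_
    rw [MvPowerSeries.isUnit_iff_constantCoeff, ← coeToMvPowerSeries.ringHom_apply, map_sub]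
    simpa using hT
  · rw [map_sub, h0, h2]
    refine isUnit_end_of_ps ?_
    rw [MvPowerSeries.isUnit_iff_constantCoeff, ← coeToMvPowerSeries.ringHom_apply, map_sub]
    simpa using hT
  · rw [map_sub, h1, h2]
    exact isUnit_end_sing (hu _ (by simp [polesX]))

/-- The expansion `i_{z_1; z_2, z_3}` in the region `|z_1| > |z_2|, |z_3|`, which leaves the poles
in `z_2` and `z_2 - z_3` alone. Its values lie in `V((z_1))[[z_2, z_3]][z_2⁻¹, (z_2 - z_3)⁻¹]`. -/
def Sing.expand3 : Sing (poles3 𝕜) V →ₗ[𝕜] Sing (polesX (LaurentSeries 𝕜)) (Lau 𝕜 V) :=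
  locLiftLin (poles3 𝕜) (peelRing 2 𝕜) ((LocalizedModule.mkLinearMap
    (dens (polesX (LaurentSeries 𝕜))) (PS 2 (Lau 𝕜 V))).comp (peel (K := 𝕜) (W := V) 2))
    peelRing_unit

theorem coeff_x (i j : ℤ) : HahnSeries.coeff (HahnSeries.coeff (L2Ring.x 𝕜) j) i
    = if i = 1 ∧ j = 0 then 1 else 0 := by
  have : L2Ring.x 𝕜 = HahnSeries.single 0 (HahnSeries.single 1 1) := rfl
  rw [this, HahnSeries.coeff_single]
  by_cases hj : j = 0
  · simp [hj, HahnSeries.coeff_single]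
  · simp [hj]

theorem coeff_y (i j : ℤ) : HahnSeries.coeff (HahnSeries.coeff (L2Ring.y 𝕜) j) i
    = if i = 0 ∧ j = 1 then 1 else 0 := by
  have : L2Ring.y 𝕜 = HahnSeries.single 1 1 := rfl
  rw [this, HahnSeries.coeff_single]
  by_cases hj : j = 1
  · simp [hj, HahnSeries.coeff_one]
  · simp [hj]

theorem x_ne_zero : L2Ring.x 𝕜 ≠ 0 := fun h => by
  have := coeff_x (𝕜 := 𝕜) 1 0
  simp [h] at this

theorem y_ne_zero : L2Ring.y 𝕜 ≠ 0 := fun h => by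
  have := coeff_y (𝕜 := 𝕜) 0 1
  simp [h] at this

theorem x_sub_y_ne_zero : L2Ring.x 𝕜 - L2Ring.y 𝕜 ≠ 0 := fun h => by
  have h1 := coeff_x (𝕜 := 𝕜) 1 0
  have h2 := coeff_y (𝕜 := 𝕜) 1 0
  rw [sub_eq_zero] at h
  rw [h, h2] at h1
  simp at h1

theorem x_add_y_ne_zero : L2Ring.x 𝕜 + L2Ring.y 𝕜 ≠ 0 := fun h => by
  have h1 := coeff_x (𝕜 := 𝕜) 1 0
  have h2 := coeff_y (𝕜 := 𝕜) 1 0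
  rw [add_eq_zero_iff_eq_neg] at h
  rw [h, HahnSeries.coeff_neg, HahnSeries.coeff_neg, h2] at h1
  simp at h1

theorem expandS_ne_zero : ∀ d ∈ polesS 𝕜, expandRing 𝕜 d ≠ 0 := by
  intro d hd
  simp only [polesS, Set.mem_insert_iff, Set.mem_singleton_iff] at hd
  rcases hd with rfl | rfl | rfl
  · rw [expandRing_X0]; exact x_ne_zero
  · rw [expandRing_X1]; exact y_ne_zero
  · rw [map_sub, expandRing_X0, expandRing_X1]; exact x_sub_y_ne_zero

theorem expandA_ne_zero : ∀ d ∈ polesA 𝕜, expandRing 𝕜 d ≠ 0 := by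
  intro d hd
  simp only [polesA, Set.mem_insert_iff, Set.mem_singleton_iff] at hd
  rcases hd with rfl | rfl | rfl
  · rw [expandRing_X0]; exact x_ne_zero
  · rw [expandRing_X1]; exact y_ne_zero
  · rw [map_add, expandRing_X0, expandRing_X1]; exact x_add_y_ne_zero

theorem expandX_ne_zero : ∀ d ∈ polesX 𝕜, expandRing 𝕜 d ≠ 0 := by
  intro d hd
  simp only [polesX, Set.mem_insert_iff, Set.mem_singleton_iff] at hd
  rcases hd with rfl | rfl
  · rw [expandRing_X0]; exact x_ne_zero
  · rw [map_sub, expandRing_X0, expandRing_X1]; exact x_sub_y_ne_zero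

/-- The coefficientwise application of `f : V → V((x))` to a Laurent series in `V((y))`. -/
def Lau.map : (V →ₗ[𝕜] Lau 𝕜 V) →ₗ[𝕜] Lau 𝕜 V →ₗ[𝕜] L2 𝕜 V :=
  LinearMap.mk₂ 𝕜 (fun f F => HahnModule.of (LaurentSeries 𝕜) (((HahnModule.of 𝕜).symm F).map f))
    (fun f g F => Lau.ext fun k => rfl)
    (fun c f F => Lau.ext fun k => by
      rw [L2_smul_def]
      exact (algebraMap_smul (LaurentSeries 𝕜) c (f (Lau.coeff F k))).symm)
    (fun f F G => Lau.ext fun k => map_add f _ _)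
    (fun c f F => Lau.ext fun k => by
      rw [L2_smul_def]
      refine (map_smul f c (Lau.coeff F k)).trans ?_
      exact (algebraMap_smul (LaurentSeries 𝕜) c (f (Lau.coeff F k))).symm)

theorem Lau.coeff_map (f : V →ₗ[𝕜] Lau 𝕜 V) (F : Lau 𝕜 V) (k : ℤ) :
    Lau.coeff (Lau.map f F) k = f (F.coeff k) := rfl

end Expansions

section Substitutions
open MvPolynomial
variable (𝕜 : Type*) [Field 𝕜]

theorem adm_id : Adm (![![1, 0], ![0, 1]] : Fin 2 → Fin 2 → 𝕜) (polesX 𝕜) (polesS 𝕜) := by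
  intro d hd
  simp only [polesX, Set.mem_insert_iff, Set.mem_singleton_iff] at hd
  rcases hd with rfl | rfl
  · exact isUnit_rat 𝕜 (X 0) (by simp [polesS]) (by simp [lin, Fin.sum_univ_succ])
  · exact isUnit_rat 𝕜 (X 0 - X 1) (by simp [polesS]) (by simp [lin, Fin.sum_univ_succ])

theorem adm_swap : Adm (![![0, 1], ![1, 0]] : Fin 2 → Fin 2 → 𝕜) (polesX 𝕜) (polesS 𝕜) := by
  intro d hd
  simp only [polesX, Set.mem_insert_iff, Set.mem_singleton_iff] at hd
  rcases hd with rfl | rfl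
  · exact isUnit_rat 𝕜 (X 1) (by simp [polesS]) (by simp [lin, Fin.sum_univ_succ])
  · exact isUnit_rat 𝕜 (X 0 - X 1) (by simp [polesS]) (by simp [lin, Fin.sum_univ_succ])

theorem adm_swapS : Adm (![![0, 1], ![1, 0]] : Fin 2 → Fin 2 → 𝕜) (polesS 𝕜) (polesS 𝕜) := by
  intro d hd
  simp only [polesS, Set.mem_insert_iff, Set.mem_singleton_iff] at hd
  rcases hd with rfl | rfl | rfl
  · exact isUnit_rat 𝕜 (X 1) (by simp [polesS]) (by simp [lin, Fin.sum_univ_succ])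
  · exact isUnit_rat 𝕜 (X 0) (by simp [polesS]) (by simp [lin, Fin.sum_univ_succ])
  · exact isUnit_rat 𝕜 (X 0 - X 1) (by simp [polesS]) (by simp [lin, Fin.sum_univ_succ])

theorem adm_eval : Adm (![![1], ![0]] : Fin 2 → Fin 1 → 𝕜) (polesX 𝕜) (poles1 𝕜) := by
  intro d hd
  simp only [polesX, Set.mem_insert_iff, Set.mem_singleton_iff] at hd
  rcases hd with rfl | rfl
  · exact isUnit_rat 𝕜 (X 0) (by simp [poles1]) (by simp [lin])
  · exact isUnit_rat 𝕜 (X 0) (by simp [poles1]) (by simp [lin])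

theorem adm_incl : Adm (![![1, 0, 0], ![0, 1, 0]] : Fin 2 → Fin 3 → 𝕜) (polesX 𝕜) (polesT 𝕜) := by
  intro d hd
  simp only [polesX, Set.mem_insert_iff, Set.mem_singleton_iff] at hd
  rcases hd with rfl | rfl
  · exact isUnit_rat 𝕜 (X 0) (by simp [polesT]) (by simp [lin, Fin.sum_univ_succ])
  · exact isUnit_rat 𝕜 (X 0 - X 1) (by simp [polesT]) (by simp [lin, Fin.sum_univ_succ])

theorem adm_shift : Adm (![![1, 0, 1], ![0, 1, 1]] : Fin 2 → Fin 3 → 𝕜)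
    (polesX 𝕜) (polesT 𝕜) := by
  intro d hd
  simp only [polesX, Set.mem_insert_iff, Set.mem_singleton_iff] at hd
  rcases hd with rfl | rfl
  · exact isUnit_rat 𝕜 (X 0 + X 2) (by simp [polesT]) (by simp [lin, Fin.sum_univ_succ])
  · exact isUnit_rat 𝕜 (X 0 - X 1) (by simp [polesT]) (by simp [lin, Fin.sum_univ_succ])

theorem adm_12 : Adm (![![1, 0, 0], ![0, 1, 0]] : Fin 2 → Fin 3 → 𝕜)
    (polesS 𝕜) (polesYB 𝕜) := by
  intro d hd
  simp only [polesS, Set.mem_insert_iff, Set.mem_singleton_iff] at hd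
  rcases hd with rfl | rfl | rfl
  · exact isUnit_rat 𝕜 (X 0) (by simp [polesYB]) (by simp [lin, Fin.sum_univ_succ])
  · exact isUnit_rat 𝕜 (X 1) (by simp [polesYB]) (by simp [lin, Fin.sum_univ_succ])
  · exact isUnit_rat 𝕜 (X 0 - X 1) (by simp [polesYB]) (by simp [lin, Fin.sum_univ_succ])

theorem adm_13 : Adm (![![1, 0, 0], ![0, 0, 1]] : Fin 2 → Fin 3 → 𝕜)
    (polesS 𝕜) (polesYB 𝕜) := by
  intro d hd
  simp only [polesS, Set.mem_insert_iff, Set.mem_singleton_iff] at hd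
  rcases hd with rfl | rfl | rfl
  · exact isUnit_rat 𝕜 (X 0) (by simp [polesYB]) (by simp [lin, Fin.sum_univ_succ])
  · exact isUnit_rat 𝕜 (X 2) (by simp [polesYB]) (by simp [lin, Fin.sum_univ_succ])
  · exact isUnit_rat 𝕜 (X 0 - X 2) (by simp [polesYB]) (by simp [lin, Fin.sum_univ_succ])

theorem adm_23 : Adm (![![0, 1, 0], ![0, 0, 1]] : Fin 2 → Fin 3 → 𝕜)
    (polesS 𝕜) (polesYB 𝕜) := by
  intro d hd
  simp only [polesS, Set.mem_insert_iff, Set.mem_singleton_iff] at hd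
  rcases hd with rfl | rfl | rfl
  · exact isUnit_rat 𝕜 (X 1) (by simp [polesYB]) (by simp [lin, Fin.sum_univ_succ])
  · exact isUnit_rat 𝕜 (X 2) (by simp [polesYB]) (by simp [lin, Fin.sum_univ_succ])
  · exact isUnit_rat 𝕜 (X 1 - X 2) (by simp [polesYB]) (by simp [lin, Fin.sum_univ_succ])

theorem adm_expand1 : Adm (![![1, 0], ![0, 1], ![0, 0]] : Fin 3 → Fin 2 → 𝕜)
    (poles3 𝕜) (polesS 𝕜) := by
  intro d hd
  simp only [poles3, Set.mem_insert_iff, Set.mem_singleton_iff] at hd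
  rcases hd with rfl | rfl | rfl | rfl | rfl
  · exact isUnit_rat 𝕜 (X 0) (by simp [polesS]) (by simp [lin, Fin.sum_univ_succ])
  · exact isUnit_rat 𝕜 (X 1) (by simp [polesS]) (by simp [lin, Fin.sum_univ_succ])
  · exact isUnit_rat 𝕜 (X 0 - X 1) (by simp [polesS]) (by simp [lin, Fin.sum_univ_succ])
  · exact isUnit_rat 𝕜 (X 0) (by simp [polesS]) (by simp [lin, Fin.sum_univ_succ])
  · exact isUnit_rat 𝕜 (X 1) (by simp [polesS]) (by simp [lin, Fin.sum_univ_succ])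

theorem adm_expand2 : Adm (![![0, 1], ![1, 0], ![0, 0]] : Fin 3 → Fin 2 → 𝕜)
    (poles3 𝕜) (polesS 𝕜) := by
  intro d hd
  simp only [poles3, Set.mem_insert_iff, Set.mem_singleton_iff] at hd
  rcases hd with rfl | rfl | rfl | rfl | rfl
  · exact isUnit_rat 𝕜 (X 1) (by simp [polesS]) (by simp [lin, Fin.sum_univ_succ])
  · exact isUnit_rat 𝕜 (X 0) (by simp [polesS]) (by simp [lin, Fin.sum_univ_succ])
  · exact isUnit_rat 𝕜 (X 0 - X 1) (by simp [polesS]) (by simp [lin, Fin.sum_univ_succ])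
  · exact isUnit_rat 𝕜 (X 1) (by simp [polesS]) (by simp [lin, Fin.sum_univ_succ])
  · exact isUnit_rat 𝕜 (X 0) (by simp [polesS]) (by simp [lin, Fin.sum_univ_succ])

theorem adm_expand3 : Adm (![![1, 1], ![1, 0], ![0, 0]] : Fin 3 → Fin 2 → 𝕜)
    (poles3 𝕜) (polesA 𝕜) := by
  intro d hd
  simp only [poles3, Set.mem_insert_iff, Set.mem_singleton_iff] at hd
  rcases hd with rfl | rfl | rfl | rfl | rfl
  · exact isUnit_rat 𝕜 (X 0 + X 1) (by simp [polesA]) (by simp [lin, Fin.sum_univ_succ])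
  · exact isUnit_rat 𝕜 (X 0) (by simp [polesA]) (by simp [lin, Fin.sum_univ_succ])
  · exact isUnit_rat 𝕜 (X 1) (by simp [polesA]) (by simp [lin, Fin.sum_univ_succ])
  · exact isUnit_rat 𝕜 (X 0 + X 1) (by simp [polesA]) (by simp [lin, Fin.sum_univ_succ])
  · exact isUnit_rat 𝕜 (X 0) (by simp [polesA]) (by simp [lin, Fin.sum_univ_succ])

theorem adm_trans : Adm (![![0, 1], ![0, 0], ![1, 0]] : Fin 3 → Fin 2 → 𝕜)
    (polesT 𝕜) (polesA 𝕜) := by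
  intro d hd
  simp only [polesT, Set.mem_insert_iff, Set.mem_singleton_iff] at hd
  rcases hd with rfl | rfl | rfl
  · exact isUnit_rat 𝕜 (X 1) (by simp [polesA]) (by simp [lin, Fin.sum_univ_succ])
  · exact isUnit_rat 𝕜 (X 1) (by simp [polesA]) (by simp [lin, Fin.sum_univ_succ])
  · exact isUnit_rat 𝕜 (X 0 + X 1) (by simp [polesA]) (by simp [lin, Fin.sum_univ_succ, add_comm])

theorem adm_const {R : Type*} [CommRing R] [Algebra 𝕜 R] : ∀ d ∈ polesX 𝕜,
    IsUnit (algebraMap _ (Rat (polesX R)) ((mapAlgHom (Algebra.ofId 𝕜 R) :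
      MvPolynomial (Fin 2) 𝕜 →ₐ[𝕜] MvPolynomial (Fin 2) R) d)) := by
  have hu : ∀ d ∈ polesX R, IsUnit (algebraMap (MvPolynomial (Fin 2) R) (Rat (polesX R)) d) :=
    fun d hd => IsLocalization.map_units (Rat (polesX R))
      (⟨d, Submonoid.subset_closure hd⟩ : dens (polesX R))
  intro d hd
  simp only [polesX, Set.mem_insert_iff, Set.mem_singleton_iff] at hd
  rcases hd with rfl | rfl
  · have := hu (X 0) (by simp [polesX])
    simpa using this
  · have := hu (X 0 - X 1) (by simp [polesX])
    simpa using this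

/-- The expansion `f(z_1, z_2) ↦ f(z_1 + w, z_2)` in the region `|z_1| > |w|`, where `w` is the
variable `w_1` for `i = 0`, and `w_2` for `i = 1`. -/
def shiftFst (i : Fin 2) : Rat (polesS 𝕜) →ₐ[𝕜] MvPowerSeries (Fin 2) (Rat (polesS 𝕜)) :=
  ratLift (polesS 𝕜) (aeval ![MvPowerSeries.C (algebraMap (MvPolynomial (Fin 2) 𝕜) (Rat (polesS 𝕜)) (X 0)) + MvPowerSeries.X i,
    MvPowerSeries.C (algebraMap (MvPolynomial (Fin 2) 𝕜) (Rat (polesS 𝕜)) (X 1))]) (by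
    have hu : ∀ d ∈ polesS 𝕜, IsUnit (algebraMap (MvPolynomial (Fin 2) 𝕜) (Rat (polesS 𝕜)) d) :=
      fun d hd => isUnit_rat 𝕜 d hd (Or.inl rfl)
    intro d hd
    rw [MvPowerSeries.isUnit_iff_constantCoeff]
    have h := hu d hd
    simp only [polesS, Set.mem_insert_iff, Set.mem_singleton_iff] at hd
    rcases hd with rfl | rfl | rfl
    · simpa using h
    · simpa using h
    · simpa using h)

end Substitutions

section QuantumVertexAlgebra
variable {𝕜 : Type*} [Field 𝕜] {V : Type*} [AddCommGroup V] [Module 𝕜 V]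

/-- `e^{z_i D}` as a power series with coefficients in `End V`. -/
def expSeries (D : V →ₗ[𝕜] V) {n : ℕ} (i : Fin n) : MvPowerSeries (Fin n) (Module.End 𝕜 V) :=
  fun m => if m = Finsupp.single i (m i) then
    ((m i).factorial : 𝕜)⁻¹ • (D : Module.End 𝕜 V) ^ (m i) else 0

/-- A constant power series. -/
def PS.const (n : ℕ) (a : V) : PS n V := fun m => if m = 0 then a else 0

/-- Multiplication by `e^{z_i D}` on `V[[z]][P⁻¹]`. -/
def expAct (D : V →ₗ[𝕜] V) {n : ℕ} (i : Fin n) (P : Set (MvPolynomial (Fin n) 𝕜))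
    (F : Sing P V) : Sing P V :=
  endLoc P (psEnd (K := 𝕜) (expSeries D i)) F

/-- The linear extension, as a power series in `t` of endomorphisms, of a map
`U → B ⊗ U[[t]]`. -/
def extend {B U : Type*} [CommRing B] [Algebra 𝕜 B] [AddCommGroup U] [Module 𝕜 U]
    (s : ℕ → U →ₗ[𝕜] B ⊗[𝕜] U) : PowerSeries (Module.End B (B ⊗[𝕜] U)) :=
  PowerSeries.mk fun k => (s k).liftBaseChange B

/-- Change of the ring of functions in which a braiding or translation map has its values. -/
def along {R B U : Type*} [CommRing R] [Algebra 𝕜 R] [CommRing B] [Algebra 𝕜 B]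
    [AddCommGroup U] [Module 𝕜 U] (ρ : R →ₐ[𝕜] B) (s : ℕ → U →ₗ[𝕜] R ⊗[𝕜] U) :
    ℕ → U →ₗ[𝕜] B ⊗[𝕜] U :=
  fun k => ρ.toLinearMap.rTensor U ∘ₗ s k

/-- The composition of `y : U → N[[t]]`, extended linearly over `B`, with `E`, evaluated at
`1 ⊗ u`; coefficient of `t^k`. -/
def applySeries {B U N : Type*} [CommRing B] [Algebra 𝕜 B] [AddCommGroup U] [Module 𝕜 U]
    [AddCommGroup N] [Module 𝕜 N] [Module B N] [IsScalarTower 𝕜 B N]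
    (y : ℕ → U →ₗ[𝕜] N) (E : PowerSeries (Module.End B (B ⊗[𝕜] U))) (k : ℕ) (u : U) : N :=
  ∑ p ∈ Finset.HasAntidiagonal.antidiagonal k,
    (y p.1).liftBaseChange B (PowerSeries.coeff p.2 E (1 ⊗ₜ u))

/-- The action of `s : V ⊗ V → B ⊗ V ⊗ V [[t]]` on two of the factors of `V ⊗ V ⊗ V`, which are
moved to the first two places by `e`. -/
def leg {B : Type*} [CommRing B] [Algebra 𝕜 B]
    (e : (V ⊗[𝕜] V) ⊗[𝕜] V ≃ₗ[𝕜] (V ⊗[𝕜] V) ⊗[𝕜] V)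
    (s : ℕ → V ⊗[𝕜] V →ₗ[𝕜] B ⊗[𝕜] (V ⊗[𝕜] V)) :
    PowerSeries (Module.End B (B ⊗[𝕜] ((V ⊗[𝕜] V) ⊗[𝕜] V))) :=
  extend fun k => e.symm.toLinearMap.lTensor B ∘ₗ
    (TensorProduct.assoc 𝕜 B (V ⊗[𝕜] V) V).toLinearMap ∘ₗ (s k).rTensor V ∘ₗ e.toLinearMap

section legs
variable {B : Type*} [CommRing B] [Algebra 𝕜 B]
  (s : ℕ → V ⊗[𝕜] V →ₗ[𝕜] B ⊗[𝕜] (V ⊗[𝕜] V))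

/-- `S^{12}`, `S^{13}` and `S^{23}`. -/
def leg12 : PowerSeries (Module.End B (B ⊗[𝕜] ((V ⊗[𝕜] V) ⊗[𝕜] V))) :=
  leg (LinearEquiv.refl 𝕜 _) s
def leg13 : PowerSeries (Module.End B (B ⊗[𝕜] ((V ⊗[𝕜] V) ⊗[𝕜] V))) :=
  leg (TensorProduct.rightComm 𝕜 V V V) s
def leg23 : PowerSeries (Module.End B (B ⊗[𝕜] ((V ⊗[𝕜] V) ⊗[𝕜] V))) :=
  leg ((TensorProduct.assoc 𝕜 V V V).trans (TensorProduct.comm 𝕜 V (V ⊗[𝕜] V))) s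

end legs

/-- The map `a ⊗ b ↦ b ⊗ a`. -/
def flip : V ⊗[𝕜] V →ₗ[𝕜] V ⊗[𝕜] V := (TensorProduct.comm 𝕜 V V).toLinearMap

/-- The one-variable vertex operator `Y(a, z) b = X_{z,0}(a ⊗ b)`; coefficient of `t^k`. -/
def vertexOp (X : ℕ → V ⊗[𝕜] V →ₗ[𝕜] Sing (polesX 𝕜) V) (k : ℕ) : V ⊗[𝕜] V →ₗ[𝕜] Lau 𝕜 V :=
  Sing.flat ∘ₗ Sing.subst ![![1], ![0]] (adm_eval 𝕜) ∘ₗ X k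

/-- `a ⊗ b ⊗ c ↦ Y(a, x) Y(b, y) c`, with values in `V((x))((y))`; coefficient of `t^k`. -/
def prodOp (Y : ℕ → V ⊗[𝕜] V →ₗ[𝕜] Lau 𝕜 V) (k : ℕ) : (V ⊗[𝕜] V) ⊗[𝕜] V →ₗ[𝕜] L2 𝕜 V :=
  ∑ p ∈ Finset.HasAntidiagonal.antidiagonal k,
    TensorProduct.lift ((Lau.map ∘ₗ TensorProduct.curry (Y p.1)).compl₂ (Y p.2)) ∘ₗ
      (TensorProduct.assoc 𝕜 V V V).toLinearMap

/-- `a ⊗ b ⊗ c ↦ Y(Y(a, y) b, x) c`, with values in `V((x))((y))`; coefficient of `t^k`. -/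
def iterOp (Y : ℕ → V ⊗[𝕜] V →ₗ[𝕜] Lau 𝕜 V) (k : ℕ) : (V ⊗[𝕜] V) ⊗[𝕜] V →ₗ[𝕜] L2 𝕜 V :=
  ∑ p ∈ Finset.HasAntidiagonal.antidiagonal k,
    TensorProduct.lift
      ((Lau.map ∘ₗ (TensorProduct.curry (Y p.1)).flip).compl₂ (Y p.2)).flip

/-- `u ⊗ v ⊗ w ↦ X_{w_1,w_2}(u ⊗ v) ⊗ w`; coefficient of `t^k`. -/
def mulFst (X : ℕ → V ⊗[𝕜] V →ₗ[𝕜] Sing (polesX 𝕜) V) (k : ℕ) :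
    (V ⊗[𝕜] V) ⊗[𝕜] V →ₗ[𝕜]
      Sing (polesX (Rat (polesS 𝕜))) (Rat (polesS 𝕜) ⊗[𝕜] (V ⊗[𝕜] V)) :=
  TensorProduct.lift
    ((singMap (adm_const 𝕜) ∘ₗ
      (LinearMap.llcomp 𝕜 V (V ⊗[𝕜] V) _ (TensorProduct.mk 𝕜 (Rat (polesS 𝕜)) (V ⊗[𝕜] V) 1)) ∘ₗ
        (TensorProduct.mk 𝕜 V V).flip).compl₂ (X k)).flip

variable (𝕜 V) in
/-- An `H_D`-quantum vertex algebra: a vector space `V` with an action of `H_D = 𝕜[D]`, a vacuum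
vector, a singular multiplication
`X_{z_1,z_2} : V ⊗ V → V[[z_1, z_2]][z_1⁻¹, (z_1 - z_2)⁻¹][[t]]`, a braiding map
`S^{(τ)}_{z_1,z_2} : V ⊗ V → V ⊗ V [z_1^{±1}, z_2^{±1}, (z_1 - z_2)⁻¹][[t]]` and a translation map
`S^{(γ)}_{z_1,z_2} : V ⊗ V → V ⊗ V [z_1^{±1}, z_2, (z_1 - z_2)⁻¹, (z_1 + γ)^{±1}, z_2 + γ][[t]]`.
Power series in `t` are given by their sequences of coefficients, and all the maps are extended
to be linear and continuous over `𝕜[[t]]`. -/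
structure HDQuantumVertexAlgebra where
  D : V →ₗ[𝕜] V
  vac : V
  X : ℕ → V ⊗[𝕜] V →ₗ[𝕜] Sing (polesX 𝕜) V
  braid : ℕ → V ⊗[𝕜] V →ₗ[𝕜] Rat (polesS 𝕜) ⊗[𝕜] (V ⊗[𝕜] V)
  trans : ℕ → V ⊗[𝕜] V →ₗ[𝕜] Rat (polesT 𝕜) ⊗[𝕜] (V ⊗[𝕜] V)
  /-- `X_{z_1,z_2}(a ⊗ 1) = e^{z_1 D} a`. -/
  X_vac : ∀ k a, X k (a ⊗ₜ vac)
    = if k = 0 then PS.toSing _ (expSeries D (0 : Fin 2) • PS.const 2 a) else 0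
  /-- `X_{z_1,z_2}(1 ⊗ a) = e^{z_2 D} a`. -/
  vac_X : ∀ k a, X k (vac ⊗ₜ a)
    = if k = 0 then PS.toSing _ (expSeries D (1 : Fin 2) • PS.const 2 a) else 0
  /-- `S^{(τ)}(a ⊗ 1) = a ⊗ 1`. -/
  braid_vac : ∀ k a, braid k (a ⊗ₜ vac) = if k = 0 then 1 ⊗ₜ (a ⊗ₜ vac) else 0
  /-- `S^{(τ)}(1 ⊗ a) = 1 ⊗ a`. -/
  vac_braid : ∀ k a, braid k (vac ⊗ₜ a) = if k = 0 then 1 ⊗ₜ (vac ⊗ₜ a) else 0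
  /-- `X_{z_1,z_2}(a ⊗ D b) = ∂_{z_2} X_{z_1,z_2}(a ⊗ b)`, written out for the coefficients of
  `z_2^n` in `V((z_1))((z_2))`. -/
  X_D : ∀ k a b (n : ℤ),
    Lau.coeff (Sing.expand 𝕜 (polesX 𝕜) (expandX_ne_zero) (X k (a ⊗ₜ D b))) n
      = (n + 1) • Lau.coeff (Sing.expand 𝕜 (polesX 𝕜) (expandX_ne_zero) (X k (a ⊗ₜ b))) (n + 1)
  /-- Braided commutativity
  `X_{z_1,z_2}(a ⊗ b) = X_{z_2,z_1} S^{(τ)}_{z_2,z_1}(b ⊗ a)`. -/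
  braided_comm : ∀ k a b, Sing.subst ![![1, 0], ![0, 1]] (adm_id 𝕜) (X k (a ⊗ₜ b))
    = applySeries (fun i => Sing.subst ![![0, 1], ![1, 0]] (adm_swap 𝕜) ∘ₗ X i)
      (extend (along (Rat.subst ![![0, 1], ![1, 0]] (adm_swapS 𝕜)) braid)) k (b ⊗ₜ a)
  /-- Broken translation covariance
  `e^{γ D} X_{z_1,z_2} S^{(γ)}_{z_1,z_2}(a ⊗ b) = X_{z_1+γ,z_2+γ}(a ⊗ b)`. -/
  translation : ∀ k a b, expAct D 2 (polesT 𝕜)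
      (applySeries (fun i => Sing.subst ![![1, 0, 0], ![0, 1, 0]] (adm_incl 𝕜) ∘ₗ X i)
        (extend trans) k (a ⊗ₜ b))
    = Sing.subst ![![1, 0, 1], ![0, 1, 1]] (adm_shift 𝕜) (X k (a ⊗ₜ b))
  /-- Unitarity `S^{(τ)}_{z_1,z_2} ∘ τ ∘ S^{(τ)}_{z_2,z_1} ∘ τ = 1`. -/
  unitarity : extend braid *
    extend (fun k => flip.lTensor (Rat (polesS 𝕜)) ∘ₗ
      along (Rat.subst ![![0, 1], ![1, 0]] (adm_swapS 𝕜)) braid k ∘ₗ flip) = 1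
  /-- The Yang-Baxter equation
  `S^{12}_{z_1,z_2} S^{13}_{z_1,z_3} S^{23}_{z_2,z_3} = S^{23}_{z_2,z_3} S^{13}_{z_1,z_3}
  S^{12}_{z_1,z_2}`. -/
  yang_baxter :
    leg12 (along (Rat.subst ![![1, 0, 0], ![0, 1, 0]] (adm_12 𝕜)) braid) *
    leg13 (along (Rat.subst ![![1, 0, 0], ![0, 0, 1]] (adm_13 𝕜)) braid) *
    leg23 (along (Rat.subst ![![0, 1, 0], ![0, 0, 1]] (adm_23 𝕜)) braid) =
    leg23 (along (Rat.subst ![![0, 1, 0], ![0, 0, 1]] (adm_23 𝕜)) braid) *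
    leg13 (along (Rat.subst ![![1, 0, 0], ![0, 0, 1]] (adm_13 𝕜)) braid) *
    leg12 (along (Rat.subst ![![1, 0, 0], ![0, 1, 0]] (adm_12 𝕜)) braid)
  /-- The hexagon axiom `S_{z_1,z_2}(X_{w_1,w_2} ⊗ 1)
  = (X_{w_1,w_2} ⊗ 1) i_{z_1;w_1,w_2} S^{23}_{z_1+w_2,z_2} S^{13}_{z_1+w_1,z_2}`. -/
  hexagon : ∀ k a b c,
    ∑ p ∈ Finset.HasAntidiagonal.antidiagonal k,
      singMap (D' := polesX (Rat (polesS 𝕜))) (adm_const 𝕜)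
        (braid p.1 ∘ₗ (TensorProduct.mk 𝕜 V V).flip c) (X p.2 (a ⊗ₜ b))
    = applySeries (mulFst X)
        (leg23 (along (shiftFst 𝕜 1) braid) * leg13 (along (shiftFst 𝕜 0) braid))
        k ((a ⊗ₜ b) ⊗ₜ c)
  /-- Locality: for all `a`, `b` and `K` there is an `N` such that for all `c`
  `(z_1 - z_2)^N Y(a, z_1) Y(b, z_2) c
  ≡ (z_1 - z_2)^N Y_{z_2}(1 ⊗ Y_{z_1}) i_{z_2;z_1} S^{(τ),12}_{z_2,z_1}(b ⊗ a ⊗ c)  mod t^K`;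
  the coefficients of `z_1^m z_2^n` of both sides are compared. -/
  locality : ∀ a b (K : ℕ), ∃ N : ℕ, ∀ c, ∀ k < K, ∀ m n : ℤ,
    Lau.coeff (Lau.coeff ((L2Ring.x 𝕜 - L2Ring.y 𝕜) ^ N •
      prodOp (vertexOp X) k ((a ⊗ₜ b) ⊗ₜ c)) n) m
    = Lau.coeff (Lau.coeff ((L2Ring.y 𝕜 - L2Ring.x 𝕜) ^ N •
      applySeries (prodOp (vertexOp X))
        (leg12 (along (Rat.expand 𝕜 (polesS 𝕜) expandS_ne_zero) braid))
        k ((b ⊗ₜ a) ⊗ₜ c)) m) n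

/-- The vertex operators `Y(a, z) b` of an `H_D`-quantum vertex algebra. -/
def HDQuantumVertexAlgebra.Y (Q : HDQuantumVertexAlgebra 𝕜 V) (k : ℕ) :
    V ⊗[𝕜] V →ₗ[𝕜] Lau 𝕜 V :=
  vertexOp Q.X k

end QuantumVertexAlgebra

end HDQVA

open HDQVA

/-! Existence. By $H_D$-covariance the second variable of $X$ enters only through an exponential. So
in the region $|z_1|>|z_2|>|z_3|$ the series $X_{z_1,0}(1\otimes X_{z_2,z_3})(a\otimes b\otimes c)$
is $Y(a,z_1)Y(b,z_2)e^{z_3D}c$ (`evX_tripleRhs`). Its poles in $z_2$ are bounded, because it is the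
expansion of a fraction; nothing bounds its poles in $z_1$ so far. The exponent $N$ of locality does
not depend on the third vector and therefore serves all the vectors $D^nc$ at once. Hence
$(z_1-z_2)^N$ times the series has the same coefficients as $(z_1-z_2)^N$ times the product in the
opposite order, preceded by the braiding (`swapRel_trip`), and that product has bounded poles in
$z_1$. Once the denominators are cleared, no negative powers of $z_1$ or $z_2$ remain: what is left
is a power series in three variables, and dividing it by the denominators gives the triple product
(`tripP_tmul_mem_range`). The expansion is injective (`evT_injective`), so the triple product is
unique and depends linearly on the vectors. The first two formulas are the two orderings at $z_3=0$.

Third formula. The last variable is kept: let $X_{x+w,x,z}(a\otimes b\otimes c)$ be expanded for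
$|z|>|x|>|w|$. Exchanging $c$ with its neighbours twice gives $X_{z,x+w,x}(c\otimes a\otimes
b)=X_{x+w,x,z}S^{23}_{x,z}S^{13}_{x+w,z}(a\otimes b\otimes c)$ (`sum_lmap2_X`). On the left $z$ is
largest, so this is $Y(c,z)X_{x+w,x}(a\otimes b)$. Broken translation covariance turns $X_{x+w,x}$
into $e^{xD}Y_wS^{(x)}_{w,0}$, and covariance absorbs the exponential: the left side is
$X_{z,x}(c\otimes Y_wS^{(x)}_{w,0}(a\otimes b))$ (`lmap2_toL2_matSum`).

It remains to move $c$ back behind $Y_wS^{(x)}_{w,0}$. For $Y_w$ alone this is the hexagon at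
$w_2=0$ (`coefOp_Y`). For $G_\gamma=Y_wS^{(\gamma)}_{w,0}$, expanded in powers of $\gamma$,
translation covariance gives $G_0=Y$ and $\partial_\gamma G=\partial_wG+G(1\otimes D)-DG$
(`gammaCoeff_succ`). The operator on the right preserves the exchange identity, because the hexagon
with a vacuum entry shows how $S^{(\tau)}$ commutes with $D$ (`braid_D`). So every coefficient in
$\gamma$ satisfies the identity (`braidCompatible_gammaCoeff`). The dependence on $\gamma$ is
rational with denominators powers of $w+\gamma$, so $\gamma=x$ may be inserted, and unitarity
cancels the braidings: $X_{x+w,x,z}=X_{x,z}(Y_wS^{(x)}_{w,0}\otimes1)$ (`tripXZ_eq`). Finally $z=0$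
is inserted through the relation `specPairs`. This is legitimate because the coefficients of the
powers of $w$ are fractions in $x$ and $z$ without a pole at $z=0$. -/

namespace HDQVA

/-! ### Comparing maps out of localized modules -/

section Localization

/-- Denominators act injectively on the target, so after multiplication by $s$ only numerators are
compared. Most identities between expansions below are proved this way: linearity over the
polynomials on both sides, then a comparison of coefficients of power series. -/
theorem locLift_ext {R R' M N : Type*} [CommRing R] [CommRing R'] [AddCommGroup M] [Module R M]
    [AddCommGroup N] [Module R' N] {φ : R →+* R'} {D : Set R}
    (h : ∀ d ∈ D, IsUnit (algebraMap R' (Module.End R' N) (φ d)))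
    (g₁ g₂ : LocalizedModule (Submonoid.closure D) M → N)
    (h₁ : ∀ (p : R) x, g₁ (p • x) = φ p • g₁ x) (h₂ : ∀ (p : R) x, g₂ (p • x) = φ p • g₂ x)
    (h₀ : ∀ F, g₁ (LocalizedModule.mk F 1) = g₂ (LocalizedModule.mk F 1)) (x) : g₁ x = g₂ x := by
  induction x using LocalizedModule.induction_on with
  | _ F s =>
    have hs := locLift_unit φ D h s
    let : Module R N := Module.compHom N φ
    rw [Module.End.isUnit_iff] at hs
    apply hs.1
    change φ s • g₁ _ = φ s • g₂ _
    rw [← h₁, ← h₂, LocalizedModule.smul'_mk]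
    have : (LocalizedModule.mk ((s : R) • F) s : LocalizedModule (Submonoid.closure D) M)
      = LocalizedModule.mk F 1 := LocalizedModule.mk_cancel s F
    rw [this, h₀]

section
variable {k R R' M N : Type*} [CommRing k] [CommRing R] [Algebra k R] [CommRing R']
    [Algebra k R'] [AddCommGroup M] [Module R M] [Module k M] [IsScalarTower k R M]
    [AddCommGroup N] [Module R' N] [Module k N] [IsScalarTower k R' N]
    (D : Set R) (φ : R →ₐ[k] R') (f : M →ₛₗ[φ.toRingHom] N)
    (h : ∀ d ∈ D, IsUnit (algebraMap R' (Module.End R' N) (φ d)))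

theorem locLiftLin_mk_one (F : M) : locLiftLin D φ f h (LocalizedModule.mk F 1) = f F :=
  locLift_mk_one D f h F

theorem locLiftLin_smul (p : R) (x) :
    locLiftLin D φ f h (p • x) = φ p • locLiftLin D φ f h x :=
  (locLift D f h).map_smulₛₗ p x

end

theorem isUnit_end {R' N : Type*} [CommRing R'] [AddCommGroup N] [Module R' N] {r : R'}
    (h : IsUnit r) : IsUnit (algebraMap R' (Module.End R' N) r) := h.map _

end Localization

/-! ### Semilinearity tested on the variables -/

section Semilinear
variable {K A A' N N' : Type*} [CommRing K] [CommRing A] [Algebra K A] [CommRing A'] [Algebra K A']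
  [AddCommGroup N] [Module A N] [Module K N] [IsScalarTower K A N]
  [AddCommGroup N'] [Module A' N'] [Module K N'] [IsScalarTower K A' N']

theorem mvPolynomial_smul_of_X {σ : Type*} (φ : MvPolynomial σ K →ₐ[K] A)
    (φ' : MvPolynomial σ K →ₐ[K] A') (g : N →ₗ[K] N')
    (hX : ∀ (i : σ) (m : N), g (φ (MvPolynomial.X i) • m) = φ' (MvPolynomial.X i) • g m) (p) :
    ∀ m, g (φ p • m) = φ' p • g m := by
  induction p using MvPolynomial.induction_on with
  | C k =>
    intro m
    have h1 : φ (MvPolynomial.C k) = algebraMap K A k := φ.commutes k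
    have h2 : φ' (MvPolynomial.C k) = algebraMap K A' k := φ'.commutes k
    rw [h1, h2, algebraMap_smul, algebraMap_smul, map_smul]
  | add p q hp hq => intro m; rw [map_add, map_add, add_smul, add_smul, map_add, hp, hq]
  | mul_X p i hp => intro m; rw [map_mul, map_mul, mul_smul, mul_smul, hp, hX]

/-- A fraction $p/s$ is handled by multiplying by $s$, since $\rho'(s)$ is a unit and can be
cancelled on the target. In this way a map is pushed through the scalars that a braiding produces.
-/
theorem rat_smul_of_X {n : ℕ} {D : Set (MvPolynomial (Fin n) K)} (ρ : Rat D →ₐ[K] A)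
    (ρ' : Rat D →ₐ[K] A') (g : N →ₗ[K] N')
    (hX : ∀ (i : Fin n) (m : N), g (ρ (algebraMap (MvPolynomial (Fin n) K) _ (MvPolynomial.X i)) • m)
      = ρ' (algebraMap (MvPolynomial (Fin n) K) _ (MvPolynomial.X i)) • g m) (r : Rat D) (m : N) :
    g (ρ r • m) = ρ' r • g m := by
  have hp := mvPolynomial_smul_of_X (ρ.comp (IsScalarTower.toAlgHom K _ _))
    (ρ'.comp (IsScalarTower.toAlgHom K _ _)) g hX
  obtain ⟨p, s, rfl⟩ := IsLocalization.exists_mk'_eq (dens D) r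
  have hs := (IsLocalization.map_units (Rat D) s).map ρ'
  rw [← hs.smul_left_cancel]
  have e1 := hp s (ρ (IsLocalization.mk' (Rat D) p s) • m)
  have e2 := hp p m
  simp only [AlgHom.comp_apply, IsScalarTower.toAlgHom_apply] at e1 e2
  refine e1.symm.trans ?_
  rw [← mul_smul, ← mul_smul, ← map_mul, ← map_mul, mul_comm, IsLocalization.mk'_spec, e2]

/-- Both modules are taken to be `A`, with the identity map between them. -/
theorem rat_algHom_ext {n : ℕ} {D : Set (MvPolynomial (Fin n) K)} {ρ ρ' : Rat D →ₐ[K] A}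
    (hX : ∀ i : Fin n, ρ (algebraMap (MvPolynomial (Fin n) K) _ (MvPolynomial.X i))
      = ρ' (algebraMap (MvPolynomial (Fin n) K) _ (MvPolynomial.X i))) :
    ρ = ρ' := by
  refine AlgHom.ext fun r => ?_
  have := rat_smul_of_X ρ ρ' (N := A) (N' := A) LinearMap.id
    (fun i m => by rw [hX]; rfl) r 1
  simpa using this

theorem ratLift_algebraMap {n : ℕ} {B : Type*} [CommRing B] [Algebra K B]
    (D : Set (MvPolynomial (Fin n) K)) (f : MvPolynomial (Fin n) K →ₐ[K] B)
    (h : ∀ d ∈ D, IsUnit (f d)) (p) : ratLift D f h (algebraMap _ _ p) = f p :=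
  IsLocalization.lift_eq _ _

end Semilinear

/-! ### Power series in $t$ of linear maps -/

section Convolution
variable {K : Type*} [CommRing K] {E F G H : Type*} [AddCommGroup E] [Module K E]
  [AddCommGroup F] [Module K F] [AddCommGroup G] [Module K G] [AddCommGroup H] [Module K H]

/-- The composition of power series in `t` of linear maps. -/
def tc (f : ℕ → F →ₗ[K] G) (g : ℕ → E →ₗ[K] F) : ℕ → E →ₗ[K] G :=
  fun k => ∑ p ∈ Finset.HasAntidiagonal.antidiagonal k, f p.1 ∘ₗ g p.2

theorem tc_apply (f : ℕ → F →ₗ[K] G) (g : ℕ → E →ₗ[K] F) (k : ℕ) (x : E) :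
    tc f g k x = ∑ p ∈ Finset.HasAntidiagonal.antidiagonal k, f p.1 (g p.2 x) := by
  simp [tc]

/-- Both sides run over the triples with sum $k$; this is the associativity of multiplication of
series in $t$. -/
theorem sum_antidiagonal_assoc {M : Type*} [AddCommMonoid M] (f : ℕ → ℕ → ℕ → M) (k : ℕ) :
    ∑ p ∈ Finset.HasAntidiagonal.antidiagonal k, ∑ q ∈ Finset.HasAntidiagonal.antidiagonal p.1,
        f q.1 q.2 p.2
      = ∑ p ∈ Finset.HasAntidiagonal.antidiagonal k,
        ∑ q ∈ Finset.HasAntidiagonal.antidiagonal p.2, f p.1 q.1 q.2 := by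
  simp only [Finset.sum_sigma']
  apply Finset.sum_nbij' (fun ⟨⟨_i, j⟩, ⟨k, l⟩⟩ ↦ ⟨(k, l + j), (l, j)⟩)
      (fun ⟨⟨i, _j⟩, ⟨k, l⟩⟩ ↦ ⟨(i + k, l), (i, k)⟩)
  · rintro ⟨⟨a, b⟩, ⟨c, d⟩⟩ h
    simp only [Finset.mem_sigma, Finset.HasAntidiagonal.mem_antidiagonal] at h ⊢
    refine ⟨?_, trivial⟩
    rw [← h.1, ← h.2, add_assoc]
  · rintro ⟨⟨a, b⟩, ⟨c, d⟩⟩ h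
    simp only [Finset.mem_sigma, Finset.HasAntidiagonal.mem_antidiagonal] at h ⊢
    refine ⟨?_, trivial⟩
    rw [← h.1, ← h.2, add_assoc]
  · rintro ⟨⟨a, b⟩, ⟨c, d⟩⟩ h
    simp only [Finset.mem_sigma, Finset.HasAntidiagonal.mem_antidiagonal] at h
    simp [h.2]
  · rintro ⟨⟨a, b⟩, ⟨c, d⟩⟩ h
    simp only [Finset.mem_sigma, Finset.HasAntidiagonal.mem_antidiagonal] at h
    simp [h.2]
  · rintro ⟨⟨a, b⟩, ⟨c, d⟩⟩ h
    rfl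

theorem tc_assoc (f : ℕ → G →ₗ[K] H) (g : ℕ → F →ₗ[K] G) (h : ℕ → E →ₗ[K] F) :
    tc (tc f g) h = tc f (tc g h) := by
  funext k
  ext x
  simp only [tc_apply, map_sum]
  exact sum_antidiagonal_assoc (fun i j l => f i (g j (h l x))) k

theorem comp_tc (u : G →ₗ[K] H) (f : ℕ → F →ₗ[K] G) (g : ℕ → E →ₗ[K] F) (k : ℕ) :
    u ∘ₗ tc f g k = tc (fun i => u ∘ₗ f i) g k := by
  ext x; simp [tc_apply]

theorem tc_single (f : ℕ → F →ₗ[K] G) (g : E →ₗ[K] F) :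
    tc f (fun k => if k = 0 then g else 0) = fun k => f k ∘ₗ g := by
  funext k
  rw [tc, Finset.sum_eq_single (k, 0)]
  · simp
  · rintro ⟨i, j⟩ hij hne
    have : j ≠ 0 := by
      rintro rfl
      apply hne
      simpa using hij
    simp [this]
  · simp

end Convolution

/-! ### Extension of scalars along a homomorphism -/

section BaseChange
variable {K : Type*} [CommRing K] {A B : Type*} [CommRing A] [Algebra K A] [CommRing B]
  [Algebra K B] {U W V N N' : Type*} [AddCommGroup U] [Module K U] [AddCommGroup W] [Module K W]
  [AddCommGroup V] [Module K V]
  [AddCommGroup N] [Module K N] [Module B N] [IsScalarTower K B N]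


/-- The linear extension of `y` along a homomorphism `ρ` of scalars. -/
def lb (ρ : A →ₐ[K] B) (y : U →ₗ[K] N) : A ⊗[K] U →ₗ[K] N :=
  TensorProduct.lift (((Algebra.lsmul K K N).toLinearMap ∘ₗ ρ.toLinearMap).compl₂ y)

@[simp]
theorem lb_tmul (ρ : A →ₐ[K] B) (y : U →ₗ[K] N) (r : A) (u : U) :
    lb ρ y (r ⊗ₜ u) = ρ r • y u := rfl

theorem lb_smul (ρ : A →ₐ[K] B) (y : U →ₗ[K] N) (r : A) (x : A ⊗[K] U) :
    lb ρ y (r • x) = ρ r • lb ρ y x := by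
  induction x with
  | zero => simp
  | tmul r u => simp [TensorProduct.smul_tmul', mul_smul]
  | add x y hx hy => rw [smul_add, map_add, map_add, hx, hy, smul_add]

theorem lb_sum {ι : Type*} (s : Finset ι) (ρ : A →ₐ[K] B) (y : ι → U →ₗ[K] N) :
    lb ρ (∑ i ∈ s, y i) = ∑ i ∈ s, lb ρ (y i) := by
  ext r u
  simp [Finset.smul_sum]

theorem lb_add (ρ : A →ₐ[K] B) (y y' : U →ₗ[K] N) : lb ρ (y + y') = lb ρ y + lb ρ y' := by
  ext r u
  simp

theorem lb_lb (ρ : A →ₐ[K] B) (y : U →ₗ[K] N) (s : W →ₗ[K] A ⊗[K] U) :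
    lb ρ (lb ρ y ∘ₗ s) = lb ρ y ∘ₗ lb (AlgHom.id K A) s := by
  ext r u
  simp [lb_smul]

theorem comp_lb {B' : Type*} [CommRing B'] [Algebra K B'] [AddCommGroup N'] [Module K N']
    [Module B' N'] [IsScalarTower K B' N'] (ρ : A →ₐ[K] B) (ρ' : A →ₐ[K] B') (g : N →ₗ[K] N')
    (hg : ∀ r m, g (ρ r • m) = ρ' r • g m) (y : U →ₗ[K] N) :
    g ∘ₗ lb ρ y = lb ρ' (g ∘ₗ y) := by
  ext r u
  simp [hg]

/-- The composition of `y` with `s`, where scalars are moved by `ρ`; power series in `t`. -/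
def bc (ρ : A →ₐ[K] B) (y : ℕ → U →ₗ[K] N) (s : ℕ → W →ₗ[K] A ⊗[K] U) : ℕ → W →ₗ[K] N :=
  tc (fun i => lb ρ (y i)) s

theorem bc_apply (ρ : A →ₐ[K] B) (y : ℕ → U →ₗ[K] N) (s : ℕ → W →ₗ[K] A ⊗[K] U) (k : ℕ) (u : W) :
    bc ρ y s k u = ∑ p ∈ Finset.HasAntidiagonal.antidiagonal k, lb ρ (y p.1) (s p.2 u) :=
  tc_apply _ _ _ _

theorem lb_tc {X : Type*} [AddCommGroup X] [Module K X] (ρ : A →ₐ[K] B) (f : ℕ → X →ₗ[K] N)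
    (g : ℕ → U →ₗ[K] X) (k : ℕ) :
    lb ρ (tc f g k) = ∑ p ∈ Finset.HasAntidiagonal.antidiagonal k, lb ρ (f p.1 ∘ₗ g p.2) :=
  lb_sum _ _ _

/-- The two scalar-producing maps can be composed inside $A$ before $\rho$ is applied. There
unitarity is available as an identity over one ring of functions. -/
theorem bc_bc {X : Type*} [AddCommGroup X] [Module K X] (ρ : A →ₐ[K] B) (y : ℕ → U →ₗ[K] N)
    (s : ℕ → W →ₗ[K] A ⊗[K] U) (s' : ℕ → X →ₗ[K] A ⊗[K] W) :
    bc ρ (bc ρ y s) s' = bc ρ y (bc (AlgHom.id K A) s s') := by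
  have : (fun i => lb ρ (bc ρ y s i))
      = tc (fun i => lb ρ (y i)) (fun i => lb (AlgHom.id K A) (s i)) := by
    funext k
    rw [bc, lb_tc, tc]
    exact Finset.sum_congr rfl fun p _ => lb_lb _ _ _
  rw [bc, this, tc_assoc]; rfl

theorem comp_bc {B' : Type*} [CommRing B'] [Algebra K B'] [AddCommGroup N'] [Module K N']
    [Module B' N'] [IsScalarTower K B' N'] (ρ : A →ₐ[K] B) (ρ' : A →ₐ[K] B') (g : N →ₗ[K] N')
    (hg : ∀ r m, g (ρ r • m) = ρ' r • g m) (y : ℕ → U →ₗ[K] N) (s : ℕ → W →ₗ[K] A ⊗[K] U) (k : ℕ) :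
    g ∘ₗ bc ρ y s k = bc ρ' (fun i => g ∘ₗ y i) s k := by
  rw [bc, comp_tc, bc]
  simp only [comp_lb ρ ρ' g hg]

/-- The map $s$ contributes only scalars and vectors, and `hg` says how $g$ passes the scalars; the
price is that $\rho$ is replaced by $\rho'$. -/
theorem tc_bc {B' : Type*} [CommRing B'] [Algebra K B'] [AddCommGroup N'] [Module K N']
    [Module B' N'] [IsScalarTower K B' N'] (ρ : A →ₐ[K] B) (ρ' : A →ₐ[K] B') (g : ℕ → N →ₗ[K] N')
    (hg : ∀ i r m, g i (ρ r • m) = ρ' r • g i m) (y : ℕ → U →ₗ[K] N) (s : ℕ → W →ₗ[K] A ⊗[K] U) :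
    tc g (bc ρ y s) = bc ρ' (tc g y) s := by
  rw [bc, ← tc_assoc, bc]
  congr 1
  funext k
  rw [lb_tc, tc]
  exact Finset.sum_congr rfl fun p _ => comp_lb ρ ρ' _ (hg _) _

theorem bc_one (ρ : A →ₐ[K] B) (y : ℕ → U →ₗ[K] N) :
    bc ρ y (fun k => if k = 0 then TensorProduct.mk K A U 1 else 0) = y := by
  rw [bc, tc_single]
  funext k
  ext u
  simp

theorem liftBaseChange_eq (y : U →ₗ[K] N) (x : B ⊗[K] U) :
    y.liftBaseChange B x = lb (AlgHom.id K B) y x := by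
  induction x with
  | zero => simp
  | tmul r u => simp
  | add x y hx hy => rw [map_add, map_add, hx, hy]

theorem lb_along (ρ : A →ₐ[K] B) (y : U →ₗ[K] N) (x : A ⊗[K] U) :
    lb (AlgHom.id K B) y (ρ.toLinearMap.rTensor U x) = lb ρ y x := by
  induction x with
  | zero => simp
  | tmul r u => simp
  | add x y hx hy => rw [map_add, map_add, map_add, hx, hy]

end BaseChange

/-! ### Maps acting on two of three tensor factors -/

section Legs
variable {𝕜 : Type*} [Field 𝕜] {A B : Type*} [CommRing A] [Algebra 𝕜 A] [CommRing B]
  [Algebra 𝕜 B] {U V N : Type*} [AddCommGroup U] [Module 𝕜 U] [AddCommGroup V] [Module 𝕜 V]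
  [AddCommGroup N] [Module 𝕜 N] [Module B N] [IsScalarTower 𝕜 B N]

theorem coeff_extend (s : ℕ → U →ₗ[𝕜] B ⊗[𝕜] U) (k : ℕ) (x : B ⊗[𝕜] U) :
    PowerSeries.coeff k (extend s) x = lb (AlgHom.id 𝕜 B) (s k) x := by
  rw [extend, PowerSeries.coeff_mk, liftBaseChange_eq]

theorem applySeries_extend_along (ρ : A →ₐ[𝕜] B) (y : ℕ → U →ₗ[𝕜] N) (s : ℕ → U →ₗ[𝕜] A ⊗[𝕜] U)
    (k : ℕ) (u : U) : applySeries y (extend (along ρ s)) k u = bc ρ y s k u := by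
  rw [applySeries, bc_apply]
  refine Finset.sum_congr rfl fun p _ => ?_
  rw [coeff_extend, liftBaseChange_eq, lb_tmul, map_one, one_smul, along, LinearMap.comp_apply,
    lb_along]

/-- Bridge from the product of operators in the hexagon to nested compositions. The right factor
acts on the vector first, so it is the outer `bc`. -/
theorem applySeries_extend_along_mul {A' : Type*} [CommRing A'] [Algebra 𝕜 A']
    (ρ : A →ₐ[𝕜] B) (ρ' : A' →ₐ[𝕜] B) (y : ℕ → U →ₗ[𝕜] N)
    (s : ℕ → U →ₗ[𝕜] A ⊗[𝕜] U) (s' : ℕ → U →ₗ[𝕜] A' ⊗[𝕜] U) (k : ℕ) (u : U) :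
    applySeries y (extend (along ρ s) * extend (along ρ' s')) k u
      = bc ρ' (bc ρ y s) s' k u := by
  rw [applySeries, bc_apply]
  simp only [PowerSeries.coeff_mul, LinearMap.sum_apply, Module.End.mul_apply, coeff_extend,
    lb_tmul, map_one, one_smul, along, LinearMap.comp_apply, liftBaseChange_eq, map_sum]
  rw [← sum_antidiagonal_assoc (fun i j l => lb (AlgHom.id 𝕜 B) (y i)
    (lb (AlgHom.id 𝕜 B) ((ρ.toLinearMap.rTensor U) ∘ₗ s j) (ρ'.toLinearMap.rTensor U (s' l u))))]
  refine Finset.sum_congr rfl fun p _ => ?_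
  rw [bc, lb_tc, LinearMap.sum_apply]
  refine Finset.sum_congr rfl fun q _ => ?_
  rw [← LinearMap.comp_apply (lb (AlgHom.id 𝕜 B) (y q.1)), ← lb_lb, lb_along]
  congr 2
  ext u
  exact lb_along _ _ _

/-- The action of `s` on two of the three factors. -/
def legMap (e : (V ⊗[𝕜] V) ⊗[𝕜] V ≃ₗ[𝕜] (V ⊗[𝕜] V) ⊗[𝕜] V)
    (s : V ⊗[𝕜] V →ₗ[𝕜] A ⊗[𝕜] (V ⊗[𝕜] V)) :
    (V ⊗[𝕜] V) ⊗[𝕜] V →ₗ[𝕜] A ⊗[𝕜] ((V ⊗[𝕜] V) ⊗[𝕜] V) :=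
  e.symm.toLinearMap.lTensor A ∘ₗ
    (TensorProduct.assoc 𝕜 A (V ⊗[𝕜] V) V).toLinearMap ∘ₗ s.rTensor V ∘ₗ e.toLinearMap

theorem leg_along (e : (V ⊗[𝕜] V) ⊗[𝕜] V ≃ₗ[𝕜] (V ⊗[𝕜] V) ⊗[𝕜] V) (ρ : A →ₐ[𝕜] B)
    (s : ℕ → V ⊗[𝕜] V →ₗ[𝕜] A ⊗[𝕜] (V ⊗[𝕜] V)) :
    leg e (along ρ s) = extend (along ρ fun k => legMap e (s k)) := by
  rw [leg]
  congr 1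
  funext k
  refine LinearMap.ext fun u => ?_
  simp only [along, legMap, LinearMap.comp_apply]
  generalize (e.toLinearMap u) = w
  induction w with
  | zero => simp
  | add x y hx hy => simp only [map_add, hx, hy]
  | tmul w c =>
    simp only [LinearMap.rTensor_tmul, LinearMap.comp_apply]
    generalize s k w = x
    induction x with
    | zero => simp
    | add x y hx hy => simp only [map_add, TensorProduct.add_tmul, hx, hy]
    | tmul r w => simp

/-- A leg leaves the remaining factor $c$ alone, so $c$ can be frozen and absorbed into $y$.
Questions about legs become questions about maps on two factors. -/
theorem lb_legMap_apply (e : (V ⊗[𝕜] V) ⊗[𝕜] V ≃ₗ[𝕜] (V ⊗[𝕜] V) ⊗[𝕜] V) (ρ : A →ₐ[𝕜] B)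
    (s : V ⊗[𝕜] V →ₗ[𝕜] A ⊗[𝕜] (V ⊗[𝕜] V)) (y : (V ⊗[𝕜] V) ⊗[𝕜] V →ₗ[𝕜] N) (w : V ⊗[𝕜] V) (c : V) :
    lb ρ y (legMap e s (e.symm (w ⊗ₜ c)))
      = lb ρ (y ∘ₗ e.symm.toLinearMap ∘ₗ (TensorProduct.mk 𝕜 (V ⊗[𝕜] V) V).flip c) (s w) := by
  simp only [legMap, LinearMap.comp_apply, LinearEquiv.coe_coe, LinearEquiv.apply_symm_apply,
    LinearMap.rTensor_tmul]
  generalize s w = x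
  induction x with
  | zero => simp
  | add x y hx hy => simp only [map_add, TensorProduct.add_tmul, hx, hy]
  | tmul r w => simp

/-- Legs on the same pair of factors compose like the maps themselves; this transfers unitarity to
every leg. -/
theorem legMap_lb (e : (V ⊗[𝕜] V) ⊗[𝕜] V ≃ₗ[𝕜] (V ⊗[𝕜] V) ⊗[𝕜] V)
    (s s' : V ⊗[𝕜] V →ₗ[𝕜] A ⊗[𝕜] (V ⊗[𝕜] V)) :
    lb (AlgHom.id 𝕜 A) (legMap e s) ∘ₗ legMap e s'
      = legMap e (lb (AlgHom.id 𝕜 A) s ∘ₗ s') := by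
  refine LinearMap.ext fun u => ?_
  obtain ⟨u, rfl⟩ := e.symm.surjective u
  rw [LinearMap.comp_apply]
  induction u with
  | zero => simp
  | add x y hx hy => simp only [map_add, hx, hy]
  | tmul w c =>
    rw [lb_legMap_apply]
    simp only [legMap, LinearMap.comp_apply, LinearEquiv.coe_coe, LinearEquiv.apply_symm_apply,
      LinearMap.rTensor_tmul]
    generalize s' w = x
    induction x with
    | zero => simp
    | add x y hx hy => simp only [map_add, TensorProduct.add_tmul, hx, hy]
    | tmul r w =>
      simp only [lb_tmul, LinearMap.comp_apply, LinearEquiv.coe_coe, LinearEquiv.apply_symm_apply,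
        LinearMap.rTensor_tmul, LinearMap.flip_apply, TensorProduct.mk_apply, AlgHom.id_apply]
      generalize s w = x
      induction x with
      | zero => simp
      | add x y hx hy => simp only [map_add, TensorProduct.add_tmul, smul_add, hx, hy]
      | tmul r w => simp [TensorProduct.smul_tmul']

theorem legMap_sum (e : (V ⊗[𝕜] V) ⊗[𝕜] V ≃ₗ[𝕜] (V ⊗[𝕜] V) ⊗[𝕜] V) {ι : Type*} (t : Finset ι)
    (s : ι → V ⊗[𝕜] V →ₗ[𝕜] A ⊗[𝕜] (V ⊗[𝕜] V)) :
    legMap e (∑ i ∈ t, s i) = ∑ i ∈ t, legMap e (s i) := by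
  refine LinearMap.ext fun u => ?_
  have h : (∑ i ∈ t, s i).rTensor V = ∑ i ∈ t, (s i).rTensor V :=
    map_sum (LinearMap.rTensorHom V) s t
  simp [legMap, h]

theorem bc_legMap (e : (V ⊗[𝕜] V) ⊗[𝕜] V ≃ₗ[𝕜] (V ⊗[𝕜] V) ⊗[𝕜] V)
    (s s' : ℕ → V ⊗[𝕜] V →ₗ[𝕜] A ⊗[𝕜] (V ⊗[𝕜] V)) :
    bc (AlgHom.id 𝕜 A) (fun i => legMap e (s i)) (fun i => legMap e (s' i))
      = fun k => legMap e (bc (AlgHom.id 𝕜 A) s s' k) := by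
  funext k
  simp only [bc, tc, legMap_lb, legMap_sum]

theorem legMap_one (e : (V ⊗[𝕜] V) ⊗[𝕜] V ≃ₗ[𝕜] (V ⊗[𝕜] V) ⊗[𝕜] V) :
    legMap e (TensorProduct.mk 𝕜 A (V ⊗[𝕜] V) 1) = TensorProduct.mk 𝕜 A _ 1 := by
  refine LinearMap.ext fun u => ?_
  obtain ⟨u, rfl⟩ := e.symm.surjective u
  induction u with
  | zero => simp
  | add x y hx hy => simp only [map_add, hx, hy]
  | tmul w c => simp [legMap]

/-- Read off from the values at $1\otimes u$, which determine the $A$-linear extensions. -/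
theorem bc_one_of_mul_eq_one {s s' : ℕ → U →ₗ[𝕜] A ⊗[𝕜] U} (h : extend s * extend s' = 1) :
    bc (AlgHom.id 𝕜 A) s s' = fun k => if k = 0 then TensorProduct.mk 𝕜 A U 1 else 0 := by
  funext k
  refine LinearMap.ext fun u => ?_
  have := congrArg (fun E : PowerSeries (Module.End A (A ⊗[𝕜] U)) => PowerSeries.coeff k E ((1 : A) ⊗ₜ[𝕜] u)) h
  simp only [PowerSeries.coeff_mul, LinearMap.sum_apply, Module.End.mul_apply, coeff_extend,
    lb_tmul, map_one, one_smul, PowerSeries.coeff_one] at this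
  rw [bc_apply, this]
  split_ifs <;> simp

/-- Precomposition with a leg of an invertible series is injective. -/
theorem bc_legMap_injective (e : (V ⊗[𝕜] V) ⊗[𝕜] V ≃ₗ[𝕜] (V ⊗[𝕜] V) ⊗[𝕜] V)
    {s s' : ℕ → V ⊗[𝕜] V →ₗ[𝕜] A ⊗[𝕜] (V ⊗[𝕜] V)} (h : extend s * extend s' = 1)
    (ρ : A →ₐ[𝕜] B) {y y' : ℕ → (V ⊗[𝕜] V) ⊗[𝕜] V →ₗ[𝕜] N}
    (hy : bc ρ y (fun i => legMap e (s i)) = bc ρ y' (fun i => legMap e (s i))) : y = y' := by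
  -- Since $s'$ is a right inverse of $s$, composing further with the leg of $s'$ recovers $y$.
  have key : ∀ y : ℕ → (V ⊗[𝕜] V) ⊗[𝕜] V →ₗ[𝕜] N,
      bc ρ (bc ρ y fun i => legMap e (s i)) (fun i => legMap e (s' i)) = y := by
    intro y
    have h1 : (fun k => legMap e ((fun k => if k = 0 then TensorProduct.mk 𝕜 A (V ⊗[𝕜] V) 1 else 0) k))
        = fun k : ℕ => if k = 0 then TensorProduct.mk 𝕜 A ((V ⊗[𝕜] V) ⊗[𝕜] V) 1 else 0 := by
      funext k
      dsimp only
      split_ifs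
      · exact legMap_one e
      · exact legMap_sum e ∅ fun _ : ℕ => 0
    rw [bc_bc, bc_legMap, bc_one_of_mul_eq_one h, h1, bc_one]
  rw [← key y, hy, key]

end Legs

/-! ### Composition of linear substitutions -/

section Subst
variable {n m l : ℕ} {K : Type*} [CommRing K] {W : Type*} [AddCommGroup W] [Module K W]

/-- The matrix of a composition of linear substitutions. -/
def matMul (M : Fin n → Fin m → K) (M' : Fin m → Fin l → K) : Fin n → Fin l → K :=
  fun i j => ∑ a, M i a * M' a j

theorem lin_X (M : Fin n → Fin m → K) (i : Fin n) :
    lin M (MvPolynomial.X i) = ∑ j, MvPolynomial.C (M i j) * MvPolynomial.X j := by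
  simp [lin]

theorem lin_comp (M : Fin n → Fin m → K) (M' : Fin m → Fin l → K) :
    (lin M').comp (lin M) = lin (matMul M M') := by
  ext1 i
  rw [AlgHom.comp_apply, lin_X, lin_X, map_sum]
  simp only [map_mul, lin_X, matMul, map_sum, Finset.sum_mul, Finset.mul_sum]
  have : ∀ r, lin M' (MvPolynomial.C r) = MvPolynomial.C r := fun r => (lin M').commutes r
  simp only [this]
  rw [Finset.sum_comm]
  refine Finset.sum_congr rfl fun j _ => Finset.sum_congr rfl fun a _ => ?_
  ring

/-- A linear substitution preserves the degree, so only monomials of the degree of $b$ contribute,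
and any finite set containing them will do. Double sums can then be exchanged. -/
theorem subst_eq_sum (M : Fin n → Fin m → K) (F : PS n W) (b : Fin m →₀ ℕ)
    (s : Finset (Fin n →₀ ℕ)) (hs : ∀ a, a.degree = b.degree → a ∈ s) :
    PS.subst M F b = ∑ a ∈ s, (linMon M a).coeff b • F a := by
  refine finsum_eq_sum_of_support_subset _ fun a ha => ?_
  apply hs
  by_contra hne
  apply ha
  have : (linMon M a).coeff b = 0 := (linMon_hom M a).coeff_eq_zero (fun h => hne h.symm)
  simp [this]

theorem subst_subst (M : Fin n → Fin m → K) (M' : Fin m → Fin l → K) (F : PS n W) :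
    PS.subst M' (PS.subst M F) = PS.subst (matMul M M') F := by
  funext c
  have hn := fun (a : Fin n →₀ ℕ) (h : a.degree = c.degree) => (finite_degree n c.degree).mem_toFinset.2 h
  have hm := fun (b : Fin m →₀ ℕ) (h : b.degree = c.degree) => (finite_degree m c.degree).mem_toFinset.2 h
  rw [subst_eq_sum M' _ c _ hm, subst_eq_sum _ F c _ hn]
  have h1 : ∀ b ∈ (finite_degree m c.degree).toFinset, (linMon M' b).coeff c • PS.subst M F b
      = ∑ a ∈ (finite_degree n c.degree).toFinset,
        ((linMon M' b).coeff c * (linMon M a).coeff b) • F a := by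
    intro b hb
    have hb' : b.degree = c.degree := (finite_degree m c.degree).mem_toFinset.1 hb
    rw [subst_eq_sum M F b _ fun a h => hn a (h.trans hb'), Finset.smul_sum]
    simp only [mul_smul]
  rw [Finset.sum_congr rfl h1, Finset.sum_comm]
  refine Finset.sum_congr rfl fun a ha => ?_
  have ha' : a.degree = c.degree := (finite_degree n c.degree).mem_toFinset.1 ha
  rw [← Finset.sum_smul]
  congr 1
  -- The image of $z^a$ under the composite is found by expanding its image under $M$ into
  -- monomials, which by homogeneity all have the degree of $c$.
  have h2 : linMon (matMul M M') a = ∑ b ∈ (finite_degree m c.degree).toFinset,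
      MvPolynomial.C ((linMon M a).coeff b) * linMon M' b := by
    rw [linMon, ← lin_comp, AlgHom.comp_apply]
    change lin M' (linMon M a) = _
    conv_lhs => rw [(linMon M a).as_sum, map_sum]
    rw [Finset.sum_subset (s₂ := (finite_degree m c.degree).toFinset)]
    · refine Finset.sum_congr rfl fun b _ => ?_
      generalize MvPolynomial.coeff b (linMon M a) = r
      rw [linMon, ← mul_one r, ← MvPolynomial.C_mul_monomial, map_mul, mul_one]
      congr 1
      exact (lin M').commutes _
    · intro b hb
      apply hm
      rw [← ha']
      by_contra hne
      exact (MvPolynomial.mem_support_iff.1 hb) ((linMon_hom M a).coeff_eq_zero hne)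
    · intro b _ hb
      rw [MvPolynomial.notMem_support_iff.1 hb, MvPolynomial.monomial_zero, map_zero]
  rw [h2, MvPolynomial.coeff_sum]
  refine Finset.sum_congr rfl fun b _ => ?_
  rw [MvPolynomial.coeff_C_mul, mul_comm]

theorem subst_eq_of_coeff (M : Fin n → Fin m → K) (F : PS n W) (b : Fin m →₀ ℕ)
    (a₀ : Fin n →₀ ℕ) (h : ∀ a, (linMon M a).coeff b = if a = a₀ then 1 else 0) :
    PS.subst M F b = F a₀ := by
  refine (finsum_eq_single _ a₀ fun a ha => ?_).trans ?_
  · simp [h, ha]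
  · simp [h]

theorem subst_eq_zero_of_coeff (M : Fin n → Fin m → K) (F : PS n W) (b : Fin m →₀ ℕ)
    (h : ∀ a, (linMon M a).coeff b = 0) : PS.subst M F b = 0 :=
  finsum_eq_zero_of_forall_eq_zero fun a => by simp [h]

theorem linMon_eq (M : Fin n → Fin m → K) (a : Fin n →₀ ℕ) :
    linMon M a = ∏ i, (∑ j, MvPolynomial.C (M i j) * MvPolynomial.X j) ^ (a i) := by
  rw [linMon, lin, MvPolynomial.aeval_monomial, map_one, one_mul,
    Finsupp.prod_fintype _ _ (fun i => by simp)]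

section
variable {D : Set (MvPolynomial (Fin n) K)} {D' : Set (MvPolynomial (Fin m) K)}
  (M : Fin n → Fin m → K) (h : Adm M D D')

theorem Sing.subst_mk_one (F : PS n W) :
    Sing.subst M h (LocalizedModule.mk F 1 : Sing D W) = LocalizedModule.mk (PS.subst M F) 1 :=
  locLiftLin_mk_one _ _ _ _ _

theorem Sing.subst_smul (p : MvPolynomial (Fin n) K) (x : Sing D W) :
    Sing.subst M h (p • x) = lin M p • Sing.subst M h x :=
  locLiftLin_smul _ _ _ _ _ _

theorem Rat.subst_algebraMap (p : MvPolynomial (Fin n) K) :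
    Rat.subst M h (algebraMap _ (Rat D) p) = algebraMap _ (Rat D') (lin M p) :=
  ratLift_algebraMap _ _ _ _

end

end Subst

/-! ### Iterated Laurent expansions in two and three variables -/

section Triple

theorem lau_smul_def {K : Type*} [CommRing K] {W : Type*} [AddCommGroup W] [Module K W] (c : K)
    (F : Lau K W) : (algebraMap K (LaurentSeries K) c) • F = c • F :=
  HahnModule.single_zero_smul_eq_smul ℤ

variable (K : Type*) [Field K] (V : Type*) [AddCommGroup V] [Module K V]

/-- `K((z_1))((z_2))((z_3))`. -/
abbrev L3Ring : Type _ := L2Ring (LaurentSeries K)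

/-- `V((z_1))((z_2))((z_3))`. -/
abbrev L3 : Type _ := L2 (LaurentSeries K) (Lau K V)

instance : Module K (L3 K V) := Module.compHom _ (algebraMap K (LaurentSeries K))

instance : IsScalarTower K (L3Ring K) (L3 K V) where
  smul_assoc c f F := by
    have h : c • f = algebraMap K (L3Ring K) c * f := Algebra.smul_def c f
    refine (congrArg (fun g : L3Ring K => g • F) h).trans ?_
    refine (mul_smul (algebraMap K (L3Ring K) c) f F).trans ?_
    exact lau_smul_def (algebraMap K (L2Ring K) c) (f • F)

variable {V}

theorem lau_coeff_add {K : Type*} [CommRing K] {W : Type*} [AddCommGroup W] [Module K W]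
    (F G : Lau K W) (n : ℤ) : (F + G).coeff n = F.coeff n + G.coeff n := rfl

theorem lau_coeff_smul {K : Type*} [CommRing K] {W : Type*} [AddCommGroup W] [Module K W]
    (c : K) (F : Lau K W) (n : ℤ) : (c • F).coeff n = c • F.coeff n := rfl

theorem L2_coeff_smul (c : K) (F : L2 K V) (n : ℤ) : (c • F).coeff n = c • F.coeff n := by
  rw [L2_smul_def, lau_coeff_smul, lau_smul_def]

theorem L3_coeff_smul (c : K) (F : L3 K V) (n : ℤ) : (c • F).coeff n = (c • F.coeff n : L2 K V) := by
  change Lau.coeff ((algebraMap K (LaurentSeries K) c) • F) n = _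
  rw [L2_coeff_smul, L2_smul_def]


/-- Such a polynomial is a unit of the ring of power series, and the inverse series acts on
$W[[z]]$. -/
theorem isUnit_end_ps {n : ℕ} {K : Type*} [CommRing K] {W : Type*} [AddCommGroup W] [Module K W]
    {p : MvPolynomial (Fin n) K} (h : IsUnit (MvPolynomial.constantCoeff p)) :
    IsUnit (algebraMap (MvPolynomial (Fin n) K)
      (Module.End (MvPolynomial (Fin n) K) (PS n W)) p) := by
  have hu : IsUnit (p : MvPowerSeries (Fin n) K) := by
    rw [MvPowerSeries.isUnit_iff_constantCoeff]
    exact h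
  obtain ⟨u, hu⟩ := hu
  have h1 : ∀ F : PS n W, p • (((u⁻¹ : (MvPowerSeries (Fin n) K)ˣ) : MvPowerSeries (Fin n) K) • F)
      = F := by
    intro F
    rw [poly_smul_eq, ← hu, ← mul_smul, Units.mul_inv, one_smul]
  have h2 : ∀ F : PS n W, ((u⁻¹ : (MvPowerSeries (Fin n) K)ˣ) : MvPowerSeries (Fin n) K) • (p • F)
      = F := by
    intro F
    rw [poly_smul_eq, ← hu, ← mul_smul, Units.inv_mul, one_smul]
  rw [Module.End.isUnit_iff, Function.bijective_iff_has_inverse]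
  exact ⟨_, h2, h1⟩

section Maps
variable {n m : ℕ} {K} (M : Fin n → Fin 2 → K) (D : Set (MvPolynomial (Fin n) K))

/-- Substitution followed by the expansion in the second variable, with values in
`V((z_1))[[z_2]]`. -/
def toP1 (h : ∀ d ∈ D, MvPolynomial.constantCoeff (peelRing 1 K (lin M d)) ≠ 0) :
    Sing D V →ₗ[K] PS 1 (Lau K V) :=
  letI : RingHomCompTriple (lin M).toRingHom (peelRing 1 K).toRingHom
    ((peelRing 1 K).comp (lin M)).toRingHom := ⟨rfl⟩
  locLiftLin D ((peelRing 1 K).comp (lin M)) ((peel (K := K) (W := V) 1).comp (PS.subst M))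
    fun d hd => isUnit_end_ps (h d hd).isUnit

/-- Substitution followed by the expansion in the region `|z_1| > |z_2|`. -/
def toL2 (h : ∀ d ∈ D, expandRing K (lin M d) ≠ 0) : Sing D V →ₗ[K] L2 K V :=
  letI : RingHomCompTriple (peelRing 1 K).toRingHom (flatRing (LaurentSeries K)).toRingHom
    (expandRing K).toRingHom := ⟨rfl⟩
  letI : RingHomCompTriple (lin M).toRingHom (expandRing K).toRingHom
    ((expandRing K).comp (lin M)).toRingHom := ⟨rfl⟩
  locLiftLin D ((expandRing K).comp (lin M))
    (((flat (K := LaurentSeries K) (W := Lau K V)).comp (peel (K := K) (W := V) 1)).comp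
      (PS.subst M)) fun d hd => isUnit_end (h d hd).isUnit

variable {M D}

theorem toP1_mk_one (h) (F : PS n V) :
    toP1 M D h (LocalizedModule.mk F 1) = peel 1 (PS.subst M F) :=
  locLiftLin_mk_one _ _ _ _ _

theorem toP1_smul (h) (p : MvPolynomial (Fin n) K) (x : Sing D V) :
    toP1 M D h (p • x) = peelRing 1 K (lin M p) • toP1 M D h x :=
  locLiftLin_smul _ _ _ _ _ _

theorem toL2_mk_one (h) (F : PS n V) :
    toL2 M D h (LocalizedModule.mk F 1) = flat (K := LaurentSeries K) (peel 1 (PS.subst M F)) :=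
  locLiftLin_mk_one _ _ _ _ _

theorem toL2_smul (h) (p : MvPolynomial (Fin n) K) (x : Sing D V) :
    toL2 M D h (p • x) = expandRing K (lin M p) • toL2 M D h x :=
  locLiftLin_smul _ _ _ _ _ _

theorem expand_mk_one {D : Set (MvPolynomial (Fin 2) K)} (h) (F : PS 2 V) :
    Sing.expand K D h (LocalizedModule.mk F 1) = flat (K := LaurentSeries K) (peel 1 F) :=
  locLiftLin_mk_one _ _ _ _ _

theorem expand_smul {D : Set (MvPolynomial (Fin 2) K)} (h) (p : MvPolynomial (Fin 2) K)
    (x : Sing D V) : Sing.expand K D h (p • x) = expandRing K p • Sing.expand K D h x :=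
  locLiftLin_smul _ _ _ _ _ _

theorem flat_smul {K : Type*} [CommRing K] {W : Type*} [AddCommGroup W] [Module K W]
    (p : MvPolynomial (Fin 1) K) (G : PS 1 W) : flat (K := K) (p • G) = flatRing K p • flat G :=
  (flat (K := K)).map_smulₛₗ p G

theorem toL2_eq_flat (h h') (x : Sing D V) :
    toL2 M D h x = flat (K := LaurentSeries K) (toP1 M D h' x) := by
  refine locLift_ext (φ := ((expandRing K).comp (lin M)).toRingHom)
    (fun d hd => isUnit_end (h d hd).isUnit) (toL2 M D h) (fun x => flat (toP1 M D h' x))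
    (toL2_smul h) (fun p x => ?_) (fun F => ?_) x
  · rw [toP1_smul, flat_smul]; rfl
  · rw [toL2_mk_one, toP1_mk_one]

theorem toL2_subst {l : ℕ} {D' : Set (MvPolynomial (Fin l) K)} {M' : Fin l → Fin n → K}
    (hM : Adm M' D' D) (h) (h' : ∀ d ∈ D', expandRing K (lin (matMul M' M) d) ≠ 0)
    (x : Sing D' V) : toL2 M D h (Sing.subst M' hM x) = toL2 (matMul M' M) D' h' x := by
  refine locLift_ext (φ := ((expandRing K).comp (lin (matMul M' M))).toRingHom)
    (fun d hd => isUnit_end (h' d hd).isUnit) (fun x => toL2 M D h (Sing.subst M' hM x))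
    (toL2 (matMul M' M) D' h') (fun p x => ?_) (toL2_smul h') (fun F => ?_) x
  · rw [Sing.subst_smul, toL2_smul, ← AlgHom.comp_apply (lin M), lin_comp]; rfl
  · rw [Sing.subst_mk_one, toL2_mk_one, toL2_mk_one, subst_subst]

theorem expand_subst {D' : Set (MvPolynomial (Fin 2) K)} (hM : Adm M D D') (h h')
    (x : Sing D V) : Sing.expand K D' h (Sing.subst M hM x) = toL2 M D h' x := by
  refine locLift_ext (φ := ((expandRing K).comp (lin M)).toRingHom)
    (fun d hd => isUnit_end (h' d hd).isUnit) (fun x => Sing.expand K D' h (Sing.subst M hM x))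
    (toL2 M D h') (fun p x => ?_) (toL2_smul h') (fun F => ?_) x
  · rw [Sing.subst_smul, expand_smul]; rfl
  · rw [Sing.subst_mk_one, expand_mk_one, toL2_mk_one]

theorem toP1_subst {l : ℕ} {D' : Set (MvPolynomial (Fin l) K)} {M' : Fin l → Fin n → K}
    (hM : Adm M' D' D) (h)
    (h' : ∀ d ∈ D', MvPolynomial.constantCoeff (peelRing 1 K (lin (matMul M' M) d)) ≠ 0)
    (x : Sing D' V) : toP1 M D h (Sing.subst M' hM x) = toP1 (matMul M' M) D' h' x := by
  refine locLift_ext (φ := ((peelRing 1 K).comp (lin (matMul M' M))).toRingHom)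
    (fun d hd => isUnit_end_ps (h' d hd).isUnit) (fun x => toP1 M D h (Sing.subst M' hM x))
    (toP1 (matMul M' M) D' h') (fun p x => ?_) (toP1_smul h') (fun F => ?_) x
  · rw [Sing.subst_smul, toP1_smul, ← AlgHom.comp_apply (lin M), lin_comp]; rfl
  · rw [Sing.subst_mk_one, toP1_mk_one, toP1_mk_one, subst_subst]

end Maps

section Maps3
variable {n : ℕ} {K} (M : Fin n → Fin 3 → K) (D : Set (MvPolynomial (Fin n) K))

variable (K) in
/-- `K[z_1, z_2, z_3] → K((z_1))((z_2))((z_3))`. -/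
def expandRing3 : MvPolynomial (Fin 3) K →ₐ[K] L3Ring K :=
  ((expandRing (LaurentSeries K)).restrictScalars K).comp (peelRing 2 K)

/-- The embedding `V[[z_1, z_2, z_3]] → V((z_1))((z_2))((z_3))`. -/
def peel3 : PS 3 V →ₛₗ[(expandRing3 K).toRingHom] L3 K V :=
  letI : RingHomCompTriple (peelRing 1 (LaurentSeries K)).toRingHom
    (flatRing (L2Ring K)).toRingHom (expandRing (LaurentSeries K)).toRingHom := ⟨rfl⟩
  letI : RingHomCompTriple (peelRing 2 K).toRingHom (expandRing (LaurentSeries K)).toRingHom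
    (expandRing3 K).toRingHom := ⟨rfl⟩
  ((flat (K := L2Ring K) (W := L2 K V)).comp
    (peel (K := LaurentSeries K) (W := Lau K V) 1)).comp (peel (K := K) (W := V) 2)

/-- Substitution followed by the expansion in the region `|z_1| > |z_2| > |z_3|`. -/
def toL3 (h : ∀ d ∈ D, expandRing3 K (lin M d) ≠ 0) : Sing D V →ₗ[K] L3 K V :=
  letI : RingHomCompTriple (lin M).toRingHom (expandRing3 K).toRingHom
    ((expandRing3 K).comp (lin M)).toRingHom := ⟨rfl⟩
  locLiftLin D ((expandRing3 K).comp (lin M)) (peel3.comp (PS.subst M))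
    fun d hd => isUnit_end (h d hd).isUnit

variable {M D}

theorem peel3_apply (F : PS 3 V) :
    peel3 F = flat (K := L2Ring K) (peel (K := LaurentSeries K) 1 (peel (K := K) 2 F)) := rfl

theorem toL3_mk_one (h) (F : PS n V) :
    toL3 M D h (LocalizedModule.mk F 1) = peel3 (PS.subst M F) :=
  locLiftLin_mk_one _ _ _ _ _

theorem toL3_smul (h) (p : MvPolynomial (Fin n) K) (x : Sing D V) :
    toL3 M D h (p • x) = expandRing3 K (lin M p) • toL3 M D h x :=
  locLiftLin_smul _ _ _ _ _ _

theorem toL3_subst {l : ℕ} {D' : Set (MvPolynomial (Fin l) K)} {M' : Fin l → Fin n → K}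
    (hM : Adm M' D' D) (h) (h' : ∀ d ∈ D', expandRing3 K (lin (matMul M' M) d) ≠ 0)
    (x : Sing D' V) : toL3 M D h (Sing.subst M' hM x) = toL3 (matMul M' M) D' h' x := by
  refine locLift_ext (φ := ((expandRing3 K).comp (lin (matMul M' M))).toRingHom)
    (fun d hd => isUnit_end (h' d hd).isUnit) (fun x => toL3 M D h (Sing.subst M' hM x))
    (toL3 (matMul M' M) D' h') (fun p x => ?_) (toL3_smul h') (fun F => ?_) x
  · rw [Sing.subst_smul, toL3_smul, ← AlgHom.comp_apply (lin M), lin_comp]; rfl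
  · rw [Sing.subst_mk_one, toL3_mk_one, toL3_mk_one, subst_subst]

end Maps3

end Triple

/-! ### Substituting variables or zero for the variables -/

section Rows
variable {n m : ℕ} {K : Type*} [CommRing K] {W : Type*} [AddCommGroup W] [Module K W]

/-- The matrix of a substitution of variables or zero for the variables. -/
def rowMat (K : Type*) [CommRing K] (σ : Fin n → Option (Fin m)) : Fin n → Fin m → K :=
  fun i j => if σ i = some j then 1 else 0

/-- Every row of the matrix is a variable or zero, so a monomial goes to one monomial with
coefficient $1$, or to zero if it contains a variable that is set to zero. -/
theorem coeff_linMon_rowMat (σ : Fin n → Option (Fin m)) (a : Fin n →₀ ℕ) (b : Fin m →₀ ℕ) :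
    (linMon (rowMat K σ) a).coeff b = if (∀ i, σ i = none → a i = 0) ∧
      ∀ j, ∑ i, (if σ i = some j then a i else 0) = b j then 1 else 0 := by
  classical
  rw [linMon_eq]
  have row : ∀ i, (∑ j, MvPolynomial.C (rowMat K σ i j) * (MvPolynomial.X j : MvPolynomial (Fin m) K))
      = (σ i).elim 0 MvPolynomial.X := by
    intro i
    cases h : σ i with
    | none => simp [rowMat, h]
    | some j => simp [rowMat, h]
  simp only [row]
  by_cases h : ∀ i, σ i = none → a i = 0
  · have fac : ∀ i, ((σ i).elim 0 MvPolynomial.X : MvPolynomial (Fin m) K) ^ a i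
        = MvPolynomial.monomial ((σ i).elim 0 fun j => Finsupp.single j (a i)) 1 := by
      intro i
      cases h' : σ i with
      | none => simp [h i h']
      | some j => simp [MvPolynomial.X_pow_eq_monomial]
    simp only [fac]
    have prod : ∀ s : Finset (Fin n), (∏ i ∈ s, MvPolynomial.monomial
        ((σ i).elim 0 fun j => Finsupp.single j (a i)) (1 : K))
        = MvPolynomial.monomial (∑ i ∈ s, (σ i).elim 0 fun j => Finsupp.single j (a i)) 1 := by
      intro s
      induction s using Finset.induction_on with
      | empty => simp
      | insert i s hi ih => rw [Finset.prod_insert hi, ih, MvPolynomial.monomial_mul,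
          Finset.sum_insert hi, one_mul]
    rw [prod, MvPolynomial.coeff_monomial]
    have e : (∑ i, (σ i).elim 0 fun j => Finsupp.single j (a i)) = b ↔
        ∀ j, ∑ i, (if σ i = some j then a i else 0) = b j := by
      rw [DFunLike.ext_iff]
      refine forall_congr' fun j => ?_
      rw [Finsupp.finsetSum_apply]
      have : ∀ i, ((σ i).elim 0 fun j => Finsupp.single j (a i) : Fin m →₀ ℕ) j
          = if σ i = some j then a i else 0 := by
        intro i
        cases σ i <;> simp [Finsupp.single_apply]
      simp only [this]
    exact if_congr (e.trans (and_iff_right h).symm) rfl rfl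
  · rw [if_neg fun h' => h h'.1]
    push Not at h
    obtain ⟨i, hi, hai⟩ := h
    rw [Finset.prod_eq_zero (Finset.mem_univ i)]
    · simp
    · simp [hi, hai]

theorem subst_rowMat (σ : Fin n → Option (Fin m)) (F : PS n W) (b : Fin m →₀ ℕ) (a₀ : Fin n →₀ ℕ)
    (h : ∀ a : Fin n →₀ ℕ, ((∀ i, σ i = none → a i = 0) ∧
      ∀ j, ∑ i, (if σ i = some j then a i else 0) = b j) ↔ a = a₀) :
    PS.subst (rowMat K σ) F b = F a₀ := by
  classical
  refine subst_eq_of_coeff _ _ _ _ fun a => ?_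
  rw [coeff_linMon_rowMat]
  exact if_congr (h a) rfl rfl

theorem subst_rowMat_zero (σ : Fin n → Option (Fin m)) (F : PS n W) (b : Fin m →₀ ℕ)
    (h : ∀ a : Fin n →₀ ℕ, ¬((∀ i, σ i = none → a i = 0) ∧
      ∀ j, ∑ i, (if σ i = some j then a i else 0) = b j)) :
    PS.subst (rowMat K σ) F b = 0 :=
  subst_eq_zero_of_coeff _ _ _ fun a => by rw [coeff_linMon_rowMat, if_neg (h a)]

theorem idMat2 : (![![1, 0], ![0, 1]] : Fin 2 → Fin 2 → K) = rowMat K ![some 0, some 1] := by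
  ext i j; fin_cases i <;> fin_cases j <;> simp [rowMat]

theorem subst_id2 (F : PS 2 W) : PS.subst (![![1, 0], ![0, 1]] : Fin 2 → Fin 2 → K) F = F := by
  funext b
  rw [idMat2]
  refine subst_rowMat _ _ _ _ fun a => ?_
  simp [Fin.forall_fin_succ, Fin.sum_univ_succ, DFunLike.ext_iff]

theorem subst_evalSnd (F : PS 2 W) (n : ℕ) :
    PS.subst (![![1], ![0]] : Fin 2 → Fin 1 → K) F (Finsupp.single 0 n) = F (Finsupp.cons n 0) := by
  have : (![![1], ![0]] : Fin 2 → Fin 1 → K) = rowMat K ![some 0, none] := by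
    ext i j; fin_cases i <;> fin_cases j <;> simp [rowMat]
  rw [this]
  refine subst_rowMat _ _ _ _ fun a => ?_
  simp [Fin.forall_fin_succ, Fin.sum_univ_succ, DFunLike.ext_iff, and_comm]

theorem idMat3 : (![![1, 0, 0], ![0, 1, 0], ![0, 0, 1]] : Fin 3 → Fin 3 → K)
    = rowMat K ![some 0, some 1, some 2] := by
  ext i j; fin_cases i <;> fin_cases j <;> simp [rowMat]

theorem subst_id3 (F : PS 3 W) :
    PS.subst (![![1, 0, 0], ![0, 1, 0], ![0, 0, 1]] : Fin 3 → Fin 3 → K) F = F := by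
  funext b
  rw [idMat3]
  refine subst_rowMat _ _ _ _ fun a => ?_
  simp [Fin.forall_fin_succ, Fin.sum_univ_succ, DFunLike.ext_iff]

theorem subst_evalThd (F : PS 3 W) (i j : ℕ) :
    PS.subst (![![1, 0], ![0, 1], ![0, 0]] : Fin 3 → Fin 2 → K) F
      (Finsupp.cons i (Finsupp.single 0 j)) = F (Finsupp.cons i (Finsupp.cons j 0)) := by
  have : (![![1, 0], ![0, 1], ![0, 0]] : Fin 3 → Fin 2 → K) = rowMat K ![some 0, some 1, none] := by
    ext i j; fin_cases i <;> fin_cases j <;> simp [rowMat]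
  rw [this]
  refine subst_rowMat _ _ _ _ fun a => ?_
  simp [Fin.forall_fin_succ, Fin.sum_univ_succ, DFunLike.ext_iff, and_comm, and_assoc]
  omega

end Rows

/-! ### The expansion of $X_{z_1,z_2}$ in $V((z_1))[[z_2]]$ -/

section Expand
variable {K : Type*} [Field K] {V : Type*} [AddCommGroup V] [Module K V]

theorem T_ne_zero (K : Type*) [Field K] : Lau.T K ≠ 0 :=
  HahnSeries.single_ne_zero one_ne_zero

theorem peelRing_X_zero (n : ℕ) : peelRing n K (MvPolynomial.X 0) = MvPolynomial.C (Lau.T K) := by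
  rw [peelRing, MvPolynomial.aeval_X]; rfl

theorem peelRing_X_succ (n : ℕ) (i : Fin n) :
    peelRing n K (MvPolynomial.X i.succ) = MvPolynomial.X i := by
  rw [peelRing, MvPolynomial.aeval_X]; rfl

theorem constantCoeff_peelRing_X0 :
    MvPolynomial.constantCoeff (peelRing 1 K (MvPolynomial.X 0)) = Lau.T K := by
  rw [peelRing_X_zero, MvPolynomial.constantCoeff_C]

theorem constantCoeff_peelRing_X1 :
    MvPolynomial.constantCoeff (peelRing 1 K (MvPolynomial.X 1)) = 0 := by
  rw [show (1 : Fin 2) = Fin.succ 0 from rfl, peelRing_X_succ, MvPolynomial.constantCoeff_X]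

theorem evX_unit : ∀ d ∈ polesX K, MvPolynomial.constantCoeff
    (peelRing 1 K (lin (![![1, 0], ![0, 1]] : Fin 2 → Fin 2 → K) d)) ≠ 0 := by
  intro d hd
  simp only [polesX, Set.mem_insert_iff, Set.mem_singleton_iff] at hd
  rcases hd with rfl | rfl <;>
  simp [lin_X, Fin.sum_univ_succ, constantCoeff_peelRing_X0, constantCoeff_peelRing_X1, T_ne_zero]

/-- The expansion of `V[[z_1, z_2]][z_1⁻¹, (z_1 - z_2)⁻¹]` in `V((z_1))[[z_2]]`. -/
def evX : Sing (polesX K) V →ₗ[K] PS 1 (Lau K V) := toP1 ![![1, 0], ![0, 1]] (polesX K) evX_unit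

theorem evX_mk_one (F : PS 2 V) :
    evX (LocalizedModule.mk F 1 : Sing (polesX K) V) = peel (K := K) 1 F := by
  rw [evX, toP1_mk_one, subst_id2]

theorem lin_id2 (p : MvPolynomial (Fin 2) K) : lin (![![1, 0], ![0, 1]] : Fin 2 → Fin 2 → K) p = p := by
  have : lin (![![1, 0], ![0, 1]] : Fin 2 → Fin 2 → K) = AlgHom.id K _ := by
    ext1 i
    fin_cases i <;> simp [lin_X]
  rw [this]; rfl

theorem evX_smul (p : MvPolynomial (Fin 2) K) (x : Sing (polesX K) V) :
    evX (p • x) = peelRing 1 K p • evX x := by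
  rw [evX, toP1_smul, lin_id2]

theorem expand_eq_flat (h) (x : Sing (polesX K) V) :
    Sing.expand K (polesX K) h x = flat (K := LaurentSeries K) (evX x) := by
  refine locLift_ext (φ := (expandRing K).toRingHom)
    (fun d hd => isUnit_end (h d hd).isUnit) (Sing.expand K (polesX K) h) (fun x => flat (evX x))
    (expand_smul h) (fun p x => ?_) (fun F => ?_) x
  · rw [evX_smul, flat_smul]; rfl
  · rw [expand_mk_one, evX_mk_one]

theorem ps_smul_zero {n : ℕ} {A N : Type*} [CommRing A] [AddCommGroup N] [Module A N]
    (p : MvPolynomial (Fin n) A) (G : PS n N) :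
    (p • G) 0 = MvPolynomial.constantCoeff p • G 0 := by
  rw [poly_smul_eq, ps_smul_apply]
  simp
  rfl

theorem lau_zero_eq_single : (0 : Fin 1 →₀ ℕ) = Finsupp.single 0 0 := by simp

theorem singFlat_mk_one (F : PS 1 V) :
    Sing.flat (LocalizedModule.mk F 1 : Sing (poles1 K) V) = flat (K := K) F :=
  locLiftLin_mk_one _ _ _ _ _

theorem singFlat_smul (p : MvPolynomial (Fin 1) K) (x : Sing (poles1 K) V) :
    Sing.flat (p • x) = flatRing K p • Sing.flat x :=
  locLiftLin_smul _ _ _ _ _ _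

/-- Both sides are semilinear along $p\mapsto p(z,0)$, under which both poles $z_1$ and $z_1-z_2$
become the unit $z$. It identifies the constant term in $z_2$ with the vertex operator. -/
theorem evX_zero (x : Sing (polesX K) V) :
    evX x 0 = Sing.flat (Sing.subst ![![1], ![0]] (adm_eval K) x) := by
  have hφ : (MvPolynomial.constantCoeff).comp (peelRing 1 K).toRingHom
      = ((flatRing K).comp (lin (![![1], ![0]] : Fin 2 → Fin 1 → K))).toRingHom := by
    refine MvPolynomial.ringHom_ext (fun r => ?_) (fun i => ?_)
    · have h1 : peelRing 1 K (MvPolynomial.C r) = MvPolynomial.C (algebraMap K _ r) :=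
        (peelRing 1 K).commutes r
      have h2 := ((flatRing K).comp (lin (![![1], ![0]] : Fin 2 → Fin 1 → K))).commutes r
      simp only [MvPolynomial.algebraMap_eq] at h2
      simp [h1, h2]
    · fin_cases i
      · simp [constantCoeff_peelRing_X0, lin_X, flatRing]
      · simp [constantCoeff_peelRing_X1, lin_X, flatRing]
  refine locLift_ext (φ := MvPolynomial.constantCoeff.comp (peelRing 1 K).toRingHom)
    (fun d hd => isUnit_end (N := Lau K V) (by
      have := (evX_unit d hd).isUnit
      rwa [lin_id2] at this))
    (fun x => evX x 0) (fun x => Sing.flat (Sing.subst ![![1], ![0]] (adm_eval K) x))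
    (fun p x => ?_) (fun p x => ?_) (fun F => ?_) x
  · rw [evX_smul, ps_smul_zero]; rfl
  · rw [Sing.subst_smul, singFlat_smul, hφ]; rfl
  · rw [evX_mk_one, Sing.subst_mk_one, singFlat_mk_one]
    refine Lau.ext fun k => ?_
    change Lau.coeff (peelFun K F 0) k = Lau.coeff (flatFun K _) k
    rw [peelFun_coeff, flatFun_coeff, subst_evalSnd]

end Expand

section Semilinear

theorem mvPolynomial_smul_of_C_of_X {K A A' N N' σ : Type*} [CommSemiring K] [Semiring A]
    [Semiring A'] [AddCommMonoid N] [Module A N] [AddCommMonoid N'] [Module A' N']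
    (φ : MvPolynomial σ K →+* A) (φ' : MvPolynomial σ K →+* A') (g : N →+ N')
    (hC : ∀ r m, g (φ (MvPolynomial.C r) • m) = φ' (MvPolynomial.C r) • g m)
    (hX : ∀ i m, g (φ (MvPolynomial.X i) • m) = φ' (MvPolynomial.X i) • g m) (p) :
    ∀ m, g (φ p • m) = φ' p • g m := by
  induction p using MvPolynomial.induction_on with
  | C k => exact hC k
  | add p q hp hq => intro m; rw [map_add, map_add, add_smul, add_smul, map_add, hp, hq]
  | mul_X p i hp => intro m; rw [map_mul, map_mul, mul_smul, mul_smul, hp, hX]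

end Semilinear

section SingMap
variable {n : ℕ} {k K : Type*} [CommRing k] [CommRing K] [Algebra k K] {V W : Type*}
  [AddCommGroup V] [Module k V] [AddCommGroup W] [Module K W] [Module k W] [IsScalarTower k K W]
  {D : Set (MvPolynomial (Fin n) k)} {D' : Set (MvPolynomial (Fin n) K)}

theorem singMap_mk_one (h) (f : V →ₗ[k] W) (F : PS n V) :
    singMap (D := D) (D' := D') h f (LocalizedModule.mk F 1)
      = LocalizedModule.mk (PS.map (K := K) f F) 1 :=
  locLiftLin_mk_one _ _ _ _ _

theorem singMap_smul (h) (f : V →ₗ[k] W) (p : MvPolynomial (Fin n) k) (x : Sing D V) :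
    singMap (D := D) (D' := D') h f (p • x)
      = MvPolynomial.mapAlgHom (Algebra.ofId k K) p • singMap (D' := D') h f x :=
  locLiftLin_smul _ _ _ _ _ _

end SingMap

/-! ### The expansion of triple products for $|z_1|>|z_2|>|z_3|$ -/

section Triple
variable {K : Type*} [Field K] {V : Type*} [AddCommGroup V] [Module K V]

theorem lauMap_T_smul (f : V →ₗ[K] Lau K V) (F : Lau K V) :
    Lau.map f (Lau.T K • F) = Lau.T (LaurentSeries K) • Lau.map f F := by
  refine Lau.ext fun n => ?_
  rw [Lau.coeff_T_smul, Lau.coeff_map, Lau.coeff_map, Lau.coeff_T_smul]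

variable (K) in
/-- `K[z_2, z_3] → K((z_1))((z_2))[z_3]`. -/
def evXMapRing : MvPolynomial (Fin 2) K →ₐ[K] MvPolynomial (Fin 1) (L2Ring K) :=
  ((peelRing 1 (LaurentSeries K)).restrictScalars K).comp
    (MvPolynomial.mapAlgHom (Algebra.ofId K (LaurentSeries K)))

theorem mapAlgHom_X {k K σ : Type*} [CommRing k] [CommRing K] [Algebra k K] (i : σ) :
    MvPolynomial.mapAlgHom (Algebra.ofId k K) (MvPolynomial.X i) = MvPolynomial.X i := by
  simp

theorem evXMapRing_X0 :
    evXMapRing K (MvPolynomial.X 0) = MvPolynomial.C (Lau.T (LaurentSeries K)) := by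
  rw [evXMapRing, AlgHom.comp_apply, mapAlgHom_X]
  exact peelRing_X_zero 1

theorem evXMapRing_X1 : evXMapRing K (MvPolynomial.X 1) = MvPolynomial.X 0 := by
  rw [evXMapRing, AlgHom.comp_apply, mapAlgHom_X]
  exact peelRing_X_succ 1 0

/-- The coefficientwise application of `f` to `V((z_1))[[z_2]]`. -/
def psLauMap (f : V →ₗ[K] Lau K V) : PS 1 (Lau K V) →+ PS 1 (L2 K V) where
  toFun G m := Lau.map f (G m)
  map_zero' := funext fun _ => map_zero (Lau.map f)
  map_add' G H := funext fun m => map_add (Lau.map f) (G m) (H m)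

theorem psLauMap_apply (f : V →ₗ[K] Lau K V) (G : PS 1 (Lau K V)) (m) :
    psLauMap f G m = Lau.map f (G m) := rfl

theorem psLauMap_smul (f : V →ₗ[K] Lau K V) (p : MvPolynomial (Fin 2) K) (G : PS 1 (Lau K V)) :
    psLauMap f (peelRing 1 K p • G) = evXMapRing K p • psLauMap f G := by
  refine mvPolynomial_smul_of_C_of_X (peelRing 1 K).toRingHom (evXMapRing K).toRingHom (psLauMap f)
    (fun r G => ?_) (fun i G => ?_) p G
  · have h1 : (peelRing 1 K).toRingHom (MvPolynomial.C r) = MvPolynomial.C (algebraMap K _ r) :=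
      (peelRing 1 K).commutes r
    have h2 : (evXMapRing K).toRingHom (MvPolynomial.C r)
        = MvPolynomial.C (algebraMap K (L2Ring K) r) := (evXMapRing K).commutes r
    rw [h1, h2]
    funext m
    rw [C_smul_apply, psLauMap_apply, psLauMap_apply, C_smul_apply, lau_smul_def, map_smul,
      algebraMap_smul]
  · funext m
    fin_cases i
    · have h1 : (peelRing 1 K).toRingHom (MvPolynomial.X 0) = MvPolynomial.C (Lau.T K) :=
        peelRing_X_zero 1
      have h2 : (evXMapRing K).toRingHom (MvPolynomial.X 0)
        = MvPolynomial.C (Lau.T (LaurentSeries K)) := evXMapRing_X0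
      simp only [Fin.zero_eta]
      rw [h1, h2, C_smul_apply, psLauMap_apply, psLauMap_apply, C_smul_apply, lauMap_T_smul]
    · have h1 : (peelRing 1 K).toRingHom (MvPolynomial.X 1) = MvPolynomial.X 0 :=
        peelRing_X_succ 1 0
      have h2 : (evXMapRing K).toRingHom (MvPolynomial.X 1) = MvPolynomial.X 0 := evXMapRing_X1
      simp only [Fin.mk_one]
      rw [h1, h2, psLauMap_apply, X_smul_apply, X_smul_apply]
      by_cases h : m 0 = 0
      · rw [if_pos h, if_pos h, map_zero]
      · rw [if_neg h, if_neg h, psLauMap_apply]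

theorem evXMapRing_unit : ∀ d ∈ polesX K, MvPolynomial.constantCoeff (evXMapRing K d) ≠ 0 := by
  intro d hd
  simp only [polesX, Set.mem_insert_iff, Set.mem_singleton_iff] at hd
  rcases hd with rfl | rfl
  · rw [evXMapRing_X0, MvPolynomial.constantCoeff_C]
    exact T_ne_zero _
  · rw [map_sub, evXMapRing_X0, evXMapRing_X1, map_sub, MvPolynomial.constantCoeff_C,
      MvPolynomial.constantCoeff_X, sub_zero]
    exact T_ne_zero _

/-- Applying $f$ to coefficients does not touch $z_2$ and $z_3$, so it commutes with expanding in
them. For $f=Y(a,z_1)$ this computes $X_{z_1,0}(1\otimes X_{z_2,z_3})$ in powers of $z_3$. -/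
theorem evX_singMap (f : V →ₗ[K] Lau K V) (x : Sing (polesX K) V) :
    evX (singMap (D' := polesX (LaurentSeries K)) (adm_const K) f x) = psLauMap f (evX x) := by
  refine locLift_ext (R' := MvPolynomial (Fin 1) (L2Ring K)) (φ := (evXMapRing K).toRingHom)
    (fun d hd => isUnit_end_ps (evXMapRing_unit d hd).isUnit)
    (fun x => evX (singMap (D' := polesX (LaurentSeries K)) (adm_const K) f x))
    (fun x => psLauMap f (evX x)) (fun p x => ?_) (fun p x => ?_) (fun F => ?_) x
  · rw [singMap_smul, evX_smul]; rfl
  · rw [evX_smul, psLauMap_smul]; rfl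
  · rw [singMap_mk_one, evX_mk_one, evX_mk_one]
    funext m
    refine Lau.ext fun n => ?_
    change Lau.coeff (peelFun (LaurentSeries K) _ m) n = Lau.coeff (Lau.map f (peelFun K F m)) n
    rw [Lau.coeff_map, peelFun_coeff, peelFun_coeff, apply_ite f, map_zero]
    rfl

theorem expand3_mk_one (F : PS 3 V) :
    Sing.expand3 (LocalizedModule.mk F 1 : Sing (poles3 K) V)
      = LocalizedModule.mk (peel (K := K) 2 F) 1 :=
  locLiftLin_mk_one _ _ _ _ _

theorem expand3_smul (p : MvPolynomial (Fin 3) K) (x : Sing (poles3 K) V) :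
    Sing.expand3 (p • x) = peelRing 2 K p • Sing.expand3 x :=
  locLiftLin_smul _ _ _ _ _ _

/-- The expansion in the region `|z_1| > |z_2| > |z_3|`, as a power series in `z_3`. -/
def evT : Sing (poles3 K) V →ₗ[K] PS 1 (L2 K V) where
  toFun x := evX (Sing.expand3 x)
  map_add' x y := by rw [map_add, map_add]
  map_smul' c x := by
    have h : peelRing 1 (LaurentSeries K) (algebraMap K (MvPolynomial (Fin 2) (LaurentSeries K)) c)
        = algebraMap K (MvPolynomial (Fin 1) (L2Ring K)) c :=
      ((peelRing 1 (LaurentSeries K)).restrictScalars K).commutes c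
    rw [map_smul, ← algebraMap_smul (MvPolynomial (Fin 2) (LaurentSeries K)) c (Sing.expand3 x),
      evX_smul, h, algebraMap_smul, RingHom.id_apply]

theorem evT_apply (x : Sing (poles3 K) V) : evT x = evX (Sing.expand3 x) := rfl

variable (K) in
/-- `K[z_1, z_2, z_3] → K((z_1))((z_2))[z_3]`. -/
def evTRing : MvPolynomial (Fin 3) K →ₐ[K] MvPolynomial (Fin 1) (L2Ring K) :=
  ((peelRing 1 (LaurentSeries K)).restrictScalars K).comp (peelRing 2 K)

theorem evT_smul (p : MvPolynomial (Fin 3) K) (x : Sing (poles3 K) V) :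
    evT (p • x) = evTRing K p • evT x := by
  rw [evT_apply, expand3_smul, evX_smul]; rfl

theorem evT_mk_one (F : PS 3 V) :
    evT (LocalizedModule.mk F 1 : Sing (poles3 K) V)
      = peel (K := LaurentSeries K) 1 (peel (K := K) 2 F) := by
  rw [evT_apply, expand3_mk_one, evX_mk_one]

theorem coeff_evT_mk_one (F : PS 3 V) (n : ℕ) (j i : ℤ) :
    Lau.coeff (Lau.coeff (evT (LocalizedModule.mk F 1 : Sing (poles3 K) V) (Finsupp.single 0 n)) j) i
      = if 0 ≤ j ∧ 0 ≤ i then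
        F (Finsupp.cons i.toNat (Finsupp.cons j.toNat (Finsupp.single 0 n))) else 0 := by
  rw [evT_mk_one]
  change Lau.coeff (Lau.coeff (peelFun (LaurentSeries K) (peelFun K F) _) j) i = _
  rw [peelFun_coeff]
  by_cases hj : 0 ≤ j
  · rw [if_pos hj, peelFun_coeff]
    simp [hj]
  · rw [if_neg hj, if_neg fun h => hj h.1]; rfl

theorem evTRing_X0 : evTRing K (MvPolynomial.X 0) = MvPolynomial.C (L2Ring.x K) := by
  rw [evTRing, AlgHom.comp_apply, peelRing_X_zero]
  exact (peelRing 1 (LaurentSeries K)).commutes _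

theorem evTRing_X1 : evTRing K (MvPolynomial.X 1) = MvPolynomial.C (L2Ring.y K) := by
  rw [evTRing, AlgHom.comp_apply, show (1 : Fin 3) = Fin.succ 0 from rfl, peelRing_X_succ]
  exact peelRing_X_zero 1

theorem evTRing_X2 : evTRing K (MvPolynomial.X 2) = MvPolynomial.X 0 := by
  rw [evTRing, AlgHom.comp_apply, show (2 : Fin 3) = Fin.succ 1 from rfl, peelRing_X_succ]
  exact peelRing_X_succ 1 0

/-- At $z_3=0$ the five denominators become $x$, $y$, $x-y$, $x$, $y$, so the expansion has no
negative powers of $z_3$. -/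
theorem evT_unit : ∀ d ∈ poles3 K, MvPolynomial.constantCoeff (evTRing K d) ≠ 0 := by
  intro d hd
  simp only [poles3, Set.mem_insert_iff, Set.mem_singleton_iff] at hd
  rcases hd with rfl | rfl | rfl | rfl | rfl <;>
  simp [evTRing_X0, evTRing_X1, evTRing_X2, x_ne_zero, y_ne_zero, x_sub_y_ne_zero]

theorem ext_cons {V : Type*} (F G : PS 3 V) (h : ∀ i j n : ℕ, F (Finsupp.cons i (Finsupp.cons j (Finsupp.single 0 n)))
    = G (Finsupp.cons i (Finsupp.cons j (Finsupp.single 0 n)))) : F = G := by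
  funext m
  have : m = Finsupp.cons (m 0) (Finsupp.cons (m 1) (Finsupp.single 0 (m 2))) := by
    ext a
    fin_cases a
    · rfl
    · rfl
    · simp only [show (⟨2, by omega⟩ : Fin 3) = Fin.succ (Fin.succ 0) from rfl, Finsupp.cons_succ, Finsupp.single_eq_same]
      rfl
  rw [this, h]

theorem evT_mk_one_injective {F G : PS 3 V}
    (h : evT (LocalizedModule.mk F 1 : Sing (poles3 K) V) = evT (LocalizedModule.mk G 1)) : F = G := by
  refine ext_cons _ _ fun i j n => ?_
  have := congrArg (fun H : PS 1 (L2 K V) => Lau.coeff (Lau.coeff (H (Finsupp.single 0 n)) j) i) h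
  simpa [coeff_evT_mk_one] using this

/-- Clearing the denominator leaves a power series in three variables, whose coefficients can be
read off its expansion. The uniqueness of the triple product rests on this. -/
theorem evT_injective : Function.Injective (evT : Sing (poles3 K) V →ₗ[K] PS 1 (L2 K V)) := by
  rw [injective_iff_map_eq_zero]
  intro x hx
  induction x using LocalizedModule.induction_on with
  | _ F s =>
    have h1 : (s : MvPolynomial (Fin 3) K) • (LocalizedModule.mk F s : Sing (poles3 K) V)
        = LocalizedModule.mk F 1 := by
      rw [LocalizedModule.smul'_mk]
      exact LocalizedModule.mk_cancel s F
    have h2 : evT (LocalizedModule.mk F 1 : Sing (poles3 K) V)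
        = evT (LocalizedModule.mk (0 : PS 3 V) 1) := by
      rw [← h1, evT_smul, hx, smul_zero, LocalizedModule.zero_mk, map_zero]
    rw [evT_mk_one_injective h2, LocalizedModule.zero_mk]

end Triple

/-! ### Consequences of $H_D$-covariance -/

section Algebra
variable {K : Type*} [Field K] {V : Type*} [AddCommGroup V] [Module K V]
  (Q : HDQuantumVertexAlgebra K V)

theorem evX_X_zero (k : ℕ) (u : V ⊗[K] V) : evX (Q.X k u) 0 = Q.Y k u := evX_zero _

theorem flat_coeff_nat {A N : Type*} [CommRing A] [AddCommGroup N] [Module A N] (G : PS 1 N) (n : ℕ) :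
    Lau.coeff (flat (K := A) G) n = G (Finsupp.single 0 n) := by
  change Lau.coeff (flatFun A G) n = _
  rw [flatFun_coeff]; simp

theorem evX_X_D (k : ℕ) (a b : V) (n : ℕ) :
    evX (Q.X k (a ⊗ₜ Q.D b)) (Finsupp.single 0 n)
      = (n + 1 : K) • evX (Q.X k (a ⊗ₜ b)) (Finsupp.single 0 (n + 1)) := by
  have h := Q.X_D k a b n
  rw [expand_eq_flat, expand_eq_flat, flat_coeff_nat] at h
  have h2 := flat_coeff_nat (A := LaurentSeries K) (evX (Q.X k (a ⊗ₜ b))) (n + 1)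
  push_cast at h2
  rw [h2] at h
  rw [h, ← Int.cast_smul_eq_zsmul K]
  push_cast
  rfl

/-- Each derivative in $z_2$ costs one $D$, so the expansion is the Taylor series of
$Y(a,z_1)e^{z_2D}b$. Characteristic zero is needed to divide by $n!$. -/
theorem evX_X [CharZero K] (k : ℕ) (a b : V) (n : ℕ) :
    evX (Q.X k (a ⊗ₜ b)) (Finsupp.single 0 n)
      = (n.factorial : K)⁻¹ • Q.Y k (a ⊗ₜ (Q.D ^ n) b) := by
  induction n generalizing b with
  | zero =>
    rw [← lau_zero_eq_single, evX_X_zero]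
    simp
  | succ n ih =>
    have h := evX_X_D Q k a b n
    rw [ih] at h
    have hn : (n + 1 : K) ≠ 0 := by exact_mod_cast Nat.succ_ne_zero n
    rw [pow_succ, Module.End.mul_apply, Nat.factorial_succ]
    push_cast
    rw [mul_inv, mul_smul, h, smul_smul, inv_mul_cancel₀ hn, one_smul]

/-- The right-hand side `X_{z_1,0}(1 ⊗ X_{z_2,z_3})` of the definition of the triple product. -/
def tripleRhs (k : ℕ) (a b c : V) : Sing (polesX (LaurentSeries K)) (Lau K V) :=
  ∑ p ∈ Finset.HasAntidiagonal.antidiagonal k,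
    singMap (D' := polesX (LaurentSeries K)) (adm_const K)
      (TensorProduct.curry (Q.Y p.1) a) (Q.X p.2 (b ⊗ₜ c))

theorem prodOp_apply (Y : ℕ → V ⊗[K] V →ₗ[K] Lau K V) (k : ℕ) (a b c : V) :
    prodOp Y k ((a ⊗ₜ b) ⊗ₜ c) = ∑ p ∈ Finset.HasAntidiagonal.antidiagonal k,
      Lau.map (TensorProduct.curry (Y p.1) a) (Y p.2 (b ⊗ₜ c)) := by
  simp [prodOp]

/-- Covariance of the inner factor brings the series to the form $Y(a,z_1)Y(b,z_2)e^{z_3D}c$, to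
which locality applies. -/
theorem evX_tripleRhs [CharZero K] (k : ℕ) (a b c : V) (n : ℕ) :
    evX (tripleRhs Q k a b c) (Finsupp.single 0 n)
      = (n.factorial : K)⁻¹ • prodOp Q.Y k ((a ⊗ₜ b) ⊗ₜ (Q.D ^ n) c) := by
  rw [tripleRhs, map_sum, PS.sum_apply, prodOp_apply, Finset.smul_sum]
  refine Finset.sum_congr rfl fun p _ => ?_
  rw [evX_singMap, psLauMap_apply, evX_X, map_smul]

end Algebra

/-! ### Exchange of variables and bounded poles -/

section Coefficients
variable {K : Type*} [Field K] {V : Type*} [AddCommGroup V] [Module K V]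

/-- The coefficient of `z_1^i z_2^j z_3^n`. -/
def cf (n : ℕ) (j i : ℤ) : PS 1 (L2 K V) →ₗ[K] V where
  toFun G := Lau.coeff (Lau.coeff (G (Finsupp.single 0 n)) j) i
  map_add' _ _ := rfl
  map_smul' c G := by
    change Lau.coeff (Lau.coeff (c • (G (Finsupp.single 0 n))) j) i = _
    rw [L2_coeff_smul]; rfl

theorem cf_apply (n : ℕ) (j i : ℤ) (G : PS 1 (L2 K V)) :
    cf n j i G = Lau.coeff (Lau.coeff (G (Finsupp.single 0 n)) j) i := rfl

theorem ps1_ext {N : Type*} {G H : PS 1 N}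
    (h : ∀ n, G (Finsupp.single 0 n) = H (Finsupp.single 0 n)) : G = H := by
  funext m
  have : m = Finsupp.single 0 (m 0) := by
    refine Finsupp.ext fun a => ?_
    rw [Subsingleton.elim a 0, Finsupp.single_eq_same]
  rw [this, h]

theorem cf_ext {G H : PS 1 (L2 K V)} (h : ∀ n j i, cf n j i G = cf n j i H) : G = H :=
  ps1_ext fun n => Lau.ext fun j => Lau.ext fun i => h n j i

theorem cf_X0 (n : ℕ) (j i : ℤ) (G : PS 1 (L2 K V)) :
    cf n j i (evTRing K (MvPolynomial.X 0) • G) = cf n j (i - 1) G := by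
  rw [evTRing_X0, cf_apply, C_smul_apply, L2Ring.x, lau_smul_def, lau_coeff_smul, Lau.coeff_T_smul]
  rfl

theorem cf_X1 (n : ℕ) (j i : ℤ) (G : PS 1 (L2 K V)) :
    cf n j i (evTRing K (MvPolynomial.X 1) • G) = cf n (j - 1) i G := by
  rw [evTRing_X1, cf_apply, C_smul_apply, L2Ring.y, Lau.coeff_T_smul]
  rfl

theorem cf_X2 (n : ℕ) (j i : ℤ) (G : PS 1 (L2 K V)) :
    cf n j i (evTRing K (MvPolynomial.X 2) • G) = if n = 0 then 0 else cf (n - 1) j i G := by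
  rw [evTRing_X2, cf_apply, X_smul_apply, Finsupp.single_eq_same]
  split_ifs
  · rfl
  · rw [← Finsupp.single_tsub]; rfl

theorem cf_C (n : ℕ) (j i : ℤ) (r : K) (G : PS 1 (L2 K V)) :
    cf n j i (evTRing K (MvPolynomial.C r) • G) = r • cf n j i G := by
  have h : evTRing K (MvPolynomial.C r) = algebraMap K _ r := (evTRing K).commutes r
  rw [h, algebraMap_smul, map_smul]

variable (K) in
/-- The exchange of the first two variables. -/
abbrev swapMat : Fin 3 → Fin 3 → K := ![![0, 1, 0], ![1, 0, 0], ![0, 0, 1]]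

theorem swap_X0 : lin (swapMat K) (MvPolynomial.X 0) = MvPolynomial.X 1 := by
  simp [lin_X, Fin.sum_univ_succ]
theorem swap_X1 : lin (swapMat K) (MvPolynomial.X 1) = MvPolynomial.X 0 := by
  simp [lin_X, Fin.sum_univ_succ]
theorem swap_X2 : lin (swapMat K) (MvPolynomial.X 2) = MvPolynomial.X 2 := by
  simp [lin_X, Fin.sum_univ_succ]

/-- `G` and `H` are expansions in `z_1, z_2` and in `z_2, z_1` with the same coefficients. -/
def SwapRel (G H : PS 1 (L2 K V)) : Prop := ∀ n j i, cf n j i G = cf n i j H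

/-- Multiplication by a variable shifts one index, and the exchanged variable shifts the matching
index on the other side. -/
theorem SwapRel.smul (p : MvPolynomial (Fin 3) K) : ∀ {G H : PS 1 (L2 K V)}, SwapRel G H →
    SwapRel (evTRing K p • G) (evTRing K (lin (swapMat K) p) • H) := by
  induction p using MvPolynomial.induction_on with
  | C r =>
    intro G H h n j i
    have hr : lin (swapMat K) (MvPolynomial.C r) = MvPolynomial.C r := (lin (swapMat K)).commutes r
    rw [hr, cf_C, cf_C, h]
  | add p q hp hq =>
    intro G H h n j i
    rw [map_add, map_add, map_add, add_smul, add_smul, map_add, map_add, hp h, hq h]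
  | mul_X p a hp =>
    intro G H h
    rw [map_mul, map_mul, map_mul, mul_smul, mul_smul]
    refine hp fun n j i => ?_
    fin_cases a
    · simp only [Fin.zero_eta]
      rw [swap_X0, cf_X0, cf_X1, h]
    · simp only [Fin.mk_one]
      rw [swap_X1, cf_X0, cf_X1, h]
    · simp only [Fin.reduceFinMk]
      rw [swap_X2, cf_X2, cf_X2, h]

theorem SwapRel.right_unique {G H H' : PS 1 (L2 K V)} (h : SwapRel G H) (h' : SwapRel G H') :
    H = H' := cf_ext fun n j i => by rw [← h, h']

/-- No negative powers of the second variable. -/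
def NonnegY (G : PS 1 (L2 K V)) : Prop := ∀ n j i, j < 0 → cf n j i G = 0

/-- No negative powers of the first variable. -/
def NonnegX (G : PS 1 (L2 K V)) : Prop := ∀ n j i, i < 0 → cf n j i G = 0

theorem NonnegY.smul (p : MvPolynomial (Fin 3) K) : ∀ {G : PS 1 (L2 K V)}, NonnegY G →
    NonnegY (evTRing K p • G) := by
  induction p using MvPolynomial.induction_on with
  | C r => intro G h n j i hj; rw [cf_C, h _ _ _ hj, smul_zero]
  | add p q hp hq =>
    intro G h n j i hj
    rw [map_add, add_smul, map_add, hp h _ _ _ hj, hq h _ _ _ hj, add_zero]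
  | mul_X p a hp =>
    intro G h
    rw [map_mul, mul_smul]
    refine hp fun n j i hj => ?_
    fin_cases a
    · simp only [Fin.zero_eta]
      rw [cf_X0, h _ _ _ hj]
    · simp only [Fin.mk_one]
      rw [cf_X1, h _ _ _ (by omega)]
    · simp only [Fin.reduceFinMk]
      rw [cf_X2, h _ _ _ hj, ite_self]

theorem NonnegX.smul (p : MvPolynomial (Fin 3) K) : ∀ {G : PS 1 (L2 K V)}, NonnegX G →
    NonnegX (evTRing K p • G) := by
  induction p using MvPolynomial.induction_on with
  | C r => intro G h n j i hj; rw [cf_C, h _ _ _ hj, smul_zero]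
  | add p q hp hq =>
    intro G h n j i hj
    rw [map_add, add_smul, map_add, hp h _ _ _ hj, hq h _ _ _ hj, add_zero]
  | mul_X p a hp =>
    intro G h
    rw [map_mul, mul_smul]
    refine hp fun n j i hj => ?_
    fin_cases a
    · simp only [Fin.zero_eta]
      rw [cf_X0, h _ _ _ (by omega)]
    · simp only [Fin.mk_one]
      rw [cf_X1, h _ _ _ hj]
    · simp only [Fin.reduceFinMk]
      rw [cf_X2, h _ _ _ hj, ite_self]

theorem mk_smul_self {n : ℕ} {D : Set (MvPolynomial (Fin n) K)} (F : PS n V) (s : dens D) :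
    (s : MvPolynomial (Fin n) K) • (LocalizedModule.mk F s : Sing D V) = LocalizedModule.mk F 1 := by
  rw [LocalizedModule.smul'_mk]
  exact LocalizedModule.mk_cancel s F

/-- With no negative powers of $z_1$ and $z_2$, and none of $z_3$ by construction, the coefficients
themselves form a power series in three variables. -/
theorem exists_evT_eq {G : PS 1 (L2 K V)} (hX : NonnegX G) (hY : NonnegY G) :
    ∃ F : PS 3 V, evT (LocalizedModule.mk F 1 : Sing (poles3 K) V) = G := by
  let F : PS 3 V := fun m => cf (m 2) (m 1) (m 0) G
  refine ⟨F, cf_ext fun n j i => ?_⟩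
  rw [cf_apply, coeff_evT_mk_one]
  by_cases hj : 0 ≤ j
  · by_cases hi : 0 ≤ i
    · rw [if_pos ⟨hj, hi⟩]
      change cf ((Finsupp.cons i.toNat (Finsupp.cons j.toNat (Finsupp.single 0 n)) : Fin 3 →₀ ℕ)
        (Fin.succ (Fin.succ 0))) _ _ _ = _
      rw [Finsupp.cons_succ, Finsupp.cons_succ, Finsupp.cons_zero,
        show (1 : Fin 3) = Fin.succ 0 from rfl, Finsupp.cons_succ, Finsupp.cons_zero,
        Finsupp.single_eq_same, Int.toNat_of_nonneg hj, Int.toNat_of_nonneg hi]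
    · rw [if_neg fun h => hi h.2, hX _ _ _ (by omega)]
  · rw [if_neg fun h => hj h.1, hY _ _ _ (by omega)]

theorem evTRing_smul_injective {s : MvPolynomial (Fin 3) K} (hs : s ∈ dens (poles3 K)) :
    ∀ {G H : PS 1 (L2 K V)}, evTRing K s • G = evTRing K s • H → G = H := by
  induction hs using Submonoid.closure_induction with
  | mem d hd =>
    intro G H h
    have := isUnit_end_ps (W := L2 K V) (evT_unit d hd).isUnit
    rw [Module.End.isUnit_iff] at this
    exact this.1 h
  | one => intro G H h; rwa [map_one, one_smul, one_smul] at h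
  | mul x y _ _ hx hy =>
    intro G H h
    rw [map_mul, mul_smul, mul_smul] at h
    exact hy (hx h)

/-- The power series found for $sG$ is divided by $s$; denominators act injectively on expansions,
so the fraction expands to $G$. The triple product is constructed through this criterion. -/
theorem mem_range_evT {G : PS 1 (L2 K V)} {s : MvPolynomial (Fin 3) K} (hs : s ∈ dens (poles3 K))
    (hX : NonnegX (evTRing K s • G)) (hY : NonnegY (evTRing K s • G)) :
    G ∈ LinearMap.range (evT : Sing (poles3 K) V →ₗ[K] PS 1 (L2 K V)) := by
  obtain ⟨F, hF⟩ := exists_evT_eq hX hY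
  refine ⟨LocalizedModule.mk F ⟨s, hs⟩, evTRing_smul_injective hs ?_⟩
  rw [← evT_smul, ← hF]
  exact congrArg _ (mk_smul_self F ⟨s, hs⟩)

/-- The exchange permutes the denominators, except for the sign that $z_1-z_2$ acquires. -/
theorem swap_dens : ∀ d ∈ dens (poles3 K), ∃ d' ∈ dens (poles3 K),
    lin (swapMat K) d = d' ∨ lin (swapMat K) d = -d' := by
  intro d hd
  induction hd using Submonoid.closure_induction with
  | mem d hd =>
    simp only [poles3, Set.mem_insert_iff, Set.mem_singleton_iff] at hd
    have hm : ∀ d ∈ poles3 K, d ∈ dens (poles3 K) := fun d hd => Submonoid.subset_closure hd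
    rcases hd with rfl | rfl | rfl | rfl | rfl
    · exact ⟨_, hm (MvPolynomial.X 1) (by simp [poles3]), Or.inl swap_X0⟩
    · exact ⟨_, hm (MvPolynomial.X 0) (by simp [poles3]), Or.inl swap_X1⟩
    · exact ⟨_, hm (MvPolynomial.X 0 - MvPolynomial.X 1) (by simp [poles3]),
        Or.inr (by rw [map_sub, swap_X0, swap_X1, neg_sub])⟩
    · exact ⟨_, hm (MvPolynomial.X 1 - MvPolynomial.X 2) (by simp [poles3]),
        Or.inl (by rw [map_sub, swap_X0, swap_X2])⟩
    · exact ⟨_, hm (MvPolynomial.X 0 - MvPolynomial.X 2) (by simp [poles3]),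
        Or.inl (by rw [map_sub, swap_X1, swap_X2])⟩
  | one => exact ⟨1, one_mem _, Or.inl (map_one _)⟩
  | mul x y _ _ hx hy =>
    obtain ⟨x', hx', h1⟩ := hx
    obtain ⟨y', hy', h2⟩ := hy
    refine ⟨x' * y', mul_mem hx' hy', ?_⟩
    rw [map_mul]
    rcases h1 with h1 | h1 <;> rcases h2 with h2 | h2 <;> rw [h1, h2] <;> simp

/-- `G` has bounded poles in the second variable. -/
def BddY (G : PS 1 (L2 K V)) : Prop := ∃ d ∈ dens (poles3 K), NonnegY (evTRing K d • G)

theorem BddY.zero : BddY (0 : PS 1 (L2 K V)) :=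
  ⟨1, one_mem _, fun n j i _ => by rw [smul_zero, map_zero]⟩

theorem BddY.add {G H : PS 1 (L2 K V)} (hG : BddY G) (hH : BddY H) : BddY (G + H) := by
  obtain ⟨d, hd, h⟩ := hG
  obtain ⟨e, he, h'⟩ := hH
  refine ⟨d * e, mul_mem hd he, fun n j i hj => ?_⟩
  have h1 := h.smul e n j i hj
  have h2 := h'.smul d n j i hj
  rw [← mul_smul, ← map_mul] at h1 h2
  rw [smul_add, map_add, h2, mul_comm d e, h1, add_zero]

theorem BddY.sum {ι : Type*} (s : Finset ι) (f : ι → PS 1 (L2 K V)) (h : ∀ i ∈ s, BddY (f i)) :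
    BddY (∑ i ∈ s, f i) :=
  Finset.sum_induction f BddY (fun _ _ => BddY.add) BddY.zero h

theorem peelRing_dens : ∀ s ∈ dens (polesX (LaurentSeries K)), ∃ d ∈ dens (poles3 K),
    peelRing 2 K d = s := by
  intro s hs
  induction hs using Submonoid.closure_induction with
  | mem d hd =>
    have hm : ∀ d ∈ poles3 K, d ∈ dens (poles3 K) := fun d hd => Submonoid.subset_closure hd
    simp only [polesX, Set.mem_insert_iff, Set.mem_singleton_iff] at hd
    have h1 : peelRing 2 K (MvPolynomial.X 1) = MvPolynomial.X 0 := peelRing_X_succ 2 0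
    have h2 : peelRing 2 K (MvPolynomial.X 2) = MvPolynomial.X 1 := peelRing_X_succ 2 1
    rcases hd with rfl | rfl
    · exact ⟨_, hm (MvPolynomial.X 1) (by simp [poles3]), h1⟩
    · exact ⟨_, hm (MvPolynomial.X 1 - MvPolynomial.X 2) (by simp [poles3]),
        by rw [map_sub, h1, h2]⟩
  | one => exact ⟨1, one_mem _, map_one _⟩
  | mul x y _ _ hx hy =>
    obtain ⟨x', hx', rfl⟩ := hx
    obtain ⟨y', hy', rfl⟩ := hy
    exact ⟨x' * y', mul_mem hx' hy', map_mul _ _ _⟩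

/-- The denominator involves only $z_2$ and $z_2-z_3$, which are poles of the triple product; once
it is cleared, a power series in $z_2$ and $z_3$ remains. -/
theorem bddY_evX (z : Sing (polesX (LaurentSeries K)) (Lau K V)) : BddY (evX z) := by
  induction z using LocalizedModule.induction_on with
  | _ F s =>
    obtain ⟨d, hd, h⟩ := peelRing_dens (K := K) s s.2
    refine ⟨d, hd, fun n j i hj => ?_⟩
    have : evTRing K d • evX (LocalizedModule.mk F s : Sing (polesX (LaurentSeries K)) (Lau K V))
        = peel (K := LaurentSeries K) 1 F := by
      rw [← evX_mk_one, ← mk_smul_self F s, evX_smul, ← h]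
      rfl
    rw [this, cf_apply]
    change Lau.coeff (Lau.coeff (peelFun (LaurentSeries K) F _) j) i = _
    rw [peelFun_coeff, if_neg (by omega)]
    rfl

theorem peel_injective {K V : Type*} [Field K] [AddCommGroup V] [Module K V] {F G : PS 2 V}
    (h : peel (K := K) 1 F = peel 1 G) : F = G := by
  funext m
  have hm : m = Finsupp.cons (m 0) (Finsupp.single 0 (m 1)) := by
    ext a
    fin_cases a
    · rfl
    · simp only [show (⟨1, by omega⟩ : Fin 2) = Fin.succ 0 from rfl, Finsupp.cons_succ,
        Finsupp.single_eq_same]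
      rfl
  have := congrArg (fun H : PS 1 (Lau K V) => Lau.coeff (H (Finsupp.single 0 (m 1))) (m 0)) h
  change Lau.coeff (peelFun K F _) _ = Lau.coeff (peelFun K G _) _ at this
  rw [peelFun_coeff, peelFun_coeff, if_pos (by omega), if_pos (by omega), Int.toNat_natCast,
    ← hm] at this
  exact this

theorem evX_injective {K V : Type*} [Field K] [AddCommGroup V] [Module K V] :
    Function.Injective (evX : Sing (polesX K) V →ₗ[K] PS 1 (Lau K V)) := by
  rw [injective_iff_map_eq_zero]
  intro x hx
  induction x using LocalizedModule.induction_on with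
  | _ F s =>
    have h1 := mk_smul_self F s
    have h2 : peel (K := K) 1 F = peel (K := K) 1 (0 : PS 2 V) := by
      rw [← evX_mk_one, ← h1, evX_smul, hx, smul_zero, map_zero]
    rw [peel_injective h2, LocalizedModule.zero_mk]

end Coefficients

/-! ### The triple product in its two orders -/

section Existence
variable {K : Type*} [Field K] {V : Type*} [AddCommGroup V] [Module K V]
  (Q : HDQuantumVertexAlgebra K V)

/-- The expansion of the triple product, where `z_3` enters through `e^{z_3 D}`. -/
def tripP (k : ℕ) : (V ⊗[K] V) ⊗[K] V →ₗ[K] PS 1 (L2 K V) where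
  toFun u m := ((m 0).factorial : K)⁻¹ • prodOp Q.Y k ((Q.D ^ (m 0)).lTensor (V ⊗[K] V) u)
  map_add' u v := funext fun m => by
    rw [map_add, map_add, smul_add]; rfl
  map_smul' c u := funext fun m => by
    rw [map_smul, map_smul, smul_comm]; rfl

theorem tripP_apply (k n : ℕ) (u : (V ⊗[K] V) ⊗[K] V) : tripP Q k u (Finsupp.single 0 n)
    = (n.factorial : K)⁻¹ • prodOp Q.Y k ((Q.D ^ n).lTensor (V ⊗[K] V) u) := by
  change ((Finsupp.single (0 : Fin 1) n 0).factorial : K)⁻¹ • prodOp Q.Y k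
    ((Q.D ^ (Finsupp.single (0 : Fin 1) n 0)).lTensor (V ⊗[K] V) u) = _
  rw [Finsupp.single_eq_same]

theorem tripP_tmul [CharZero K] (k : ℕ) (a b c : V) :
    tripP Q k ((a ⊗ₜ b) ⊗ₜ c) = evX (tripleRhs Q k a b c) :=
  ps1_ext fun n => by rw [tripP_apply, evX_tripleRhs, LinearMap.lTensor_tmul]

theorem bddY_tripP [CharZero K] (k : ℕ) (u : (V ⊗[K] V) ⊗[K] V) : BddY (tripP Q k u) := by
  induction u with
  | zero => rw [map_zero]; exact BddY.zero
  | add x y hx hy => rw [map_add]; exact hx.add hy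
  | tmul w c =>
    induction w with
    | zero => rw [TensorProduct.zero_tmul, map_zero]; exact BddY.zero
    | add x y hx hy => rw [TensorProduct.add_tmul, map_add]; exact hx.add hy
    | tmul a b => rw [tripP_tmul]; exact bddY_evX _

variable (K) in
/-- The expansion of rational functions of `z_1, z_2`, as constants in `z_3`. -/
def ratC : Rat (polesS K) →ₐ[K] MvPolynomial (Fin 1) (L2Ring K) :=
  ((Algebra.ofId (L2Ring K) (MvPolynomial (Fin 1) (L2Ring K))).restrictScalars K).comp
    (Rat.expand K (polesS K) expandS_ne_zero)

theorem ratC_smul_apply (r : Rat (polesS K)) (G : PS 1 (L2 K V)) (m) :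
    (ratC K r • G) m = Rat.expand K (polesS K) expandS_ne_zero r • G m := by
  change ((MvPolynomial.C _ : MvPolynomial (Fin 1) (L2Ring K)) • G) m = _
  rw [C_smul_apply]
  rfl

instance : IsScalarTower K (L2Ring K) (PS 1 (L2 K V)) where
  smul_assoc c f G := funext fun m => smul_assoc c f (G m)

theorem const_smul_apply (f : L2Ring K) (G : PS 1 (L2 K V)) (m) : (f • G) m = f • G m := rfl

theorem ratC_smul (r : Rat (polesS K)) (G : PS 1 (L2 K V)) :
    ratC K r • G = Rat.expand K (polesS K) expandS_ne_zero r • G :=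
  funext fun m => ratC_smul_apply r G m

variable (K) in
abbrev inclMat : Fin 2 → Fin 3 → K := ![![1, 0, 0], ![0, 1, 0]]

theorem incl_X0 : lin (inclMat K) (MvPolynomial.X 0) = MvPolynomial.X 0 := by
  simp [lin_X, Fin.sum_univ_succ]
theorem incl_X1 : lin (inclMat K) (MvPolynomial.X 1) = MvPolynomial.X 1 := by
  simp [lin_X, Fin.sum_univ_succ]

theorem expand_algebraMap {D : Set (MvPolynomial (Fin 2) K)} (h) (p) :
    Rat.expand K D h (algebraMap _ _ p) = expandRing K p := ratLift_algebraMap _ _ _ _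

theorem ratC_algebraMap (p : MvPolynomial (Fin 2) K) :
    ratC K (algebraMap _ _ p) = evTRing K (lin (inclMat K) p) := by
  rw [← AlgHom.comp_apply]
  refine DFunLike.congr_fun (f := (ratC K).comp (IsScalarTower.toAlgHom K (MvPolynomial (Fin 2) K) _))
    (MvPolynomial.algHom_ext fun i => ?_) p
  change (MvPolynomial.C (Rat.expand K (polesS K) expandS_ne_zero (algebraMap _ _ (MvPolynomial.X i)))
    : MvPolynomial (Fin 1) (L2Ring K)) = evTRing K (lin (inclMat K) (MvPolynomial.X i))
  rw [expand_algebraMap]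
  fin_cases i
  · simp only [Fin.zero_eta]
    rw [incl_X0, evTRing_X0, expandRing_X0]
  · simp only [Fin.mk_one]
    rw [incl_X1, evTRing_X1, expandRing_X1]

theorem incl_dens : ∀ d ∈ dens (polesS K), lin (inclMat K) d ∈ dens (poles3 K) := by
  intro d hd
  induction hd using Submonoid.closure_induction with
  | mem d hd =>
    refine Submonoid.subset_closure ?_
    simp only [polesS, Set.mem_insert_iff, Set.mem_singleton_iff] at hd
    rcases hd with rfl | rfl | rfl
    · rw [incl_X0]; simp [poles3]
    · rw [incl_X1]; simp [poles3]
    · rw [map_sub, incl_X0, incl_X1]; simp [poles3]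
  | one => rw [map_one]; exact one_mem _
  | mul x y _ _ hx hy => rw [map_mul]; exact mul_mem hx hy

theorem evTRing_mul_ratC {r : Rat (polesS K)} {p s : MvPolynomial (Fin 2) K}
    (hr : r * algebraMap (MvPolynomial (Fin 2) K) (Rat (polesS K)) s = algebraMap _ _ p) :
    evTRing K (lin (inclMat K) s) * ratC K r = evTRing K (lin (inclMat K) p) := by
  rw [← ratC_algebraMap, ← ratC_algebraMap, ← hr, map_mul, mul_comm]

theorem NonnegY.smul_of_mul_eq {G : PS 1 (L2 K V)} {r : MvPolynomial (Fin 1) (L2Ring K)}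
    {p s d : MvPolynomial (Fin 3) K} (h : NonnegY (evTRing K d • G))
    (hr : evTRing K s * r = evTRing K p) : NonnegY (evTRing K (d * s) • r • G) := by
  have : evTRing K (d * s) • r • G = evTRing K p • evTRing K d • G := by
    rw [← mul_smul, ← mul_smul, map_mul, mul_assoc, hr, mul_comm]
  rw [this]
  exact h.smul _

/-- The denominators of $r$ are products of $z_1$, $z_2$, $z_1-z_2$, all of them admitted poles, and
they are cleared together with those of $G$. -/
theorem BddY.ratC_smul {G : PS 1 (L2 K V)} (h : BddY G) (r : Rat (polesS K)) :
    BddY (ratC K r • G) := by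
  obtain ⟨⟨p, s, hs⟩, hr⟩ := IsLocalization.surj (dens (polesS K)) r
  obtain ⟨d, hd, h⟩ := h
  exact ⟨d * lin (inclMat K) s, mul_mem hd (incl_dens s hs), h.smul_of_mul_eq (evTRing_mul_ratC hr)⟩

theorem bddY_lb [CharZero K] (k : ℕ) (x : Rat (polesS K) ⊗[K] ((V ⊗[K] V) ⊗[K] V)) :
    BddY (lb (Rat.expand K (polesS K) expandS_ne_zero) (tripP Q k) x) := by
  induction x with
  | zero => rw [map_zero]; exact BddY.zero
  | add x y hx hy => rw [map_add]; exact hx.add hy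
  | tmul r u => rw [lb_tmul, ← ratC_smul]; exact (bddY_tripP Q k u).ratC_smul r

/-- The expansion of the triple product in the opposite order. -/
def tripJ (k : ℕ) : (V ⊗[K] V) ⊗[K] V →ₗ[K] PS 1 (L2 K V) :=
  bc (Rat.expand K (polesS K) expandS_ne_zero) (tripP Q) (fun i => legMap (LinearEquiv.refl K _) (Q.braid i)) k

/-- At each order in $t$ only finitely many terms of the braiding contribute, and each has bounded
poles. The second variable here plays the role of $z_1$: this is the bound that the original order
does not supply. -/
theorem bddY_tripJ [CharZero K] (k : ℕ) (u : (V ⊗[K] V) ⊗[K] V) : BddY (tripJ Q k u) := by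
  rw [tripJ, bc_apply]
  exact BddY.sum _ _ fun p _ => bddY_lb _ _ _

theorem legMap_lTensor {A : Type*} [CommRing A] [Algebra K A]
    (s : V ⊗[K] V →ₗ[K] A ⊗[K] (V ⊗[K] V)) (f : V →ₗ[K] V) (u : (V ⊗[K] V) ⊗[K] V) :
    legMap (LinearEquiv.refl K _) s (f.lTensor (V ⊗[K] V) u)
      = (f.lTensor (V ⊗[K] V)).lTensor A (legMap (LinearEquiv.refl K _) s u) := by
  induction u with
  | zero => simp
  | add x y hx hy => simp only [map_add, hx, hy]
  | tmul w c =>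
    simp only [legMap, LinearMap.lTensor_tmul, LinearMap.comp_apply, LinearEquiv.refl_toLinearMap, LinearMap.id_apply,
      LinearMap.rTensor_tmul, LinearEquiv.refl_symm, LinearEquiv.coe_coe]
    generalize s w = x
    induction x with
    | zero => simp
    | add x y hx hy => simp only [map_add, TensorProduct.add_tmul, hx, hy]
    | tmul r w => simp

/-- The braiding acts on the first two factors and $e^{z_3D}$ on the third, so the two commute. The
coefficient of $z_3^n$ is therefore of the shape that occurs in locality. -/
theorem tripJ_apply (k n : ℕ) (u : (V ⊗[K] V) ⊗[K] V) :
    tripJ Q k u (Finsupp.single 0 n) = (n.factorial : K)⁻¹ • applySeries (prodOp Q.Y)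
        (leg12 (along (Rat.expand K (polesS K) expandS_ne_zero) Q.braid))
        k ((Q.D ^ n).lTensor (V ⊗[K] V) u) := by
  rw [leg12, leg_along, applySeries_extend_along, tripJ, bc_apply, bc_apply, PS.sum_apply,
    Finset.smul_sum]
  refine Finset.sum_congr rfl fun p _ => ?_
  rw [legMap_lTensor]
  generalize legMap (LinearEquiv.refl K _) (Q.braid p.2) u = x
  induction x with
  | zero => simp; rfl
  | add x y hx hy =>
    rw [map_add, map_add, map_add, smul_add, ← hx, ← hy]; rfl
  | tmul r u =>
    rw [LinearMap.lTensor_tmul, lb_tmul, lb_tmul, const_smul_apply, tripP_apply,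
      ← smul_algebra_smul_comm]

end Existence

/-! ### Locality: existence and the first two formulas -/

section Existence
variable {K : Type*} [Field K] {V : Type*} [AddCommGroup V] [Module K V]
  (Q : HDQuantumVertexAlgebra K V)

theorem L2_smul_comm (r : K) (f : L2Ring K) (G : L2 K V) : f • r • G = r • f • G :=
  smul_algebra_smul_comm r f G

theorem toL2_congr {n : ℕ} {D : Set (MvPolynomial (Fin n) K)} {M M' : Fin n → Fin 2 → K}
    (hM : M = M') (h h') (x : Sing D V) : toL2 M D h x = toL2 M' D h' x := by
  subst hM; rfl

theorem evTRing_neg_smul (p : MvPolynomial (Fin 3) K) (G : PS 1 (L2 K V)) :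
    evTRing K (-p) • G = -(evTRing K p • G) :=
  (congrArg (· • G) (map_neg (evTRing K) p)).trans (neg_smul (evTRing K p) G)

theorem evTRing_pow_smul_apply (N : ℕ) (G : PS 1 (L2 K V)) (m) :
    (evTRing K ((MvPolynomial.X 0 - MvPolynomial.X 1) ^ N) • G) m
      = (L2Ring.x K - L2Ring.y K) ^ N • G m := by
  rw [map_pow, map_sub, evTRing_X0, evTRing_X1, ← map_sub, ← map_pow, C_smul_apply]

theorem evTRing_swap_pow_smul_apply (N : ℕ) (G : PS 1 (L2 K V)) (m) :
    (evTRing K (lin (swapMat K) ((MvPolynomial.X 0 - MvPolynomial.X 1) ^ N)) • G) m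
      = (L2Ring.y K - L2Ring.x K) ^ N • G m := by
  rw [map_pow, map_sub, swap_X0, swap_X1, map_pow, map_sub, evTRing_X0, evTRing_X1, ← map_sub,
    ← map_pow, C_smul_apply]

/-- The exponent in locality is independent of the third vector, so one $N$ serves all the vectors
$D^nc$, that is, all powers of $z_3$ at once. -/
theorem swapRel_trip (k : ℕ) (a b c : V) : ∃ N : ℕ, SwapRel
    (evTRing K ((MvPolynomial.X 0 - MvPolynomial.X 1) ^ N) • tripP Q k ((a ⊗ₜ b) ⊗ₜ c))
    (evTRing K (lin (swapMat K) ((MvPolynomial.X 0 - MvPolynomial.X 1) ^ N)) •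
      tripJ Q k ((b ⊗ₜ a) ⊗ₜ c)) := by
  -- The coefficient of $t^k$ is controlled by the congruence modulo $t^{k+1}$.
  obtain ⟨N, hN⟩ := Q.locality a b (k + 1)
  refine ⟨N, fun n j i => ?_⟩
  have h := hN ((Q.D ^ n) c) k (Nat.lt_succ_self k) i j
  rw [cf_apply, cf_apply, evTRing_pow_smul_apply, evTRing_swap_pow_smul_apply, tripP_apply,
    tripJ_apply, L2_smul_comm, L2_smul_comm, L2_coeff_smul, L2_coeff_smul,
    lau_coeff_smul, lau_coeff_smul, LinearMap.lTensor_tmul, LinearMap.lTensor_tmul]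
  exact congrArg _ h

/-- Locality transfers to $z_1$ the pole bound of the opposite order, while $z_2$ is already
bounded; the product of the three denominators involved removes all negative powers. -/
theorem tripP_tmul_mem_range [CharZero K] (k : ℕ) (a b c : V) :
    tripP Q k ((a ⊗ₜ b) ⊗ₜ c) ∈ LinearMap.range (evT : Sing (poles3 K) V →ₗ[K] _) := by
  obtain ⟨N, hN⟩ := swapRel_trip Q k a b c
  obtain ⟨d, hd, hJ⟩ := bddY_tripJ Q k ((b ⊗ₜ a) ⊗ₜ c)
  obtain ⟨e, he, hG⟩ := bddY_tripP Q k ((a ⊗ₜ b) ⊗ₜ c)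
  obtain ⟨d', hd', hdd⟩ := swap_dens d hd
  have hss : ∀ p : MvPolynomial (Fin 3) K, lin (swapMat K) (lin (swapMat K) p) = p := fun p => by
    rw [← AlgHom.comp_apply]
    refine DFunLike.congr_fun (f := (lin (swapMat K)).comp (lin (swapMat K))) (g := AlgHom.id K _)
      (MvPolynomial.algHom_ext fun i => ?_) p
    rw [AlgHom.comp_apply]
    fin_cases i
    · simp only [Fin.zero_eta]; rw [swap_X0, swap_X1]; rfl
    · simp only [Fin.mk_one]; rw [swap_X1, swap_X0]; rfl
    · simp only [Fin.reduceFinMk]; rw [swap_X2, swap_X2]; rfl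
  set q : MvPolynomial (Fin 3) K := (MvPolynomial.X 0 - MvPolynomial.X 1) ^ N with hq
  have hqd : q ∈ dens (poles3 K) :=
    pow_mem (Submonoid.subset_closure (by simp [poles3])) N
  -- The denominator $d$ was found in the exchanged variables and has to be carried back. On the
  -- opposite order, the factor coming from $(z_1-z_2)^N$ multiplies a series in which $d$ has
  -- already removed the negative powers.
  have h1 : NonnegX (evTRing K (lin (swapMat K) d) • evTRing K q • tripP Q k ((a ⊗ₜ b) ⊗ₜ c)) := by
    have h := hN.smul (lin (swapMat K) d)
    rw [hss] at h
    intro n j i hi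
    rw [h n j i, ← mul_smul, mul_comm, mul_smul]
    exact hJ.smul _ _ _ _ hi
  -- The exchanged denominator is a denominator only up to sign, which does not affect the vanishing
  -- of coefficients.
  have h2 : NonnegX (evTRing K (d' * q) • tripP Q k ((a ⊗ₜ b) ⊗ₜ c)) := by
    rw [map_mul, mul_smul]
    rcases hdd with h | h
    · rwa [h] at h1
    · intro n j i hi
      have := h1 n j i hi
      rw [h, evTRing_neg_smul, map_neg, neg_eq_zero] at this
      exact this
  refine mem_range_evT (s := d' * q * e) (mul_mem (mul_mem hd' hqd) he) ?_ ?_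
  · rw [mul_comm, map_mul, mul_smul]
    exact h2.smul e
  · rw [map_mul, mul_smul]
    exact hG.smul _

theorem tripP_mem_range [CharZero K] (k : ℕ) (u : (V ⊗[K] V) ⊗[K] V) :
    tripP Q k u ∈ LinearMap.range (evT : Sing (poles3 K) V →ₗ[K] _) := by
  induction u with
  | zero => rw [map_zero]; exact zero_mem _
  | add x y hx hy => rw [map_add]; exact add_mem hx hy
  | tmul w c =>
    induction w with
    | zero => rw [TensorProduct.zero_tmul, map_zero]; exact zero_mem _
    | add x y hx hy => rw [TensorProduct.add_tmul, map_add]; exact add_mem hx hy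
    | tmul a b => exact tripP_tmul_mem_range Q k a b c

/-- The further expansion in $z_2$ and $z_3$ is injective, so the defining property of the triple
product can be tested on the full iterated expansion. -/
theorem expand3_eq_iff [CharZero K] (x : Sing (poles3 K) V) (k : ℕ) (a b c : V) :
    Sing.expand3 x = tripleRhs Q k a b c ↔ evT x = tripP Q k ((a ⊗ₜ b) ⊗ₜ c) := by
  rw [tripP_tmul, evT_apply]
  exact evX_injective.eq_iff.symm

/-- The triple product `X_{z_1,z_2,z_3}`. -/
def tripX [CharZero K] (k : ℕ) : (V ⊗[K] V) ⊗[K] V →ₗ[K] Sing (poles3 K) V :=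
  (LinearEquiv.ofInjective evT evT_injective).symm.toLinearMap ∘ₗ
    (tripP Q k).codRestrict _ (tripP_mem_range Q k)

theorem evT_tripX [CharZero K] (k : ℕ) (u) : evT (tripX Q k u) = tripP Q k u := by
  have := LinearEquiv.ofInjective_symm_apply (f := evT) (h := evT_injective)
    ((tripP Q k).codRestrict _ (tripP_mem_range Q k) u)
  exact this

theorem exists_triple [CharZero K] : ∃ X₃ : ℕ → (V ⊗[K] V) ⊗[K] V →ₗ[K] Sing (poles3 K) V,
    ∀ k a b c, Sing.expand3 (X₃ k ((a ⊗ₜ b) ⊗ₜ c)) = tripleRhs Q k a b c :=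
  ⟨tripX Q, fun k a b c => by rw [expand3_eq_iff, evT_tripX]⟩

theorem adm_swap3 : Adm (swapMat K) (poles3 K) (poles3 K) := by
  intro d hd
  simp only [poles3, Set.mem_insert_iff, Set.mem_singleton_iff] at hd
  rcases hd with rfl | rfl | rfl | rfl | rfl
  · exact isUnit_rat K (MvPolynomial.X 1) (by simp [poles3]) (Or.inl swap_X0)
  · exact isUnit_rat K (MvPolynomial.X 0) (by simp [poles3]) (Or.inl swap_X1)
  · exact isUnit_rat K (MvPolynomial.X 0 - MvPolynomial.X 1) (by simp [poles3])
      (Or.inr (by rw [map_sub, swap_X0, swap_X1, neg_sub]))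
  · exact isUnit_rat K (MvPolynomial.X 1 - MvPolynomial.X 2) (by simp [poles3])
      (Or.inl (by rw [map_sub, swap_X0, swap_X2]))
  · exact isUnit_rat K (MvPolynomial.X 0 - MvPolynomial.X 2) (by simp [poles3])
      (Or.inl (by rw [map_sub, swap_X1, swap_X2]))

theorem swapMat_eq : swapMat K = rowMat K ![some 1, some 0, some 2] := by
  ext i j; fin_cases i <;> fin_cases j <;> simp [rowMat]

theorem subst_swap_apply (F : PS 3 V) (i j n : ℕ) :
    PS.subst (swapMat K) F (Finsupp.cons i (Finsupp.cons j (Finsupp.single 0 n)))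
      = F (Finsupp.cons j (Finsupp.cons i (Finsupp.single 0 n))) := by
  rw [swapMat_eq]
  refine subst_rowMat _ _ _ _ fun a => ?_
  simp [Fin.forall_fin_succ, Fin.sum_univ_succ, DFunLike.ext_iff]
  tauto

theorem swapRel_mk_one (F : PS 3 V) : SwapRel (evT (LocalizedModule.mk F 1 : Sing (poles3 K) V))
    (evT (Sing.subst (swapMat K) adm_swap3 (LocalizedModule.mk F 1 : Sing (poles3 K) V))) := by
  intro n j i
  rw [Sing.subst_mk_one, cf_apply, cf_apply, coeff_evT_mk_one, coeff_evT_mk_one, subst_swap_apply]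
  exact if_congr and_comm rfl rfl

/-- For a power series the exchange of variables is visible on coefficients. For a fraction the two
expansions belong to different regions, and their coefficients match only after multiplication by
the denominator. -/
theorem exists_swapRel (x : Sing (poles3 K) V) : ∃ s ∈ dens (poles3 K),
    SwapRel (evTRing K s • evT x)
      (evTRing K (lin (swapMat K) s) • evT (Sing.subst (swapMat K) adm_swap3 x)) := by
  induction x using LocalizedModule.induction_on with
  | _ F s =>
    refine ⟨s, s.2, ?_⟩
    rw [← evT_smul, ← evT_smul, ← Sing.subst_smul, mk_smul_self]
    exact swapRel_mk_one F

theorem evTRing_swap_smul_injective {s : MvPolynomial (Fin 3) K} (hs : s ∈ dens (poles3 K))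
    {G H : PS 1 (L2 K V)} (h : evTRing K (lin (swapMat K) s) • G = evTRing K (lin (swapMat K) s) • H) :
    G = H := by
  obtain ⟨d, hd, h' | h'⟩ := swap_dens s hs
  · rw [h'] at h; exact evTRing_smul_injective hd h
  · rw [h', evTRing_neg_smul, evTRing_neg_smul, neg_inj] at h; exact evTRing_smul_injective hd h

/-- The triple product with the first two variables exchanged. -/
theorem evT_swap (k : ℕ) (a b c : V) (x : Sing (poles3 K) V)
    (hx : evT x = tripP Q k ((a ⊗ₜ b) ⊗ₜ c)) :
    evT (Sing.subst (swapMat K) adm_swap3 x) = tripJ Q k ((b ⊗ₜ a) ⊗ₜ c) := by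
  obtain ⟨N, hN⟩ := swapRel_trip Q k a b c
  obtain ⟨s, hs, h⟩ := exists_swapRel x
  set q : MvPolynomial (Fin 3) K := (MvPolynomial.X 0 - MvPolynomial.X 1) ^ N with hq
  have hqd : q ∈ dens (poles3 K) :=
    pow_mem (Submonoid.subset_closure (by simp [poles3])) N
  have h1 := h.smul q
  have h2 := hN.smul s
  rw [← hx, ← mul_smul, ← map_mul, mul_comm s q, map_mul, mul_smul] at h2
  -- Both series are obtained by exchanging the variables in the same product of $qs$ with the
  -- expansion; it remains to cancel the exchanged denominator.
  have h3 := h1.right_unique h2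
  rw [← mul_smul, ← mul_smul, ← map_mul, ← map_mul, ← map_mul, ← map_mul, mul_comm s q] at h3
  exact evTRing_swap_smul_injective (mul_mem hqd hs) h3

variable (K) in
abbrev evalMat : Fin 3 → Fin 2 → K := ![![1, 0], ![0, 1], ![0, 0]]

theorem evalMat_ne_zero : ∀ d ∈ poles3 K, expandRing K (lin (evalMat K) d) ≠ 0 := by
  intro d hd
  simp only [poles3, Set.mem_insert_iff, Set.mem_singleton_iff] at hd
  rcases hd with rfl | rfl | rfl | rfl | rfl <;>
  simp [lin_X, Fin.sum_univ_succ, expandRing_X0, expandRing_X1, x_ne_zero, y_ne_zero,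
    x_sub_y_ne_zero]

/-- No denominator vanishes at $z_3=0$, so this value can be inserted before or after expanding in
$|z_1|>|z_2|$. -/
theorem evT_zero (x : Sing (poles3 K) V) : evT x 0 = toL2 (evalMat K) (poles3 K) evalMat_ne_zero x := by
  have hφ : MvPolynomial.constantCoeff.comp (evTRing K).toRingHom
      = ((expandRing K).comp (lin (evalMat K))).toRingHom := by
    refine MvPolynomial.ringHom_ext (fun r => ?_) (fun i => ?_)
    · have h1 : evTRing K (MvPolynomial.C r) = MvPolynomial.C (algebraMap K _ r) :=
        (evTRing K).commutes r
      have h2 := ((expandRing K).comp (lin (evalMat K))).commutes r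
      simp only [MvPolynomial.algebraMap_eq] at h2
      simp [h1, h2]
    · fin_cases i
      · simp [evTRing_X0, lin_X, expandRing_X0, Fin.sum_univ_succ]
      · simp [evTRing_X1, lin_X, expandRing_X1, Fin.sum_univ_succ]
      · simp [evTRing_X2, lin_X, Fin.sum_univ_succ]
  refine locLift_ext (φ := ((expandRing K).comp (lin (evalMat K))).toRingHom)
    (fun d hd => isUnit_end (evalMat_ne_zero d hd).isUnit) (fun x => evT x 0)
    (toL2 (evalMat K) (poles3 K) evalMat_ne_zero) (fun p x => ?_) (toL2_smul _) (fun F => ?_) x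
  · rw [evT_smul, ps_smul_zero, ← hφ]; rfl
  · rw [toL2_mk_one]
    refine Lau.ext fun j => Lau.ext fun i => ?_
    rw [lau_zero_eq_single, coeff_evT_mk_one]
    change _ = Lau.coeff (Lau.coeff (flatFun (LaurentSeries K) (peelFun K _)) j) i
    rw [flatFun_coeff]
    by_cases hj : 0 ≤ j
    · rw [if_pos hj, peelFun_coeff, subst_evalThd]
      simp [hj]
    · rw [if_neg hj, if_neg fun h => hj h.1]; rfl

theorem swapEval_ne_zero : ∀ d ∈ poles3 K,
    expandRing K (lin (matMul (swapMat K) (evalMat K)) d) ≠ 0 := by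
  intro d hd
  rw [← lin_comp, AlgHom.comp_apply]
  simp only [poles3, Set.mem_insert_iff, Set.mem_singleton_iff] at hd
  rcases hd with rfl | rfl | rfl | rfl | rfl <;>
  simp only [map_sub, swap_X0, swap_X1, swap_X2] <;>
  simp [lin_X, Fin.sum_univ_succ, expandRing_X0, expandRing_X1, x_ne_zero, y_ne_zero]
  exact sub_ne_zero.2 fun h => x_sub_y_ne_zero (sub_eq_zero.2 h.symm)

/-- At $z_3=0$ only the term $n=0$ of $e^{z_3D}$ survives. -/
theorem expand_triple_fst (k : ℕ) (a b c : V) (x : Sing (poles3 K) V)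
    (hx : evT x = tripP Q k ((a ⊗ₜ b) ⊗ₜ c)) :
    Sing.expand K (polesS K) expandS_ne_zero (Sing.subst (evalMat K) (adm_expand1 K) x)
      = prodOp Q.Y k ((a ⊗ₜ b) ⊗ₜ c) := by
  rw [expand_subst _ _ evalMat_ne_zero, ← evT_zero, hx, lau_zero_eq_single, tripP_apply]
  simp

/-- Exchanging $z_1$ and $z_2$ first makes $|z_2|>|z_1|$ the standard region; then `evT_swap` is
evaluated at $z_3=0$. -/
theorem expand_triple_snd (k : ℕ) (a b c : V) (x : Sing (poles3 K) V)
    (hx : evT x = tripP Q k ((a ⊗ₜ b) ⊗ₜ c)) :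
    Sing.expand K (polesS K) expandS_ne_zero
        (Sing.subst ![![0, 1], ![1, 0], ![0, 0]] (adm_expand2 K) x)
      = applySeries (prodOp Q.Y)
          (leg12 (along (Rat.expand K (polesS K) expandS_ne_zero) Q.braid))
          k ((b ⊗ₜ a) ⊗ₜ c) := by
  have hM : matMul (swapMat K) (evalMat K) = ![![0, 1], ![1, 0], ![0, 0]] := by
    ext i j; fin_cases i <;> fin_cases j <;> simp [matMul, Fin.sum_univ_succ]
  have h1 := toL2_subst adm_swap3 evalMat_ne_zero swapEval_ne_zero x
  rw [← evT_zero, evT_swap Q k a b c x hx, lau_zero_eq_single, tripJ_apply] at h1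
  have hne : ∀ d ∈ poles3 K,
      expandRing K (lin (![![0, 1], ![1, 0], ![0, 0]] : Fin 3 → Fin 2 → K) d) ≠ 0 := by
    rw [← hM]; exact swapEval_ne_zero
  rw [expand_subst _ _ hne, ← toL2_congr hM swapEval_ne_zero hne, ← h1]
  simp

end Existence

/-! ### Substitutions that keep the first variable -/

section ConsMat
variable {n m : ℕ} {K : Type*} [CommRing K] {W : Type*} [AddCommGroup W] [Module K W]

/-- The substitution `M` for all variables but the first, which is kept. -/
def consMat (M : Fin n → Fin m → K) : Fin (n + 1) → Fin (m + 1) → K :=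
  Fin.cons (Fin.cons 1 0) fun i => Fin.cons 0 (M i)

/-- Viewed as a polynomial in $z_0$, the monomial is a power of $z_0$ times a monomial in the other
variables, and the substitution acts on that coefficient alone. -/
theorem finSuccEquiv_linMon_consMat (M : Fin n → Fin m → K) (k : ℕ) (a : Fin n →₀ ℕ) :
    MvPolynomial.finSuccEquiv K m (linMon (consMat M) (Finsupp.cons k a))
      = Polynomial.X ^ k * Polynomial.C (linMon M a) := by
  have hC : ∀ r, MvPolynomial.finSuccEquiv K m (MvPolynomial.C r)
      = Polynomial.C (MvPolynomial.C r) := (MvPolynomial.finSuccEquiv K m).commutes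
  rw [linMon_eq, linMon_eq, Fin.prod_univ_succ, map_mul, map_pow, map_prod, map_prod]
  congr 1
  · rw [Fin.sum_univ_succ]
    simp [consMat, MvPolynomial.finSuccEquiv_X_zero]
  · refine Finset.prod_congr rfl fun i _ => ?_
    rw [map_pow, map_pow, Finsupp.cons_succ, Fin.sum_univ_succ]
    simp [consMat, MvPolynomial.finSuccEquiv_X_succ, hC]

theorem coeff_linMon_consMat (M : Fin n → Fin m → K) (k i : ℕ) (a : Fin n →₀ ℕ)
    (b : Fin m →₀ ℕ) :
    (linMon (consMat M) (Finsupp.cons k a)).coeff (Finsupp.cons i b)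
      = if i = k then (linMon M a).coeff b else 0 := by
  rw [← MvPolynomial.finSuccEquiv_coeff_coeff, finSuccEquiv_linMon_consMat, mul_comm,
    Polynomial.coeff_C_mul_X_pow]
  split_ifs <;> simp

/-- The coefficient of `z_0^i`. -/
def PS.slice (F : PS (n + 1) W) (i : ℕ) : PS n W := fun a => F (Finsupp.cons i a)

theorem subst_consMat (M : Fin n → Fin m → K) (F : PS (n + 1) W) (i : ℕ) (b : Fin m →₀ ℕ) :
    PS.subst (consMat M) F (Finsupp.cons i b)
      = PS.subst M (F.slice i) b := by
  change ∑ᶠ c, (linMon (consMat M) c).coeff (Finsupp.cons i b) • F c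
    = ∑ᶠ a, (linMon M a).coeff b • F (Finsupp.cons i a)
  have hinj : Function.Injective (Finsupp.cons i : (Fin n →₀ ℕ) → (Fin (n + 1) →₀ ℕ)) :=
    Finsupp.cons_right_injective i
  have h : ∀ a, (linMon M a).coeff b • F (Finsupp.cons i a)
      = (linMon (consMat M) (Finsupp.cons i a)).coeff (Finsupp.cons i b) • F (Finsupp.cons i a) :=
    fun a => by rw [coeff_linMon_consMat, if_pos rfl]
  rw [finsum_congr h, ← finsum_mem_range
    (f := fun c => (linMon (consMat M) c).coeff (Finsupp.cons i b) • F c) hinj]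
  conv_lhs => rw [← finsum_mem_univ]
  apply finsum_mem_inter_support_eq
  ext c
  simp only [Set.univ_inter, Set.mem_inter_iff, Set.mem_range, Function.mem_support]
  refine ⟨fun hc => ⟨⟨Finsupp.tail c, ?_⟩, hc⟩, fun h => h.2⟩
  by_contra hne
  apply hc
  have hck : c = Finsupp.cons (c 0) (Finsupp.tail c) := (Finsupp.cons_tail c).symm
  have h0 : i ≠ c 0 := fun h => hne (by rw [h]; exact hck.symm)
  have : (linMon (consMat M) c).coeff (Finsupp.cons i b) = 0 := by
    rw [hck, coeff_linMon_consMat, if_neg h0]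
  rw [this, zero_smul]

theorem linMon_map {k : Type*} [CommRing k] [Algebra k K] (M : Fin n → Fin m → k)
    (a : Fin n →₀ ℕ) : linMon (fun i j => algebraMap k K (M i j)) a
      = MvPolynomial.map (algebraMap k K) (linMon M a) := by
  rw [linMon_eq, linMon_eq, map_prod]
  simp

theorem lau_coeff_sum {ι : Type*} (s : Finset ι) (f : ι → Lau K W) (k : ℤ) :
    Lau.coeff (∑ i ∈ s, f i) k = ∑ i ∈ s, Lau.coeff (f i) k := by
  classical
  induction s using Finset.induction_on with
  | empty => rfl
  | insert i s hi ih => rw [Finset.sum_insert hi, Finset.sum_insert hi, lau_coeff_add, ih]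

/-- The substitution acts on each coefficient of a power of $z_0$ separately, so it does not matter
whether $z_0$ is first absorbed into the constants. -/
theorem peel_subst_consMat (M : Fin n → Fin m → K) (F : PS (n + 1) W) :
    peel (K := K) m (PS.subst (consMat M) F)
      = PS.subst (fun i j => algebraMap K (LaurentSeries K) (M i j)) (peel (K := K) n F) := by
  funext b
  refine Lau.ext fun k => ?_
  have hs := fun (a : Fin n →₀ ℕ) (h : a.degree = b.degree) =>
    (finite_degree n b.degree).mem_toFinset.2 h
  rw [subst_eq_sum _ _ b _ hs, lau_coeff_sum]
  change Lau.coeff (peelFun K _ b) k = _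
  rw [peelFun_coeff, subst_consMat, subst_eq_sum M _ b _ hs]
  have : ∀ a, Lau.coeff (MvPolynomial.coeff b (linMon (fun i j => algebraMap K (LaurentSeries K)
      (M i j)) a) • peel (K := K) n F a) k = MvPolynomial.coeff b (linMon M a) •
        if 0 ≤ k then F (Finsupp.cons k.toNat a) else 0 := by
    intro a
    rw [linMon_map, MvPolynomial.coeff_map, lau_smul_def, lau_coeff_smul]
    rfl
  simp only [this]
  split_ifs
  · rfl
  · simp

theorem subst_map {k V : Type*} [CommRing k] [Algebra k K] [AddCommGroup V] [Module k V]
    [Module k W] [IsScalarTower k K W] (M : Fin n → Fin m → k) (f : V →ₗ[k] W) (F : PS n V) :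
    PS.subst (fun i j => algebraMap k K (M i j)) (PS.map (K := K) f F)
      = PS.map (K := K) f (PS.subst M F) := by
  funext b
  have hs := fun (a : Fin n →₀ ℕ) (h : a.degree = b.degree) =>
    (finite_degree n b.degree).mem_toFinset.2 h
  change _ = f (PS.subst M F b)
  rw [subst_eq_sum _ _ b _ hs, subst_eq_sum M _ b _ hs, map_sum]
  refine Finset.sum_congr rfl fun a _ => ?_
  rw [linMon_map, MvPolynomial.coeff_map, algebraMap_smul, map_smul]
  rfl

theorem lin_map {k : Type*} [CommRing k] [Algebra k K] (M : Fin n → Fin m → k)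
    (p : MvPolynomial (Fin n) k) : lin (fun i j => algebraMap k K (M i j))
      (MvPolynomial.map (algebraMap k K) p) = MvPolynomial.map (algebraMap k K) (lin M p) := by
  induction p using MvPolynomial.induction_on with
  | C r =>
    rw [MvPolynomial.map_C]
    refine ((lin _).commutes (algebraMap k K r)).trans ?_
    have : lin M (MvPolynomial.C r) = MvPolynomial.C r := (lin M).commutes r
    rw [this, MvPolynomial.map_C]; rfl
  | add p q hp hq => simp only [map_add, hp, hq]
  | mul_X p i hp =>
    rw [map_mul, map_mul, map_mul, map_mul, hp, MvPolynomial.map_X, lin_X, lin_X]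
    simp

end ConsMat

section
variable {n m : ℕ} {K : Type*} [Field K]

theorem peelRing_lin_consMat (M : Fin n → Fin m → K) (p : MvPolynomial (Fin (n + 1)) K) :
    peelRing m K (lin (consMat M) p)
      = lin (fun i j => algebraMap K (LaurentSeries K) (M i j)) (peelRing n K p) := by
  refine DFunLike.congr_fun (f := (peelRing m K).comp (lin (consMat M)))
    (g := ((lin (fun i j => algebraMap K (LaurentSeries K) (M i j))).restrictScalars K).comp
      (peelRing n K)) (MvPolynomial.algHom_ext fun i => ?_) p
  rw [AlgHom.comp_apply, AlgHom.comp_apply, lin_X]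
  refine Fin.cases ?_ (fun i => ?_) i
  · rw [peelRing_X_zero]
    refine Eq.trans ?_ ((lin fun i j => algebraMap K (LaurentSeries K) (M i j)).commutes
      (Lau.T K)).symm
    rw [Fin.sum_univ_succ]
    simp [consMat, peelRing_X_zero, MvPolynomial.algebraMap_eq]
  · rw [peelRing_X_succ]
    refine Eq.trans ?_ (lin_X _ _).symm
    have hC : ∀ r, peelRing m K (MvPolynomial.C r) = MvPolynomial.C (algebraMap K _ r) :=
      (peelRing m K).commutes
    rw [Fin.sum_univ_succ]
    simp [consMat, peelRing_X_succ, hC]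

end

/-! ### Fractions under substitution and expansion -/

section RatL3
variable {n : ℕ} {K : Type*} [Field K] {V : Type*} [AddCommGroup V] [Module K V]

/-- Substitution in rational functions, followed by the expansion in `|z_1| > |z_2| > |z_3|`. -/
def ratL3 (M : Fin n → Fin 3 → K) (D : Set (MvPolynomial (Fin n) K))
    (h : ∀ d ∈ D, expandRing3 K (lin M d) ≠ 0) : Rat D →ₐ[K] L3Ring K :=
  ratLift D ((expandRing3 K).comp (lin M)) fun d hd => (h d hd).isUnit

/-- Substitution in rational functions, followed by the expansion in `|z_1| > |z_2|`. -/
def ratL2 (M : Fin n → Fin 2 → K) (D : Set (MvPolynomial (Fin n) K))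
    (h : ∀ d ∈ D, expandRing K (lin M d) ≠ 0) : Rat D →ₐ[K] L2Ring K :=
  ratLift D ((expandRing K).comp (lin M)) fun d hd => (h d hd).isUnit

variable {D : Set (MvPolynomial (Fin n) K)}

theorem ratL3_algebraMap {M : Fin n → Fin 3 → K} (h) (p : MvPolynomial (Fin n) K) :
    ratL3 M D h (algebraMap _ _ p) = expandRing3 K (lin M p) := ratLift_algebraMap _ _ _ _

theorem ratL2_algebraMap {M : Fin n → Fin 2 → K} (h) (p : MvPolynomial (Fin n) K) :
    ratL2 M D h (algebraMap _ _ p) = expandRing K (lin M p) := ratLift_algebraMap _ _ _ _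

theorem toL3_rat_smul {M : Fin n → Fin 3 → K} (h) (r : Rat D) (x : Sing D V) :
    toL3 M D h (r • x) = ratL3 M D h r • toL3 M D h x := by
  refine rat_smul_of_X (AlgHom.id K (Rat D)) (ratL3 M D h) (toL3 M D h) (fun i m => ?_) r x
  rw [AlgHom.id_apply, algebraMap_smul, toL3_smul, ratL3_algebraMap]

theorem toL2_rat_smul {M : Fin n → Fin 2 → K} (h) (r : Rat D) (x : Sing D V) :
    toL2 M D h (r • x) = ratL2 M D h r • toL2 M D h x := by
  refine rat_smul_of_X (AlgHom.id K (Rat D)) (ratL2 M D h) (toL2 M D h) (fun i m => ?_) r x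
  rw [AlgHom.id_apply, algebraMap_smul, toL2_smul, ratL2_algebraMap]

theorem ratL3_subst {l : ℕ} {D' : Set (MvPolynomial (Fin l) K)} {M : Fin n → Fin 3 → K}
    {M' : Fin l → Fin n → K} (hM : Adm M' D' D) (h)
    (h' : ∀ d ∈ D', expandRing3 K (lin (matMul M' M) d) ≠ 0) :
    (ratL3 M D h).comp (Rat.subst M' hM) = ratL3 (matMul M' M) D' h' := by
  refine rat_algHom_ext fun i => ?_
  rw [AlgHom.comp_apply, Rat.subst_algebraMap, ratL3_algebraMap, ratL3_algebraMap,
    ← AlgHom.comp_apply (lin M), lin_comp]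

theorem ratL3_congr {M M' : Fin n → Fin 3 → K} (hM : M = M') (h h') :
    ratL3 M D h = ratL3 M' D h' := by subst hM; rfl

theorem toL3_congr {M M' : Fin n → Fin 3 → K} (hM : M = M') (h h') :
    (toL3 M D h : Sing D V →ₗ[K] L3 K V) = toL3 M' D h' := by subst hM; rfl

end RatL3

/-! ### Expanding the triple product with $z_1$ largest -/

section Slice
variable {K : Type*} [Field K] {V : Type*} [AddCommGroup V] [Module K V]

/-- The coefficientwise application of `f` to `V((z_2))((z_3))`. -/
def lmap2 (f : V →ₗ[K] Lau K V) : L2 K V →ₗ[K] L3 K V where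
  toFun F := HahnModule.of (L2Ring K) (((HahnModule.of (LaurentSeries K)).symm F).map (Lau.map f))
  map_add' F G := Lau.ext fun k => map_add (Lau.map f) _ _
  map_smul' c F := Lau.ext fun k => by
    rw [RingHom.id_apply, L3_coeff_smul]
    change Lau.map f (Lau.coeff (c • F) k) = _
    rw [L2_coeff_smul]
    exact map_smul (Lau.map f) c _

theorem coeff_lmap2 (f : V →ₗ[K] Lau K V) (F : L2 K V) (k : ℤ) :
    Lau.coeff (lmap2 f F) k = Lau.map f (F.coeff k) := rfl

variable (K) in
/-- `K[z_2, z_3] → K((z_1))((z_2))((z_3))`. -/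
def sliceRing : MvPolynomial (Fin 2) K →ₐ[K] L3Ring K :=
  ((expandRing (LaurentSeries K)).restrictScalars K).comp
    (MvPolynomial.mapAlgHom (Algebra.ofId K (LaurentSeries K)))

theorem sliceRing_X0 : sliceRing K (MvPolynomial.X 0) = L2Ring.x (LaurentSeries K) := by
  rw [sliceRing, AlgHom.comp_apply, mapAlgHom_X]
  exact expandRing_X0 _

theorem sliceRing_X1 : sliceRing K (MvPolynomial.X 1) = L2Ring.y (LaurentSeries K) := by
  rw [sliceRing, AlgHom.comp_apply, mapAlgHom_X]
  exact expandRing_X1 _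

theorem lmap2_smul (f : V →ₗ[K] Lau K V) (p : MvPolynomial (Fin 2) K) (F : L2 K V) :
    lmap2 f (expandRing K p • F) = sliceRing K p • lmap2 f F := by
  refine mvPolynomial_smul_of_X (expandRing K) (sliceRing K) (lmap2 f) (fun i F => ?_) p F
  refine Lau.ext fun k => ?_
  fin_cases i
  · simp only [Fin.zero_eta]
    rw [expandRing_X0, sliceRing_X0, coeff_lmap2, L2Ring.x, L2Ring.x, Lau.coeff_C_smul,
      Lau.coeff_C_smul, lauMap_T_smul, coeff_lmap2]
  · simp only [Fin.mk_one]
    rw [expandRing_X1, sliceRing_X1, coeff_lmap2, L2Ring.y, L2Ring.y, Lau.coeff_T_smul,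
      Lau.coeff_T_smul, coeff_lmap2]

/-- Scalar extension of a matrix. -/
abbrev extMat (M : Fin 2 → Fin 2 → K) : Fin 2 → Fin 2 → LaurentSeries K :=
  fun i j => algebraMap K (LaurentSeries K) (M i j)

/-- The map $f$ acts on coefficients only, so it commutes with a substitution in $z_2,z_3$ followed
by the expansion. -/
theorem toL2_singMap {M : Fin 2 → Fin 2 → K} (h : ∀ d ∈ polesX K, expandRing K (lin M d) ≠ 0)
    (h' : ∀ d ∈ polesX (LaurentSeries K), expandRing (LaurentSeries K) (lin (extMat M) d) ≠ 0)
    (h'' : ∀ d ∈ polesX K, sliceRing K (lin M d) ≠ 0)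
    (f : V →ₗ[K] Lau K V) (x : Sing (polesX K) V) :
    toL2 (extMat M) (polesX (LaurentSeries K)) h'
        (singMap (D' := polesX (LaurentSeries K)) (adm_const K) f x)
      = lmap2 f (toL2 M (polesX K) h x) := by
  refine locLift_ext (R' := L3Ring K) (φ := ((sliceRing K).comp (lin M)).toRingHom)
    (fun d hd => isUnit_end (h'' d hd).isUnit)
    (fun x => toL2 (extMat M) (polesX (LaurentSeries K)) h'
        (singMap (D' := polesX (LaurentSeries K)) (adm_const K) f x))
    (fun x => lmap2 f (toL2 M (polesX K) h x)) (fun p x => ?_) (fun p x => ?_) (fun F => ?_) x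
  · rw [singMap_smul, toL2_smul]
    refine congrArg (· • _) ?_
    refine (congrArg (expandRing (LaurentSeries K)) (lin_map M p)).trans ?_
    rfl
  · rw [toL2_smul, lmap2_smul]; rfl
  · rw [singMap_mk_one, toL2_mk_one, toL2_mk_one, subst_map]
    refine Lau.ext fun j => Lau.ext fun i => ?_
    rw [coeff_lmap2]
    change Lau.coeff (Lau.coeff (flatFun (L2Ring K) (peelFun (LaurentSeries K) _)) j) i
      = Lau.coeff (Lau.map f (Lau.coeff (flatFun (LaurentSeries K) (peelFun K _)) j)) i
    rw [Lau.coeff_map, flatFun_coeff, flatFun_coeff]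
    by_cases hj : 0 ≤ j
    · rw [if_pos hj, if_pos hj, peelFun_coeff, peelFun_coeff, apply_ite f, map_zero]
      rfl
    · rw [if_neg hj, if_neg hj]
      exact (map_zero f).symm

/-- A substitution that keeps $z_1$ can be made after the expansion for $z_1$ large. The defining
property of the triple product then gives its value at the new $z_2,z_3$. -/
theorem toL3_expand3 {M : Fin 2 → Fin 2 → K}
    (h' : ∀ d ∈ polesX (LaurentSeries K), expandRing (LaurentSeries K) (lin (extMat M) d) ≠ 0)
    (h : ∀ d ∈ poles3 K, expandRing3 K (lin (consMat M) d) ≠ 0) (x : Sing (poles3 K) V) :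
    toL3 (consMat M) (poles3 K) h x
      = toL2 (extMat M) (polesX (LaurentSeries K)) h' (Sing.expand3 x) := by
  refine locLift_ext (R' := L3Ring K) (φ := ((expandRing3 K).comp (lin (consMat M))).toRingHom)
    (fun d hd => isUnit_end (h d hd).isUnit) (toL3 (consMat M) (poles3 K) h)
    (fun x => toL2 (extMat M) (polesX (LaurentSeries K)) h' (Sing.expand3 x))
    (toL3_smul h) (fun p x => ?_) (fun F => ?_) x
  · rw [expand3_smul, toL2_smul, ← peelRing_lin_consMat]
    rfl
  · rw [toL3_mk_one, expand3_mk_one, toL2_mk_one, peel3_apply, peel_subst_consMat]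

end Slice

/-! ### Expanded denominators do not vanish -/

section Injective
variable {K : Type*} [Field K] {V : Type*} [AddCommGroup V] [Module K V]

theorem peel_inj {K V : Type*} [CommRing K] [AddCommGroup V] [Module K V] (n : ℕ)
    {F G : PS (n + 1) V} (h : peel (K := K) n F = peel n G) : F = G := by
  funext m
  have := congrArg (fun H : PS n (Lau K V) => Lau.coeff (H (Finsupp.tail m)) (m 0)) h
  change Lau.coeff (peelFun K F _) _ = Lau.coeff (peelFun K G _) _ at this
  rw [peelFun_coeff, peelFun_coeff, if_pos (by omega), if_pos (by omega), Int.toNat_natCast,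
    Finsupp.cons_tail] at this
  exact this

theorem flat_inj {K V : Type*} [CommRing K] [AddCommGroup V] [Module K V] {F G : PS 1 V}
    (h : flat (K := K) F = flat G) : F = G :=
  ps1_ext fun n => (flat_coeff_nat (A := K) F n).symm.trans
    ((congrArg (fun H => Lau.coeff H n) h).trans (flat_coeff_nat (A := K) G n))

theorem peel3_inj {F G : PS 3 V} (h : peel3 (K := K) F = peel3 G) : F = G :=
  peel_inj 2 (peel_inj (K := LaurentSeries K) 1 (flat_inj (K := L2Ring K) h))

theorem smul_const_apply {n : ℕ} {K : Type*} [CommRing K] (p : MvPolynomial (Fin n) K)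
    (m : Fin n →₀ ℕ) : (p • PS.const n (1 : K)) m = MvPolynomial.coeff m p := by
  classical
  rw [poly_smul_eq, ps_smul_apply, Finset.sum_eq_single (m, 0)]
  · simp [PS.const]
  · rintro ⟨i, j⟩ hij hne
    have : j ≠ 0 := by
      rintro rfl
      apply hne
      simpa using hij
    simp [PS.const, this]
  · simp

theorem eq_zero_of_smul_const {n : ℕ} {K : Type*} [CommRing K] {p : MvPolynomial (Fin n) K}
    (h : p • PS.const n (1 : K) = 0) : p = 0 :=
  MvPolynomial.ext _ _ fun m => by rw [← smul_const_apply, h]; rfl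

/-- The injective embedding of power series is applied to $p\cdot1$. Invertibility of an expanded
denominator is thereby reduced to its being a nonzero polynomial. -/
theorem expandRing3_ne_zero {p : MvPolynomial (Fin 3) K} (hp : p ≠ 0) : expandRing3 K p ≠ 0 := by
  refine fun h => hp (eq_zero_of_smul_const (peel3_inj (K := K) ?_))
  rw [map_zero]
  exact ((peel3 (K := K)).map_smulₛₗ p _).trans ((congrArg (· • _) h).trans
    (zero_smul (L3Ring K) (peel3 (K := K) (PS.const 3 (1 : K)))))

theorem expandRing_ne_zero {p : MvPolynomial (Fin 2) K} (hp : p ≠ 0) : expandRing K p ≠ 0 := by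
  refine fun h => hp (eq_zero_of_smul_const (peel_inj (K := K) 1 (flat_inj (K := LaurentSeries K) ?_)))
  rw [map_zero, map_zero]
  refine (congrArg _ ((peel (K := K) 1).map_smulₛₗ p _)).trans ?_
  rw [flat_smul]
  exact (congrArg (· • _) h).trans (zero_smul (L2Ring K)
    (flat (K := LaurentSeries K) (peel (K := K) 1 (PS.const 2 (1 : K)))))

theorem sliceRing_ne_zero {p : MvPolynomial (Fin 2) K} (hp : p ≠ 0) : sliceRing K p ≠ 0 := by
  refine expandRing_ne_zero (K := LaurentSeries K) fun h => hp ?_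
  refine MvPolynomial.map_injective (algebraMap K (LaurentSeries K)) (RingHom.injective _) ?_
  rw [map_zero]
  exact h

theorem ne_zero_of_eval {n : ℕ} {K : Type*} [CommRing K] (v : Fin n → K)
    {p : MvPolynomial (Fin n) K} (h : MvPolynomial.eval v p ≠ 0) : p ≠ 0 := by
  rintro rfl
  exact h (map_zero _)

theorem eval_lin {n m : ℕ} {K : Type*} [CommRing K] (M : Fin n → Fin m → K) (v : Fin m → K)
    (p : MvPolynomial (Fin n) K) :
    MvPolynomial.eval v (lin M p) = MvPolynomial.eval (fun i => ∑ j, M i j * v j) p := by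
  induction p using MvPolynomial.induction_on with
  | C r =>
    have : lin M (MvPolynomial.C r) = MvPolynomial.C r := (lin M).commutes r
    rw [this, MvPolynomial.eval_C, MvPolynomial.eval_C]
  | add p q hp hq => rw [map_add, map_add, map_add, hp, hq]
  | mul_X p i hp =>
    rw [map_mul, map_mul, map_mul, hp, lin_X]
    simp

/-- One point at which the substituted polynomial does not vanish is enough. -/
theorem lin_ne_zero {n m : ℕ} {K : Type*} [CommRing K] (M : Fin n → Fin m → K) (v : Fin m → K)
    {p : MvPolynomial (Fin n) K} (h : MvPolynomial.eval (fun i => ∑ j, M i j * v j) p ≠ 0) :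
    lin M p ≠ 0 := ne_zero_of_eval v (by rwa [eval_lin])

theorem toL3_injective {D : Set (MvPolynomial (Fin 3) K)} (h) :
    Function.Injective (toL3 ![![1, 0, 0], ![0, 1, 0], ![0, 0, 1]] D h : Sing D V →ₗ[K] L3 K V) := by
  rw [injective_iff_map_eq_zero]
  intro x hx
  induction x using LocalizedModule.induction_on with
  | _ F s =>
    have h2 : peel3 (K := K) F = peel3 (K := K) (0 : PS 3 V) := by
      rw [← subst_id3 (K := K) F, ← toL3_mk_one h, ← mk_smul_self F s, toL3_smul, hx, smul_zero,
        map_zero]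
    rw [peel3_inj h2, LocalizedModule.zero_mk]

end Injective

section Conditions
variable {K : Type*} [Field K]

/-- A point off the zeros of the linear forms in `D` gives nonzero expansions. -/
theorem l3_ne_zero {n : ℕ} (M : Fin n → Fin 3 → K) (D : Set (MvPolynomial (Fin n) K))
    (v : Fin 3 → K) (h : ∀ d ∈ D, MvPolynomial.eval (fun i => ∑ j, M i j * v j) d ≠ 0) :
    ∀ d ∈ D, expandRing3 K (lin M d) ≠ 0 :=
  fun d hd => expandRing3_ne_zero (lin_ne_zero M v (h d hd))

theorem l2_ne_zero {n : ℕ} (M : Fin n → Fin 2 → K) (D : Set (MvPolynomial (Fin n) K))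
    (v : Fin 2 → K) (h : ∀ d ∈ D, MvPolynomial.eval (fun i => ∑ j, M i j * v j) d ≠ 0) :
    ∀ d ∈ D, expandRing K (lin M d) ≠ 0 :=
  fun d hd => expandRing_ne_zero (lin_ne_zero M v (h d hd))

theorem poles3_forall {v : Fin 3 → K} (h0 : v 0 ≠ 0) (h1 : v 1 ≠ 0) (h01 : v 0 - v 1 ≠ 0)
    (h02 : v 0 - v 2 ≠ 0) (h12 : v 1 - v 2 ≠ 0) : ∀ d ∈ poles3 K, MvPolynomial.eval v d ≠ 0 := by
  intro d hd
  simp only [poles3, Set.mem_insert_iff, Set.mem_singleton_iff] at hd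
  rcases hd with rfl | rfl | rfl | rfl | rfl <;> simpa

end Conditions

section BaseChange
variable {K : Type*} [CommRing K] {A B B' U W N N' : Type*} [CommRing A] [Algebra K A] [CommRing B]
  [Algebra K B] [CommRing B'] [Algebra K B'] [AddCommGroup U] [Module K U] [AddCommGroup W]
  [Module K W] [AddCommGroup N] [Module K N] [Module B N] [IsScalarTower K B N]
  [AddCommGroup N'] [Module K N'] [Module B' N'] [IsScalarTower K B' N']

theorem map_bc (ρ : A →ₐ[K] B) (ρ' : A →ₐ[K] B') (g : N →ₗ[K] N')
    (hg : ∀ r m, g (ρ r • m) = ρ' r • g m) {y : ℕ → U →ₗ[K] N} {y' : ℕ → U →ₗ[K] N'}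
    (hy : ∀ i u, g (y i u) = y' i u) (s : ℕ → W →ₗ[K] A ⊗[K] U) (k : ℕ) (u : W) :
    g (bc ρ y s k u) = bc ρ' y' s k u := by
  have : (fun i => g ∘ₗ y i) = y' := funext fun i => LinearMap.ext fun u => hy i u
  rw [← this, ← comp_bc ρ ρ' g hg]; rfl

end BaseChange

/-! ### Braided commutativity after expansion -/

section Braid
variable {K : Type*} [Field K] {V : Type*} [AddCommGroup V] [Module K V]
  (Q : HDQuantumVertexAlgebra K V)

/-- Braided commutativity, expanded. -/
theorem toL2_X_comm {M M' : Fin 2 → Fin 2 → K} (hM : M' = fun i => M (Equiv.swap 0 1 i))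
    (h : ∀ d ∈ polesX K, expandRing K (lin M d) ≠ 0)
    (h' : ∀ d ∈ polesX K, expandRing K (lin M' d) ≠ 0)
    (h'' : ∀ d ∈ polesS K, expandRing K (lin M d) ≠ 0)
    (h''' : ∀ d ∈ polesS K, expandRing K (lin M' d) ≠ 0) (k : ℕ) (b c : V) :
    toL2 M (polesX K) h (Q.X k (b ⊗ₜ c)) = bc (ratL2 M' (polesS K) h''')
      (fun i => toL2 M' (polesX K) h' ∘ₗ Q.X i) Q.braid k (c ⊗ₜ b) := by
  have e1 : matMul ![![1, 0], ![0, 1]] M = M := by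
    funext i j; fin_cases i <;> simp [matMul, Fin.sum_univ_succ]
  have e2 : matMul ![![0, 1], ![1, 0]] M = M' := by
    subst hM; funext i j; fin_cases i <;> simp [matMul, Fin.sum_univ_succ]
  have he1 : ∀ d ∈ polesX K, expandRing K (lin (matMul ![![1, 0], ![0, 1]] M) d) ≠ 0 := by
    rw [e1]; exact h
  have he2 : ∀ d ∈ polesX K, expandRing K (lin (matMul ![![0, 1], ![1, 0]] M) d) ≠ 0 := by
    rw [e2]; exact h'
  have h1 := congrArg (toL2 M (polesS K) h'') (Q.braided_comm k b c)
  rw [applySeries_extend_along, toL2_subst (adm_id K) h'' he1, toL2_congr e1 he1 h] at h1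
  rw [h1]
  refine map_bc _ _ _ (fun r m => ?_) (fun i u => ?_) _ _ _
  · rw [toL2_rat_smul]
    refine congrArg (· • _) ?_
    refine DFunLike.congr_fun (f := (ratL2 M (polesS K) h'').comp
      (Rat.subst ![![0, 1], ![1, 0]] (adm_swapS K))) (rat_algHom_ext fun i => ?_) r
    rw [AlgHom.comp_apply, Rat.subst_algebraMap, ratL2_algebraMap, ratL2_algebraMap,
      ← AlgHom.comp_apply (lin M), lin_comp, e2]
  · rw [LinearMap.comp_apply, LinearMap.comp_apply, toL2_subst (adm_swap K) h'' he2,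
      toL2_congr e2 he2 h']

theorem adm_inclS : Adm (inclMat K) (polesS K) (poles3 K) := fun d hd =>
  IsLocalization.map_units (Rat (poles3 K))
    (⟨_, incl_dens d (Submonoid.subset_closure hd)⟩ : dens (poles3 K))

theorem evT_rat_smul (r : Rat (polesS K)) (x : Sing (poles3 K) V) :
    evT (Rat.subst (inclMat K) adm_inclS r • x)
      = Rat.expand K (polesS K) expandS_ne_zero r • evT x := by
  refine rat_smul_of_X (Rat.subst (inclMat K) adm_inclS)
    (Rat.expand K (polesS K) expandS_ne_zero) evT (fun i m => ?_) r x
  rw [Rat.subst_algebraMap, algebraMap_smul, evT_smul, ← ratC_smul, ratC_algebraMap]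

variable [CharZero K]

/-- The triple product with the first two variables exchanged. -/
theorem subst_swap_tripX (k : ℕ) (a b c : V) :
    Sing.subst (swapMat K) adm_swap3 (tripX Q k ((a ⊗ₜ b) ⊗ₜ c))
      = bc (Rat.subst (inclMat K) adm_inclS) (tripX Q)
        (fun i => legMap (LinearEquiv.refl K _) (Q.braid i)) k ((b ⊗ₜ a) ⊗ₜ c) := by
  -- Injectivity of one expansion gives an identity of fractions, which may afterwards be expanded
  -- in other regions.
  refine evT_injective ?_
  rw [evT_swap Q k a b c _ (evT_tripX Q k _), tripJ]
  exact (map_bc (Rat.subst (inclMat K) adm_inclS) _ evT evT_rat_smul (evT_tripX Q) _ k ((b ⊗ₜ a) ⊗ₜ c)).symm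

end Braid

section Legs
variable {K : Type*} [Field K] {V : Type*} [AddCommGroup V] [Module K V]
  {A B N : Type*} [CommRing A] [Algebra K A] [CommRing B] [Algebra K B] [AddCommGroup N] [Module K N]
  [Module B N] [IsScalarTower K B N]

theorem bc_legMap_apply (e : (V ⊗[K] V) ⊗[K] V ≃ₗ[K] (V ⊗[K] V) ⊗[K] V) (ρ : A →ₐ[K] B)
    (y : ℕ → (V ⊗[K] V) ⊗[K] V →ₗ[K] N) (s : ℕ → V ⊗[K] V →ₗ[K] A ⊗[K] (V ⊗[K] V)) (k : ℕ)
    (w : V ⊗[K] V) (c : V) :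
    bc ρ y (fun i => legMap e (s i)) k (e.symm (w ⊗ₜ c))
      = bc ρ (fun i => y i ∘ₗ e.symm.toLinearMap ∘ₗ (TensorProduct.mk K (V ⊗[K] V) V).flip c)
        s k w := by
  rw [bc_apply, bc_apply]
  exact Finset.sum_congr rfl fun p _ => lb_legMap_apply _ _ _ _ _ _

/-- `a ⊗ b ⊗ c ↦ b ⊗ c ⊗ a`. -/
abbrev legEquiv23 (K V : Type*) [Field K] [AddCommGroup V] [Module K V] :
    (V ⊗[K] V) ⊗[K] V ≃ₗ[K] (V ⊗[K] V) ⊗[K] V :=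
  (TensorProduct.assoc K V V V).trans (TensorProduct.comm K V (V ⊗[K] V))

end Legs

/-! ### The variables $x+w$, $x$ and $z$ -/

section Matrices
variable (K : Type*) [Field K]

abbrev idMat : Fin 3 → Fin 3 → K := ![![1, 0, 0], ![0, 1, 0], ![0, 0, 1]]
abbrev swapMat2 : Fin 2 → Fin 2 → K := ![![0, 1], ![1, 0]]
/-- `z_1, z_2, z_3 ↦ x + w, x, z` in the variables `z, x, w`. -/
abbrev matXZ : Fin 3 → Fin 3 → K := ![![0, 1, 1], ![0, 1, 0], ![1, 0, 0]]
/-- `z_1, z_2, z_3 ↦ x + w, z, x` in the variables `z, x, w`. -/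
abbrev matZX : Fin 3 → Fin 3 → K := ![![0, 1, 1], ![1, 0, 0], ![0, 1, 0]]
/-- `z_1, z_2 ↦ x + w, x`. -/
abbrev matSum : Fin 2 → Fin 2 → K := ![![1, 1], ![1, 0]]

variable {K}

theorem expandRing3_X0 : expandRing3 K (MvPolynomial.X 0)
    = algebraMap (LaurentSeries K) (L3Ring K) (Lau.T K) := by
  rw [expandRing3, AlgHom.comp_apply, peelRing_X_zero]
  exact (expandRing (LaurentSeries K)).commutes _

theorem expandRing3_X1 : expandRing3 K (MvPolynomial.X 1) = L2Ring.x (LaurentSeries K) := by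
  rw [expandRing3, AlgHom.comp_apply, show (1 : Fin 3) = Fin.succ 0 from rfl, peelRing_X_succ]
  exact expandRing_X0 _

theorem expandRing3_X2 : expandRing3 K (MvPolynomial.X 2) = L2Ring.y (LaurentSeries K) := by
  rw [expandRing3, AlgHom.comp_apply, show (2 : Fin 3) = Fin.succ 1 from rfl, peelRing_X_succ]
  exact expandRing_X1 _

theorem polesX_forall {K : Type*} [CommRing K] {v : Fin 2 → K} (h0 : v 0 ≠ 0) (h01 : v 0 - v 1 ≠ 0) :
    ∀ d ∈ polesX K, MvPolynomial.eval v d ≠ 0 := by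
  intro d hd
  simp only [polesX, Set.mem_insert_iff, Set.mem_singleton_iff] at hd
  rcases hd with rfl | rfl <;> simpa

theorem polesS_forall {v : Fin 2 → K} (h0 : v 0 ≠ 0) (h1 : v 1 ≠ 0) (h01 : v 0 - v 1 ≠ 0) :
    ∀ d ∈ polesS K, MvPolynomial.eval v d ≠ 0 := by
  intro d hd
  simp only [polesS, Set.mem_insert_iff, Set.mem_singleton_iff] at hd
  rcases hd with rfl | rfl | rfl <;> simpa

theorem polesYB_forall {v : Fin 3 → K} (h0 : v 0 ≠ 0) (h1 : v 1 ≠ 0) (h2 : v 2 ≠ 0)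
    (h01 : v 0 - v 1 ≠ 0) (h02 : v 0 - v 2 ≠ 0) (h12 : v 1 - v 2 ≠ 0) :
    ∀ d ∈ polesYB K, MvPolynomial.eval v d ≠ 0 := by
  intro d hd
  simp only [polesYB, Set.mem_insert_iff, Set.mem_singleton_iff] at hd
  rcases hd with rfl | rfl | rfl | rfl | rfl | rfl <;> simpa

theorem adm_id3 : Adm (idMat K) (poles3 K) (polesYB K) := by
  intro d hd
  refine isUnit_rat K d ?_ (Or.inl ?_)
  · simp only [poles3, Set.mem_insert_iff, Set.mem_singleton_iff] at hd
    rcases hd with rfl | rfl | rfl | rfl | rfl <;> simp [polesYB]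
  · have : lin (idMat K) = AlgHom.id K _ := by
      ext1 i
      fin_cases i <;> simp [lin_X, Fin.sum_univ_succ]
    rw [this]; rfl

theorem consMat_explicit {a b c d : K} : consMat ![![a, b], ![c, d]]
    = ![![1, 0, 0], ![0, a, b], ![0, c, d]] := by
  funext i j
  fin_cases i <;> fin_cases j <;> rfl

theorem adm_swap23 : Adm (consMat (swapMat2 K)) (poles3 K) (polesYB K) := by
  have h0 : lin (consMat (swapMat2 K)) (MvPolynomial.X 0) = MvPolynomial.X 0 := by
    rw [swapMat2, consMat_explicit]; simp [lin_X, Fin.sum_univ_succ]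
  have h1 : lin (consMat (swapMat2 K)) (MvPolynomial.X 1) = MvPolynomial.X 2 := by
    rw [swapMat2, consMat_explicit]; simp [lin_X, Fin.sum_univ_succ]
  have h2 : lin (consMat (swapMat2 K)) (MvPolynomial.X 2) = MvPolynomial.X 1 := by
    rw [swapMat2, consMat_explicit]; simp [lin_X, Fin.sum_univ_succ]
  intro d hd
  simp only [poles3, Set.mem_insert_iff, Set.mem_singleton_iff] at hd
  rcases hd with rfl | rfl | rfl | rfl | rfl
  · exact isUnit_rat K (MvPolynomial.X 0) (by simp [polesYB]) (Or.inl h0)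
  · exact isUnit_rat K (MvPolynomial.X 2) (by simp [polesYB]) (Or.inl h1)
  · exact isUnit_rat K (MvPolynomial.X 0 - MvPolynomial.X 2) (by simp [polesYB])
      (Or.inl (by rw [map_sub, h0, h1]))
  · exact isUnit_rat K (MvPolynomial.X 0 - MvPolynomial.X 1) (by simp [polesYB])
      (Or.inl (by rw [map_sub, h0, h2]))
  · exact isUnit_rat K (MvPolynomial.X 1 - MvPolynomial.X 2) (by simp [polesYB])
      (Or.inr (by rw [map_sub, h1, h2, neg_sub]))

theorem adm_32 : Adm (![![0, 0, 1], ![0, 1, 0]] : Fin 2 → Fin 3 → K) (polesS K) (polesYB K) := by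
  intro d hd
  simp only [polesS, Set.mem_insert_iff, Set.mem_singleton_iff] at hd
  rcases hd with rfl | rfl | rfl
  · exact isUnit_rat K (MvPolynomial.X 2) (by simp [polesYB])
      (Or.inl (by simp [lin_X, Fin.sum_univ_succ]))
  · exact isUnit_rat K (MvPolynomial.X 1) (by simp [polesYB])
      (Or.inl (by simp [lin_X, Fin.sum_univ_succ]))
  · exact isUnit_rat K (MvPolynomial.X 1 - MvPolynomial.X 2) (by simp [polesYB])
      (Or.inr (by simp [lin_X, Fin.sum_univ_succ]))

theorem lin_injective_ne_zero {M : Fin 2 → Fin 2 → K} (v : Fin 2 → K)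
    (hv : ∀ d ∈ polesX K, MvPolynomial.eval (fun i => ∑ j, M i j * v j) d ≠ 0) :
    ∀ d ∈ polesX (LaurentSeries K), expandRing (LaurentSeries K) (lin (extMat M) d) ≠ 0 := by
  have h : ∀ d ∈ polesX (LaurentSeries K), ∃ e ∈ polesX K,
      d = MvPolynomial.map (algebraMap K (LaurentSeries K)) e := by
    intro d hd
    simp only [polesX, Set.mem_insert_iff, Set.mem_singleton_iff] at hd
    rcases hd with rfl | rfl
    · exact ⟨MvPolynomial.X 0, by simp [polesX], by simp⟩
    · exact ⟨MvPolynomial.X 0 - MvPolynomial.X 1, by simp [polesX], by simp⟩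
  intro d hd
  obtain ⟨e, he, rfl⟩ := h d hd
  rw [lin_map]
  exact sliceRing_ne_zero (lin_ne_zero M v (hv e he))

end Matrices

section Triple
variable {K : Type*} [Field K] [CharZero K] {V : Type*} [AddCommGroup V] [Module K V]
  (Q : HDQuantumVertexAlgebra K V)

/-- The expansion of the triple product for `z_1` large. -/
theorem toL3_tripX {M : Fin 2 → Fin 2 → K} (v : Fin 2 → K)
    (hv : ∀ d ∈ polesX K, MvPolynomial.eval (fun i => ∑ j, M i j * v j) d ≠ 0)
    (h : ∀ d ∈ poles3 K, expandRing3 K (lin (consMat M) d) ≠ 0) (k : ℕ) (a b c : V) :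
    toL3 (consMat M) (poles3 K) h (tripX Q k ((a ⊗ₜ b) ⊗ₜ c))
      = ∑ p ∈ Finset.HasAntidiagonal.antidiagonal k, lmap2 (TensorProduct.curry (Q.Y p.1) a)
        (toL2 M (polesX K) (l2_ne_zero M _ v hv) (Q.X p.2 (b ⊗ₜ c))) := by
  rw [toL3_expand3 (lin_injective_ne_zero v hv), (expand3_eq_iff Q _ k a b c).2 (evT_tripX Q k _),
    tripleRhs, map_sum]
  refine Finset.sum_congr rfl fun p _ => ?_
  rw [toL2_singMap (l2_ne_zero M _ v hv) _ fun d hd => sliceRing_ne_zero (lin_ne_zero M v (hv d hd))]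

/-- The test point $(1,3,5)$ is chosen so that none of the denominators in play vanishes in
characteristic zero; it serves all the conditions of this kind below, with its tail $(3,5)$ for two
variables. -/
theorem swap23_ne_zero : ∀ d ∈ poles3 K, expandRing3 K (lin (consMat (swapMat2 K)) d) ≠ 0 := by
  rw [consMat_explicit]
  refine l3_ne_zero _ _ ![1, 3, 5] (poles3_forall ?_ ?_ ?_ ?_ ?_) <;>
    simp [Fin.sum_univ_three] <;> norm_num

theorem id3_ne_zero : ∀ d ∈ poles3 K, expandRing3 K (lin (consMat ![![1, 0], ![0, 1]]) d) ≠ 0 := by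
  rw [consMat_explicit]
  refine l3_ne_zero _ _ ![1, 3, 5] (poles3_forall ?_ ?_ ?_ ?_ ?_) <;>
    simp [Fin.sum_univ_three] <;> norm_num

theorem matSum_ne_zero : ∀ d ∈ poles3 K, expandRing3 K (lin (consMat (matSum K)) d) ≠ 0 := by
  rw [consMat_explicit]
  refine l3_ne_zero _ _ ![1, 3, 5] (poles3_forall ?_ ?_ ?_ ?_ ?_) <;>
    simp [Fin.sum_univ_three] <;> norm_num

theorem matXZ_ne_zero : ∀ d ∈ poles3 K, expandRing3 K (lin (matXZ K) d) ≠ 0 := by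
  refine l3_ne_zero _ _ ![1, 3, 5] (poles3_forall ?_ ?_ ?_ ?_ ?_) <;>
    simp [Fin.sum_univ_three] <;> norm_num

theorem matZX_ne_zero : ∀ d ∈ poles3 K, expandRing3 K (lin (matZX K) d) ≠ 0 := by
  refine l3_ne_zero _ _ ![1, 3, 5] (poles3_forall ?_ ?_ ?_ ?_ ?_) <;>
    simp [Fin.sum_univ_three] <;> norm_num

theorem matZX_ne_zeroYB : ∀ d ∈ polesYB K, expandRing3 K (lin (matZX K) d) ≠ 0 := by
  refine l3_ne_zero _ _ ![1, 3, 5] (polesYB_forall ?_ ?_ ?_ ?_ ?_ ?_) <;>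
    simp [Fin.sum_univ_three] <;> norm_num

theorem idMat_ne_zeroYB : ∀ d ∈ polesYB K, expandRing3 K (lin (idMat K) d) ≠ 0 := by
  refine l3_ne_zero _ _ ![1, 3, 5] (polesYB_forall ?_ ?_ ?_ ?_ ?_ ?_) <;>
    simp [Fin.sum_univ_three] <;> norm_num

theorem ratL3_ne_zero13 : ∀ d ∈ polesS K,
    expandRing3 K (lin (![![0, 1, 1], ![1, 0, 0]] : Fin 2 → Fin 3 → K) d) ≠ 0 := by
  refine l3_ne_zero _ _ ![1, 3, 5] (polesS_forall ?_ ?_ ?_) <;>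
    simp [Fin.sum_univ_three] <;> norm_num

theorem ratL3_ne_zero23 : ∀ d ∈ polesS K,
    expandRing3 K (lin (![![0, 1, 0], ![1, 0, 0]] : Fin 2 → Fin 3 → K) d) ≠ 0 := by
  refine l3_ne_zero _ _ ![1, 3, 5] (polesS_forall ?_ ?_ ?_) <;>
    simp [Fin.sum_univ_three] <;> norm_num

theorem ratL3_ne_zero32 : ∀ d ∈ polesS K,
    expandRing3 K (lin (![![0, 0, 1], ![0, 1, 0]] : Fin 2 → Fin 3 → K) d) ≠ 0 := by
  refine l3_ne_zero _ _ ![1, 3, 5] (polesS_forall ?_ ?_ ?_) <;>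
    simp [Fin.sum_univ_three] <;> norm_num

end Triple

/-! ### Moving the third vector to the front -/

section Swap23
variable {K : Type*} [Field K] [CharZero K] {V : Type*} [AddCommGroup V] [Module K V]
  (Q : HDQuantumVertexAlgebra K V)

theorem idMat2_X (K : Type*) [Field K] [CharZero K] : ∀ d ∈ polesX K, MvPolynomial.eval
    (fun i => ∑ j, (![![1, 0], ![0, 1]] : Fin 2 → Fin 2 → K) i j * (![3, 5] : Fin 2 → K) j) d ≠ 0 := by
  refine polesX_forall ?_ ?_ <;> (simp; try norm_num)

theorem swapMat2_X (K : Type*) [Field K] [CharZero K] : ∀ d ∈ polesX K, MvPolynomial.eval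
    (fun i => ∑ j, swapMat2 K i j * (![3, 5] : Fin 2 → K) j) d ≠ 0 := by
  refine polesX_forall ?_ ?_ <;> (simp; try norm_num)

theorem matSum_X (K : Type*) [Field K] [CharZero K] : ∀ d ∈ polesX K, MvPolynomial.eval
    (fun i => ∑ j, matSum K i j * (![3, 5] : Fin 2 → K) j) d ≠ 0 := by
  refine polesX_forall ?_ ?_ <;> (simp; try norm_num)

theorem idMat2_S (K : Type*) [Field K] [CharZero K] : ∀ d ∈ polesS K, expandRing K
    (lin (![![1, 0], ![0, 1]] : Fin 2 → Fin 2 → K) d) ≠ 0 := by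
  refine l2_ne_zero _ _ ![3, 5] (polesS_forall ?_ ?_ ?_) <;> (simp; try norm_num)

theorem swapMat2_S (K : Type*) [Field K] [CharZero K] : ∀ d ∈ polesS K, expandRing K
    (lin (swapMat2 K) d) ≠ 0 := by
  refine l2_ne_zero _ _ ![3, 5] (polesS_forall ?_ ?_ ?_) <;> (simp; try norm_num)

theorem lmap2_rat_smul (f : V →ₗ[K] Lau K V) (r : Rat (polesS K)) (F : L2 K V) :
    lmap2 f (ratL2 (swapMat2 K) (polesS K) (swapMat2_S K) r • F)
      = ratL3 ![![0, 0, 1], ![0, 1, 0]] (polesS K) ratL3_ne_zero32 r • lmap2 f F := by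
  refine rat_smul_of_X (ratL2 (swapMat2 K) (polesS K) (swapMat2_S K))
    (ratL3 ![![0, 0, 1], ![0, 1, 0]] (polesS K) ratL3_ne_zero32) (lmap2 f) (fun i F => ?_) r F
  rw [ratL2_algebraMap, ratL3_algebraMap, lmap2_smul]
  refine congrArg (· • _) ?_
  fin_cases i
  · simp [lin_X, Fin.sum_univ_three, sliceRing_X1, expandRing3_X2]
  · simp [lin_X, Fin.sum_univ_three, sliceRing_X0, expandRing3_X1]

/-- With $z_1$ largest the triple product is $Y(a,z_1)$ applied to $X_{z_2,z_3}(b\otimes c)$, and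
braided commutativity is used on the inner factor. -/
theorem toL3_tripX_id (k : ℕ) (a b c : V) :
    toL3 (consMat ![![1, 0], ![0, 1]]) (poles3 K) id3_ne_zero (tripX Q k ((a ⊗ₜ b) ⊗ₜ c))
      = tc (fun i => lmap2 (TensorProduct.curry (Q.Y i) a))
        (bc (ratL2 (swapMat2 K) (polesS K) (swapMat2_S K))
          (fun i => toL2 (swapMat2 K) (polesX K) (l2_ne_zero _ _ _ (swapMat2_X K)) ∘ₗ Q.X i)
          Q.braid) k (c ⊗ₜ b) := by
  rw [toL3_tripX Q _ (idMat2_X K) id3_ne_zero, tc_apply]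
  refine Finset.sum_congr rfl fun p _ => congrArg _ ?_
  refine toL2_X_comm Q ?_ _ (l2_ne_zero _ _ _ (swapMat2_X K)) (idMat2_S K) (swapMat2_S K) _ b c
  funext i j
  fin_cases i <;> fin_cases j <;> rfl

theorem adm_32_id : ∀ d ∈ polesS K,
    expandRing3 K (lin (matMul ![![0, 0, 1], ![0, 1, 0]] (idMat K)) d) ≠ 0 := by
  have e3 : matMul ![![0, 0, 1], ![0, 1, 0]] (idMat K) = ![![0, 0, 1], ![0, 1, 0]] := by
    funext i j; fin_cases i <;> fin_cases j <;> simp [matMul, Fin.sum_univ_succ]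
  rw [e3]; exact ratL3_ne_zero32

theorem toL3_id_rat_smul (r : Rat (polesS K)) (m : Sing (polesYB K) V) :
    toL3 (idMat K) (polesYB K) idMat_ne_zeroYB (Rat.subst ![![0, 0, 1], ![0, 1, 0]] adm_32 r • m)
      = ratL3 ![![0, 0, 1], ![0, 1, 0]] (polesS K) ratL3_ne_zero32 r
        • toL3 (idMat K) (polesYB K) idMat_ne_zeroYB m := by
  have e3 : matMul ![![0, 0, 1], ![0, 1, 0]] (idMat K) = ![![0, 0, 1], ![0, 1, 0]] := by
    funext i j; fin_cases i <;> fin_cases j <;> simp [matMul, Fin.sum_univ_succ]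
  rw [toL3_rat_smul]
  refine congrArg (· • _) ?_
  exact DFunLike.congr_fun ((ratL3_subst adm_32 idMat_ne_zeroYB adm_32_id).trans
    (ratL3_congr e3 adm_32_id ratL3_ne_zero32)) r

theorem toL3_id_swap (x : Sing (poles3 K) V) :
    toL3 (idMat K) (polesYB K) idMat_ne_zeroYB
        (Sing.subst (consMat (swapMat2 K)) adm_swap23 x)
      = toL3 (consMat (swapMat2 K)) (poles3 K) swap23_ne_zero x := by
  have e2 : matMul (consMat (swapMat2 K)) (idMat K) = consMat (swapMat2 K) := by
    rw [swapMat2, consMat_explicit]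
    funext i j; fin_cases i <;> fin_cases j <;> simp [matMul, Fin.sum_univ_succ]
  have he2 : ∀ d ∈ poles3 K,
      expandRing3 K (lin (matMul (consMat (swapMat2 K)) (idMat K)) d) ≠ 0 := by
    rw [e2]; exact swap23_ne_zero
  rw [toL3_subst adm_swap23 idMat_ne_zeroYB he2, toL3_congr e2 he2 swap23_ne_zero]

theorem toL3_id_id (x : Sing (poles3 K) V) :
    toL3 (idMat K) (polesYB K) idMat_ne_zeroYB (Sing.subst (idMat K) adm_id3 x)
      = toL3 (consMat ![![1, 0], ![0, 1]]) (poles3 K) id3_ne_zero x := by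
  have e1 : matMul (idMat K) (idMat K) = consMat ![![1, 0], ![0, 1]] := by
    rw [consMat_explicit]
    funext i j; fin_cases i <;> fin_cases j <;> simp [matMul, Fin.sum_univ_succ]
  have he1 : ∀ d ∈ poles3 K, expandRing3 K (lin (matMul (idMat K) (idMat K)) d) ≠ 0 := by
    rw [e1]; exact id3_ne_zero
  rw [toL3_subst adm_id3 idMat_ne_zeroYB he1, toL3_congr e1 he1 id3_ne_zero]

/-- The leg $23$ only sees $c\otimes b$; the vector $a$ stays frozen in $Y(a,z_1)$. -/
theorem bc_swap23 (k : ℕ) (a b c : V) :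
    bc (ratL3 ![![0, 0, 1], ![0, 1, 0]] (polesS K) ratL3_ne_zero32)
        (fun i => toL3 (consMat (swapMat2 K)) (poles3 K) swap23_ne_zero ∘ₗ tripX Q i)
        (fun i => legMap (legEquiv23 K V) (Q.braid i)) k ((a ⊗ₜ c) ⊗ₜ b)
      = bc (ratL3 ![![0, 0, 1], ![0, 1, 0]] (polesS K) ratL3_ne_zero32)
        (tc (fun i => lmap2 (TensorProduct.curry (Q.Y i) a))
          (fun i => toL2 (swapMat2 K) (polesX K) (l2_ne_zero _ _ _ (swapMat2_X K)) ∘ₗ Q.X i))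
        Q.braid k (c ⊗ₜ b) := by
  refine (bc_legMap_apply (legEquiv23 K V)
    (ratL3 ![![0, 0, 1], ![0, 1, 0]] (polesS K) ratL3_ne_zero32)
    (fun i => toL3 (consMat (swapMat2 K)) (poles3 K) swap23_ne_zero ∘ₗ tripX Q i) Q.braid k
    (c ⊗ₜ b) a).trans ?_
  refine congrArg (fun y => bc _ y Q.braid k (c ⊗ₜ b)) (funext fun i => ?_)
  refine TensorProduct.ext' fun c b => ?_
  rw [tc_apply]
  exact toL3_tripX Q _ (swapMat2_X K) swap23_ne_zero i a c b

/-- The triple product with the last two variables exchanged. -/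
theorem subst_id_tripX (k : ℕ) (a b c : V) :
    Sing.subst (idMat K) adm_id3 (tripX Q k ((a ⊗ₜ b) ⊗ₜ c))
      = bc (Rat.subst ![![0, 0, 1], ![0, 1, 0]] adm_32)
        (fun i => Sing.subst (consMat (swapMat2 K)) adm_swap23 ∘ₗ tripX Q i)
        (fun i => legMap (legEquiv23 K V) (Q.braid i)) k ((a ⊗ₜ c) ⊗ₜ b) := by
  -- An identity of fractions may be tested in the single region $|z_1|>|z_2|>|z_3|$. The pole at
  -- $z_3$ has to be admitted because $S_{z_3,z_2}$ may have it.
  refine toL3_injective idMat_ne_zeroYB ?_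
  have h := tc_bc (ratL2 (swapMat2 K) (polesS K) (swapMat2_S K))
    (ratL3 ![![0, 0, 1], ![0, 1, 0]] (polesS K) ratL3_ne_zero32)
    (fun i => lmap2 (TensorProduct.curry (Q.Y i) a))
    (fun i r m => lmap2_rat_smul (TensorProduct.curry (Q.Y i) a) r m)
    (fun i => toL2 (swapMat2 K) (polesX K) (l2_ne_zero _ _ _ (swapMat2_X K)) ∘ₗ Q.X i) Q.braid
  rw [toL3_id_id, toL3_tripX_id, h, ← bc_swap23]
  symm
  refine map_bc _ _ _ (fun r m => ?_) (fun i u => ?_) _ _ _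
  · exact toL3_id_rat_smul r m
  · exact toL3_id_swap _

/-- Exchange of `b` and `c` in `X_{x+w,z,x}(a ⊗ c ⊗ b)`. -/
theorem toL3_matZX (k : ℕ) (a b c : V) :
    toL3 (matZX K) (poles3 K) matZX_ne_zero (tripX Q k ((a ⊗ₜ c) ⊗ₜ b))
      = bc (ratL3 ![![0, 1, 0], ![1, 0, 0]] (polesS K) ratL3_ne_zero23)
        (fun i => toL3 (matXZ K) (poles3 K) matXZ_ne_zero ∘ₗ tripX Q i)
        (fun i => legMap (legEquiv23 K V) (Q.braid i)) k ((a ⊗ₜ b) ⊗ₜ c) := by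
  have e1 : matMul (idMat K) (matZX K) = matZX K := by
    funext i j; fin_cases i <;> fin_cases j <;> simp [matMul, Fin.sum_univ_succ]
  have e2 : matMul (consMat (swapMat2 K)) (matZX K) = matXZ K := by
    rw [swapMat2, consMat_explicit]
    funext i j; fin_cases i <;> fin_cases j <;> simp [matMul, Fin.sum_univ_succ]
  have e3 : matMul ![![0, 0, 1], ![0, 1, 0]] (matZX K) = ![![0, 1, 0], ![1, 0, 0]] := by
    funext i j; fin_cases i <;> fin_cases j <;> simp [matMul, Fin.sum_univ_succ]
  have he1 : ∀ d ∈ poles3 K, expandRing3 K (lin (matMul (idMat K) (matZX K)) d) ≠ 0 := by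
    rw [e1]; exact matZX_ne_zero
  have he2 : ∀ d ∈ poles3 K,
      expandRing3 K (lin (matMul (consMat (swapMat2 K)) (matZX K)) d) ≠ 0 := by
    rw [e2]; exact matXZ_ne_zero
  have he3 : ∀ d ∈ polesS K,
      expandRing3 K (lin (matMul ![![0, 0, 1], ![0, 1, 0]] (matZX K)) d) ≠ 0 := by
    rw [e3]; exact ratL3_ne_zero23
  -- The identity of fractions is now expanded at $z_1=x+w$, $z_2=z$, $z_3=x$ for $|z|>|x|>|w|$, a
  -- region in which $z_1$ is not the largest variable.
  have h := congrArg (toL3 (matZX K) (polesYB K) matZX_ne_zeroYB) (subst_id_tripX Q k a c b)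
  rw [toL3_subst adm_id3 matZX_ne_zeroYB he1, toL3_congr e1 he1 matZX_ne_zero] at h
  rw [h]
  refine map_bc _ _ _ (fun r m => ?_) (fun i u => ?_) _ _ _
  · rw [toL3_rat_smul]
    refine congrArg (· • _) ?_
    exact DFunLike.congr_fun ((ratL3_subst adm_32 matZX_ne_zeroYB he3).trans
      (ratL3_congr e3 he3 ratL3_ne_zero23)) r
  · rw [LinearMap.comp_apply, LinearMap.comp_apply, toL3_subst adm_swap23 matZX_ne_zeroYB he2,
      toL3_congr e2 he2 matXZ_ne_zero]

/-- Exchange of `a` and `c` in `X_{z,x+w,x}(c ⊗ a ⊗ b)`. -/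
theorem toL3_matSum (k : ℕ) (a b c : V) :
    toL3 (consMat (matSum K)) (poles3 K) matSum_ne_zero (tripX Q k ((c ⊗ₜ a) ⊗ₜ b))
      = bc (ratL3 ![![0, 1, 1], ![1, 0, 0]] (polesS K) ratL3_ne_zero13)
        (fun i => toL3 (matZX K) (poles3 K) matZX_ne_zero ∘ₗ tripX Q i)
        (fun i => legMap (LinearEquiv.refl K _) (Q.braid i)) k ((a ⊗ₜ c) ⊗ₜ b) := by
  have e1 : matMul (swapMat K) (matZX K) = consMat (matSum K) := by
    rw [matSum, consMat_explicit]
    funext i j; fin_cases i <;> fin_cases j <;> simp [matMul, Fin.sum_univ_succ, swapMat]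
  have e3 : matMul (inclMat K) (matZX K) = ![![0, 1, 1], ![1, 0, 0]] := by
    funext i j; fin_cases i <;> fin_cases j <;> simp [matMul, Fin.sum_univ_succ]
  have he1 : ∀ d ∈ poles3 K, expandRing3 K (lin (matMul (swapMat K) (matZX K)) d) ≠ 0 := by
    rw [e1]; exact matSum_ne_zero
  have he3 : ∀ d ∈ polesS K, expandRing3 K (lin (matMul (inclMat K) (matZX K)) d) ≠ 0 := by
    rw [e3]; exact ratL3_ne_zero13
  have h := congrArg (toL3 (matZX K) (poles3 K) matZX_ne_zero) (subst_swap_tripX Q k c a b)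
  rw [toL3_subst adm_swap3 matZX_ne_zero he1, toL3_congr e1 he1 matSum_ne_zero] at h
  rw [h]
  refine map_bc _ _ _ (fun r m => ?_) (fun i u => rfl) _ _ _
  rw [toL3_rat_smul]
  refine congrArg (· • _) ?_
  exact DFunLike.congr_fun ((ratL3_subst adm_inclS matZX_ne_zero he3).trans
    (ratL3_congr e3 he3 ratL3_ne_zero13)) r

/-- The triple product in the variables `x + w, x, z`, expanded for `|z| > |x| > |w|`. -/
def tripXZ (k : ℕ) : (V ⊗[K] V) ⊗[K] V →ₗ[K] L3 K V :=
  toL3 (matXZ K) (poles3 K) matXZ_ne_zero ∘ₗ tripX Q k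

/-- Two exchanges, of $c$ with $a$ and of $c$ with $b$. Where $c$ comes first its variable $z$ is
the largest, so the triple product begins with $Y(c,z)$. -/
theorem sum_lmap2_X (k : ℕ) (a b c : V) :
    ∑ p ∈ Finset.HasAntidiagonal.antidiagonal k, lmap2 (TensorProduct.curry (Q.Y p.1) c)
        (toL2 (matSum K) (polesX K) (l2_ne_zero _ _ _ (matSum_X K)) (Q.X p.2 (a ⊗ₜ b)))
      = bc (ratL3 ![![0, 1, 1], ![1, 0, 0]] (polesS K) ratL3_ne_zero13)
        (bc (ratL3 ![![0, 1, 0], ![1, 0, 0]] (polesS K) ratL3_ne_zero23) (tripXZ Q)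
          (fun i => legMap (legEquiv23 K V) (Q.braid i)))
        (fun i => legMap (TensorProduct.rightComm K V V V) (Q.braid i)) k ((a ⊗ₜ b) ⊗ₜ c) := by
  rw [← toL3_tripX Q _ (matSum_X K) matSum_ne_zero, toL3_matSum]
  refine (bc_legMap_apply (LinearEquiv.refl K _) _ _ Q.braid k (a ⊗ₜ c) b).trans
    (Eq.trans ?_ (bc_legMap_apply (TensorProduct.rightComm K V V V) _ _ Q.braid k (a ⊗ₜ c) b).symm)
  refine congrArg (fun y => bc _ y Q.braid k (a ⊗ₜ c)) (funext fun i => ?_)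
  exact TensorProduct.ext' fun a c => toL3_matZX Q i a b c

end Swap23

/-! ### Broken translation covariance at $\gamma=x$ -/

section Exp
variable {K : Type*} [Field K] {V : Type*} [AddCommGroup V] [Module K V]

theorem applySeries_extend {A U N : Type*} [CommRing A] [Algebra K A] [AddCommGroup U] [Module K U]
    [AddCommGroup N] [Module K N] [Module A N] [IsScalarTower K A N] (y : ℕ → U →ₗ[K] N)
    (s : ℕ → U →ₗ[K] A ⊗[K] U) (k : ℕ) (u : U) :
    applySeries y (extend s) k u = bc (AlgHom.id K A) y s k u := by
  rw [applySeries, bc_apply]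
  refine Finset.sum_congr rfl fun p _ => ?_
  rw [liftBaseChange_eq, coeff_extend, lb_tmul, map_one, one_smul]

theorem expAct_mk_one (D : V →ₗ[K] V) {n : ℕ} (i : Fin n) (P : Set (MvPolynomial (Fin n) K))
    (F : PS n V) : expAct D i P (LocalizedModule.mk F 1) = LocalizedModule.mk (expSeries D i • F) 1 :=
  IsLocalizedModule.map_LocalizedModules (dens P) (psMul (expSeries D i)) F 1

theorem expAct_smul (D : V →ₗ[K] V) {n : ℕ} (i : Fin n) (P : Set (MvPolynomial (Fin n) K))
    (p : MvPolynomial (Fin n) K) (x : Sing P V) : expAct D i P (p • x) = p • expAct D i P x :=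
  map_smul _ _ _

theorem subst_incl (F : PS 2 V) (b : Fin 3 →₀ ℕ) : PS.subst (inclMat K) F b
    = if b 2 = 0 then F (Finsupp.cons (b 0) (Finsupp.single 0 (b 1))) else 0 := by
  have : inclMat K = rowMat K ![some 0, some 1] := by
    ext i j; fin_cases i <;> fin_cases j <;> simp [rowMat]
  rw [this]
  split_ifs with hb
  · refine subst_rowMat _ _ _ _ fun a => ?_
    simp [Fin.forall_fin_succ, Fin.sum_univ_succ, DFunLike.ext_iff, hb]
  · refine subst_rowMat_zero _ _ _ fun a => ?_
    simp [Fin.forall_fin_succ, Fin.sum_univ_succ, Ne.symm hb]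

/-- $F$ does not involve the third variable, so all its powers come from the exponential. -/
theorem expSeries_smul_incl (D : V →ₗ[K] V) (F : PS 2 V) (a : Fin 3 →₀ ℕ) :
    (expSeries D (2 : Fin 3) • PS.subst (inclMat K) F) a
      = ((a 2).factorial : K)⁻¹ • (D ^ a 2) (F (Finsupp.cons (a 0) (Finsupp.single 0 (a 1)))) := by
  have hle : Finsupp.single 2 (a 2) ≤ a := by rw [Finsupp.single_le_iff]
  rw [ps_smul_apply, Finset.sum_eq_single (Finsupp.single 2 (a 2), a - Finsupp.single 2 (a 2))]
  · rw [subst_incl, if_pos (by simp)]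
    change (if _ then _ else _ : Module.End K V) _ = _
    simp
  · rintro ⟨i, j⟩ hij hne
    rw [Finset.HasAntidiagonal.mem_antidiagonal] at hij
    dsimp only at hij ⊢
    rw [subst_incl]
    by_cases hi : i = Finsupp.single 2 (i 2)
    · rw [if_neg, smul_zero]
      intro hj
      have h2 : i 2 = a 2 := by rw [← hij]; simp [hj]
      refine hne ?_
      rw [h2] at hi
      rw [Prod.mk.injEq]
      exact ⟨hi, by rw [← hi, ← hij]; simp⟩
    · have : MvPowerSeries.coeff i (expSeries D (2 : Fin 3)) = 0 := if_neg hi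
      rw [this, zero_smul]
  · intro h
    exact absurd (Finset.HasAntidiagonal.mem_antidiagonal.2 (add_tsub_cancel_of_le hle)) h

/-- `v ↦ e^{zD} v`. -/
def expL (D : V →ₗ[K] V) : V →ₗ[K] Lau K V where
  toFun v := Lau.ofNat K fun n => (n.factorial : K)⁻¹ • (D ^ n) v
  map_add' u v := Lau.ext fun k => by
    rw [lau_coeff_add, Lau.coeff_ofNat, Lau.coeff_ofNat, Lau.coeff_ofNat]
    split_ifs <;> simp
  map_smul' c v := Lau.ext fun k => by
    rw [RingHom.id_apply, lau_coeff_smul, Lau.coeff_ofNat, Lau.coeff_ofNat, map_smul, smul_comm]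
    split_ifs <;> simp

theorem expL_coeff (D : V →ₗ[K] V) (v : V) (k : ℤ) : Lau.coeff (expL D v) k
    = if 0 ≤ k then (k.toNat.factorial : K)⁻¹ • (D ^ k.toNat) v else 0 := rfl

/-- `z_1, z_2, γ ↦ w, 0, x` in the variables `x, w`. -/
abbrev matT (K : Type*) [Field K] : Fin 3 → Fin 2 → K := ![![0, 1], ![0, 0], ![1, 0]]

theorem matT_ne_zero [CharZero K] : ∀ d ∈ polesT K, expandRing K (lin (matT K) d) ≠ 0 := by
  intro d hd
  simp only [polesT, Set.mem_insert_iff, Set.mem_singleton_iff] at hd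
  rcases hd with rfl | rfl | rfl
  · simp [lin_X, expandRing_X1, y_ne_zero]
  · simp [lin_X, expandRing_X1, y_ne_zero]
  · simp [lin_X, expandRing_X1, expandRing_X0, add_comm, x_add_y_ne_zero]

theorem lauMap_flatRing_smul (f : V →ₗ[K] Lau K V) (p : MvPolynomial (Fin 2) K) (F : Lau K V) :
    Lau.map f (flatRing K (lin ![![1], ![0]] p) • F)
      = expandRing K (lin (matMul (inclMat K) (matT K)) p) • Lau.map f F := by
  refine mvPolynomial_smul_of_X ((flatRing K).comp (lin ![![1], ![0]]))
    ((expandRing K).comp (lin (matMul (inclMat K) (matT K)))) (Lau.map f) (fun i F => ?_) p F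
  rw [AlgHom.comp_apply, AlgHom.comp_apply]
  fin_cases i
  · have h1 : flatRing K (lin (![![1], ![0]] : Fin 2 → Fin 1 → K) (MvPolynomial.X 0)) = Lau.T K := by
      simp [lin_X, flatRing]
    have h2 : expandRing K (lin (matMul (inclMat K) (matT K)) (MvPolynomial.X 0)) = L2Ring.y K := by
      simp [lin_X, matMul, Fin.sum_univ_succ, expandRing_X1]
    simp only [Fin.zero_eta]
    rw [h1, h2, lauMap_T_smul]; rfl
  · have h1 : flatRing K (lin (![![1], ![0]] : Fin 2 → Fin 1 → K) (MvPolynomial.X 1)) = 0 := by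
      simp [lin_X]
    have h2 : expandRing K (lin (matMul (inclMat K) (matT K)) (MvPolynomial.X 1)) = 0 := by
      simp [lin_X, matMul, Fin.sum_univ_succ]
    simp only [Fin.mk_one]
    rw [h1, h2, zero_smul (LaurentSeries K) F, zero_smul (L2Ring K) (Lau.map f F), map_zero]

variable [CharZero K]

/-- At $z_1=w$, $z_2=0$, $\gamma=x$ both poles of $X$ become $w$, so $X$ turns into $Y_w$ and
$e^{xD}$ acts on the coefficients of the powers of $w$. -/
theorem toL2_expAct (D : V →ₗ[K] V) (y : Sing (polesX K) V) :
    toL2 (matT K) (polesT K) matT_ne_zero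
        (expAct D 2 (polesT K) (Sing.subst (inclMat K) (adm_incl K) y))
      = Lau.map (expL D) (Sing.flat (Sing.subst ![![1], ![0]] (adm_eval K) y)) := by
  refine locLift_ext (R' := L2Ring K)
    (φ := ((expandRing K).comp (lin (matMul (inclMat K) (matT K)))).toRingHom)
    (fun d hd => isUnit_end (isUnit_iff_ne_zero.2 ?_))
    (fun y => toL2 (matT K) (polesT K) matT_ne_zero
        (expAct D 2 (polesT K) (Sing.subst (inclMat K) (adm_incl K) y)))
    (fun y => Lau.map (expL D) (Sing.flat (Sing.subst ![![1], ![0]] (adm_eval K) y)))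
    (fun p x => ?_) (fun p x => ?_) (fun F => ?_) y
  · change expandRing K (lin (matMul (inclMat K) (matT K)) d) ≠ 0
    simp only [polesX, Set.mem_insert_iff, Set.mem_singleton_iff] at hd
    rcases hd with rfl | rfl <;>
    simp [lin_X, matMul, Fin.sum_univ_succ, expandRing_X1, y_ne_zero]
  · rw [Sing.subst_smul, expAct_smul, toL2_smul, ← AlgHom.comp_apply (lin (matT K)), lin_comp]
    rfl
  · rw [Sing.subst_smul, singFlat_smul, lauMap_flatRing_smul]
    rfl
  · rw [Sing.subst_mk_one, Sing.subst_mk_one, singFlat_mk_one, expAct_mk_one, toL2_mk_one]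
    refine Lau.ext fun n => Lau.ext fun m => ?_
    rw [Lau.coeff_map, expL_coeff]
    change Lau.coeff (Lau.coeff (flatFun (LaurentSeries K) (peelFun K _)) n) m
      = if 0 ≤ m then _ • (D ^ m.toNat) (Lau.coeff (flatFun K _) n) else 0
    rw [flatFun_coeff, flatFun_coeff]
    by_cases hn : 0 ≤ n
    · rw [if_pos hn, if_pos hn, peelFun_coeff, subst_evalSnd]
      refine if_congr Iff.rfl ?_ rfl
      have hM : matT K = rowMat K ![some 1, none, some 0] := by
        ext i j; fin_cases i <;> fin_cases j <;> simp [rowMat]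
      rw [hM, subst_rowMat _ _ _ (Finsupp.cons n.toNat (Finsupp.cons 0 (Finsupp.single 0 m.toNat))),
        expSeries_smul_incl]
      · have e2 : (Finsupp.cons n.toNat (Finsupp.cons 0 (Finsupp.single 0 m.toNat)) : Fin 3 →₀ ℕ) 2
            = m.toNat := by
          rw [show (2 : Fin 3) = Fin.succ (Fin.succ 0) from rfl, Finsupp.cons_succ,
            Finsupp.cons_succ, Finsupp.single_eq_same]
        have e1 : (Finsupp.cons n.toNat (Finsupp.cons 0 (Finsupp.single 0 m.toNat)) : Fin 3 →₀ ℕ) 1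
            = 0 := rfl
        rw [e2, e1, Finsupp.cons_zero, Finsupp.single_zero]
      · intro a
        simp [Fin.forall_fin_succ, Fin.sum_univ_succ, DFunLike.ext_iff]
        tauto
    · rw [if_neg hn, if_neg hn, map_zero, smul_zero, ite_self]
      rfl

variable (Q : HDQuantumVertexAlgebra K V)

theorem toL2_expAct_rat_smul (r : Rat (polesT K)) (x : Sing (polesT K) V) :
    toL2 (matT K) (polesT K) matT_ne_zero (expAct Q.D 2 (polesT K) (r • x))
      = ratL2 (matT K) (polesT K) matT_ne_zero r
        • toL2 (matT K) (polesT K) matT_ne_zero (expAct Q.D 2 (polesT K) x) := by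
  refine rat_smul_of_X (AlgHom.id K (Rat (polesT K))) (ratL2 (matT K) (polesT K) matT_ne_zero)
    (toL2 (matT K) (polesT K) matT_ne_zero ∘ₗ
      (endLoc (polesT K) (psEnd (K := K) (expSeries Q.D 2))).restrictScalars K) (fun i m => ?_) r x
  rw [AlgHom.id_apply, algebraMap_smul, ratL2_algebraMap]
  change toL2 (matT K) (polesT K) matT_ne_zero (expAct Q.D 2 (polesT K) _) = _
  rw [expAct_smul, toL2_smul]
  rfl

/-- Broken translation covariance, expanded for `γ = x`, `z_1 = w`, `z_2 = 0` and `|x| > |w|`. -/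
theorem toL2_matSum (k : ℕ) (a b : V) :
    toL2 (matSum K) (polesX K) (l2_ne_zero _ _ _ (matSum_X K)) (Q.X k (a ⊗ₜ b))
      = bc (ratL2 (matT K) (polesT K) matT_ne_zero) (fun i => Lau.map (expL Q.D) ∘ₗ Q.Y i)
        Q.trans k (a ⊗ₜ b) := by
  have e1 : matMul ![![1, 0, 1], ![0, 1, 1]] (matT K) = matSum K := by
    funext i j; fin_cases i <;> fin_cases j <;> simp [matMul, Fin.sum_univ_succ]
  have he1 : ∀ d ∈ polesX K,
      expandRing K (lin (matMul ![![1, 0, 1], ![0, 1, 1]] (matT K)) d) ≠ 0 := by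
    rw [e1]; exact l2_ne_zero _ _ _ (matSum_X K)
  have h := congrArg (toL2 (matT K) (polesT K) matT_ne_zero) (Q.translation k a b)
  rw [toL2_subst (adm_shift K) matT_ne_zero he1,
    toL2_congr e1 he1 (l2_ne_zero _ _ _ (matSum_X K)), applySeries_extend] at h
  rw [← h]
  exact map_bc (AlgHom.id K _) (ratL2 (matT K) (polesT K) matT_ne_zero)
    (toL2 (matT K) (polesT K) matT_ne_zero ∘ₗ
      (endLoc (polesT K) (psEnd (K := K) (expSeries Q.D 2))).restrictScalars K)
    (fun r m => toL2_expAct_rat_smul Q r m)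
    (fun i u => toL2_expAct Q.D (Q.X i u)) Q.trans k (a ⊗ₜ b)

end Exp

/-! ### Composites $f(Z\otimes1)$ with Laurent series $Z$ in $w$ -/

section Coefficientwise
variable {K : Type*} [Field K] {V : Type*} [AddCommGroup V] [Module K V]

/-- The coefficientwise application of `f : V → V((z))((x))` to Laurent series in `w`. -/
def l3map : (V →ₗ[K] L2 K V) →ₗ[K] Lau K V →ₗ[K] L3 K V :=
  LinearMap.mk₂ K (fun f F => HahnModule.of (L2Ring K) (((HahnModule.of K).symm F).map f))
    (fun _ _ _ => Lau.ext fun _ => rfl)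
    (fun c f F => Lau.ext fun k => (L3_coeff_smul K c
      (HahnModule.of (L2Ring K) (((HahnModule.of K).symm F).map f)) k).symm)
    (fun f _ _ => Lau.ext fun _ => map_add f _ _)
    (fun c f F => Lau.ext fun k => (map_smul f c (Lau.coeff F k)).trans (L3_coeff_smul K c
      (HahnModule.of (L2Ring K) (((HahnModule.of K).symm F).map f)) k).symm)

theorem coeff_l3map (f : V →ₗ[K] L2 K V) (F : Lau K V) (k : ℤ) :
    Lau.coeff (l3map f F) k = f (F.coeff k) := rfl

/-- `u ⊗ c ↦ f(Z(u) ⊗ c)`, where `f` is applied to the coefficients of the Laurent series `Z(u)`;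
power series in `t`. -/
def coefOp {U : Type*} [AddCommGroup U] [Module K U] (f : ℕ → V ⊗[K] V →ₗ[K] L2 K V)
    (Z : ℕ → U →ₗ[K] Lau K V) (k : ℕ) : U ⊗[K] V →ₗ[K] L3 K V :=
  ∑ p ∈ Finset.HasAntidiagonal.antidiagonal k,
    TensorProduct.lift ((l3map ∘ₗ (TensorProduct.curry (f p.1)).flip).compl₂ (Z p.2)).flip

theorem coefOp_apply {U : Type*} [AddCommGroup U] [Module K U] (f : ℕ → V ⊗[K] V →ₗ[K] L2 K V)
    (Z : ℕ → U →ₗ[K] Lau K V) (k : ℕ) (u : U) (c : V) :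
    coefOp f Z k (u ⊗ₜ c) = ∑ p ∈ Finset.HasAntidiagonal.antidiagonal k,
      l3map ((TensorProduct.curry (f p.1)).flip c) (Z p.2 u) := by
  simp [coefOp]

theorem toL2_id_eq_flat (h) (x : Sing (polesX K) V) :
    toL2 ![![1, 0], ![0, 1]] (polesX K) h x = flat (K := LaurentSeries K) (evX x) :=
  toL2_eq_flat _ _ x

end Coefficientwise

/-! ### The composite with $c$ in front -/

section Expansion
variable {K : Type*} [Field K] [CharZero K] {V : Type*} [AddCommGroup V] [Module K V]
  (Q : HDQuantumVertexAlgebra K V)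

/-- The expansion of `X_{x,z}` in the region `|z| > |x|`. -/
def expXZ (k : ℕ) : V ⊗[K] V →ₗ[K] L2 K V :=
  toL2 (swapMat2 K) (polesX K) (l2_ne_zero _ _ _ (swapMat2_X K)) ∘ₗ Q.X k

/-- `v ⊗ c ↦ X_{z,x}(c ⊗ v)`, expanded in the region `|z| > |x|`. -/
def expZX (k : ℕ) : V ⊗[K] V →ₗ[K] L2 K V :=
  toL2 ![![1, 0], ![0, 1]] (polesX K) (l2_ne_zero _ _ _ (idMat2_X K)) ∘ₗ Q.X k ∘ₗ
    (TensorProduct.comm K V V).toLinearMap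

/-- Braided commutativity, expanded for $|z|>|x|$. -/
theorem expZX_eq (k : ℕ) : expZX Q k
    = bc (ratL2 (swapMat2 K) (polesS K) (swapMat2_S K)) (expXZ Q) Q.braid k := by
  refine TensorProduct.ext' fun v c => ?_
  refine toL2_X_comm Q ?_ (l2_ne_zero _ _ _ (idMat2_X K)) (l2_ne_zero _ _ _ (swapMat2_X K))
    (idMat2_S K) (swapMat2_S K) _ c v
  funext i j
  fin_cases i <;> fin_cases j <;> rfl

theorem coeff_expZX (k : ℕ) (v c : V) (n : ℤ) : Lau.coeff (expZX Q k (v ⊗ₜ c)) n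
    = if 0 ≤ n then (n.toNat.factorial : K)⁻¹ • Q.Y k (c ⊗ₜ (Q.D ^ n.toNat) v) else 0 := by
  change Lau.coeff (toL2 _ _ (l2_ne_zero _ _ _ (idMat2_X K)) (Q.X k (c ⊗ₜ v))) n = _
  rw [toL2_id_eq_flat]
  change Lau.coeff (flatFun (LaurentSeries K) (evX (Q.X k (c ⊗ₜ v)))) n = _
  rw [flatFun_coeff, evX_X]

/-- By covariance the second variable of $X$ is the parameter of an exponential. Thus the factor
$e^{xD}$ of broken translation covariance can be absorbed into $X_{z,x}$. -/
theorem lauMap_expL (k : ℕ) (v c : V) :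
    Lau.map (TensorProduct.curry (Q.Y k) c) (expL Q.D v) = expZX Q k (v ⊗ₜ c) := by
  refine Lau.ext fun n => ?_
  rw [Lau.coeff_map, expL_coeff, coeff_expZX]
  split_ifs
  · rw [map_smul]; rfl
  · exact map_zero _

theorem lmap2_lauMap_expL (k : ℕ) (c : V) (G : Lau K V) :
    lmap2 (TensorProduct.curry (Q.Y k) c) (Lau.map (expL Q.D) G)
      = l3map ((TensorProduct.curry (expZX Q k)).flip c) G :=
  Lau.ext fun n => by
    rw [coeff_lmap2, Lau.coeff_map, lauMap_expL, coeff_l3map]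
    rfl

/-- `z_1, z_2, γ ↦ w, 0, x` in the variables `z, x, w`. -/
abbrev matT3 (K : Type*) [Field K] : Fin 3 → Fin 3 → K := ![![0, 0, 1], ![0, 0, 0], ![0, 1, 0]]

theorem matT3_ne_zero : ∀ d ∈ polesT K, expandRing3 K (lin (matT3 K) d) ≠ 0 := by
  refine l3_ne_zero _ _ ![1, 3, 5] ?_
  intro d hd
  simp only [polesT, Set.mem_insert_iff, Set.mem_singleton_iff] at hd
  rcases hd with rfl | rfl | rfl <;> (simp [Fin.sum_univ_three]; try norm_num)

theorem lmap2_ratT_smul (f : V →ₗ[K] Lau K V) (r : Rat (polesT K)) (F : L2 K V) :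
    lmap2 f (ratL2 (matT K) (polesT K) matT_ne_zero r • F)
      = ratL3 (matT3 K) (polesT K) matT3_ne_zero r • lmap2 f F := by
  refine rat_smul_of_X (ratL2 (matT K) (polesT K) matT_ne_zero)
    (ratL3 (matT3 K) (polesT K) matT3_ne_zero) (lmap2 f) (fun i F => ?_) r F
  rw [ratL2_algebraMap, ratL3_algebraMap, lmap2_smul]
  refine congrArg (· • _) ?_
  fin_cases i
  · simp [lin_X, Fin.sum_univ_three, sliceRing_X1, expandRing3_X2]
  · simp [lin_X, Fin.sum_univ_three]
  · simp [lin_X, Fin.sum_univ_three, sliceRing_X0, expandRing3_X1]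

/-- $X_{x+w,x}$ is rewritten as $e^{xD}Y_wS^{(x)}_{w,0}$ and the exponential is absorbed by
`lauMap_expL`. The left side is that of `sum_lmap2_X`, which is thus evaluated in a second way. -/
theorem lmap2_toL2_matSum (k : ℕ) (a b c : V) :
    ∑ p ∈ Finset.HasAntidiagonal.antidiagonal k, lmap2 (TensorProduct.curry (Q.Y p.1) c)
        (toL2 (matSum K) (polesX K) (l2_ne_zero _ _ _ (matSum_X K)) (Q.X p.2 (a ⊗ₜ b)))
      = bc (ratL3 (matT3 K) (polesT K) matT3_ne_zero) (coefOp (expZX Q) Q.Y)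
        (fun i => legMap (LinearEquiv.refl K _) (Q.trans i)) k ((a ⊗ₜ b) ⊗ₜ c) := by
  have h := tc_bc (ratL2 (matT K) (polesT K) matT_ne_zero)
    (ratL3 (matT3 K) (polesT K) matT3_ne_zero)
    (fun i => lmap2 (TensorProduct.curry (Q.Y i) c))
    (fun i r m => lmap2_ratT_smul (TensorProduct.curry (Q.Y i) c) r m)
    (fun i => Lau.map (expL Q.D) ∘ₗ Q.Y i) Q.trans
  have h2 := DFunLike.congr_fun (congrFun h k) (a ⊗ₜ b)
  rw [tc_apply] at h2
  refine (Finset.sum_congr rfl fun p _ => congrArg _ (toL2_matSum Q p.2 a b)).trans (h2.trans ?_)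
  refine Eq.trans ?_ (bc_legMap_apply (LinearEquiv.refl K _) _ _ Q.trans k (a ⊗ₜ b) c).symm
  refine congrArg (fun y => bc _ y Q.trans k (a ⊗ₜ b)) (funext fun i => LinearMap.ext fun u => ?_)
  rw [tc_apply]
  refine Eq.trans ?_ (coefOp_apply (expZX Q) Q.Y i u c).symm
  exact Finset.sum_congr rfl fun p _ => lmap2_lauMap_expL Q p.1 c (Q.Y p.2 u)

end Expansion

/-! ### Setting $w_2=0$ in the hexagon -/

section EvalFst
variable {A M B P : Type*} [CommRing A] [AddCommGroup M] [Module A M] [CommRing B] [AddCommGroup P]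
  [Module B P] {ρ : A →+* B}

theorem isUnit_T (B : Type*) [CommRing B] : IsUnit (Lau.T B) := by
  refine IsUnit.of_mul_eq_one (HahnSeries.single (-1) 1) ?_
  rw [Lau.T, HahnSeries.single_mul_single]
  simp

/-- `z_1 ↦ w`, `z_2 ↦ 0`. -/
def evalFstRing (ρ : A →+* B) : MvPolynomial (Fin 2) A →+* LaurentSeries B :=
  MvPolynomial.eval₂Hom ((algebraMap B (LaurentSeries B)).comp ρ) ![Lau.T B, 0]

theorem evalFstRing_C (r : A) :
    evalFstRing ρ (MvPolynomial.C r) = algebraMap B (LaurentSeries B) (ρ r) := by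
  simp [evalFstRing]

theorem evalFstRing_X0 : evalFstRing ρ (MvPolynomial.X 0) = Lau.T B := by
  simp [evalFstRing]

theorem evalFstRing_X1 : evalFstRing ρ (MvPolynomial.X 1) = 0 := by
  simp [evalFstRing]

/-- The coefficients of `Θ(F(w, 0))`. -/
def evalFstFun (Θ : M →ₛₗ[ρ] P) (F : PS 2 M) : Lau B P :=
  Lau.ofNat B fun n => Θ (F (Finsupp.cons n 0))

theorem coeff_evalFstFun (Θ : M →ₛₗ[ρ] P) (F : PS 2 M) (n : ℤ) :
    Lau.coeff (evalFstFun Θ F) n = if 0 ≤ n then Θ (F (Finsupp.cons n.toNat 0)) else 0 := rfl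

/-- The map `F(z_1, z_2) ↦ Θ(F(w, 0))` on power series. -/
def evalFst (Θ : M →ₛₗ[ρ] P) : PS 2 M →ₛₗ[evalFstRing ρ] Lau B P :=
  semilin _
    { toFun := evalFstFun Θ
      map_zero' := Lau.ext fun k => by
        rw [coeff_evalFstFun]
        exact (if_congr Iff.rfl (map_zero Θ) rfl).trans (ite_self 0)
      map_add' := fun F G => Lau.ext fun k => by
        rw [lau_coeff_add, coeff_evalFstFun, coeff_evalFstFun, coeff_evalFstFun]
        split_ifs
        · exact map_add Θ _ _
        · simp }
    (fun k F => Lau.ext fun n => by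
      rw [evalFstRing_C, Lau.coeff_C_smul]
      change Lau.coeff (evalFstFun Θ _) n = ρ k • Lau.coeff (evalFstFun Θ F) n
      rw [coeff_evalFstFun, coeff_evalFstFun, C_smul_apply]
      split_ifs
      · exact map_smulₛₗ Θ k _
      · simp)
    (fun i F => Lau.ext fun n => by
      fin_cases i
      · change Lau.coeff (evalFstFun Θ ((MvPolynomial.X 0 : MvPolynomial (Fin 2) A) • F)) n
          = Lau.coeff (evalFstRing ρ (MvPolynomial.X 0) • evalFstFun Θ F) n
        rw [evalFstRing_X0, Lau.coeff_T_smul]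
        rw [coeff_evalFstFun, coeff_evalFstFun, X_smul_apply, Finsupp.cons_zero]
        by_cases h0 : 0 ≤ n
        · by_cases h1 : n = 0
          · simp [h1]
          · have h2 : 0 ≤ n - 1 := by omega
            have h3 : n.toNat ≠ 0 := by omega
            have h4 : (Finsupp.cons n.toNat 0 - Finsupp.single 0 1 : Fin 2 →₀ ℕ)
                = Finsupp.cons (n - 1).toNat 0 := by
              ext j
              refine Fin.cases ?_ (fun j => ?_) j
              · simp
              · simp
            rw [if_pos h0, if_pos h2]
            exact congrArg Θ ((if_neg h3).trans (congrArg F h4))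
        · have h2 : ¬ 0 ≤ n - 1 := by omega
          rw [if_neg h0, if_neg h2]
      · change Lau.coeff (evalFstFun Θ ((MvPolynomial.X 1 : MvPolynomial (Fin 2) A) • F)) n
          = Lau.coeff (evalFstRing ρ (MvPolynomial.X 1) • evalFstFun Θ F) n
        rw [evalFstRing_X1, zero_smul (LaurentSeries B)]
        change _ = (0 : P)
        have h : (Finsupp.cons n.toNat 0 : Fin 2 →₀ ℕ) 1 = 0 := rfl
        rw [coeff_evalFstFun, X_smul_apply]
        exact (if_congr Iff.rfl ((congrArg Θ (if_pos h)).trans (map_zero Θ)) rfl).trans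
          (ite_self 0))

/-- The map `F(z_1, z_2) ↦ Θ(F(w, 0))`. -/
def singLau (Θ : M →ₛₗ[ρ] P) : Sing (polesX A) M →ₛₗ[evalFstRing ρ] Lau B P :=
  locLift (polesX A) (evalFst Θ) fun d hd => isUnit_end (by
    simp only [polesX, Set.mem_insert_iff, Set.mem_singleton_iff] at hd
    rcases hd with rfl | rfl
    · rw [evalFstRing_X0]; exact isUnit_T B
    · rw [map_sub, evalFstRing_X0, evalFstRing_X1, sub_zero]; exact isUnit_T B)

theorem singLau_mk_one (Θ : M →ₛₗ[ρ] P) (F : PS 2 M) :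
    singLau Θ (LocalizedModule.mk F 1) = evalFst Θ F := locLift_mk_one _ _ _ _

theorem coe_smul_sing {n : ℕ} {D : Set (MvPolynomial (Fin n) A)} (p : MvPolynomial (Fin n) A)
    (x : Sing D M) : (p : MvPowerSeries (Fin n) A) • x = p • x := by
  induction x using LocalizedModule.induction_on with
  | _ F s => rw [singPS_smul_mk, LocalizedModule.smul'_mk, poly_smul_eq]

end EvalFst

/-! ### Applying $X_{x,z}$ to the coefficients of the hexagon -/

section ApplyL3
variable {K : Type*} [Field K] {V : Type*} [AddCommGroup V] [Module K V] {A U : Type*} [CommRing A]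
  [Algebra K A] [AddCommGroup U] [Module K U] (ρ : A →ₐ[K] L2Ring K) (f : U →ₗ[K] L2 K V)

/-- The extension of scalars of `f`. -/
def lbSemi : A ⊗[K] U →ₛₗ[ρ.toRingHom] L2 K V where
  toFun := lb ρ f
  map_add' := map_add _
  map_smul' := lb_smul _ _

theorem singLau_smul (p : MvPolynomial (Fin 2) A) (x : Sing (polesX A) (A ⊗[K] U)) :
    singLau (lbSemi ρ f) (p • x) = evalFstRing ρ.toRingHom p • singLau (lbSemi ρ f) x :=
  (singLau (lbSemi ρ f)).map_smul' p x

/-- The application of `f` to the coefficients of a series in `w`. -/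
def applyL3 : Sing (polesX A) (A ⊗[K] U) →ₗ[K] L3 K V where
  toFun x := singLau (lbSemi ρ f) x
  map_add' := map_add _
  map_smul' c x := by
    have h : evalFstRing ρ.toRingHom (algebraMap K (MvPolynomial (Fin 2) A) c)
        = algebraMap K (L3Ring K) c := by
      rw [IsScalarTower.algebraMap_apply K A, MvPolynomial.algebraMap_eq, evalFstRing_C]
      exact congrArg (algebraMap (L2Ring K) (LaurentSeries (L2Ring K))) (ρ.commutes c)
    rw [← algebraMap_smul (MvPolynomial (Fin 2) A) c x, singLau_smul, h, RingHom.id_apply]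
    exact algebraMap_smul (L3Ring K) c (singLau (lbSemi ρ f) x : L3 K V)

theorem applyL3_smul (p : MvPolynomial (Fin 2) A) (x : Sing (polesX A) (A ⊗[K] U)) :
    applyL3 ρ f (p • x) = (evalFstRing ρ.toRingHom p : L3Ring K) • applyL3 ρ f x :=
  singLau_smul ρ f p x

/-- The shifted braiding acts through power series in $w_1,w_2$, but the shifted variables
themselves are polynomials, whose evaluation is known; for the inverted denominators `rat_smul_of_X`
does the rest. -/
theorem applyL3_ps_smul {n : ℕ} {D : Set (MvPolynomial (Fin n) K)}
    (σ : Rat D →ₐ[K] MvPowerSeries (Fin 2) A) (ρ' : Rat D →ₐ[K] L3Ring K)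
    (h : ∀ i, ∃ p : MvPolynomial (Fin 2) A, σ (algebraMap (MvPolynomial (Fin n) K) (Rat D) (MvPolynomial.X i)) = p ∧
      evalFstRing ρ.toRingHom p = ρ' (algebraMap (MvPolynomial (Fin n) K) (Rat D) (MvPolynomial.X i))) (r : Rat D)
    (x : Sing (polesX A) (A ⊗[K] U)) :
    applyL3 ρ f (σ r • x) = ρ' r • applyL3 ρ f x := by
  refine rat_smul_of_X σ ρ' (applyL3 ρ f) (fun j x => ?_) r x
  obtain ⟨p, h1, h2⟩ := h j
  rw [h1, coe_smul_sing, applyL3_smul, h2]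

theorem l3map_T_smul (f : V →ₗ[K] L2 K V) (F : Lau K V) :
    l3map f (Lau.T K • F) = L2Ring.y (LaurentSeries K) • l3map f F :=
  Lau.ext fun n => by
    rw [coeff_l3map, Lau.coeff_T_smul, L2Ring.y, Lau.coeff_T_smul, coeff_l3map]

abbrev matW (K : Type*) [Field K] : Fin 2 → Fin 3 → K := ![![0, 0, 1], ![0, 0, 0]]

theorem expandRing3_matW0 :
    expandRing3 K (lin (matW K) (MvPolynomial.X 0)) = L2Ring.y (LaurentSeries K) := by
  simp [lin_X, Fin.sum_univ_succ, ← expandRing3_X2]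

theorem expandRing3_matW1 : expandRing3 K (lin (matW K) (MvPolynomial.X 1)) = 0 := by
  simp [lin_X, Fin.sum_univ_succ]

theorem l3map_flatRing_smul (f : V →ₗ[K] L2 K V) (p : MvPolynomial (Fin 2) K) (F : Lau K V) :
    l3map f (flatRing K (lin ![![1], ![0]] p) • F)
      = expandRing3 K (lin (matW K) p) • l3map f F := by
  refine mvPolynomial_smul_of_X ((flatRing K).comp (lin ![![1], ![0]]))
    ((expandRing3 K).comp (lin (matW K))) (l3map f) (fun i F => ?_) p F
  rw [AlgHom.comp_apply, AlgHom.comp_apply]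
  fin_cases i
  · have h1 : flatRing K (lin (![![1], ![0]] : Fin 2 → Fin 1 → K) (MvPolynomial.X 0)) = Lau.T K := by
      simp [lin_X, flatRing]
    simp only [Fin.zero_eta]
    rw [h1, expandRing3_matW0, l3map_T_smul]
  · have h1 : flatRing K (lin (![![1], ![0]] : Fin 2 → Fin 1 → K) (MvPolynomial.X 1)) = 0 := by
      simp [lin_X]
    simp only [Fin.mk_one]
    rw [h1, expandRing3_matW1, zero_smul (LaurentSeries K) F, zero_smul (L3Ring K) (l3map f F),
      map_zero]

theorem evalFstRing_map (p : MvPolynomial (Fin 2) K) :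
    evalFstRing ρ.toRingHom (MvPolynomial.mapAlgHom (Algebra.ofId K A) p)
      = expandRing3 K (lin (matW K) p) := by
  induction p using MvPolynomial.induction_on with
  | C r =>
    have h1 : lin (matW K) (MvPolynomial.C r) = MvPolynomial.C r := (lin _).commutes r
    have h3 : MvPolynomial.mapAlgHom (Algebra.ofId K A) (MvPolynomial.C r
        : MvPolynomial (Fin 2) K) = MvPolynomial.C (algebraMap K A r) := by
      simp
    rw [h1, h3, evalFstRing_C]
    exact (congrArg (algebraMap (L2Ring K) (LaurentSeries (L2Ring K))) (ρ.commutes r)).trans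
      ((expandRing3 K).commutes r).symm
  | add p q hp hq => simp only [map_add, hp, hq]
  | mul_X p i hp =>
    rw [map_mul, map_mul, map_mul, map_mul, hp, mapAlgHom_X]
    refine congrArg (_ * ·) ?_
    fin_cases i
    · exact evalFstRing_X0.trans expandRing3_matW0.symm
    · exact evalFstRing_X1.trans expandRing3_matW1.symm

theorem matW_ne_zero : ∀ d ∈ polesX K, expandRing3 K (lin (matW K) d) ≠ 0 := by
  have hy : L2Ring.y (LaurentSeries K) ≠ 0 := y_ne_zero
  intro d hd
  simp only [polesX, Set.mem_insert_iff, Set.mem_singleton_iff] at hd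
  rcases hd with rfl | rfl
  · rwa [expandRing3_matW0]
  · rwa [map_sub, map_sub, expandRing3_matW0, expandRing3_matW1, sub_zero]

/-- The evaluation turns $X_{w_1,w_2}$ into $Y_w$, and what remains is a linear map applied to its
coefficients. -/
theorem applyL3_singMap (h : V →ₗ[K] A ⊗[K] U) (x : Sing (polesX K) V) :
    applyL3 ρ f (singMap (D' := polesX A) (adm_const K) h x)
      = l3map (lb ρ f ∘ₗ h) (Sing.flat (Sing.subst ![![1], ![0]] (adm_eval K) x)) := by
  refine locLift_ext (R' := L3Ring K) (φ := ((expandRing3 K).comp (lin (matW K))).toRingHom)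
    (fun d hd => isUnit_end (isUnit_iff_ne_zero.2 (matW_ne_zero d hd)))
    (fun x => applyL3 ρ f (singMap (D' := polesX A) (adm_const K) h x))
    (fun x => l3map (lb ρ f ∘ₗ h) (Sing.flat (Sing.subst ![![1], ![0]] (adm_eval K) x)))
    (fun p x => ?_) (fun p x => ?_) (fun F => ?_) x
  · rw [singMap_smul, applyL3_smul, evalFstRing_map]; rfl
  · rw [Sing.subst_smul, singFlat_smul, l3map_flatRing_smul]; rfl
  · rw [singMap_mk_one, Sing.subst_mk_one, singFlat_mk_one]
    refine Lau.ext fun n => ?_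
    rw [coeff_l3map]
    change Lau.coeff (singLau (lbSemi ρ f) (LocalizedModule.mk (PS.map h F) 1)) n
      = lb ρ f (h (Lau.coeff (flatFun K _) n))
    rw [singLau_mk_one, flatFun_coeff, subst_evalSnd]
    change Lau.coeff (evalFstFun (lbSemi ρ f) _) n = _
    rw [coeff_evalFstFun]
    by_cases hn : 0 ≤ n
    · rw [if_pos hn, if_pos hn]; rfl
    · rw [if_neg hn, if_neg hn, map_zero, map_zero]

end ApplyL3

section Shift
variable (K : Type*) [Field K]

theorem shiftFst_X0 (i : Fin 2) :
    shiftFst K i (algebraMap (MvPolynomial (Fin 2) K) (Rat (polesS K)) (MvPolynomial.X 0))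
    = ((MvPolynomial.C (algebraMap (MvPolynomial (Fin 2) K) (Rat (polesS K)) (MvPolynomial.X 0))
      + MvPolynomial.X i : MvPolynomial (Fin 2) (Rat (polesS K))) :
        MvPowerSeries (Fin 2) (Rat (polesS K))) := by
  rw [shiftFst, ratLift_algebraMap]
  simp

theorem shiftFst_X1 (i : Fin 2) :
    shiftFst K i (algebraMap (MvPolynomial (Fin 2) K) (Rat (polesS K)) (MvPolynomial.X 1))
    = ((MvPolynomial.C (algebraMap (MvPolynomial (Fin 2) K) (Rat (polesS K)) (MvPolynomial.X 1))
      : MvPolynomial (Fin 2) (Rat (polesS K))) : MvPowerSeries (Fin 2) (Rat (polesS K))) := by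
  rw [shiftFst, ratLift_algebraMap]
  simp

variable [CharZero K]

/-- The expansion of `K[z_1^{±1}, z_2^{±1}, (z_1 - z_2)⁻¹]` for `z_1 = x`, `z_2 = z`, `|z| > |x|`. -/
abbrev ratXZ : Rat (polesS K) →ₐ[K] L2Ring K := ratL2 (swapMat2 K) (polesS K) (swapMat2_S K)

/-- `z_1, z_2 ↦ x + w, z`, expanded for `|z| > |x| > |w|`. -/
abbrev rat13 : Rat (polesS K) →ₐ[K] L3Ring K :=
  ratL3 ![![0, 1, 1], ![1, 0, 0]] (polesS K) ratL3_ne_zero13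

/-- `z_1, z_2 ↦ x, z`, expanded for `|z| > |x| > |w|`. -/
abbrev rat23 : Rat (polesS K) →ₐ[K] L3Ring K :=
  ratL3 ![![0, 1, 0], ![1, 0, 0]] (polesS K) ratL3_ne_zero23

variable {K}

theorem ratXZ_X0 : (ratXZ K).toRingHom
    (algebraMap (MvPolynomial (Fin 2) K) (Rat (polesS K)) (MvPolynomial.X 0)) = L2Ring.y K := by
  refine (ratL2_algebraMap (swapMat2_S K) _).trans ?_
  simp [lin_X, expandRing_X1]

theorem ratXZ_X1 : (ratXZ K).toRingHom
    (algebraMap (MvPolynomial (Fin 2) K) (Rat (polesS K)) (MvPolynomial.X 1)) = L2Ring.x K := by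
  refine (ratL2_algebraMap (swapMat2_S K) _).trans ?_
  simp [lin_X, expandRing_X0]

/-- The shift by $w_1=w$ is kept: the first argument becomes $x+w$. -/
theorem shift13 (i : Fin 2) : ∃ p : MvPolynomial (Fin 2) (Rat (polesS K)),
    shiftFst K 0 (algebraMap (MvPolynomial (Fin 2) K) (Rat (polesS K)) (MvPolynomial.X i)) = p ∧
    evalFstRing (ratXZ K).toRingHom p
      = rat13 K (algebraMap (MvPolynomial (Fin 2) K) (Rat (polesS K)) (MvPolynomial.X i)) := by
  fin_cases i
  · refine ⟨_, shiftFst_X0 K 0, ?_⟩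
    have h : rat13 K (algebraMap (MvPolynomial (Fin 2) K) (Rat (polesS K)) (MvPolynomial.X 0))
        = L2Ring.x (LaurentSeries K) + L2Ring.y (LaurentSeries K) := by
      rw [ratL3_algebraMap, ← expandRing3_X1, ← expandRing3_X2, ← map_add]
      simp [lin_X, Fin.sum_univ_three]
    rw [map_add, evalFstRing_C, evalFstRing_X0, ratXZ_X0]
    exact h.symm
  · refine ⟨_, shiftFst_X1 K 0, ?_⟩
    have h : rat13 K (algebraMap (MvPolynomial (Fin 2) K) (Rat (polesS K)) (MvPolynomial.X 1))
        = algebraMap (LaurentSeries K) (L3Ring K) (Lau.T K) := by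
      rw [ratL3_algebraMap, ← expandRing3_X0]
      simp [lin_X, Fin.sum_univ_three]
    rw [evalFstRing_C, ratXZ_X1]
    exact h.symm

/-- Here the shift is by $w_2$, which is set to zero. This is why $S^{23}$ occurs with argument $x$
and not $x+w$. -/
theorem shift23 (i : Fin 2) : ∃ p : MvPolynomial (Fin 2) (Rat (polesS K)),
    shiftFst K 1 (algebraMap (MvPolynomial (Fin 2) K) (Rat (polesS K)) (MvPolynomial.X i)) = p ∧
    evalFstRing (ratXZ K).toRingHom p
      = rat23 K (algebraMap (MvPolynomial (Fin 2) K) (Rat (polesS K)) (MvPolynomial.X i)) := by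
  fin_cases i
  · refine ⟨_, shiftFst_X0 K 1, ?_⟩
    have h : rat23 K (algebraMap (MvPolynomial (Fin 2) K) (Rat (polesS K)) (MvPolynomial.X 0))
        = L2Ring.x (LaurentSeries K) := by
      rw [ratL3_algebraMap, ← expandRing3_X1]
      simp [lin_X, Fin.sum_univ_three]
    rw [map_add, evalFstRing_C, evalFstRing_X1, ratXZ_X0, add_zero]
    exact h.symm
  · refine ⟨_, shiftFst_X1 K 1, ?_⟩
    have h : rat23 K (algebraMap (MvPolynomial (Fin 2) K) (Rat (polesS K)) (MvPolynomial.X 1))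
        = algebraMap (LaurentSeries K) (L3Ring K) (Lau.T K) := by
      rw [ratL3_algebraMap, ← expandRing3_X0]
      simp [lin_X, Fin.sum_univ_three]
    rw [evalFstRing_C, ratXZ_X1]
    exact h.symm

end Shift

/-! ### The exchange identity for $Y_w$ -/

section Hexagon
variable {K : Type*} [Field K] {V : Type*} [AddCommGroup V] [Module K V]

theorem mulFst_apply (X : ℕ → V ⊗[K] V →ₗ[K] Sing (polesX K) V) (k : ℕ) (u : V ⊗[K] V) (c : V) :
    mulFst X k (u ⊗ₜ c) = singMap (D' := polesX (Rat (polesS K))) (adm_const K)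
      (TensorProduct.mk K (Rat (polesS K)) (V ⊗[K] V) 1 ∘ₗ (TensorProduct.mk K V V).flip c)
      (X k u) := by
  simp only [mulFst, TensorProduct.lift.tmul, LinearMap.flip_apply, LinearMap.compl₂_apply,
    LinearMap.comp_apply]
  rfl

variable [CharZero K]
  (Q : HDQuantumVertexAlgebra K V)

theorem applyL3_mulFst (k : ℕ) (u : V ⊗[K] V) (c : V) :
    tc (fun i => applyL3 (ratXZ K) (expXZ Q i)) (mulFst Q.X) k (u ⊗ₜ c)
      = coefOp (expXZ Q) Q.Y k (u ⊗ₜ c) := by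
  rw [tc_apply, coefOp_apply]
  refine Finset.sum_congr rfl fun p _ => ?_
  rw [mulFst_apply, applyL3_singMap]
  refine congrArg (fun h => l3map h (Q.Y p.2 u)) (LinearMap.ext fun v => ?_)
  simp

/-- The composite $X_{x,z}S_{x,z}$ is $X_{z,x}$ in the opposite order by `expZX_eq`; here it is
applied to the coefficients of $Y_w(a\otimes b)$. -/
theorem applyL3_braid (k : ℕ) (a b c : V) :
    ∑ q ∈ Finset.HasAntidiagonal.antidiagonal k, applyL3 (ratXZ K) (expXZ Q q.1)
      (∑ p ∈ Finset.HasAntidiagonal.antidiagonal q.2,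
        singMap (D' := polesX (Rat (polesS K))) (adm_const K)
          (Q.braid p.1 ∘ₗ (TensorProduct.mk K V V).flip c) (Q.X p.2 (a ⊗ₜ b)))
      = coefOp (expZX Q) Q.Y k ((a ⊗ₜ b) ⊗ₜ c) := by
  have h : ∀ i j l, applyL3 (ratXZ K) (expXZ Q i)
      (singMap (D' := polesX (Rat (polesS K))) (adm_const K)
          (Q.braid j ∘ₗ (TensorProduct.mk K V V).flip c) (Q.X l (a ⊗ₜ b)))
      = l3map (lb (ratXZ K) (expXZ Q i) ∘ₗ Q.braid j ∘ₗ (TensorProduct.mk K V V).flip c)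
        (Q.Y l (a ⊗ₜ b)) := fun i j l => applyL3_singMap _ _ _ _
  simp only [map_sum, h]
  rw [← sum_antidiagonal_assoc (fun i j l => l3map (lb (ratXZ K) (expXZ Q i) ∘ₗ Q.braid j ∘ₗ
    (TensorProduct.mk K V V).flip c) (Q.Y l (a ⊗ₜ b))), coefOp_apply]
  refine Finset.sum_congr rfl fun p _ => ?_
  rw [← LinearMap.sum_apply, ← map_sum]
  refine congrArg (fun h => l3map h (Q.Y p.2 (a ⊗ₜ b))) (LinearMap.ext fun v => ?_)
  rw [expZX_eq, LinearMap.sum_apply]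
  exact (bc_apply (ratXZ K) (expXZ Q) Q.braid p.1 (v ⊗ₜ c)).symm

/-- The hexagon axiom for `w_2 = 0`, with `X_{x,z}` applied to it. -/
theorem coefOp_Y : coefOp (expZX Q) Q.Y
    = bc (rat13 K) (bc (rat23 K) (coefOp (expXZ Q) Q.Y)
          (fun i => legMap (legEquiv23 K V) (Q.braid i)))
        (fun i => legMap (TensorProduct.rightComm K V V V) (Q.braid i)) := by
  have h1 := tc_bc (shiftFst K 0) (rat13 K) (fun i => applyL3 (ratXZ K) (expXZ Q i))
    (fun i r m => applyL3_ps_smul (ratXZ K) (expXZ Q i) (shiftFst K 0) (rat13 K) shift13 r m)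
    (bc (shiftFst K 1) (mulFst Q.X) (fun i => legMap (legEquiv23 K V) (Q.braid i)))
    (fun i => legMap (TensorProduct.rightComm K V V V) (Q.braid i))
  have h2 := tc_bc (shiftFst K 1) (rat23 K) (fun i => applyL3 (ratXZ K) (expXZ Q i))
    (fun i r m => applyL3_ps_smul (ratXZ K) (expXZ Q i) (shiftFst K 1) (rat23 K) shift23 r m)
    (mulFst Q.X) (fun i => legMap (legEquiv23 K V) (Q.braid i))
  have h3 : tc (fun i => applyL3 (ratXZ K) (expXZ Q i)) (mulFst Q.X) = coefOp (expXZ Q) Q.Y :=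
    funext fun k => TensorProduct.ext' fun u c => applyL3_mulFst Q k u c
  rw [h2, h3] at h1
  rw [← h1]
  funext k
  refine TensorProduct.ext_threefold fun a b c => ?_
  rw [← applyL3_braid, tc_apply]
  refine Finset.sum_congr rfl fun p _ => congrArg _ ?_
  rw [Q.hexagon, leg23, leg13, leg_along, leg_along, applySeries_extend_along_mul]

end Hexagon

/-! ### Leibniz rules for rational functions -/

section Derivation
variable {K B N : Type*} [CommRing K] [CommRing B] [Algebra K B] [AddCommGroup N] [Module B N]
  [Module K N] [IsScalarTower K B N]

/-- A map that satisfies the Leibniz rule for the variables satisfies it for rational functions. -/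
theorem rat_leibniz_of_X {n : ℕ} {D : Set (MvPolynomial (Fin n) K)} (ρ : Rat D →ₐ[K] B)
    (d : Rat D →ₗ[K] Rat D) (hd : ∀ r s, d (r * s) = d r * s + r * d s) (c : K) (g : N →ₗ[K] N)
    (hX : ∀ (i : Fin n) (m : N), g (ρ (algebraMap (MvPolynomial (Fin n) K) _ (MvPolynomial.X i)) • m)
      = ρ (algebraMap (MvPolynomial (Fin n) K) _ (MvPolynomial.X i)) • g m
        + c • ρ (d (algebraMap (MvPolynomial (Fin n) K) _ (MvPolynomial.X i))) • m)
    (r : Rat D) (m : N) : g (ρ r • m) = ρ r • g m + c • ρ (d r) • m := by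
  have h1 : d 1 = 0 := by simpa using hd 1 1
  have hmul : ∀ r s : Rat D, (∀ m, g (ρ r • m) = ρ r • g m + c • ρ (d r) • m) →
      (∀ m, g (ρ s • m) = ρ s • g m + c • ρ (d s) • m) →
      ∀ m, g (ρ (r * s) • m) = ρ (r * s) • g m + c • ρ (d (r * s)) • m := by
    intro r s hr hs m
    rw [map_mul, mul_smul, hr, hs, hd, map_add, map_mul, map_mul, mul_smul, add_smul, mul_smul,
      mul_smul, smul_add, smul_add, smul_comm (ρ r) c]
    abel
  have hp : ∀ (p : MvPolynomial (Fin n) K) m, g (ρ (algebraMap _ _ p) • m)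
      = ρ (algebraMap _ (Rat D) p) • g m + c • ρ (d (algebraMap _ _ p)) • m := by
    intro p
    induction p using MvPolynomial.induction_on with
    | C k =>
      intro m
      have hk : algebraMap (MvPolynomial (Fin n) K) (Rat D) (MvPolynomial.C k) = k • 1 := by
        rw [← MvPolynomial.algebraMap_eq, ← IsScalarTower.algebraMap_apply,
          Algebra.algebraMap_eq_smul_one]
      have hr : ρ (k • 1) = k • 1 := by rw [map_smul, map_one]
      rw [hk, hr, LinearMap.map_smul d, h1, smul_zero, map_zero, zero_smul, smul_zero, add_zero,
        smul_assoc, smul_assoc, one_smul, one_smul, LinearMap.map_smul]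
    | add p q hp hq =>
      intro m
      simp only [map_add, add_smul, smul_add, hp, hq]
      abel
    | mul_X p i hp =>
      rw [map_mul]
      exact hmul _ _ hp (hX i)
  obtain ⟨p, s, rfl⟩ := IsLocalization.exists_mk'_eq (dens D) r
  have hs := (IsLocalization.map_units (Rat D) s).map ρ
  have e := hp p m
  -- Write $p=sr$. The rules for the polynomials $p$ and $s$ are known; their difference is the rule
  -- for $r$ multiplied by the unit $s$.
  have hps : algebraMap (MvPolynomial (Fin n) K) (Rat D) p
      = algebraMap _ _ (s : MvPolynomial (Fin n) K) * IsLocalization.mk' (Rat D) p s := by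
    rw [mul_comm, IsLocalization.mk'_spec]
  rw [hps, map_mul, mul_smul, hp, hd, map_add, map_mul, map_mul, mul_smul, add_smul, mul_smul,
    mul_smul, smul_add, smul_comm c (ρ (algebraMap _ _ (s : MvPolynomial (Fin n) K))),
    add_comm (c • _), ← add_assoc] at e
  have e2 := add_right_cancel e
  rwa [← smul_add, hs.smul_left_cancel] at e2

theorem lb_leibniz {A U : Type*} [CommRing A] [Algebra K A] [AddCommGroup U] [Module K U]
    (ρ : A →ₐ[K] B) (d : A →ₗ[K] A) (c : K) (g : N →ₗ[K] N)
    (h : ∀ r m, g (ρ r • m) = ρ r • g m + c • ρ (d r) • m) (y : U →ₗ[K] N) (x : A ⊗[K] U) :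
    g (lb ρ y x) = lb ρ (g ∘ₗ y) x + c • lb ρ y (d.rTensor U x) := by
  induction x with
  | zero => simp
  | add x y hx hy => simp only [map_add, hx, hy, smul_add]; abel
  | tmul r u => rw [LinearMap.rTensor_tmul, lb_tmul, lb_tmul, lb_tmul, h]; rfl

end Derivation

/-! ### The derivative in $z_1$ as the first-order term of the shift -/

section ShiftDerivation
variable (K : Type*) [Field K]

theorem coeff_zero_shiftFst (i : Fin 2) (r : Rat (polesS K)) :
    MvPowerSeries.coeff 0 (shiftFst K i r) = r := by
  have h : ((MvPowerSeries.constantCoeff (σ := Fin 2) (R := Rat (polesS K))).comp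
      (shiftFst K i).toRingHom) = RingHom.id _ := by
    refine IsLocalization.ringHom_ext (dens (polesS K)) (MvPolynomial.ringHom_ext ?_ fun j => ?_)
    · intro c
      have hc : algebraMap (MvPolynomial (Fin 2) K) (Rat (polesS K)) (MvPolynomial.C c)
          = algebraMap K _ c := (IsScalarTower.algebraMap_apply K _ _ c).symm
      simp only [RingHom.comp_apply, RingHom.id_apply, hc]
      refine (congrArg _ ((shiftFst K i).commutes c)).trans ?_
      simp [MvPowerSeries.algebraMap_apply]
    · fin_cases j
      · refine (congrArg (MvPowerSeries.constantCoeff) (shiftFst_X0 K i)).trans ?_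
        simp
      · refine (congrArg (MvPowerSeries.constantCoeff) (shiftFst_X1 K i)).trans ?_
        simp
  exact RingHom.congr_fun h r

/-- The derivation `∂/∂z_1`. -/
def derivFst : Rat (polesS K) →ₗ[K] Rat (polesS K) where
  toFun r := MvPowerSeries.coeff (Finsupp.single 0 1) (shiftFst K 0 r)
  map_add' r s := by rw [map_add, map_add]
  map_smul' c r := by rw [map_smul]; rfl

theorem coeff_one_shiftFst (r : Rat (polesS K)) :
    MvPowerSeries.coeff (Finsupp.single 0 1) (shiftFst K 0 r) = derivFst K r := rfl

theorem antidiagonal_single_one : Finset.HasAntidiagonal.antidiagonal (Finsupp.single (0 : Fin 2) 1)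
    = {(0, Finsupp.single 0 1), (Finsupp.single 0 1, 0)} := by
  rw [Finsupp.antidiagonal_single]
  ext x
  simp [Finset.Nat.antidiagonal_succ]

/-- The coefficient of $w_1$ in a product of two series with constant terms $r$ and $s$. -/
theorem derivFst_mul (r s : Rat (polesS K)) :
    derivFst K (r * s) = derivFst K r * s + r * derivFst K s := by
  classical
  have h : derivFst K (r * s)
      = MvPowerSeries.coeff (Finsupp.single 0 1) (shiftFst K 0 r * shiftFst K 0 s) := by
    rw [← map_mul]; rfl
  rw [h, MvPowerSeries.coeff_mul, antidiagonal_single_one,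
    Finset.sum_pair (by simp [Prod.ext_iff]), coeff_zero_shiftFst, coeff_zero_shiftFst,
    coeff_one_shiftFst, coeff_one_shiftFst, add_comm]

theorem derivFst_X0 :
    derivFst K (algebraMap (MvPolynomial (Fin 2) K) (Rat (polesS K)) (MvPolynomial.X 0)) = 1 := by
  classical
  refine (congrArg (MvPowerSeries.coeff _) (shiftFst_X0 K 0)).trans ?_
  rw [MvPolynomial.coeff_coe, MvPolynomial.coeff_add, MvPolynomial.coeff_C, MvPolynomial.coeff_X,
    if_neg (Ne.symm (Finsupp.single_ne_zero.2 one_ne_zero)), zero_add, if_pos rfl]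

theorem derivFst_X1 :
    derivFst K (algebraMap (MvPolynomial (Fin 2) K) (Rat (polesS K)) (MvPolynomial.X 1)) = 0 := by
  classical
  refine (congrArg (MvPowerSeries.coeff _) (shiftFst_X1 K 0)).trans ?_
  rw [MvPolynomial.coeff_coe, MvPolynomial.coeff_C,
    if_neg (Ne.symm (Finsupp.single_ne_zero.2 one_ne_zero))]

end ShiftDerivation

/-! ### The hexagon with a vacuum entry -/

section BraidDerivation

theorem mk_one_add_mk_one {A M : Type*} [CommRing A] [AddCommGroup M] [Module A M] {n : ℕ}
    {D : Set (MvPolynomial (Fin n) A)} (F G : PS n M) :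
    (LocalizedModule.mk F 1 : Sing D M) + LocalizedModule.mk G 1 = LocalizedModule.mk (F + G) 1 :=
  (map_add (LocalizedModule.mkLinearMap (dens D) (PS n M)) F G).symm

theorem smul_eq_mk_one {A M : Type*} [CommRing A] [AddCommGroup M] [Module A M] {n : ℕ}
    {D : Set (MvPolynomial (Fin n) A)} (p : MvPowerSeries (Fin n) A) {x : Sing D M} {F : PS n M}
    (h : x = LocalizedModule.mk F 1) : p • x = LocalizedModule.mk (p • F) 1 := by
  rw [h, singPS_smul_mk]

/-- Setting $w_2=0$ turns both denominators into $w_1$, a unit among Laurent series, so this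
coefficient survives localization whatever the module is. -/
theorem mk_one_coeff_one {A M : Type*} [CommRing A] [AddCommGroup M] [Module A M] {F G : PS 2 M}
    (h : (LocalizedModule.mk F 1 : Sing (polesX A) M) = LocalizedModule.mk G 1) :
    F (Finsupp.single 0 1) = G (Finsupp.single 0 1) := by
  have h1 := congrArg (fun x => Lau.coeff (singLau (ρ := RingHom.id A) LinearMap.id x) 1) h
  simp only [singLau_mk_one] at h1
  have e : (Finsupp.cons (Int.toNat 1) 0 : Fin 2 →₀ ℕ) = Finsupp.single 0 1 := by
    ext j; refine Fin.cases ?_ (fun j => ?_) j <;> simp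
  have h2 : ∀ F : PS 2 M, Lau.coeff (evalFst (ρ := RingHom.id A) LinearMap.id F) 1
      = F (Finsupp.cons (Int.toNat 1) 0) :=
    fun F => (coeff_evalFstFun (ρ := RingHom.id A) LinearMap.id F 1).trans (if_pos zero_le_one)
  rwa [h2, h2, e] at h1

variable {K : Type*} [Field K] {V : Type*} [AddCommGroup V] [Module K V]

theorem antidiagonal_zero_two : Finset.HasAntidiagonal.antidiagonal (0 : Fin 2 →₀ ℕ) = {(0, 0)} := by
  ext x
  simp [Prod.ext_iff]

theorem expSeries_const_zero (D : V →ₗ[K] V) (v : V) :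
    (expSeries D (0 : Fin 2) • PS.const 2 v) 0 = v := by
  rw [ps_smul_apply, antidiagonal_zero_two, Finset.sum_singleton]
  change (if _ then _ else _ : Module.End K V) (if _ then _ else _) = _
  simp

theorem expSeries_const_one (D : V →ₗ[K] V) (v : V) :
    (expSeries D (0 : Fin 2) • PS.const 2 v) (Finsupp.single 0 1) = D v := by
  rw [ps_smul_apply, antidiagonal_single_one, Finset.sum_pair (by simp [Prod.ext_iff])]
  change (if _ then _ else _ : Module.End K V) (if _ then _ else _)
    + (if _ then _ else _ : Module.End K V) (if _ then _ else _) = _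
  simp

variable (Q : HDQuantumVertexAlgebra K V)

theorem mulFst_vac (k : ℕ) (v c : V) : mulFst Q.X k ((v ⊗ₜ Q.vac) ⊗ₜ c)
    = if k = 0 then LocalizedModule.mk (PS.map (K := Rat (polesS K))
        (TensorProduct.mk K (Rat (polesS K)) (V ⊗[K] V) 1 ∘ₗ (TensorProduct.mk K V V).flip c)
        (expSeries Q.D (0 : Fin 2) • PS.const 2 v)) 1 else 0 := by
  rw [mulFst_apply, Q.X_vac, apply_ite (singMap (D' := polesX (Rat (polesS K))) (adm_const K) _),
    map_zero, PS.toSing, singMap_mk_one]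

/-- Since $X_{w_1,w_2}(v\otimes1)=e^{w_1D}v$ has no poles, the right side of the hexagon is a power
series. Its term of first order in $w_1$ has one part from $S_{z_1+w_1,z_2}$ and one from the
exponential. -/
theorem lb_mulFst_vac (t : Rat (polesS K) ⊗[K] (V ⊗[K] V)) :
    ∃ H : PS 2 (Rat (polesS K) ⊗[K] (V ⊗[K] V)),
      lb (shiftFst K 0) (mulFst Q.X 0 ∘ₗ (TensorProduct.rightComm K V V V).symm.toLinearMap ∘ₗ
        (TensorProduct.mk K (V ⊗[K] V) V).flip Q.vac) t = LocalizedModule.mk H 1 ∧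
      H (Finsupp.single 0 1) = (derivFst K).rTensor _ t + (Q.D.rTensor V).lTensor _ t := by
  induction t with
  | zero => exact ⟨0, by simp, by simp; rfl⟩
  | add x y hx hy =>
    obtain ⟨H, h1, h2⟩ := hx
    obtain ⟨H', h1', h2'⟩ := hy
    refine ⟨H + H', ?_, ?_⟩
    · rw [map_add, h1, h1', mk_one_add_mk_one]
    · change H _ + H' _ = _
      rw [h2, h2', map_add, map_add]; abel
  | tmul r u =>
    induction u with
    | zero => exact ⟨0, by simp, by simp; rfl⟩
    | add x y hx hy =>
      obtain ⟨H, h1, h2⟩ := hx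
      obtain ⟨H', h1', h2'⟩ := hy
      refine ⟨H + H', ?_, ?_⟩
      · rw [TensorProduct.tmul_add, map_add, h1, h1', mk_one_add_mk_one]
      · change H _ + H' _ = _
        rw [h2, h2', TensorProduct.tmul_add, map_add, map_add]; abel
    | tmul v c =>
      refine ⟨shiftFst K 0 r • PS.map (K := Rat (polesS K))
        (TensorProduct.mk K (Rat (polesS K)) (V ⊗[K] V) 1 ∘ₗ (TensorProduct.mk K V V).flip c)
        (expSeries Q.D (0 : Fin 2) • PS.const 2 v), ?_, ?_⟩
      · rw [lb_tmul]
        exact smul_eq_mk_one _ ((mulFst_vac Q 0 v c).trans (if_pos rfl))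
      · rw [ps_smul_apply, antidiagonal_single_one, Finset.sum_pair (by simp [Prod.ext_iff]),
          coeff_zero_shiftFst, coeff_one_shiftFst]
        change r • (1 ⊗ₜ[K] ((expSeries Q.D (0 : Fin 2) • PS.const 2 v) (Finsupp.single 0 1) ⊗ₜ[K] c))
          + derivFst K r • (1 ⊗ₜ[K] ((expSeries Q.D (0 : Fin 2) • PS.const 2 v) 0 ⊗ₜ[K] c)) = _
        rw [expSeries_const_one, expSeries_const_zero, TensorProduct.smul_tmul',
          TensorProduct.smul_tmul', smul_eq_mul, smul_eq_mul, mul_one, mul_one, add_comm]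
        rfl

/-- $S^{23}$ meets the vacuum in the middle factor and acts trivially there. -/
theorem bc_shift_vac (k : ℕ) (v c : V) :
    bc (shiftFst K 1) (mulFst Q.X) (fun i => legMap (legEquiv23 K V) (Q.braid i)) k
        ((v ⊗ₜ Q.vac) ⊗ₜ c)
      = if k = 0 then mulFst Q.X 0 ((v ⊗ₜ Q.vac) ⊗ₜ c) else 0 := by
  have h : ∀ i, legMap (legEquiv23 K V) (Q.braid i) ((v ⊗ₜ Q.vac) ⊗ₜ c)
      = if i = 0 then 1 ⊗ₜ ((v ⊗ₜ Q.vac) ⊗ₜ c) else 0 := by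
    intro i
    change (legEquiv23 K V).symm.toLinearMap.lTensor _
      ((TensorProduct.assoc K (Rat (polesS K)) (V ⊗[K] V) V) (Q.braid i (Q.vac ⊗ₜ c) ⊗ₜ v)) = _
    rw [Q.vac_braid]
    split_ifs
    · rfl
    · simp
  have h2 : ∀ p : ℕ × ℕ, lb (shiftFst K 1) (mulFst Q.X p.1)
      (legMap (legEquiv23 K V) (Q.braid p.2) ((v ⊗ₜ Q.vac) ⊗ₜ c))
      = if p = (0, 0) then mulFst Q.X 0 ((v ⊗ₜ Q.vac) ⊗ₜ c) else 0 := by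
    rintro ⟨i, j⟩
    rw [h]
    by_cases hj : j = 0
    · rw [if_pos hj, lb_tmul, map_one, one_smul, mulFst_vac, mulFst_vac, if_pos rfl]
      exact if_congr (by simp [hj]) rfl rfl
    · rw [if_neg hj, map_zero, if_neg (by simp [hj])]
  rw [bc_apply, Finset.sum_congr rfl fun p _ => h2 p, Finset.sum_ite_eq']
  exact if_congr (by simp [eq_comm]) rfl rfl

theorem sum_singMap_vac (k : ℕ) (a c : V) :
    ∑ p ∈ Finset.HasAntidiagonal.antidiagonal k, singMap (D' := polesX (Rat (polesS K)))
        (adm_const K) (Q.braid p.1 ∘ₗ (TensorProduct.mk K V V).flip c) (Q.X p.2 (a ⊗ₜ Q.vac))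
      = LocalizedModule.mk (PS.map (K := Rat (polesS K)) (W := Rat (polesS K) ⊗[K] (V ⊗[K] V))
        (Q.braid k ∘ₗ (TensorProduct.mk K V V).flip c)
        (expSeries Q.D (0 : Fin 2) • PS.const 2 a)) 1 := by
  rw [Finset.sum_eq_single (k, 0)]
  · rw [Q.X_vac, if_pos rfl, PS.toSing, singMap_mk_one]
  · rintro ⟨i, j⟩ hp hne
    rw [Finset.HasAntidiagonal.mem_antidiagonal] at hp
    dsimp only at hp ⊢
    rw [Q.X_vac, if_neg, map_zero]
    intro hj
    exact hne (by rw [Prod.mk.injEq]; exact ⟨by omega, hj⟩)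
  · intro h
    exact absurd (Finset.HasAntidiagonal.mem_antidiagonal.2 (add_zero k)) h

theorem bc_shift_vac_comp (i : ℕ) :
    bc (shiftFst K 1) (mulFst Q.X) (fun i => legMap (legEquiv23 K V) (Q.braid i)) i ∘ₗ
        (TensorProduct.rightComm K V V V).symm.toLinearMap ∘ₗ
          (TensorProduct.mk K (V ⊗[K] V) V).flip Q.vac
      = if i = 0 then mulFst Q.X 0 ∘ₗ (TensorProduct.rightComm K V V V).symm.toLinearMap ∘ₗ
          (TensorProduct.mk K (V ⊗[K] V) V).flip Q.vac else 0 := by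
  refine TensorProduct.ext' fun v c => (bc_shift_vac Q i v c).trans ?_
  split_ifs <;> rfl

theorem sum_lb_ite {A B U N : Type*} [CommRing A] [Algebra K A] [CommRing B] [Algebra K B]
    [AddCommGroup U] [Module K U] [AddCommGroup N] [Module B N] [Module K N] [IsScalarTower K B N]
    (ρ : A →ₐ[K] B) (y : U →ₗ[K] N) (s : ℕ → A ⊗[K] U) (k : ℕ) :
    ∑ p ∈ Finset.HasAntidiagonal.antidiagonal k, lb ρ (if p.1 = 0 then y else 0) (s p.2)
      = lb ρ y (s k) := by
  rw [Finset.sum_eq_single (0, k)]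
  · rw [if_pos rfl]
  · rintro ⟨i, j⟩ hp hne
    rw [Finset.HasAntidiagonal.mem_antidiagonal] at hp
    dsimp only at hp ⊢
    rw [if_neg]
    · exact DFunLike.congr_fun (lb_sum (∅ : Finset ℕ) ρ fun _ => (0 : U →ₗ[K] N)) _
    · intro hi
      exact hne (by rw [Prod.mk.injEq]; exact ⟨hi, by omega⟩)
  · intro h
    exact absurd (Finset.HasAntidiagonal.mem_antidiagonal.2 (zero_add k)) h

theorem bc_shift_shift_vac (k : ℕ) (a c : V) :
    bc (shiftFst K 0) (bc (shiftFst K 1) (mulFst Q.X)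
        (fun i => legMap (legEquiv23 K V) (Q.braid i)))
      (fun i => legMap (TensorProduct.rightComm K V V V) (Q.braid i)) k ((a ⊗ₜ Q.vac) ⊗ₜ c)
      = lb (shiftFst K 0) (mulFst Q.X 0 ∘ₗ (TensorProduct.rightComm K V V V).symm.toLinearMap ∘ₗ
        (TensorProduct.mk K (V ⊗[K] V) V).flip Q.vac) (Q.braid k (a ⊗ₜ c)) := by
  have h := bc_legMap_apply (TensorProduct.rightComm K V V V) (shiftFst K 0) (bc (shiftFst K 1)
    (mulFst Q.X) (fun i => legMap (legEquiv23 K V) (Q.braid i))) Q.braid k (a ⊗ₜ c) Q.vac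
  simp only [bc_shift_vac_comp] at h
  refine h.trans ?_
  rw [bc_apply]
  exact sum_lb_ite (shiftFst K 0) _ (fun i => Q.braid i (a ⊗ₜ c)) k

/-- The covariance of the braiding with respect to the first factor. -/
theorem braid_D (k : ℕ) (a c : V) : Q.braid k (Q.D a ⊗ₜ c)
    = (derivFst K).rTensor _ (Q.braid k (a ⊗ₜ c)) + (Q.D.rTensor V).lTensor _ (Q.braid k (a ⊗ₜ c)) := by
  -- With the vacuum in second place the hexagon reads $S_{z_1,z_2}(e^{w_1D}a\otimes
  -- c)=(e^{w_1D}\otimes1)S_{z_1+w_1,z_2}(a\otimes c)$; the coefficients of $w_1$ are compared.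
  have h := Q.hexagon k a Q.vac c
  rw [leg23, leg13, leg_along, leg_along, applySeries_extend_along_mul, sum_singMap_vac] at h
  obtain ⟨H, h1, h2⟩ := lb_mulFst_vac Q (Q.braid k (a ⊗ₜ c))
  have h4 := mk_one_coeff_one (h.trans ((bc_shift_shift_vac Q k a c).trans h1))
  rw [← h2, ← h4]
  exact (congrArg (fun v => Q.braid k (v ⊗ₜ c)) (expSeries_const_one Q.D a)).symm

end BraidDerivation

/-! ### Derivatives of Laurent series -/

section LaurentDerivation
variable {B P : Type*} [CommRing B] [AddCommGroup P] [Module B P]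

/-- The derivative of a Laurent series. -/
def lauDeriv : Lau B P →ₗ[B] Lau B P where
  toFun F := HahnModule.of B
    { coeff := fun k => (k + 1) • F.coeff (k + 1)
      isPWO_support' := by
        refine (((HahnModule.of B).symm F).isPWO_support.image_of_monotone
          (f := fun k : ℤ => k - 1) (fun a b h => by simpa using h)).mono ?_
        intro k hk
        refine ⟨k + 1, fun h => hk ?_, by simp⟩
        change (k + 1) • F.coeff (k + 1) = 0
        rw [Lau.coeff, h, smul_zero] }
  map_add' F G := Lau.ext fun k => smul_add _ _ _
  map_smul' c F := Lau.ext fun k => smul_comm _ _ _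

theorem coeff_lauDeriv (F : Lau B P) (k : ℤ) :
    Lau.coeff (lauDeriv F) k = (k + 1) • F.coeff (k + 1) := rfl

theorem lauDeriv_C_smul (r : B) (F : Lau B P) :
    lauDeriv (algebraMap B (LaurentSeries B) r • F)
      = algebraMap B (LaurentSeries B) r • lauDeriv F :=
  Lau.ext fun k => by
    rw [coeff_lauDeriv, Lau.coeff_C_smul, Lau.coeff_C_smul, coeff_lauDeriv, smul_comm]

theorem lauDeriv_T_smul (F : Lau B P) :
    lauDeriv (Lau.T B • F) = Lau.T B • lauDeriv F + F :=
  Lau.ext fun k => by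
    rw [coeff_lauDeriv, Lau.coeff_T_smul, lau_coeff_add, Lau.coeff_T_smul, coeff_lauDeriv,
      add_sub_cancel_right, sub_add_cancel, add_smul, one_smul]

end LaurentDerivation

/-! ### The derivation $\partial_w-\partial_x$ -/

section Covariance
variable {K : Type*} [Field K] {V : Type*} [AddCommGroup V] [Module K V]

/-- The derivative in the last variable of `V((z))((x))`. -/
def derivL2 : L2 K V →ₗ[K] L2 K V where
  toFun F := lauDeriv F
  map_add' := map_add _
  map_smul' c F := map_smul lauDeriv (algebraMap K (LaurentSeries K) c) F

theorem coeff_derivL2 (F : L2 K V) (k : ℤ) :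
    Lau.coeff (derivL2 F) k = (k + 1) • F.coeff (k + 1) := rfl

/-- The derivative `∂/∂w` on `V((z))((x))((w))`. -/
def derivW : L3 K V →ₗ[K] L3 K V where
  toFun F := lauDeriv F
  map_add' := map_add _
  map_smul' c F := Lau.ext fun k => by
    rw [RingHom.id_apply, L3_coeff_smul, coeff_lauDeriv, coeff_lauDeriv, L3_coeff_smul, smul_comm]

theorem coeff_derivW (F : L3 K V) (k : ℤ) :
    Lau.coeff (derivW F) k = (k + 1) • F.coeff (k + 1) := rfl

/-- The derivative `∂/∂x` on `V((z))((x))((w))`. -/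
def derivX : L3 K V →ₗ[K] L3 K V where
  toFun F := HahnModule.of (L2Ring K) (((HahnModule.of (L2Ring K)).symm F).map (derivL2 (K := K) (V := V)))
  map_add' F G := Lau.ext fun k => map_add derivL2 _ _
  map_smul' c F := Lau.ext fun k => by
    rw [RingHom.id_apply, L3_coeff_smul]
    change derivL2 (Lau.coeff (c • F) k) = _
    rw [L3_coeff_smul]
    exact map_smul derivL2 c _

theorem coeff_derivX (F : L3 K V) (k : ℤ) : Lau.coeff (derivX F) k = derivL2 (F.coeff k) := rfl

/-- The coefficientwise application of an endomorphism. -/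
def lauMapEnd (D : V →ₗ[K] V) : Lau K V →ₗ[K] Lau K V where
  toFun F := HahnModule.of K (((HahnModule.of K).symm F).map D)
  map_add' _ _ := Lau.ext fun _ => map_add D _ _
  map_smul' c _ := Lau.ext fun _ => map_smul D c _

theorem coeff_lauMapEnd (D : V →ₗ[K] V) (F : Lau K V) (k : ℤ) :
    Lau.coeff (lauMapEnd D F) k = D (F.coeff k) := rfl

theorem derivL2_X0 (F : L2 K V) : derivL2 (L2Ring.x K • F) = L2Ring.x K • derivL2 F :=
  lauDeriv_C_smul _ _

theorem derivL2_X1 (F : L2 K V) : derivL2 (L2Ring.y K • F) = L2Ring.y K • derivL2 F + F :=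
  lauDeriv_T_smul _

theorem derivX_C (r : L2Ring K) (s : L2 K V → L2 K V) (hr : ∀ F, derivL2 (r • F) = r • derivL2 F + s F)
    (F : L3 K V) (k : ℤ) : Lau.coeff (derivX (algebraMap (L2Ring K) (L3Ring K) r • F)) k
      = Lau.coeff (algebraMap (L2Ring K) (L3Ring K) r • derivX F) k + s (F.coeff k) := by
  rw [coeff_derivX]
  refine (congrArg derivL2 (Lau.coeff_C_smul r F k)).trans ((hr _).trans ?_)
  exact congrArg (· + _) (Lau.coeff_C_smul r (derivX F) k).symm

/-- `∂/∂w - ∂/∂x`. -/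
def nabla : L3 K V →ₗ[K] L3 K V := derivW - derivX

theorem nabla_z (F : L3 K V) :
    nabla (algebraMap (LaurentSeries K) (L3Ring K) (Lau.T K) • F)
      = algebraMap (LaurentSeries K) (L3Ring K) (Lau.T K) • nabla F := by
  have h : algebraMap (LaurentSeries K) (L3Ring K) (Lau.T K)
      = algebraMap (L2Ring K) (L3Ring K) (L2Ring.x K) := rfl
  have h1 : derivW (algebraMap (L2Ring K) (L3Ring K) (L2Ring.x K) • F)
      = algebraMap (L2Ring K) (L3Ring K) (L2Ring.x K) • derivW F := lauDeriv_C_smul _ _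
  have h2 : derivX (algebraMap (L2Ring K) (L3Ring K) (L2Ring.x K) • F)
      = algebraMap (L2Ring K) (L3Ring K) (L2Ring.x K) • derivX F :=
    Lau.ext fun k => (derivX_C (L2Ring.x K) (fun _ => 0)
      (fun F => by rw [derivL2_X0, add_zero]) F k).trans (add_zero _)
  rw [h, nabla, LinearMap.sub_apply, LinearMap.sub_apply, h1, h2, smul_sub]

theorem nabla_x (F : L3 K V) :
    nabla (L2Ring.x (LaurentSeries K) • F) = L2Ring.x (LaurentSeries K) • nabla F - F := by
  have h : (L2Ring.x (LaurentSeries K) : L3Ring K)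
      = algebraMap (L2Ring K) (L3Ring K) (L2Ring.y K) := rfl
  have h1 : derivW (algebraMap (L2Ring K) (L3Ring K) (L2Ring.y K) • F)
      = algebraMap (L2Ring K) (L3Ring K) (L2Ring.y K) • derivW F := lauDeriv_C_smul _ _
  have h2 : derivX (algebraMap (L2Ring K) (L3Ring K) (L2Ring.y K) • F)
      = algebraMap (L2Ring K) (L3Ring K) (L2Ring.y K) • derivX F + F :=
    Lau.ext fun k => derivX_C (L2Ring.y K) id derivL2_X1 F k
  rw [h, nabla, LinearMap.sub_apply, LinearMap.sub_apply, h1, h2, smul_sub]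
  abel

theorem nabla_w (F : L3 K V) :
    nabla (L2Ring.y (LaurentSeries K) • F) = L2Ring.y (LaurentSeries K) • nabla F + F := by
  have h1 : derivW (L2Ring.y (LaurentSeries K) • F)
      = L2Ring.y (LaurentSeries K) • derivW F + F := lauDeriv_T_smul _
  have h2 : derivX (L2Ring.y (LaurentSeries K) • F) = L2Ring.y (LaurentSeries K) • derivX F :=
    Lau.ext fun k => (congrArg derivL2 (Lau.coeff_T_smul F k)).trans
      (Lau.coeff_T_smul (derivX F) k).symm
  rw [nabla, LinearMap.sub_apply, LinearMap.sub_apply, h1, h2, smul_sub]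
  abel

/-- `Z ↦ ∂_w Z + Z (1 ⊗ D) - D Z`. -/
def translationOp (D : V →ₗ[K] V) (Z : ℕ → V ⊗[K] V →ₗ[K] Lau K V) (k : ℕ) :
    V ⊗[K] V →ₗ[K] Lau K V :=
  lauDeriv ∘ₗ Z k + Z k ∘ₗ D.lTensor V - lauMapEnd D ∘ₗ Z k

theorem l3map_lauDeriv (f : V →ₗ[K] L2 K V) (F : Lau K V) :
    l3map f (lauDeriv F) = derivW (l3map f F) :=
  Lau.ext fun k => by
    rw [coeff_l3map, coeff_lauDeriv, coeff_derivW, coeff_l3map, map_zsmul]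

theorem l3map_lauMapEnd (f : V →ₗ[K] L2 K V) (D : V →ₗ[K] V) (hf : ∀ v, f (D v) = derivL2 (f v))
    (F : Lau K V) : l3map f (lauMapEnd D F) = derivX (l3map f F) :=
  Lau.ext fun k => by
    rw [coeff_l3map, coeff_lauMapEnd, hf, coeff_derivX, coeff_l3map]

/-- The derivative of $Z$ becomes $\partial_w$, and $D$ on the values of $Z$ becomes $\partial_x$ by
the covariance of $f$ in its first argument; hence the difference of the two. -/
theorem coefOp_translationOp (f : ℕ → V ⊗[K] V →ₗ[K] L2 K V) (D : V →ₗ[K] V)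
    (hf : ∀ k v c, f k (D v ⊗ₜ c) = derivL2 (f k (v ⊗ₜ c)))
    (Z : ℕ → V ⊗[K] V →ₗ[K] Lau K V) (k : ℕ) :
    coefOp f (translationOp D Z) k
      = nabla ∘ₗ coefOp f Z k + coefOp f Z k ∘ₗ (D.lTensor V).rTensor V := by
  refine TensorProduct.ext' fun u c => ?_
  rw [LinearMap.add_apply, LinearMap.comp_apply, LinearMap.comp_apply, LinearMap.rTensor_tmul,
    coefOp_apply, coefOp_apply, coefOp_apply, map_sum, ← Finset.sum_add_distrib]
  refine Finset.sum_congr rfl fun p _ => ?_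
  rw [translationOp, LinearMap.sub_apply, LinearMap.add_apply, map_sub, map_add, nabla,
    LinearMap.sub_apply]
  change l3map _ (lauDeriv (Z p.2 u)) + l3map _ (Z p.2 (D.lTensor V u))
    - l3map _ (lauMapEnd D (Z p.2 u)) = _
  rw [l3map_lauDeriv, l3map_lauMapEnd _ D (fun v => hf p.1 v c)]
  abel

end Covariance

/-! ### Transport of derivations through a braiding -/

section Transport
variable {K A B N U : Type*} [CommRing K] [CommRing A] [Algebra K A] [CommRing B] [Algebra K B]
  [AddCommGroup N] [Module B N] [Module K N] [IsScalarTower K B N] [AddCommGroup U] [Module K U]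

/-- A map `T` commutes with `s` up to the derivation `d` of the ring of scalars. -/
theorem bc_leibniz (ρ : A →ₐ[K] B) (d : A →ₗ[K] A) (g : N →ₗ[K] N) (c : K)
    (h : ∀ r m, g (ρ r • m) = ρ r • g m + c • ρ (d r) • m) (T : U →ₗ[K] U)
    (s : ℕ → U →ₗ[K] A ⊗[K] U)
    (hs : ∀ k u, T.lTensor A (s k u) = s k (T u) + c • d.rTensor U (s k u))
    (y : ℕ → U →ₗ[K] N) (k : ℕ) :
    bc ρ (fun i => g ∘ₗ y i + y i ∘ₗ T) s k = g ∘ₗ bc ρ y s k + bc ρ y s k ∘ₗ T := by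
  refine LinearMap.ext fun u => ?_
  rw [LinearMap.add_apply, LinearMap.comp_apply, LinearMap.comp_apply, bc_apply, bc_apply, bc_apply,
    map_sum, ← Finset.sum_add_distrib]
  refine Finset.sum_congr rfl fun p _ => ?_
  have hT : ∀ x, lb ρ (y p.1) (T.lTensor A x) = lb ρ (y p.1 ∘ₗ T) x := by
    intro x
    induction x with
    | zero => simp
    | add x y hx hy => simp only [map_add, hx, hy]
    | tmul r u => rw [LinearMap.lTensor_tmul, lb_tmul, lb_tmul]; rfl
  rw [lb_add, LinearMap.add_apply, lb_leibniz ρ d c g h, ← hT, hs, map_add, LinearMap.map_smul]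
  abel

end Transport

/-! ### The exchange identity is stable under the translation operator -/

section Covariance
variable {K : Type*} [Field K] {V : Type*} [AddCommGroup V] [Module K V]
  (Q : HDQuantumVertexAlgebra K V)

theorem braid_rTensor_D (k : ℕ) (u : V ⊗[K] V) :
    (Q.D.rTensor V).lTensor _ (Q.braid k u)
      = Q.braid k (Q.D.rTensor V u) + (-1 : K) • (derivFst K).rTensor _ (Q.braid k u) := by
  induction u with
  | zero => simp
  | add x y hx hy => simp only [map_add, hx, hy, smul_add]; abel
  | tmul a c =>
    have h := braid_D Q k a c
    rw [LinearMap.rTensor_tmul, h]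
    module

/-- $D$ acts on the middle factor, the first of the two factors that $S^{23}$ sees, hence the
derivative. -/
theorem legMap23_D (k : ℕ) (u : (V ⊗[K] V) ⊗[K] V) :
    ((Q.D.lTensor V).rTensor V).lTensor _ (legMap (legEquiv23 K V) (Q.braid k) u)
      = legMap (legEquiv23 K V) (Q.braid k) ((Q.D.lTensor V).rTensor V u)
        + (-1 : K) • (derivFst K).rTensor _ (legMap (legEquiv23 K V) (Q.braid k) u) := by
  have h : ∀ (a : V) (x : Rat (polesS K) ⊗[K] (V ⊗[K] V)),
      ((Q.D.lTensor V).rTensor V).lTensor _ ((legEquiv23 K V).symm.toLinearMap.lTensor _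
        ((TensorProduct.assoc K (Rat (polesS K)) (V ⊗[K] V) V) (x ⊗ₜ a)))
      = (legEquiv23 K V).symm.toLinearMap.lTensor _
        ((TensorProduct.assoc K (Rat (polesS K)) (V ⊗[K] V) V)
          (((Q.D.rTensor V).lTensor _ x) ⊗ₜ a)) := by
    intro a x
    induction x with
    | zero => simp
    | add x y hx hy => simp only [TensorProduct.add_tmul, map_add, hx, hy]
    | tmul r u =>
      induction u with
      | zero => simp
      | add x y hx hy => simp only [TensorProduct.tmul_add, TensorProduct.add_tmul, map_add, hx, hy]
      | tmul b c => rfl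
  have h' : ∀ (a : V) (x : Rat (polesS K) ⊗[K] (V ⊗[K] V)),
      (derivFst K).rTensor _ ((legEquiv23 K V).symm.toLinearMap.lTensor _
        ((TensorProduct.assoc K (Rat (polesS K)) (V ⊗[K] V) V) (x ⊗ₜ a)))
      = (legEquiv23 K V).symm.toLinearMap.lTensor _
        ((TensorProduct.assoc K (Rat (polesS K)) (V ⊗[K] V) V)
          (((derivFst K).rTensor _ x) ⊗ₜ a)) := by
    intro a x
    induction x with
    | zero => simp
    | add x y hx hy => simp only [TensorProduct.add_tmul, map_add, hx, hy]
    | tmul r u => rfl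
  induction u with
  | zero => simp
  | add x y hx hy => simp only [map_add, hx, hy, smul_add]; abel
  | tmul u c =>
    induction u with
    | zero => simp
    | add x y hx hy => simp only [TensorProduct.add_tmul, map_add, hx, hy, smul_add]; abel
    | tmul a b =>
      refine (h a (Q.braid k (b ⊗ₜ c))).trans ?_
      rw [braid_rTensor_D, TensorProduct.add_tmul, map_add, map_add, ← TensorProduct.smul_tmul',
        LinearEquiv.map_smul, LinearMap.map_smul, ← h']
      rfl

/-- $S^{13}$ does not see the middle factor. -/
theorem legMap13_D (k : ℕ) (u : (V ⊗[K] V) ⊗[K] V) :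
    ((Q.D.lTensor V).rTensor V).lTensor _
        (legMap (TensorProduct.rightComm K V V V) (Q.braid k) u)
      = legMap (TensorProduct.rightComm K V V V) (Q.braid k) ((Q.D.lTensor V).rTensor V u) := by
  have h : ∀ (b : V) (x : Rat (polesS K) ⊗[K] (V ⊗[K] V)),
      ((Q.D.lTensor V).rTensor V).lTensor _ ((TensorProduct.rightComm K V V V).symm.toLinearMap.lTensor _
        ((TensorProduct.assoc K (Rat (polesS K)) (V ⊗[K] V) V) (x ⊗ₜ b)))
      = (TensorProduct.rightComm K V V V).symm.toLinearMap.lTensor _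
        ((TensorProduct.assoc K (Rat (polesS K)) (V ⊗[K] V) V) (x ⊗ₜ Q.D b)) := by
    intro b x
    induction x with
    | zero => simp
    | add x y hx hy => simp only [TensorProduct.add_tmul, map_add, hx, hy]
    | tmul r u =>
      induction u with
      | zero => simp
      | add x y hx hy => simp only [TensorProduct.tmul_add, TensorProduct.add_tmul, map_add, hx, hy]
      | tmul a c => rfl
  induction u with
  | zero => simp
  | add x y hx hy => simp only [map_add, hx, hy]
  | tmul u c =>
    induction u with
    | zero => simp
    | add x y hx hy => simp only [TensorProduct.add_tmul, map_add, hx, hy]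
    | tmul a b => exact h b (Q.braid k (a ⊗ₜ c))

theorem bc_injective {A B N U : Type*} [CommRing A] [Algebra K A] [CommRing B] [Algebra K B]
    [AddCommGroup N] [Module B N] [Module K N] [IsScalarTower K B N] [AddCommGroup U] [Module K U]
    {s s' : ℕ → U →ₗ[K] A ⊗[K] U} (h : extend s * extend s' = 1) (ρ : A →ₐ[K] B)
    {y y' : ℕ → U →ₗ[K] N} (hy : bc ρ y s = bc ρ y' s) : y = y' := by
  have key : ∀ y : ℕ → U →ₗ[K] N, bc ρ (bc ρ y s) s' = y := fun y => by
    rw [bc_bc, bc_one_of_mul_eq_one h, bc_one]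
  rw [← key y, hy, key]

variable [CharZero K]

/-- Functions of $x+w$ and $z$ are annihilated by $\partial_w-\partial_x$. -/
theorem nabla_rat13 (r : Rat (polesS K)) (m : L3 K V) :
    nabla (rat13 K r • m) = rat13 K r • nabla m := by
  refine rat_smul_of_X (rat13 K) (rat13 K) nabla (fun i m => ?_) r m
  rw [ratL3_algebraMap]
  fin_cases i
  · simp only [Fin.zero_eta, lin_X, Fin.sum_univ_three]
    simp [expandRing3_X1, expandRing3_X2, add_smul, nabla_x, nabla_w]
  · simp only [Fin.mk_one, lin_X, Fin.sum_univ_three]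
    simp [-algebraMap_smul, expandRing3_X0, nabla_z]

/-- On functions of $x$ and $z$ the derivation is $-\partial_x$. This term cancels against the
derivative in `legMap23_D`. -/
theorem nabla_rat23 (r : Rat (polesS K)) (m : L3 K V) :
    nabla (rat23 K r • m) = rat23 K r • nabla m + (-1 : K) • rat23 K (derivFst K r) • m := by
  refine rat_leibniz_of_X (rat23 K) (derivFst K) (derivFst_mul K) (-1) nabla (fun i m => ?_) r m
  rw [ratL3_algebraMap]
  fin_cases i
  · simp only [Fin.zero_eta, derivFst_X0, lin_X, Fin.sum_univ_three]
    simp [expandRing3_X1, nabla_x, sub_eq_add_neg]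
  · simp only [Fin.mk_one, derivFst_X1, lin_X, Fin.sum_univ_three]
    simp [-algebraMap_smul, expandRing3_X0, nabla_z]

theorem derivL2_ratXZ (r : Rat (polesS K)) (m : L2 K V) :
    derivL2 (ratXZ K r • m) = ratXZ K r • derivL2 m + (1 : K) • ratXZ K (derivFst K r) • m := by
  refine rat_leibniz_of_X (ratXZ K) (derivFst K) (derivFst_mul K) 1 derivL2 (fun i m => ?_) r m
  fin_cases i
  · have h : ratXZ K (algebraMap (MvPolynomial (Fin 2) K) (Rat (polesS K)) (MvPolynomial.X 0))
      = L2Ring.y K := ratXZ_X0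
    simp only [Fin.zero_eta, derivFst_X0]
    rw [h, derivL2_X1, map_one, one_smul, one_smul]
  · have h : ratXZ K (algebraMap (MvPolynomial (Fin 2) K) (Rat (polesS K)) (MvPolynomial.X 1))
      = L2Ring.x K := ratXZ_X1
    simp only [Fin.mk_one, derivFst_X1]
    rw [h, derivL2_X0, map_zero, zero_smul (L2Ring K) m, smul_zero, add_zero]

theorem expZX_D (k : ℕ) (v c : V) : expZX Q k (Q.D v ⊗ₜ c) = derivL2 (expZX Q k (v ⊗ₜ c)) := by
  refine Lau.ext fun n => ?_
  rw [coeff_derivL2, coeff_expZX, coeff_expZX]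
  by_cases hn : 0 ≤ n
  · have h1 : (n + 1).toNat = n.toNat + 1 := by omega
    have h2 : ((n + 1 : ℤ) : K) = ((n.toNat + 1 : ℕ) : K) := by
      rw [← h1, ← Int.cast_natCast, Int.toNat_of_nonneg (by omega)]
    have h3 : ((n.toNat + 1 : ℕ) : K) ≠ 0 := Nat.cast_ne_zero.2 (Nat.succ_ne_zero _)
    rw [if_pos hn, if_pos (by omega), ← Int.cast_smul_eq_zsmul K, h2, smul_smul, h1,
      Nat.factorial_succ, Nat.cast_mul, mul_inv, ← mul_assoc, mul_inv_cancel₀ h3, one_mul, pow_succ]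
    rfl
  · rw [if_neg hn]
    by_cases h1 : n + 1 = 0
    · rw [h1, zero_smul]
    · rw [if_neg (by omega), smul_zero]

/-- Covariance of $X$ in its first argument is not an axiom. After composition with $S_{x,z}$ it
becomes covariance of $X_{z,x}$ in its second argument, once the derivative of $S$ from `braid_D` is
taken into account; unitarity then removes $S$. -/
theorem expXZ_D (k : ℕ) (v c : V) : expXZ Q k (Q.D v ⊗ₜ c) = derivL2 (expXZ Q k (v ⊗ₜ c)) := by
  have h1 : ∀ i, bc (ratXZ K) (fun i => (-derivL2 : L2 K V →ₗ[K] L2 K V) ∘ₗ expXZ Q i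
      + expXZ Q i ∘ₗ Q.D.rTensor V) Q.braid i = 0 := fun i => by
    have h := bc_leibniz (ratXZ K) (derivFst K) (-derivL2 : L2 K V →ₗ[K] L2 K V) (-1)
      (fun r m => by
        rw [LinearMap.neg_apply, LinearMap.neg_apply, derivL2_ratXZ, smul_neg, neg_add, one_smul,
          neg_one_smul])
      (Q.D.rTensor V) Q.braid (fun k u => braid_rTensor_D Q k u) (expXZ Q) i
    rw [h, ← expZX_eq]
    refine TensorProduct.ext' fun v c => ?_
    rw [LinearMap.add_apply, LinearMap.comp_apply, LinearMap.comp_apply, LinearMap.rTensor_tmul,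
      expZX_D, LinearMap.neg_apply, neg_add_cancel]
    rfl
  have h2 : bc (ratXZ K) (fun _ => (0 : V ⊗[K] V →ₗ[K] L2 K V)) Q.braid = fun _ => 0 := by
    funext k
    refine LinearMap.ext fun u => ?_
    rw [bc_apply]
    exact Finset.sum_eq_zero fun p _ =>
      DFunLike.congr_fun (lb_sum (∅ : Finset ℕ) (ratXZ K) fun _ => (0 : V ⊗[K] V →ₗ[K] L2 K V)) _
  have h3 := bc_injective Q.unitarity (ratXZ K) ((funext h1).trans h2.symm)
  have h4 := DFunLike.congr_fun (congrFun h3 k) (v ⊗ₜ c)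
  rw [LinearMap.add_apply, LinearMap.comp_apply, LinearMap.comp_apply, LinearMap.rTensor_tmul,
    LinearMap.neg_apply, LinearMap.zero_apply, neg_add_eq_zero] at h4
  exact h4.symm

/-- The equation `X_{z,x}(c ⊗ Z(a ⊗ b)) = X_{x,z}(Z ⊗ 1) S^{23}_{x,z} S^{13}_{x+w,z}(a ⊗ b ⊗ c)`. -/
def BraidCompatible (Z : ℕ → V ⊗[K] V →ₗ[K] Lau K V) : Prop :=
  coefOp (expZX Q) Z = bc (rat13 K) (bc (rat23 K) (coefOp (expXZ Q) Z)
    (fun i => legMap (legEquiv23 K V) (Q.braid i)))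
    (fun i => legMap (TensorProduct.rightComm K V V V) (Q.braid i))

/-- On either side the operator becomes $\partial_w-\partial_x$ plus $D$ on the middle factor. This
sum passes through both braidings: the derivatives of $S_{x,z}$ that the two summands produce
cancel, and $S_{x+w,z}$ produces none. -/
theorem braidCompatible_translationOp {Z : ℕ → V ⊗[K] V →ₗ[K] Lau K V}
    (hZ : BraidCompatible Q Z) : BraidCompatible Q (translationOp Q.D Z) := by
  have h1 : coefOp (expXZ Q) (translationOp Q.D Z) = fun k => nabla ∘ₗ coefOp (expXZ Q) Z k
      + coefOp (expXZ Q) Z k ∘ₗ (Q.D.lTensor V).rTensor V :=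
    funext fun k => coefOp_translationOp (expXZ Q) Q.D (expXZ_D Q) Z k
  have h2 := fun k => bc_leibniz (rat23 K) (derivFst K) (nabla : L3 K V →ₗ[K] L3 K V) (-1)
    (fun r m => nabla_rat23 r m) ((Q.D.lTensor V).rTensor V)
    (fun i => legMap (legEquiv23 K V) (Q.braid i)) (fun k u => legMap23_D Q k u)
    (coefOp (expXZ Q) Z) k
  have h3 := fun k => bc_leibniz (rat13 K) (0 : Rat (polesS K) →ₗ[K] Rat (polesS K))
    (nabla : L3 K V →ₗ[K] L3 K V) 0 (fun r m => by rw [nabla_rat13, zero_smul K, add_zero])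
    ((Q.D.lTensor V).rTensor V)
    (fun i => legMap (TensorProduct.rightComm K V V V) (Q.braid i))
    (fun k u => by rw [legMap13_D, zero_smul K, add_zero])
    (bc (rat23 K) (coefOp (expXZ Q) Z) fun i => legMap (legEquiv23 K V) (Q.braid i)) k
  rw [BraidCompatible, h1, funext h2]
  funext k
  rw [h3, coefOp_translationOp (expZX Q) Q.D (expZX_D Q) Z k, hZ]

end Covariance

/-! ### Exponentials acting on series in $\gamma$ -/

section ExpSeq
variable {K : Type*} [Field K] {N : Type*} [AddCommGroup N] [Module K N]

/-- The coefficients of `e^{γ A} ∑_j G_j γ^j`. -/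
def expSeq (A : N →ₗ[K] N) (G : ℕ → N) (n : ℕ) : N :=
  ∑ p ∈ Finset.HasAntidiagonal.antidiagonal n, (p.1.factorial : K)⁻¹ • (A ^ p.1) (G p.2)

theorem expSeq_zero (A : N →ₗ[K] N) (G : ℕ → N) : expSeq A G 0 = G 0 := by
  simp [expSeq]

theorem expSeq_add (A : N →ₗ[K] N) (G G' : ℕ → N) (n : ℕ) :
    expSeq A (fun j => G j + G' j) n = expSeq A G n + expSeq A G' n := by
  simp [expSeq, Finset.sum_add_distrib]

theorem expSeq_smul (A : N →ₗ[K] N) (c : K) (G : ℕ → N) (n : ℕ) :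
    expSeq A (fun j => c • G j) n = c • expSeq A G n := by
  simp only [expSeq, Finset.smul_sum, map_smul]
  exact Finset.sum_congr rfl fun p _ => smul_comm _ _ _

theorem expSeq_comm (A B : N →ₗ[K] N) (h : ∀ x, A (B x) = B (A x)) (G : ℕ → N) (n : ℕ) :
    expSeq A (fun j => B (G j)) n = B (expSeq A G n) := by
  have hp : ∀ i x, (A ^ i) (B x) = B ((A ^ i) x) := by
    intro i
    induction i with
    | zero => intro x; rfl
    | succ i ih => intro x; rw [pow_succ', Module.End.mul_apply, ih, h]; rfl
  simp only [expSeq, map_sum, map_smul, hp]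

theorem expSeq_sub (A : N →ₗ[K] N) (G G' : ℕ → N) (n : ℕ) :
    expSeq A (fun j => G j - G' j) n = expSeq A G n - expSeq A G' n := by
  simp [expSeq, Finset.sum_sub_distrib, smul_sub]

/-- The exponential is unitriangular with respect to the powers of $\gamma$. -/
theorem expSeq_injective (A : N →ₗ[K] N) {G : ℕ → N} (h : ∀ n, expSeq A G n = 0) (n : ℕ) :
    G n = 0 := by
  induction n using Nat.strong_induction_on with
  | _ n ih =>
    have h1 := h n
    rw [expSeq, Finset.sum_eq_single (0, n)] at h1
    · simpa using h1
    · rintro ⟨i, j⟩ hp hne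
      rw [Finset.HasAntidiagonal.mem_antidiagonal] at hp
      dsimp only at hp ⊢
      have hj : j < n := by
        refine lt_of_le_of_ne (by omega) fun hj => hne ?_
        rw [Prod.mk.injEq]
        exact ⟨by omega, hj⟩
      rw [ih j hj, map_zero, smul_zero]
    · intro h
      exact absurd (Finset.HasAntidiagonal.mem_antidiagonal.2 (zero_add n)) h

theorem expSeq_const (A : N →ₗ[K] N) (y : N) (n : ℕ) :
    expSeq A (fun j => if j = 0 then y else 0) n = (n.factorial : K)⁻¹ • (A ^ n) y := by
  rw [expSeq, Finset.sum_eq_single (n, 0)]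
  · simp
  · rintro ⟨i, j⟩ hp hne
    rw [Finset.HasAntidiagonal.mem_antidiagonal] at hp
    dsimp only at hp ⊢
    rw [if_neg, map_zero, smul_zero]
    intro hj
    exact hne (by rw [Prod.mk.injEq]; exact ⟨by omega, hj⟩)
  · intro h
    exact absurd (Finset.HasAntidiagonal.mem_antidiagonal.2 (add_zero n)) h

theorem expSeq_shift (A : N →ₗ[K] N) (G : ℕ → N) (n : ℕ) :
    expSeq A (fun j => if j = 0 then 0 else G (j - 1)) n
      = if n = 0 then 0 else expSeq A G (n - 1) := by
  cases n with
  | zero => simp [expSeq_zero]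
  | succ n =>
    rw [expSeq, Finset.Nat.antidiagonal_succ', Finset.sum_cons, if_neg (Nat.succ_ne_zero n)]
    simp [expSeq]

variable [CharZero K]

/-- The product rule for $\partial_\gamma(e^{\gamma A}G)$, read on coefficients. -/
theorem expSeq_succ (A : N →ₗ[K] N) (G : ℕ → N) (n : ℕ) :
    (n + 1 : K) • expSeq A G (n + 1)
      = A (expSeq A G n) + expSeq A (fun j => (j + 1 : K) • G (j + 1)) n := by
  have h0 : ∀ p ∈ Finset.HasAntidiagonal.antidiagonal (n + 1),
      (n + 1 : K) • (p.1.factorial : K)⁻¹ • (A ^ p.1) (G p.2)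
      = (p.1 : K) • (p.1.factorial : K)⁻¹ • (A ^ p.1) (G p.2)
        + (p.1.factorial : K)⁻¹ • (A ^ p.1) ((p.2 : K) • G p.2) := by
    rintro ⟨i, j⟩ hp
    rw [Finset.HasAntidiagonal.mem_antidiagonal] at hp
    dsimp only at hp ⊢
    have : (n + 1 : K) = i + j := by exact_mod_cast hp.symm
    rw [this, add_smul, map_smul, smul_comm (j : K)]
  rw [expSeq, Finset.smul_sum, Finset.sum_congr rfl h0, Finset.sum_add_distrib]
  congr 1
  · rw [Finset.Nat.antidiagonal_succ, Finset.sum_cons, Finset.sum_map, expSeq, map_sum]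
    simp only [Nat.cast_zero, zero_smul, zero_add]
    refine Finset.sum_congr rfl fun p _ => ?_
    have h1 : ((p.1 + 1 : ℕ) : K) ≠ 0 := Nat.cast_ne_zero.2 (Nat.succ_ne_zero _)
    change ((p.1 + 1 : ℕ) : K) • ((p.1 + 1).factorial : K)⁻¹ • (A ^ (p.1 + 1)) (G p.2) = _
    rw [smul_smul, Nat.factorial_succ, Nat.cast_mul, mul_inv, ← mul_assoc, mul_inv_cancel₀ h1,
      one_mul, map_smul, pow_succ', Module.End.mul_apply]
  · rw [Finset.Nat.antidiagonal_succ', Finset.sum_cons, Finset.sum_map, expSeq]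
    simp

/-- The exponential of a derivation. -/
theorem expSeq_leibniz (A T : N →ₗ[K] N) (h : ∀ x, A (T x) = T (A x) + x) (G : ℕ → N) (n : ℕ) :
    expSeq A (fun j => T (G j)) n
      = T (expSeq A G n) + if n = 0 then 0 else expSeq A G (n - 1) := by
  induction n generalizing G with
  | zero => simp [expSeq_zero]
  | succ n ih =>
    have h1 : (n + 1 : K) ≠ 0 := Nat.cast_add_one_ne_zero n
    -- The coefficients of the derivatives in $\gamma$ are compared; they have lower order, so the
    -- induction hypothesis applies to them.
    refine (smul_right_injective N h1) ?_
    dsimp only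
    have h2 : (fun j : ℕ => (j + 1 : K) • T (G (j + 1)))
        = fun j : ℕ => T ((j + 1 : K) • G (j + 1)) := funext fun j => (map_smul _ _ _).symm
    rw [expSeq_succ, h2, ih, ih, if_neg (Nat.succ_ne_zero n), Nat.add_sub_cancel, smul_add,
      ← map_smul, expSeq_succ, map_add, map_add, h]
    cases n with
    | zero => simp; abel
    | succ n =>
      have h3 := expSeq_succ A G n
      rw [if_neg (Nat.succ_ne_zero n), if_neg (Nat.succ_ne_zero n), Nat.add_sub_cancel]
      push_cast
      rw [add_smul _ (1 : K), one_smul, h3]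
      abel

end ExpSeq

/-! ### Reduction to monomials -/

section Monomials
variable {n : ℕ} {K : Type*} [CommRing K] {W : Type*} [AddCommGroup W] [Module K W]

theorem monomial_smul_const (a : Fin n →₀ ℕ) (v : W) :
    (MvPolynomial.monomial a (1 : K)) • PS.const n v = Pi.single a v := by
  classical
  funext b
  rw [poly_smul_eq, ps_smul_apply, Pi.single_apply]
  have h : ∀ x : (Fin n →₀ ℕ) × (Fin n →₀ ℕ), MvPowerSeries.coeff x.1
      ((MvPolynomial.monomial a (1 : K) : MvPolynomial (Fin n) K) : MvPowerSeries (Fin n) K)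
        • PS.const n v x.2 = if x = (a, 0) then v else 0 := by
    rintro ⟨i, j⟩
    rw [MvPolynomial.coeff_coe, MvPolynomial.coeff_monomial, PS.const]
    by_cases hi : a = i
    · by_cases hj : j = 0
      · subst hi hj; simp
      · rw [if_neg hj, smul_zero, if_neg (by simp [hj])]
    · rw [if_neg hi, zero_smul, if_neg (by simp [Ne.symm hi])]
  rw [Finset.sum_congr rfl fun x _ => h x, Finset.sum_ite_eq']
  exact if_congr (by simp [eq_comm]) rfl rfl

/-- Two additive maps which depend only on the terms of degree `d` agree if they agree on
monomials. -/
theorem ps_ext_of_monomial {P : Type*} [AddCommGroup P] (d : ℤ) (f g : PS n W →+ P)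
    (hf : ∀ F : PS n W, (∀ a, (a.degree : ℤ) = d → F a = 0) → f F = 0)
    (hg : ∀ F : PS n W, (∀ a, (a.degree : ℤ) = d → F a = 0) → g F = 0)
    (h : ∀ (a : Fin n →₀ ℕ) (v : W), f ((MvPolynomial.monomial a (1 : K)) • PS.const n v)
      = g ((MvPolynomial.monomial a (1 : K)) • PS.const n v)) (F : PS n W) : f F = g F := by
  classical
  set s := (finite_degree n d.toNat).toFinset with hs
  -- The part of $F$ of degree $d$ is a finite sum of monomials with vector coefficients.
  set F' : PS n W := ∑ a ∈ s, (MvPolynomial.monomial a (1 : K)) • PS.const n (F a) with hF'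
  have h1 : ∀ a : Fin n →₀ ℕ, (a.degree : ℤ) = d → (F - F') a = 0 := by
    intro a ha
    have has : a ∈ s := by rw [hs, Set.Finite.mem_toFinset]; change a.degree = _; omega
    change F a - F' a = 0
    rw [hF', PS.sum_apply, Finset.sum_eq_single a]
    · rw [monomial_smul_const, Pi.single_eq_same, sub_self]
    · intro b _ hb
      rw [monomial_smul_const, Pi.single_eq_of_ne hb.symm]
    · exact fun h => absurd has h
  have e : F = F' + (F - F') := by abel
  rw [e, map_add, map_add, hf _ h1, hg _ h1, hF', map_sum, map_sum]
  exact congrArg (· + 0) (Finset.sum_congr rfl fun a _ => h a _)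

end Monomials

/-! ### Taylor's formula for $X_{w+\gamma,\gamma}$ -/

section Taylor
variable {K : Type*} [Field K] {V : Type*} [AddCommGroup V] [Module K V]

/-- The action of `e^{γ A}` on power series in `γ`. -/
def expP {N : Type*} [AddCommGroup N] [Module K N] (A : N →ₗ[K] N) : PS 1 N →ₗ[K] PS 1 N where
  toFun G m := expSeq A (fun j => G (Finsupp.single 0 j)) (m 0)
  map_add' _ _ := funext fun _ => expSeq_add A _ _ _
  map_smul' c _ := funext fun _ => expSeq_smul A c _ _

theorem expP_apply {N : Type*} [AddCommGroup N] [Module K N] (A : N →ₗ[K] N) (G : PS 1 N) (m) :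
    expP A G m = expSeq A (fun j => G (Finsupp.single 0 j)) (m 0) := rfl

theorem single_sub_single (j : ℕ) : (Finsupp.single 0 j - Finsupp.single 0 1 : Fin 1 →₀ ℕ)
    = Finsupp.single 0 (j - 1) := by
  ext
  simp

theorem fin1_sub_single (m : Fin 1 →₀ ℕ) : m - Finsupp.single 0 1 = Finsupp.single 0 (m 0 - 1) := by
  ext
  simp

theorem expP_X_smul {N R : Type*} [CommRing R] [AddCommGroup N] [Module K N] [Module R N]
    (A : N →ₗ[K] N) (G : PS 1 N) :
    expP A ((MvPolynomial.X 0 : MvPolynomial (Fin 1) R) • G)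
      = (MvPolynomial.X 0 : MvPolynomial (Fin 1) R) • expP A G := by
  funext m
  have h : (fun j => ((MvPolynomial.X 0 : MvPolynomial (Fin 1) R) • G) (Finsupp.single 0 j))
      = fun j => if j = 0 then 0 else G (Finsupp.single 0 (j - 1)) := by
    funext j
    rw [X_smul_apply, single_sub_single, Finsupp.single_eq_same]
  rw [expP_apply, h, expSeq_shift A (fun j => G (Finsupp.single 0 j)), X_smul_apply, expP_apply]
  simp

/-- The derivative of Laurent series as a linear map over the constants. -/
abbrev lauD (K V : Type*) [Field K] [AddCommGroup V] [Module K V] : Lau K V →ₗ[K] Lau K V := lauDeriv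

/-- `z_1, z_2 ↦ w + γ, γ`. -/
abbrev shiftMat (K : Type*) [Field K] : Fin 2 → Fin 2 → K := ![![1, 1], ![0, 1]]

theorem shiftMat_unit : ∀ d ∈ polesX K,
    MvPolynomial.constantCoeff (peelRing 1 K (lin (shiftMat K) d)) ≠ 0 := by
  intro d hd
  simp only [polesX, Set.mem_insert_iff, Set.mem_singleton_iff] at hd
  rcases hd with rfl | rfl <;>
  simp [lin_X, Fin.sum_univ_succ, constantCoeff_peelRing_X0, constantCoeff_peelRing_X1, T_ne_zero]

theorem peelRing_shift_X0 : peelRing 1 K (lin (shiftMat K) (MvPolynomial.X 0))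
    = MvPolynomial.C (Lau.T K) + MvPolynomial.X 0 := by
  rw [lin_X, Fin.sum_univ_two, map_add]
  simp only [Matrix.cons_val_zero, Matrix.cons_val_one, MvPolynomial.C_1, one_mul]
  rw [peelRing_X_zero, show (1 : Fin 2) = Fin.succ 0 from rfl, peelRing_X_succ]

theorem peelRing_shift_X1 : peelRing 1 K (lin (shiftMat K) (MvPolynomial.X 1))
    = MvPolynomial.X 0 := by
  rw [lin_X, Fin.sum_univ_two, map_add]
  simp only [Matrix.cons_val_zero, Matrix.cons_val_one, zero_mul, map_zero,
    MvPolynomial.C_1, one_mul, zero_add]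
  rw [show (1 : Fin 2) = Fin.succ 0 from rfl, peelRing_X_succ]

theorem coeff_lauD_pow (i : ℕ) (g : Lau K V) (m : ℤ) (h : g.coeff (m + i) = 0) :
    Lau.coeff ((lauD K V ^ i) g) m = 0 := by
  induction i generalizing m with
  | zero => simpa using h
  | succ i ih =>
    rw [pow_succ', Module.End.mul_apply, coeff_lauDeriv, ih (m + 1), smul_zero]
    rw [← h]
    congr 1
    push_cast
    ring

theorem lauCoeff_sum {ι : Type*} (s : Finset ι) (f : ι → Lau K V) (m : ℤ) :
    Lau.coeff (∑ i ∈ s, f i) m = ∑ i ∈ s, Lau.coeff (f i) m :=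
  map_sum (⟨⟨fun F : Lau K V => F.coeff m, rfl⟩, fun _ _ => rfl⟩ : Lau K V →+ V) f s

theorem subst_const {n m : ℕ} (M : Fin n → Fin m → K) (v : V) :
    PS.subst M (PS.const n v) = PS.const m v := by
  classical
  funext b
  change ∑ᶠ a, (linMon M a).coeff b • PS.const n v a = _
  rw [finsum_eq_single _ 0 fun a ha => by rw [PS.const, if_neg ha, smul_zero]]
  have h : linMon M 0 = 1 := by
    rw [linMon]
    exact map_one (lin M)
  rw [h, MvPolynomial.coeff_one, PS.const, PS.const, if_pos rfl, ite_smul, one_smul, zero_smul]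
  exact if_congr eq_comm rfl rfl

theorem expP_peel_const (v : V) :
    expP (lauD K V) (peel (K := K) 1 (PS.const 2 v)) = peel (K := K) 1 (PS.const 2 v) := by
  have h : ∀ j, peel (K := K) 1 (PS.const 2 v) (Finsupp.single 0 j)
      = if j = 0 then Lau.ofNat K (fun k => if k = 0 then v else 0) else 0 := by
    intro j
    refine Lau.ext fun k => ?_
    change Lau.coeff (peelFun K _ _) k = _
    rw [peelFun_coeff]
    split_ifs with hk hj hj
    · rw [hj, Lau.coeff_ofNat, if_pos hk]
      exact if_congr (by simp [Finsupp.ext_iff, Fin.forall_fin_succ, -Fin.succ_zero_eq_one]) rfl rfl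
    · refine (if_neg fun h => hj ?_).trans rfl
      have := DFunLike.congr_fun h (Fin.succ 0)
      rwa [Finsupp.cons_succ, Finsupp.single_eq_same] at this
    · rw [Lau.coeff_ofNat, if_neg hk]
    · rfl
  have hd : lauD K V (Lau.ofNat K (fun k => if k = 0 then v else 0)) = 0 := by
    refine Lau.ext fun k => ?_
    rw [coeff_lauDeriv, Lau.coeff_ofNat]
    by_cases hk : k + 1 = 0
    · rw [hk, zero_smul]; rfl
    · split_ifs with h1 h2
      · omega
      · rw [smul_zero]; rfl
      · rw [smul_zero]; rfl
  funext b
  have hb : b = Finsupp.single 0 (b 0) := by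
    ext
    simp
  rw [expP_apply]
  simp only [h]
  rw [expSeq_const]
  conv_rhs => rw [hb, h]
  cases b 0 with
  | zero => simp
  | succ n =>
    rw [pow_succ, Module.End.mul_apply, hd, map_zero, if_neg (Nat.succ_ne_zero n)]
    exact smul_zero _

variable [CharZero K]

theorem expP_lauD_T_smul (G : PS 1 (Lau K V)) :
    expP (lauD K V) ((MvPolynomial.C (Lau.T K) : MvPolynomial (Fin 1) (LaurentSeries K)) • G)
      = (MvPolynomial.C (Lau.T K) + MvPolynomial.X 0 : MvPolynomial (Fin 1) (LaurentSeries K))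
        • expP (lauD K V) G := by
  funext m
  have h : (fun j => ((MvPolynomial.C (Lau.T K) : MvPolynomial (Fin 1) (LaurentSeries K)) • G)
      (Finsupp.single 0 j)) = fun j => Lau.T K • G (Finsupp.single 0 j) := by
    funext j
    rw [C_smul_apply]
  have hT := expSeq_leibniz (lauD K V) (DistribSMul.toLinearMap K (Lau K V) (Lau.T K))
    lauDeriv_T_smul (fun j => G (Finsupp.single 0 j)) (m 0)
  rw [expP_apply, h, add_smul]
  refine hT.trans ?_
  change _ = (MvPolynomial.C (Lau.T K) • expP (lauD K V) G) m
    + ((MvPolynomial.X 0 : MvPolynomial (Fin 1) (LaurentSeries K)) • expP (lauD K V) G) m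
  rw [C_smul_apply, X_smul_apply, expP_apply, expP_apply, fin1_sub_single, Finsupp.single_eq_same]
  rfl

/-- Since $[\partial_w,w]=1$, conjugation by $e^{\gamma\partial_w}$ takes $w$ to $w+\gamma$, and it
fixes $\gamma$. -/
theorem expP_peel_smul (p : MvPolynomial (Fin 2) K) (G : PS 1 (Lau K V)) :
    expP (lauD K V) (peelRing 1 K p • G)
      = peelRing 1 K (lin (shiftMat K) p) • expP (lauD K V) G := by
  refine mvPolynomial_smul_of_X (peelRing 1 K) ((peelRing 1 K).comp (lin (shiftMat K)))
    (expP (lauD K V)) (fun i G => ?_) p G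
  rw [AlgHom.comp_apply]
  fin_cases i
  · simp only [Fin.zero_eta]
    rw [peelRing_X_zero, peelRing_shift_X0, expP_lauD_T_smul]
  · simp only [Fin.mk_one]
    rw [peelRing_shift_X1, show (1 : Fin 2) = Fin.succ 0 from rfl, peelRing_X_succ, expP_X_smul]

/-- Taylor's formula `F(w + γ, γ) = e^{γ ∂_w} F(w, γ)` for power series. -/
theorem peel_subst_shift (F : PS 2 V) :
    peel (K := K) 1 (PS.subst (shiftMat K) F) = expP (lauD K V) (peel (K := K) 1 F) := by
  funext b
  refine Lau.ext fun m => ?_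
  let ev : PS 1 (Lau K V) →+ V := ⟨⟨fun G => Lau.coeff (G b) m, rfl⟩, fun _ _ => rfl⟩
  -- Both sides preserve the total degree in $w$ and $\gamma$, so this coefficient depends only on
  -- the terms of degree $m+b_0$. On monomials the claim follows from the case of constants, as both
  -- sides are semilinear along the substitution.
  refine ps_ext_of_monomial (K := K) (m + b 0)
    (ev.comp ((peel (K := K) 1).toAddMonoidHom.comp (PS.subst (shiftMat K)).toAddMonoidHom))
    (ev.comp ((expP (lauD K V)).toAddMonoidHom.comp (peel (K := K) 1).toAddMonoidHom))
    (fun F hF => ?_) (fun F hF => ?_) (fun a v => ?_) F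
  · change Lau.coeff (peelFun K _ b) m = 0
    rw [peelFun_coeff]
    split_ifs with hm
    · refine finsum_eq_zero_of_forall_eq_zero fun a => ?_
      by_cases ha : a.degree = (Finsupp.cons m.toNat b : Fin 2 →₀ ℕ).degree
      · rw [hF a, smul_zero]
        rw [ha, Finsupp.degree_eq_sum, Fin.sum_univ_two, Finsupp.cons_zero,
          show (1 : Fin 2) = Fin.succ 0 from rfl, Finsupp.cons_succ]
        push_cast
        rw [Int.toNat_of_nonneg hm]
      · rw [(linMon_hom _ a).coeff_eq_zero (fun h => ha h.symm), zero_smul]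
    · rfl
  · change Lau.coeff (expSeq (lauD K V) (fun j => peelFun K F (Finsupp.single 0 j)) (b 0)) m = 0
    rw [expSeq, lauCoeff_sum]
    refine Finset.sum_eq_zero fun p hp => ?_
    rw [Finset.HasAntidiagonal.mem_antidiagonal] at hp
    rw [lau_coeff_smul, coeff_lauD_pow, smul_zero]
    rw [peelFun_coeff]
    split_ifs with hm
    · refine hF _ ?_
      rw [Finsupp.degree_eq_sum, Fin.sum_univ_two, Finsupp.cons_zero,
          show (1 : Fin 2) = Fin.succ 0 from rfl, Finsupp.cons_succ, Finsupp.single_eq_same]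
      push_cast
      rw [Int.toNat_of_nonneg hm, ← hp]
      push_cast
      ring
    · rfl
  · have h0 : peel (K := K) 1 (PS.subst (shiftMat K) (PS.const 2 v))
        = expP (lauD K V) (peel (K := K) 1 (PS.const 2 v)) := by
      rw [subst_const, expP_peel_const]
    change Lau.coeff (peel (K := K) 1 (PS.subst (shiftMat K) _) b) m
      = Lau.coeff (expP _ (peel (K := K) 1 _) b) m
    have h1 := (PS.subst (W := V) (shiftMat K)).map_smul' (MvPolynomial.monomial a 1) (PS.const 2 v)
    have h2 := (peel (K := K) (W := V) 1).map_smul' (lin (shiftMat K) (MvPolynomial.monomial a 1))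
      (PS.subst (shiftMat K) (PS.const 2 v))
    have h3 := (peel (K := K) (W := V) 1).map_smul' (MvPolynomial.monomial a 1) (PS.const 2 v)
    have h4 := expP_peel_smul (MvPolynomial.monomial a 1) (peel (K := K) 1 (PS.const 2 v))
    refine congrArg (fun G : PS 1 (Lau K V) => Lau.coeff (G b) m) ?_
    refine (congrArg (peel (K := K) 1) h1).trans (h2.trans ?_)
    refine Eq.trans ?_ ((congrArg (expP (lauD K V)) h3).trans h4).symm
    rw [← h0]
    rfl

/-- The poles become $w+\gamma$ and $w$, both invertible for $|w|>|\gamma|$, so Taylor's formula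
extends from power series to fractions. -/
theorem toP1_shift (x : Sing (polesX K) V) :
    toP1 (shiftMat K) (polesX K) shiftMat_unit x = expP (lauD K V) (evX x) := by
  refine locLift_ext (φ := ((peelRing 1 K).comp (lin (shiftMat K))).toRingHom)
    (fun d hd => isUnit_end_ps (shiftMat_unit d hd).isUnit)
    (toP1 (shiftMat K) (polesX K) shiftMat_unit) (fun x => expP (lauD K V) (evX x))
    (toP1_smul shiftMat_unit) (fun p x => ?_) (fun F => ?_) x
  · rw [evX_smul, expP_peel_smul]; rfl
  · rw [toP1_mk_one, peel_subst_shift]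
    exact congrArg _ (evX_mk_one (K := K) F).symm

end Taylor

/-! ### Broken translation covariance for $|w|>|\gamma|$ -/

section TranslationSeries
variable {K : Type*} [Field K] {V : Type*} [AddCommGroup V] [Module K V]

/-- `z_1, z_2, γ ↦ w, 0, γ`. -/
abbrev transMat (K : Type*) [Field K] : Fin 3 → Fin 2 → K := ![![1, 0], ![0, 0], ![0, 1]]

theorem peelRing_trans_X0 : peelRing 1 K (lin (transMat K) (MvPolynomial.X 0))
    = MvPolynomial.C (Lau.T K) := by
  rw [lin_X, Fin.sum_univ_two]
  simp [peelRing_X_zero]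

theorem peelRing_trans_X1 : peelRing 1 K (lin (transMat K) (MvPolynomial.X 1)) = 0 := by
  rw [lin_X, Fin.sum_univ_two]
  simp

theorem peelRing_trans_X2 : peelRing 1 K (lin (transMat K) (MvPolynomial.X 2))
    = MvPolynomial.X 0 := by
  rw [lin_X, Fin.sum_univ_two]
  simp only [Matrix.cons_val, zero_mul, map_zero, MvPolynomial.C_1, one_mul, zero_add]
  rw [show (1 : Fin 2) = Fin.succ 0 from rfl, peelRing_X_succ]

theorem transMat_unit : ∀ d ∈ polesT K,
    MvPolynomial.constantCoeff (peelRing 1 K (lin (transMat K) d)) ≠ 0 := by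
  intro d hd
  simp only [polesT, Set.mem_insert_iff, Set.mem_singleton_iff] at hd
  rcases hd with rfl | rfl | rfl
  · rw [peelRing_trans_X0]; simp [T_ne_zero]
  · rw [map_sub, map_sub, peelRing_trans_X0, peelRing_trans_X1]; simp [T_ne_zero]
  · rw [map_add, map_add, peelRing_trans_X0, peelRing_trans_X2]; simp [T_ne_zero]

/-- The power series in `γ` with coefficients in `K((w))`. -/
abbrev GammaRing (K : Type*) [Field K] : Type _ := MvPowerSeries (Fin 1) (LaurentSeries K)

instance : IsScalarTower K (GammaRing K) (PS 1 (Lau K V)) where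
  smul_assoc c p F := by
    funext m
    change (∑ x ∈ Finset.HasAntidiagonal.antidiagonal m, MvPowerSeries.coeff x.1 (c • p) • F x.2)
      = c • ∑ x ∈ Finset.HasAntidiagonal.antidiagonal m, MvPowerSeries.coeff x.1 p • F x.2
    rw [Finset.smul_sum]
    refine Finset.sum_congr rfl fun x _ => ?_
    exact smul_assoc c (MvPowerSeries.coeff x.1 p) (F x.2)

variable (K) in
/-- `f(z_1, z_2, γ) ↦ f(w, 0, γ)`, expanded in the region `|w| > |γ|`. -/
def ratGamma : Rat (polesT K) →ₐ[K] GammaRing K :=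
  ratLift (polesT K) (((MvPolynomial.coeToMvPowerSeries.algHom (LaurentSeries K)).restrictScalars K).comp
    ((peelRing 1 K).comp (lin (transMat K)))) fun d hd => by
      rw [MvPowerSeries.isUnit_iff_constantCoeff]
      exact (transMat_unit d hd).isUnit

theorem ratGamma_algebraMap (p : MvPolynomial (Fin 3) K) :
    ratGamma K (algebraMap (MvPolynomial (Fin 3) K) (Rat (polesT K)) p)
      = (peelRing 1 K (lin (transMat K) p) : GammaRing K) :=
  ratLift_algebraMap _ _ _ _

theorem ratGamma_smul (p : MvPolynomial (Fin 3) K) (F : PS 1 (Lau K V)) :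
    ratGamma K (algebraMap (MvPolynomial (Fin 3) K) (Rat (polesT K)) p) • F
      = peelRing 1 K (lin (transMat K) p) • F := by
  rw [ratGamma_algebraMap]; rfl

theorem expP_lauMapEnd_C_smul (D : V →ₗ[K] V) (G : PS 1 (Lau K V)) :
    expP (lauMapEnd D) ((MvPolynomial.C (Lau.T K) : MvPolynomial (Fin 1) (LaurentSeries K)) • G)
      = (MvPolynomial.C (Lau.T K) : MvPolynomial (Fin 1) (LaurentSeries K))
        • expP (lauMapEnd D) G := by
  funext m
  have h : (fun j => ((MvPolynomial.C (Lau.T K) : MvPolynomial (Fin 1) (LaurentSeries K)) • G)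
      (Finsupp.single 0 j)) = fun j => Lau.T K • G (Finsupp.single 0 j) := by
    funext j
    rw [C_smul_apply]
  have hT := expSeq_comm (lauMapEnd D) (DistribSMul.toLinearMap K (Lau K V) (Lau.T K))
    (fun F => Lau.ext fun k => by
      change D (Lau.coeff (Lau.T K • F) k) = Lau.coeff (Lau.T K • lauMapEnd D F) k
      rw [Lau.coeff_T_smul, Lau.coeff_T_smul]; rfl)
    (fun j => G (Finsupp.single 0 j)) (m 0)
  rw [expP_apply, h, C_smul_apply, expP_apply]
  exact hT

theorem expP_ratGamma_smul (D : V →ₗ[K] V) (r : Rat (polesT K)) (G : PS 1 (Lau K V)) :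
    expP (lauMapEnd D) (ratGamma K r • G) = ratGamma K r • expP (lauMapEnd D) G := by
  refine rat_smul_of_X (ratGamma K) (ratGamma K) (expP (lauMapEnd D)) (fun i G => ?_) r G
  rw [ratGamma_smul, ratGamma_smul]
  fin_cases i
  · simp only [Fin.zero_eta]
    rw [peelRing_trans_X0, expP_lauMapEnd_C_smul]
  · simp only [Fin.mk_one]
    rw [peelRing_trans_X1, zero_smul, zero_smul, map_zero]
  · simp only [Fin.reduceFinMk]
    rw [peelRing_trans_X2, expP_X_smul]

theorem const_T_smul (F : Lau K V) : PS.const 1 (Lau.T K • F)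
    = (MvPolynomial.C (Lau.T K) : MvPolynomial (Fin 1) (LaurentSeries K)) • PS.const 1 F := by
  funext m
  rw [C_smul_apply, PS.const, PS.const, smul_ite, smul_zero]

variable (K V) in
/-- The embedding of the constants in the power series in `γ`. -/
def constP : Lau K V →ₗ[K] PS 1 (Lau K V) where
  toFun := PS.const 1
  map_add' F G := funext fun m => by
    change PS.const 1 (F + G) m = PS.const 1 F m + PS.const 1 G m
    simp only [PS.const]
    split_ifs <;> simp
  map_smul' c F := funext fun m => by
    change PS.const 1 (c • F) m = c • PS.const 1 F m
    simp only [PS.const]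
    split_ifs
    · rfl
    · exact (smul_zero c).symm

theorem expP_const_smul (D : V →ₗ[K] V) (p : MvPolynomial (Fin 2) K) (F : Lau K V) :
    expP (lauMapEnd D) (PS.const 1 (flatRing K (lin ![![1], ![0]] p) • F))
      = peelRing 1 K (lin (matMul (inclMat K) (transMat K)) p)
        • expP (lauMapEnd D) (PS.const 1 F) := by
  refine mvPolynomial_smul_of_X ((flatRing K).comp (lin ![![1], ![0]]))
    ((peelRing 1 K).comp (lin (matMul (inclMat K) (transMat K))))
    (expP (lauMapEnd D) ∘ₗ constP K V) (fun i F => ?_) p F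
  rw [AlgHom.comp_apply, AlgHom.comp_apply, ← lin_comp, AlgHom.comp_apply]
  fin_cases i
  · have h1 : flatRing K (lin (![![1], ![0]] : Fin 2 → Fin 1 → K) (MvPolynomial.X 0)) = Lau.T K := by
      simp [lin_X, flatRing]
    have h2 : lin (inclMat K) (MvPolynomial.X 0) = MvPolynomial.X 0 := by
      simp [lin_X, Fin.sum_univ_succ]
    simp only [Fin.zero_eta]
    rw [h1, h2, peelRing_trans_X0]
    exact (congrArg _ (const_T_smul F)).trans (expP_lauMapEnd_C_smul D _)
  · have h1 : flatRing K (lin (![![1], ![0]] : Fin 2 → Fin 1 → K) (MvPolynomial.X 1)) = 0 := by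
      simp [lin_X]
    have h2 : lin (inclMat K) (MvPolynomial.X 1) = MvPolynomial.X 1 := by
      simp [lin_X, Fin.sum_univ_succ]
    simp only [Fin.mk_one]
    rw [h1, h2, peelRing_trans_X1, zero_smul (LaurentSeries K) F, zero_smul, map_zero]

theorem subst_transMat (F : PS 3 V) (n i : ℕ) :
    PS.subst (transMat K) F (Finsupp.cons i (Finsupp.single 0 n))
      = F (Finsupp.cons i (Finsupp.cons 0 (Finsupp.single 0 n))) := by
  have hM : transMat K = rowMat K ![some 0, none, some 1] := by
    ext i j; fin_cases i <;> fin_cases j <;> simp [rowMat]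
  rw [hM, subst_rowMat _ _ _ (Finsupp.cons i (Finsupp.cons 0 (Finsupp.single 0 n)))]
  intro a
  simp [Fin.forall_fin_succ, Fin.sum_univ_succ, DFunLike.ext_iff]
  tauto

theorem expP_const {N : Type*} [AddCommGroup N] [Module K N] (A : N →ₗ[K] N) (y : N) (n : ℕ) :
    expP A (PS.const 1 y) (Finsupp.single 0 n) = (n.factorial : K)⁻¹ • (A ^ n) y := by
  have h : (fun j => PS.const 1 y (Finsupp.single 0 j)) = fun j => if j = 0 then y else 0 :=
    funext fun j => if_congr (by simp) rfl rfl
  rw [expP_apply, Finsupp.single_eq_same, h, expSeq_const]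

/-- The same evaluation as in `toL2_expAct`, but in the region $|w|>|\gamma|$, where the result is a
power series in $\gamma$. -/
theorem toP1_expAct (D : V →ₗ[K] V) (y : Sing (polesX K) V) :
    toP1 (transMat K) (polesT K) transMat_unit
        (expAct D 2 (polesT K) (Sing.subst (inclMat K) (adm_incl K) y))
      = expP (lauMapEnd D)
        (PS.const 1 (Sing.flat (Sing.subst ![![1], ![0]] (adm_eval K) y))) := by
  refine locLift_ext (R' := MvPolynomial (Fin 1) (LaurentSeries K))
    (φ := ((peelRing 1 K).comp (lin (matMul (inclMat K) (transMat K)))).toRingHom)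
    (fun d hd => isUnit_end_ps (IsUnit.mk0 _ ?_))
    (fun y => toP1 (transMat K) (polesT K) transMat_unit
        (expAct D 2 (polesT K) (Sing.subst (inclMat K) (adm_incl K) y)))
    (fun y => expP (lauMapEnd D)
        (PS.const 1 (Sing.flat (Sing.subst ![![1], ![0]] (adm_eval K) y))))
    (fun p x => ?_) (fun p x => ?_) (fun F => ?_) y
  · change MvPolynomial.constantCoeff
      (peelRing 1 K (lin (matMul (inclMat K) (transMat K)) d)) ≠ 0
    simp only [polesX, Set.mem_insert_iff, Set.mem_singleton_iff] at hd
    rcases hd with rfl | rfl <;>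
    simp [lin_X, matMul, Fin.sum_univ_succ, constantCoeff_peelRing_X0, T_ne_zero]
  · rw [Sing.subst_smul, expAct_smul, toP1_smul, ← AlgHom.comp_apply (lin (transMat K)), lin_comp]
    rfl
  · rw [Sing.subst_smul, singFlat_smul, expP_const_smul]
    rfl
  · rw [Sing.subst_mk_one, Sing.subst_mk_one, singFlat_mk_one, expAct_mk_one, toP1_mk_one]
    funext b
    have hb : b = Finsupp.single 0 (b 0) := by
      ext
      simp
    rw [hb]
    generalize b 0 = n
    refine Eq.trans ?_ (expP_const (lauMapEnd D) _ n).symm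
    refine Lau.ext fun m => ?_
    rw [lau_coeff_smul]
    change Lau.coeff (peelFun K _ (Finsupp.single 0 n)) m = _
    have hp : ∀ G : Lau K V, Lau.coeff ((lauMapEnd D ^ n) G) m = (D ^ n) (G.coeff m) := by
      induction n with
      | zero => intro G; rfl
      | succ n ih =>
        intro G
        rw [pow_succ', pow_succ', Module.End.mul_apply, Module.End.mul_apply, coeff_lauMapEnd, ih]
    rw [hp, peelFun_coeff]
    change _ = _ • (D ^ n) (Lau.coeff (flatFun K _) m)
    rw [flatFun_coeff]
    by_cases hm : 0 ≤ m
    · rw [if_pos hm, if_pos hm, subst_evalSnd, subst_transMat, expSeries_smul_incl]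
      have e2 : (Finsupp.cons m.toNat (Finsupp.cons 0 (Finsupp.single 0 n)) : Fin 3 →₀ ℕ) 2 = n := by
        rw [show (2 : Fin 3) = Fin.succ (Fin.succ 0) from rfl, Finsupp.cons_succ,
          Finsupp.cons_succ, Finsupp.single_eq_same]
      have e1 : (Finsupp.cons m.toNat (Finsupp.cons 0 (Finsupp.single 0 n)) : Fin 3 →₀ ℕ) 1 = 0 := rfl
      rw [e2, e1, Finsupp.cons_zero, Finsupp.single_zero]
    · rw [if_neg hm, if_neg hm, map_zero, smul_zero]

end TranslationSeries

/-! ### The differential equation in $\gamma$ -/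

section TranslationSeries
variable {K : Type*} [Field K] {V : Type*} [AddCommGroup V] [Module K V]
  (Q : HDQuantumVertexAlgebra K V)

/-- `Y_w S^{(γ)}_{w,0}`, expanded in the region `|w| > |γ|`. -/
def gammaSeries : ℕ → V ⊗[K] V →ₗ[K] PS 1 (Lau K V) :=
  bc (ratGamma K) (fun i => constP K V ∘ₗ Q.Y i) Q.trans

/-- The coefficient of `γ^n` in `Y_w S^{(γ)}_{w,0}`. -/
def gammaCoeff (n k : ℕ) : V ⊗[K] V →ₗ[K] Lau K V :=
  LinearMap.proj (Finsupp.single 0 n) ∘ₗ gammaSeries Q k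

theorem gammaCoeff_apply (n k : ℕ) (u : V ⊗[K] V) :
    gammaCoeff Q n k u = gammaSeries Q k u (Finsupp.single 0 n) := rfl

theorem toP1_expAct_rat_smul (r : Rat (polesT K)) (x : Sing (polesT K) V) :
    toP1 (transMat K) (polesT K) transMat_unit (expAct Q.D 2 (polesT K) (r • x))
      = ratGamma K r
        • toP1 (transMat K) (polesT K) transMat_unit (expAct Q.D 2 (polesT K) x) := by
  refine rat_smul_of_X (AlgHom.id K (Rat (polesT K))) (ratGamma K)
    (toP1 (transMat K) (polesT K) transMat_unit ∘ₗ
      (endLoc (polesT K) (psEnd (K := K) (expSeries Q.D 2))).restrictScalars K) (fun i m => ?_) r x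
  rw [AlgHom.id_apply, algebraMap_smul, ratGamma_smul]
  change toP1 (transMat K) (polesT K) transMat_unit (expAct Q.D 2 (polesT K) _) = _
  rw [expAct_smul, toP1_smul]
  rfl

/-- Broken translation covariance, expanded for `z_1 = w`, `z_2 = 0` and `|w| > |γ|`. -/
theorem toP1_shift_X (k : ℕ) (u : V ⊗[K] V) :
    toP1 (shiftMat K) (polesX K) shiftMat_unit (Q.X k u)
      = expP (lauMapEnd Q.D) (gammaSeries Q k u) := by
  suffices h : toP1 (shiftMat K) (polesX K) shiftMat_unit ∘ₗ Q.X k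
      = expP (lauMapEnd Q.D) ∘ₗ gammaSeries Q k from DFunLike.congr_fun h u
  refine TensorProduct.ext' fun a b => ?_
  have e1 : matMul ![![1, 0, 1], ![0, 1, 1]] (transMat K) = shiftMat K := by
    funext i j; fin_cases i <;> fin_cases j <;> simp [matMul, Fin.sum_univ_succ]
  have he1 : ∀ M : Fin 2 → Fin 2 → K, M = shiftMat K → ∀ d ∈ polesX K,
      MvPolynomial.constantCoeff (peelRing 1 K (lin M d)) ≠ 0 := by
    rintro _ rfl
    exact shiftMat_unit
  have he2 : ∀ (M : Fin 2 → Fin 2 → K) (e : M = shiftMat K) (x : Sing (polesX K) V), toP1 M (polesX K) (he1 M e) x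
      = toP1 (shiftMat K) (polesX K) shiftMat_unit x := by
    rintro _ rfl x
    rfl
  have h := congrArg (toP1 (transMat K) (polesT K) transMat_unit) (Q.translation k a b)
  rw [toP1_subst (adm_shift K) transMat_unit (he1 _ e1), he2 _ e1, applySeries_extend] at h
  refine h.symm.trans ?_
  have h2 := map_bc (AlgHom.id K _) (ratGamma K)
    (toP1 (transMat K) (polesT K) transMat_unit ∘ₗ
      (endLoc (polesT K) (psEnd (K := K) (expSeries Q.D 2))).restrictScalars K)
    (fun r m => toP1_expAct_rat_smul Q r m)
    (y := fun i => Sing.subst (inclMat K) (adm_incl K) ∘ₗ Q.X i)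
    (y' := fun i => expP (lauMapEnd Q.D) ∘ₗ constP K V ∘ₗ Q.Y i)
    (fun i u => toP1_expAct Q.D (Q.X i u)) Q.trans k (a ⊗ₜ b)
  refine h2.trans ?_
  exact (map_bc (ratGamma K) (ratGamma K) (expP (lauMapEnd Q.D))
    (fun r m => expP_ratGamma_smul Q.D r m) (y := fun i => constP K V ∘ₗ Q.Y i)
    (fun i u => rfl) Q.trans k (a ⊗ₜ b)).symm

variable [CharZero K]

/-- Broken translation covariance and Taylor's formula compute the expansion of
$X_{w+\gamma,\gamma}$ in two ways. -/
theorem expSeq_gammaCoeff (k j : ℕ) (u : V ⊗[K] V) :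
    expSeq (lauMapEnd Q.D) (fun j => gammaCoeff Q j k u) j
      = expSeq (lauD K V) (fun j => evX (Q.X k u) (Finsupp.single 0 j)) j := by
  have h : expP (lauMapEnd Q.D) (gammaSeries Q k u) (Finsupp.single 0 j)
      = expP (lauD K V) (evX (Q.X k u)) (Finsupp.single 0 j) :=
    congrFun ((toP1_shift_X Q k u).symm.trans (toP1_shift (Q.X k u))) (Finsupp.single 0 j)
  rw [expP_apply, expP_apply, Finsupp.single_eq_same] at h
  exact h

/-- At $\gamma=0$ both exponentials disappear. -/
theorem gammaCoeff_zero : gammaCoeff Q 0 = Q.Y := by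
  funext k
  refine LinearMap.ext fun u => ?_
  have h := expSeq_gammaCoeff Q k 0 u
  rw [expSeq_zero, expSeq_zero, Finsupp.single_zero] at h
  rw [h, evX_zero]
  rfl

/-- The identity of `expSeq_gammaCoeff` is differentiated in $\gamma$. On the side of $X$ this
produces $\partial_w$ and, by covariance, $D$ on the second vector; on the other side it produces
$D$ and the derivative of the series sought. Since $D$ commutes with $\partial_w$, the factor
$e^{\gamma D}$ can be cancelled. This recursion determines every coefficient from $Y$. -/
theorem gammaCoeff_succ (n k : ℕ) : (n + 1 : K) • gammaCoeff Q (n + 1) k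
    = translationOp Q.D (gammaCoeff Q n) k := by
  have hD : ∀ u j, evX (Q.X k (Q.D.lTensor V u)) (Finsupp.single 0 j)
      = (j + 1 : K) • evX (Q.X k u) (Finsupp.single 0 (j + 1)) := by
    intro u j
    induction u with
    | zero => simp; exact (smul_zero _).symm
    | add x y hx hy =>
      simp only [map_add]
      refine (congrArg₂ (· + ·) hx hy).trans ?_
      exact (smul_add _ _ _).symm
    | tmul a b => exact evX_X_D Q k a b j
  refine LinearMap.ext fun u => ?_
  have hinj := expSeq_injective (lauMapEnd Q.D) (G := fun j => (j + 1 : K) • gammaCoeff Q (j + 1) k u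
    - (lauD K V (gammaCoeff Q j k u) + gammaCoeff Q j k (Q.D.lTensor V u)
      - lauMapEnd Q.D (gammaCoeff Q j k u))) (fun j => ?_) n
  · exact sub_eq_zero.1 hinj
  · have hc : ∀ x, lauMapEnd Q.D (lauD K V x) = lauD K V (lauMapEnd Q.D x) := fun x =>
      Lau.ext fun m => by
        rw [coeff_lauMapEnd, coeff_lauDeriv, coeff_lauDeriv, coeff_lauMapEnd, map_zsmul]
    have h1 := expSeq_succ (lauMapEnd Q.D) (fun j => gammaCoeff Q j k u) j
    have h2 := expSeq_succ (lauD K V) (fun j => evX (Q.X k u) (Finsupp.single 0 j)) j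
    -- The derivative in the second variable of $X$ becomes $D$ on the second vector, so that
    -- `expSeq_gammaCoeff` applies to the new vector.
    simp only [← hD] at h2
    rw [← expSeq_gammaCoeff, ← expSeq_gammaCoeff, ← expSeq_gammaCoeff, h1] at h2
    rw [expSeq_sub, expSeq_sub, expSeq_add, expSeq_comm _ _ hc,
      expSeq_comm (lauMapEnd Q.D) (lauMapEnd Q.D) (fun _ => rfl), ← h2]
    abel

end TranslationSeries

/-! ### Evaluating rational functions of $\gamma$ at $\gamma=x$ -/

section EvaluationAt
variable {F M : Type*} [Field F] [AddCommGroup M] [Module F M]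

/-- Multiplication by `γ` on power series in `γ`. -/
def seqShift (F M : Type*) [Field F] [AddCommGroup M] [Module F M] : (ℕ → M) →ₗ[F] (ℕ → M) where
  toFun G n := if n = 0 then 0 else G (n - 1)
  map_add' G H := funext fun n => by
    change (if n = 0 then 0 else G (n - 1) + H (n - 1))
      = (if n = 0 then 0 else G (n - 1)) + if n = 0 then 0 else H (n - 1)
    split_ifs <;> simp
  map_smul' c G := funext fun n => by
    change (if n = 0 then 0 else c • G (n - 1)) = c • if n = 0 then 0 else G (n - 1)
    split_ifs <;> simp

/-- The pairs of a polynomial in `γ` and its value at `γ = x`. -/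
def polyEval (M : Type*) [AddCommGroup M] [Module F M] (x : F) : Submodule F ((ℕ → M) × M) :=
  LinearMap.range ((Finsupp.lcoeFun : (ℕ →₀ M) →ₗ[F] ℕ → M).prod
    (Finsupp.lsum F fun n => x ^ n • LinearMap.id))

/-- A polynomial is determined by its coefficients, and so is its value. -/
theorem polyEval_unique {x : F} {m : M} (h : ((0, m) : (ℕ → M) × M) ∈ polyEval M x) : m = 0 := by
  obtain ⟨p, hp⟩ := h
  have : p = 0 := DFunLike.coe_injective (congrArg Prod.fst hp)
  rw [← show _ = m from congrArg Prod.snd hp, this]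
  exact map_zero _

theorem single_mem_polyEval (x : F) (n : ℕ) (m : M) :
    ((Pi.single n m, x ^ n • m) : (ℕ → M) × M) ∈ polyEval M x := by
  refine ⟨Finsupp.single n m, Prod.ext ?_ ?_⟩
  · funext i
    change Finsupp.single n m i = _
    simp [Finsupp.single_apply, Pi.single_apply, eq_comm]
  · change Finsupp.lsum F (fun n => x ^ n • (LinearMap.id : M →ₗ[F] M)) (Finsupp.single n m) = _
    simp

theorem seqShift_single (n : ℕ) (m : M) : seqShift F M (Pi.single n m) = Pi.single (n + 1) m := by
  funext i
  change (if i = 0 then 0 else (Pi.single n m : ℕ → M) (i - 1)) = _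
  cases i with
  | zero => simp
  | succ i => simp [Pi.single_apply]

/-- Multiplication by `γ`, and by `x`. -/
def mulPair (M : Type*) [AddCommGroup M] [Module F M] (x : F) : Module.End F ((ℕ → M) × M) :=
  (seqShift F M).prodMap (x • LinearMap.id)

theorem mulPair_apply (x : F) (f : ℕ → M) (m : M) :
    mulPair M x (f, m) = (seqShift F M f, x • m) := rfl

theorem mulPair_mem_polyEval {x : F} {p : (ℕ → M) × M} (h : p ∈ polyEval M x) :
    mulPair M x p ∈ polyEval M x := by
  obtain ⟨q, rfl⟩ := h
  induction q using Finsupp.induction_linear with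
  | zero => rw [map_zero, map_zero]; exact zero_mem _
  | add q r hq hr => rw [map_add, map_add]; exact add_mem hq hr
  | single n m =>
    have e : mulPair M x (((Finsupp.lcoeFun : (ℕ →₀ M) →ₗ[F] ℕ → M).prod
        (Finsupp.lsum F fun n => x ^ n • LinearMap.id))
        (Finsupp.single n m)) = (Pi.single (n + 1) m, x ^ (n + 1) • m) := by
      have h1 : (⇑(Finsupp.single n m) : ℕ → M) = Pi.single n m := by
        funext i
        simp [Finsupp.single_apply, Pi.single_apply, eq_comm]
      refine Prod.ext ?_ ?_
      · change seqShift F M ⇑(Finsupp.single n m) = _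
        rw [h1, seqShift_single]
      · change x • Finsupp.lsum F (fun n => x ^ n • (LinearMap.id : M →ₗ[F] M)) (Finsupp.single n m) = _
        simp [pow_succ', mul_smul]
    rw [e]
    exact single_mem_polyEval _ _ _

/-- Multiplication by `w + γ`, and by `w + x`. -/
def denPair (M : Type*) [AddCommGroup M] [Module F M] (x w : F) : Module.End F ((ℕ → M) × M) :=
  w • LinearMap.id + mulPair M x

theorem denPair_apply (x w : F) (f : ℕ → M) (m : M) :
    denPair M x w (f, m) = (w • f + seqShift F M f, w • m + x • m) := rfl

theorem denPair_mem_polyEval {x w : F} {p : (ℕ → M) × M} (h : p ∈ polyEval M x) :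
    denPair M x w p ∈ polyEval M x :=
  add_mem (Submodule.smul_mem _ w h) (mulPair_mem_polyEval h)

theorem denPair_pow_mem_polyEval {x w : F} {p : (ℕ → M) × M} (n : ℕ) (h : p ∈ polyEval M x) :
    (denPair M x w ^ n) p ∈ polyEval M x := by
  induction n with
  | zero => exact h
  | succ n ih => rw [pow_succ', Module.End.mul_apply]; exact denPair_mem_polyEval ih

/-- The pairs of a rational function in `γ`, with denominator a power of `w + γ`, expanded for
`|w| > |γ|`, and its value at `γ = x`. -/
def ratEval (M : Type*) [AddCommGroup M] [Module F M] (x w : F) : Submodule F ((ℕ → M) × M) where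
  carrier := {p | ∃ n, (denPair M x w ^ n) p ∈ polyEval M x}
  zero_mem' := ⟨0, zero_mem _⟩
  add_mem' := by
    rintro p q ⟨i, hi⟩ ⟨j, hj⟩
    refine ⟨i + j, ?_⟩
    rw [map_add]
    refine add_mem ?_ ?_
    · rw [add_comm, pow_add]; exact denPair_pow_mem_polyEval _ hi
    · rw [pow_add]; exact denPair_pow_mem_polyEval _ hj
  smul_mem' := by
    rintro c p ⟨i, hi⟩
    refine ⟨i, ?_⟩
    rw [map_smul]
    exact Submodule.smul_mem _ c hi

theorem mem_ratEval_of_denPair {x w : F} {p : (ℕ → M) × M} (h : denPair M x w p ∈ ratEval M x w) :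
    p ∈ ratEval M x w := by
  obtain ⟨n, hn⟩ := h
  exact ⟨n + 1, by rwa [pow_succ, Module.End.mul_apply]⟩

theorem mulPair_mem_ratEval {x w : F} {p : (ℕ → M) × M} (h : p ∈ ratEval M x w) :
    mulPair M x p ∈ ratEval M x w := by
  obtain ⟨n, hn⟩ := h
  refine ⟨n, ?_⟩
  have hc : Commute (denPair M x w) (mulPair M x) := by
    refine Commute.add_left ?_ (Commute.refl _)
    exact (Commute.one_left _).smul_left w
  rw [← Module.End.mul_apply, (hc.pow_left n).eq, Module.End.mul_apply]
  exact mulPair_mem_polyEval hn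

theorem single_mem_ratEval (x w : F) (m : M) :
    ((Pi.single 0 m, m) : (ℕ → M) × M) ∈ ratEval M x w :=
  ⟨0, by simpa using single_mem_polyEval x 0 m⟩

/-- Clearing denominators multiplies the value by a power of the nonzero scalar $w+x$. So a series
expanded for $|w|>|\gamma|$ has at most one value at $\gamma=x$, although in the intended
application $x$ lies outside that region. -/
theorem ratEval_unique {x w : F} (h0 : w + x ≠ 0) {m : M}
    (h : ((0, m) : (ℕ → M) × M) ∈ ratEval M x w) : m = 0 := by
  obtain ⟨n, hn⟩ := h
  have e : ∀ (n : ℕ) (m : M), (denPair M x w ^ n) ((0, m) : (ℕ → M) × M) = (0, (w + x) ^ n • m) := by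
    intro n
    induction n with
    | zero => intro m; simp
    | succ n ih =>
      intro m
      rw [pow_succ, Module.End.mul_apply]
      have : denPair M x w ((0, m) : (ℕ → M) × M) = (0, (w + x) • m) := by
        refine Prod.ext ?_ ?_
        · change w • (0 : ℕ → M) + seqShift F M 0 = 0
          rw [smul_zero, map_zero, add_zero]
        · exact (add_smul w x m).symm
      rw [this, ih, smul_smul, pow_succ]
  rw [e] at hn
  exact (smul_eq_zero.1 (polyEval_unique hn)).resolve_left (pow_ne_zero n h0)

theorem ratEval_ext {x w : F} (h0 : w + x ≠ 0) {G : ℕ → M} {m m' : M} (h : (G, m) ∈ ratEval M x w)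
    (h' : (G, m') ∈ ratEval M x w) : m = m' := by
  refine sub_eq_zero.1 (ratEval_unique h0 ?_)
  have := sub_mem h h'
  rwa [Prod.mk_sub_mk, sub_self] at this

section BaseChange
variable {K A U W : Type*} [Field K] [Algebra K F] [Module K M] [IsScalarTower K F M]
  [CommRing A] [Algebra K A] [AddCommGroup U] [Module K U] [AddCommGroup W] [Module K W]

/-- The scalars that $s$ contributes do not involve $\gamma$, so composing with $s$ commutes with
the evaluation. -/
theorem bc_mem_ratEval {x w : F} (ρ : A →ₐ[K] F) {y' : ℕ → ℕ → U →ₗ[K] M} {y : ℕ → U →ₗ[K] M}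
    (h : ∀ k u, ((fun n => y' n k u, y k u) : (ℕ → M) × M) ∈ ratEval M x w)
    (s : ℕ → W →ₗ[K] A ⊗[K] U) (k : ℕ) (u : W) :
    ((fun n => bc ρ (y' n) s k u, bc ρ y s k u) : (ℕ → M) × M) ∈ ratEval M x w := by
  have h1 : ∀ i (v : A ⊗[K] U),
      ((fun n => lb ρ (y' n i) v, lb ρ (y i) v) : (ℕ → M) × M) ∈ ratEval M x w := by
    intro i v
    induction v with
    | zero => simp only [map_zero]; exact zero_mem _
    | add v v' hv hv' => simp only [map_add]; exact add_mem hv hv'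
    | tmul r u => simp only [lb_tmul]; exact Submodule.smul_mem _ (ρ r) (h i u)
  have e : ((fun n => bc ρ (y' n) s k u, bc ρ y s k u) : (ℕ → M) × M)
      = ∑ p ∈ Finset.HasAntidiagonal.antidiagonal k,
        (fun n => lb ρ (y' n p.1) (s p.2 u), lb ρ (y p.1) (s p.2 u)) := by
    refine Prod.ext (funext fun n => ?_) ?_
    · rw [Prod.fst_sum, Finset.sum_apply]; exact bc_apply _ _ _ _ _
    · rw [Prod.snd_sum]; exact bc_apply _ _ _ _ _
  rw [e]
  exact sum_mem fun p _ => h1 _ _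

end BaseChange
end EvaluationAt

/-! ### Relations stable under rational functions -/

section Relations
variable {K B B' N N' : Type*} [Field K] [CommRing B] [Algebra K B] [CommRing B'] [Algebra K B']
  [AddCommGroup N] [Module K N] [Module B N] [IsScalarTower K B N]
  [AddCommGroup N'] [Module K N'] [Module B' N'] [IsScalarTower K B' N']
  (S : Submodule K (N × N'))

/-- A subspace of `N × N'` which is stable under the variables, and from which the denominators
can be cancelled, is stable under rational functions. -/
theorem rat_smul_mem_of_X {n : ℕ} {D : Set (MvPolynomial (Fin n) K)} (ρ : Rat D →ₐ[K] B)
    (ρ' : Rat D →ₐ[K] B')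
    (hX : ∀ (i : Fin n) (m : N) (m' : N'), (m, m') ∈ S →
      (ρ (algebraMap (MvPolynomial (Fin n) K) _ (MvPolynomial.X i)) • m,
        ρ' (algebraMap (MvPolynomial (Fin n) K) _ (MvPolynomial.X i)) • m') ∈ S)
    (hD : ∀ d ∈ D, ∀ (m : N) (m' : N'), (ρ (algebraMap (MvPolynomial (Fin n) K) _ d) • m,
        ρ' (algebraMap (MvPolynomial (Fin n) K) _ d) • m') ∈ S → (m, m') ∈ S)
    (r : Rat D) {m : N} {m' : N'} (h : (m, m') ∈ S) : (ρ r • m, ρ' r • m') ∈ S := by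
  have hp : ∀ (p : MvPolynomial (Fin n) K) (m : N) (m' : N'), (m, m') ∈ S →
      (ρ (algebraMap _ _ p) • m, ρ' (algebraMap _ _ p) • m') ∈ S := by
    intro p
    induction p using MvPolynomial.induction_on with
    | C k =>
      intro m m' h
      have e : algebraMap (MvPolynomial (Fin n) K) (Rat D) (MvPolynomial.C k)
          = algebraMap K (Rat D) k := (IsScalarTower.algebraMap_apply K _ _ k).symm
      rw [e, AlgHom.commutes, AlgHom.commutes, algebraMap_smul, algebraMap_smul]
      exact Submodule.smul_mem S k h
    | add p q hp hq =>
      intro m m' h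
      rw [map_add, map_add, map_add, add_smul, add_smul]
      exact add_mem (hp m m' h) (hq m m' h)
    | mul_X p i hp =>
      intro m m' h
      rw [map_mul, map_mul, map_mul, mul_smul, mul_smul]
      exact hp _ _ (hX i m m' h)
  have hs : ∀ s ∈ dens D, ∀ (m : N) (m' : N'), (ρ (algebraMap _ _ s) • m,
      ρ' (algebraMap _ _ s) • m') ∈ S → (m, m') ∈ S := by
    intro s hs
    induction hs using Submonoid.closure_induction with
    | mem d hd => exact hD d hd
    | one => intro m m' h; simpa using h
    | mul a b _ _ ha hb =>
      intro m m' h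
      rw [map_mul, map_mul, map_mul, mul_smul, mul_smul] at h
      exact hb _ _ (ha _ _ h)
  obtain ⟨p, s, rfl⟩ := IsLocalization.exists_mk'_eq (dens D) r
  refine hs s s.2 _ _ ?_
  rw [← mul_smul, ← mul_smul, ← map_mul, ← map_mul, mul_comm, IsLocalization.mk'_spec]
  exact hp p m m' h

variable {A U W : Type*} [CommRing A] [Algebra K A] [AddCommGroup U] [Module K U]
  [AddCommGroup W] [Module K W] {S}

theorem lb_mem {ρ : A →ₐ[K] B} {ρ' : A →ₐ[K] B'}
    (hρ : ∀ (r : A) (m : N) (m' : N'), (m, m') ∈ S → (ρ r • m, ρ' r • m') ∈ S)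
    {y : U →ₗ[K] N} {y' : U →ₗ[K] N'} (hy : ∀ u, (y u, y' u) ∈ S) (v : A ⊗[K] U) :
    (lb ρ y v, lb ρ' y' v) ∈ S := by
  induction v with
  | zero => rw [map_zero, map_zero]; exact zero_mem _
  | add v v' hv hv' => rw [map_add, map_add]; exact add_mem hv hv'
  | tmul r u => rw [lb_tmul, lb_tmul]; exact hρ r _ _ (hy u)

theorem bc_mem {ρ : A →ₐ[K] B} {ρ' : A →ₐ[K] B'}
    (hρ : ∀ (r : A) (m : N) (m' : N'), (m, m') ∈ S → (ρ r • m, ρ' r • m') ∈ S)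
    {y : ℕ → U →ₗ[K] N} {y' : ℕ → U →ₗ[K] N'} (hy : ∀ k u, (y k u, y' k u) ∈ S)
    (s : ℕ → W →ₗ[K] A ⊗[K] U) (k : ℕ) (u : W) : (bc ρ y s k u, bc ρ' y' s k u) ∈ S := by
  rw [bc_apply, bc_apply, prod_mk_sum]
  exact sum_mem fun p _ => lb_mem hρ (hy p.1) _

end Relations

/-! ### The value of $Y_wS^{(\gamma)}_{w,0}$ at $\gamma=x$ -/

section TranslationSeries
variable {K : Type*} [Field K] {V : Type*} [AddCommGroup V] [Module K V]

/-- The pairs of a power series in `γ` and an element of `V((z))((x))((w))`, such that the latter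
is the value at `γ = x` of the image of the former under `g`. -/
def gammaEval (g : V →ₗ[K] L2 K V) : Submodule K (PS 1 (Lau K V) × L3 K V) :=
  ((ratEval (L3 K V) (L2Ring.x (LaurentSeries K)) (L2Ring.y (LaurentSeries K))).restrictScalars K).comap
    ((LinearMap.pi fun n : ℕ => l3map g ∘ₗ LinearMap.proj (Finsupp.single 0 n)).prodMap LinearMap.id)

theorem mem_gammaEval {g : V →ₗ[K] L2 K V} {G : PS 1 (Lau K V)} {m : L3 K V} :
    (G, m) ∈ gammaEval g ↔ ((fun n : ℕ => l3map g (G (Finsupp.single 0 n)), m) : (ℕ → L3 K V) × L3 K V)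
      ∈ ratEval (L3 K V) (L2Ring.x (LaurentSeries K)) (L2Ring.y (LaurentSeries K)) := Iff.rfl

theorem l3map_C_T_smul (g : V →ₗ[K] L2 K V) (G : PS 1 (Lau K V)) :
    (fun n : ℕ => l3map g (((MvPolynomial.C (Lau.T K) : MvPolynomial (Fin 1) (LaurentSeries K)) • G)
        (Finsupp.single 0 n)))
      = L2Ring.y (LaurentSeries K) • fun n : ℕ => l3map g (G (Finsupp.single 0 n)) := by
  funext n
  rw [C_smul_apply, l3map_T_smul]
  rfl

theorem l3map_X_smul (g : V →ₗ[K] L2 K V) (G : PS 1 (Lau K V)) :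
    (fun n : ℕ => l3map g (((MvPolynomial.X 0 : MvPolynomial (Fin 1) (LaurentSeries K)) • G)
        (Finsupp.single 0 n)))
      = seqShift (L3Ring K) (L3 K V) fun n : ℕ => l3map g (G (Finsupp.single 0 n)) := by
  funext n
  rw [X_smul_apply, single_sub_single, Finsupp.single_eq_same]
  change _ = if n = 0 then 0 else l3map g (G (Finsupp.single 0 (n - 1)))
  split_ifs
  · exact map_zero _
  · rfl

theorem mem_gammaEval_C_T_smul {g : V →ₗ[K] L2 K V} {G : PS 1 (Lau K V)} {m : L3 K V} :
    ((MvPolynomial.C (Lau.T K) : MvPolynomial (Fin 1) (LaurentSeries K)) • G,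
      L2Ring.y (LaurentSeries K) • m) ∈ gammaEval g ↔ (G, m) ∈ gammaEval g := by
  rw [mem_gammaEval, l3map_C_T_smul, mem_gammaEval, ← Prod.smul_mk,
    Submodule.smul_mem_iff _ (y_ne_zero (𝕜 := LaurentSeries K))]

theorem mem_gammaEval_X_smul {g : V →ₗ[K] L2 K V} {G : PS 1 (Lau K V)} {m : L3 K V}
    (h : (G, m) ∈ gammaEval g) :
    ((MvPolynomial.X 0 : MvPolynomial (Fin 1) (LaurentSeries K)) • G,
      L2Ring.x (LaurentSeries K) • m) ∈ gammaEval g := by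
  rw [mem_gammaEval, l3map_X_smul, ← mulPair_apply]
  exact mulPair_mem_ratEval (mem_gammaEval.1 h)

/-- The relation `ratEval` allows any power of $w+\gamma$ to be cleared, so one more factor can be
cancelled. -/
theorem mem_gammaEval_of_add_smul {g : V →ₗ[K] L2 K V} {G : PS 1 (Lau K V)} {m : L3 K V}
    (h : ((MvPolynomial.C (Lau.T K) + MvPolynomial.X 0 : MvPolynomial (Fin 1) (LaurentSeries K)) • G,
      (L2Ring.y (LaurentSeries K) + L2Ring.x (LaurentSeries K)) • m) ∈ gammaEval g) :
    (G, m) ∈ gammaEval g := by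
  refine mem_gammaEval.2 (mem_ratEval_of_denPair ?_)
  rw [denPair_apply]
  rw [add_smul, add_smul, mem_gammaEval] at h
  have e : (fun n : ℕ => l3map g (((MvPolynomial.C (Lau.T K) : MvPolynomial (Fin 1) (LaurentSeries K))
      • G + (MvPolynomial.X 0 : MvPolynomial (Fin 1) (LaurentSeries K)) • G) (Finsupp.single 0 n)))
      = (L2Ring.y (LaurentSeries K) • fun n : ℕ => l3map g (G (Finsupp.single 0 n)))
        + seqShift (L3Ring K) (L3 K V) fun n : ℕ => l3map g (G (Finsupp.single 0 n)) := by
    rw [← l3map_C_T_smul, ← l3map_X_smul]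
    funext n
    exact map_add (l3map g) _ _
  rw [e] at h
  exact h

theorem expandRing3_T3_X0 : expandRing3 K (lin (matT3 K) (MvPolynomial.X 0))
    = L2Ring.y (LaurentSeries K) := by
  rw [lin_X, Fin.sum_univ_three]
  simp [expandRing3_X2]

theorem expandRing3_T3_X1 : expandRing3 K (lin (matT3 K) (MvPolynomial.X 1)) = 0 := by
  rw [lin_X, Fin.sum_univ_three]
  simp

theorem expandRing3_T3_X2 : expandRing3 K (lin (matT3 K) (MvPolynomial.X 2))
    = L2Ring.x (LaurentSeries K) := by
  rw [lin_X, Fin.sum_univ_three]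
  simp [expandRing3_X1]

theorem const_mem_gammaEval (g : V →ₗ[K] L2 K V) (F : Lau K V) :
    (constP K V F, l3map g F) ∈ gammaEval g := by
  have h := single_mem_ratEval (L2Ring.x (LaurentSeries K)) (L2Ring.y (LaurentSeries K)) (l3map g F)
  have e : (fun n : ℕ => l3map g (constP K V F (Finsupp.single 0 n))) = Pi.single 0 (l3map g F) := by
    funext n
    change l3map g (PS.const 1 F _) = _
    rw [PS.const, Pi.single_apply]
    split_ifs with h1 h2 h2
    · rfl
    · exact absurd (by simpa using h1) h2
    · exact absurd (by simp [h2]) h1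
    · exact map_zero _
  rw [← e] at h
  exact h

section
variable (Q : HDQuantumVertexAlgebra K V)

theorem coefOp_comp_flip (f : ℕ → V ⊗[K] V →ₗ[K] L2 K V) (c : V)
    (Z : ℕ → V ⊗[K] V →ₗ[K] Lau K V) :
    (fun k => coefOp f Z k ∘ₗ (TensorProduct.mk K (V ⊗[K] V) V).flip c)
      = tc (fun i => l3map ((TensorProduct.curry (f i)).flip c)) Z := by
  funext k
  refine LinearMap.ext fun u => ?_
  rw [tc_apply]
  exact coefOp_apply f Z k u c

theorem gammaCoeff_eq_tc (n : ℕ) : gammaCoeff Q n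
    = tc (E := V ⊗[K] V) (F := Rat (polesT K) ⊗[K] (V ⊗[K] V))
      (fun i => (LinearMap.proj (Finsupp.single 0 n) : PS 1 (Lau K V) →ₗ[K] Lau K V) ∘ₗ
        lb (ratGamma K) (constP K V ∘ₗ Q.Y i)) Q.trans := by
  funext k
  refine LinearMap.ext fun u => ?_
  rw [gammaCoeff_apply, gammaSeries, bc_apply, tc_apply, PS.sum_apply]
  rfl

theorem coefOp_gammaCoeff (f : ℕ → V ⊗[K] V →ₗ[K] L2 K V) (n k : ℕ) (u : V ⊗[K] V) (c : V) :
    coefOp f (gammaCoeff Q n) k (u ⊗ₜ c)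
      = ∑ p ∈ Finset.HasAntidiagonal.antidiagonal k, ∑ q ∈ Finset.HasAntidiagonal.antidiagonal p.1,
        l3map ((TensorProduct.curry (f q.1)).flip c)
          (lb (ratGamma K) (constP K V ∘ₗ Q.Y q.2) (Q.trans p.2 u) (Finsupp.single 0 n)) := by
  refine (DFunLike.congr_fun (congrFun (coefOp_comp_flip f c (gammaCoeff Q n)) k) u).trans ?_
  rw [gammaCoeff_eq_tc, ← tc_assoc, tc_apply]
  exact Finset.sum_congr rfl fun p _ => tc_apply _ _ _ _

end

variable [CharZero K]

theorem gammaEval_smul_X (g : V →ₗ[K] L2 K V) (i : Fin 3) (G : PS 1 (Lau K V)) (m : L3 K V)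
    (h : (G, m) ∈ gammaEval g) :
    (ratGamma K (algebraMap (MvPolynomial (Fin 3) K) (Rat (polesT K)) (MvPolynomial.X i)) • G,
      ratL3 (matT3 K) (polesT K) matT3_ne_zero
        (algebraMap (MvPolynomial (Fin 3) K) (Rat (polesT K)) (MvPolynomial.X i)) • m)
      ∈ gammaEval g := by
  rw [ratGamma_smul, ratL3_algebraMap]
  fin_cases i
  · simp only [Fin.zero_eta]
    rw [peelRing_trans_X0, expandRing3_T3_X0]
    exact mem_gammaEval_C_T_smul.2 h
  · simp only [Fin.mk_one]
    rw [peelRing_trans_X1, expandRing3_T3_X1, zero_smul, zero_smul (L3Ring K) m]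
    exact zero_mem _
  · simp only [Fin.reduceFinMk]
    rw [peelRing_trans_X2, expandRing3_T3_X2]
    exact mem_gammaEval_X_smul h

/-- At $z_1=w$, $z_2=0$ the denominators are $w$, $w$ and $w+\gamma$. The first two are invertible
scalars, and the third is built into the definition of `ratEval`. -/
theorem mem_gammaEval_of_smul (g : V →ₗ[K] L2 K V) (d) (hd : d ∈ polesT K) (G : PS 1 (Lau K V))
    (m : L3 K V)
    (h : (ratGamma K (algebraMap (MvPolynomial (Fin 3) K) (Rat (polesT K)) d) • G,
      ratL3 (matT3 K) (polesT K) matT3_ne_zero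
        (algebraMap (MvPolynomial (Fin 3) K) (Rat (polesT K)) d) • m) ∈ gammaEval g) :
    (G, m) ∈ gammaEval g := by
  rw [ratGamma_smul, ratL3_algebraMap] at h
  simp only [polesT, Set.mem_insert_iff, Set.mem_singleton_iff] at hd
  rcases hd with rfl | rfl | rfl
  · rw [peelRing_trans_X0, expandRing3_T3_X0] at h
    exact mem_gammaEval_C_T_smul.1 h
  · rw [map_sub, map_sub, map_sub, map_sub, peelRing_trans_X0, expandRing3_T3_X0, peelRing_trans_X1,
      expandRing3_T3_X1, sub_zero, sub_zero] at h
    exact mem_gammaEval_C_T_smul.1 h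
  · rw [map_add, map_add, map_add, map_add, peelRing_trans_X0, expandRing3_T3_X0, peelRing_trans_X2,
      expandRing3_T3_X2] at h
    exact mem_gammaEval_of_add_smul h

variable (Q : HDQuantumVertexAlgebra K V)

theorem bc_coefOp_trans (f : ℕ → V ⊗[K] V →ₗ[K] L2 K V) (k : ℕ) (u : V ⊗[K] V) (c : V) :
    bc (ratL3 (matT3 K) (polesT K) matT3_ne_zero) (coefOp f Q.Y)
        (fun i => legMap (LinearEquiv.refl K _) (Q.trans i)) k (u ⊗ₜ c)
      = ∑ p ∈ Finset.HasAntidiagonal.antidiagonal k, ∑ q ∈ Finset.HasAntidiagonal.antidiagonal p.1,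
        lb (ratL3 (matT3 K) (polesT K) matT3_ne_zero)
          (l3map ((TensorProduct.curry (f q.1)).flip c) ∘ₗ Q.Y q.2) (Q.trans p.2 u) := by
  refine (bc_legMap_apply (LinearEquiv.refl K _) _ _ Q.trans k u c).trans ?_
  have : (fun i => coefOp f Q.Y i ∘ₗ (LinearEquiv.refl K ((V ⊗[K] V) ⊗[K] V)).symm.toLinearMap ∘ₗ
      (TensorProduct.mk K (V ⊗[K] V) V).flip c)
      = tc (fun i => l3map ((TensorProduct.curry (f i)).flip c)) Q.Y := coefOp_comp_flip f c Q.Y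
  rw [this, bc_apply]
  refine Finset.sum_congr rfl fun p _ => ?_
  rw [lb_tc]
  exact LinearMap.sum_apply _ _ _

theorem rat_smul_mem_gammaEval (g : V →ₗ[K] L2 K V) (r : Rat (polesT K)) (G : PS 1 (Lau K V))
    (m : L3 K V) (h : (G, m) ∈ gammaEval g) :
    (ratGamma K r • G, ratL3 (matT3 K) (polesT K) matT3_ne_zero r • m) ∈ gammaEval g :=
  rat_smul_mem_of_X (gammaEval g) (ratGamma K) (ratL3 (matT3 K) (polesT K) matT3_ne_zero)
    (gammaEval_smul_X g) (mem_gammaEval_of_smul g) r h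

theorem lb_mem_gammaEval (g : V →ₗ[K] L2 K V) {U : Type*} [AddCommGroup U] [Module K U]
    (y : U →ₗ[K] Lau K V) (v : Rat (polesT K) ⊗[K] U) :
    (lb (ratGamma K) (constP K V ∘ₗ y) v,
      lb (ratL3 (matT3 K) (polesT K) matT3_ne_zero) (l3map g ∘ₗ y) v) ∈ gammaEval g := by
  induction v with
  | zero => rw [map_zero, map_zero]; exact zero_mem _
  | add v v' hv hv' =>
    rw [map_add, map_add, ← Prod.mk_add_mk]
    exact Submodule.add_mem _ hv hv'
  | tmul r u =>
    rw [lb_tmul, lb_tmul]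
    exact rat_smul_mem_gammaEval g r _ _ (const_mem_gammaEval g (y u))

/-- Only the scalars of $S^{(\gamma)}$ depend on $\gamma$: the relation holds for series constant in
$\gamma$ and is stable under these scalars. -/
theorem coefOp_gammaCoeff_mem (f : ℕ → V ⊗[K] V →ₗ[K] L2 K V) (k : ℕ) (u : V ⊗[K] V) (c : V) :
    ((fun n => coefOp f (gammaCoeff Q n) k (u ⊗ₜ c),
      bc (ratL3 (matT3 K) (polesT K) matT3_ne_zero) (coefOp f Q.Y)
        (fun i => legMap (LinearEquiv.refl K _) (Q.trans i)) k (u ⊗ₜ c)) : (ℕ → L3 K V) × L3 K V)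
      ∈ ratEval (L3 K V) (L2Ring.x (LaurentSeries K)) (L2Ring.y (LaurentSeries K)) := by
  rw [bc_coefOp_trans]
  have e : ∀ q : ℕ → ℕ → ℕ → ℕ → L3 K V, (fun n => ∑ p ∈ Finset.HasAntidiagonal.antidiagonal k,
      ∑ r ∈ Finset.HasAntidiagonal.antidiagonal p.1, q p.2 r.1 r.2 n)
      = ∑ p ∈ Finset.HasAntidiagonal.antidiagonal k,
        ∑ r ∈ Finset.HasAntidiagonal.antidiagonal p.1, fun n => q p.2 r.1 r.2 n := by
    intro q
    funext n
    simp only [Finset.sum_apply]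
  rw [funext fun n => coefOp_gammaCoeff Q f n k u c, e fun p r r' n =>
    l3map ((TensorProduct.curry (f r)).flip c)
      (lb (ratGamma K) (constP K V ∘ₗ Q.Y r') (Q.trans p u) (Finsupp.single 0 n)), prod_mk_sum]
  refine sum_mem fun p _ => ?_
  rw [prod_mk_sum]
  exact sum_mem fun r _ => mem_gammaEval.1 (lb_mem_gammaEval _ _ _)

end TranslationSeries

/-! ### The triple product as an iterate -/

section BraidedTranslation
variable {K : Type*} [Field K] {V : Type*} [AddCommGroup V] [Module K V]
  (Q : HDQuantumVertexAlgebra K V)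

theorem coefOp_smul {U : Type*} [AddCommGroup U] [Module K U] (f : ℕ → V ⊗[K] V →ₗ[K] L2 K V)
    (c : K) (Z : ℕ → U →ₗ[K] Lau K V) (k : ℕ) :
    coefOp f (fun i => c • Z i) k = c • coefOp f Z k := by
  refine TensorProduct.ext' fun u v => ?_
  rw [LinearMap.smul_apply, coefOp_apply, coefOp_apply, Finset.smul_sum]
  exact Finset.sum_congr rfl fun p _ => LinearMap.map_smul _ _ _

theorem bc_const_smul {A B N U W : Type*} [CommRing A] [Algebra K A] [CommRing B] [Algebra K B]
    [AddCommGroup N] [Module K N] [Module B N] [IsScalarTower K B N] [AddCommGroup U] [Module K U]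
    [AddCommGroup W] [Module K W] (ρ : A →ₐ[K] B) (c : K) (y : ℕ → U →ₗ[K] N)
    (s : ℕ → W →ₗ[K] A ⊗[K] U) (k : ℕ) :
    bc ρ (fun i => c • y i) s k = c • bc ρ y s k := by
  refine LinearMap.ext fun u => ?_
  exact (map_bc ρ ρ (c • LinearMap.id : N →ₗ[K] N)
    (fun r m => smul_comm c (ρ r) m) (y := y) (y' := fun i => c • y i) (fun i u => rfl) s k u).symm

variable [CharZero K]

theorem BraidCompatible.smul {Z : ℕ → V ⊗[K] V →ₗ[K] Lau K V} (hZ : BraidCompatible Q Z) (c : K) :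
    BraidCompatible Q (fun i => c • Z i) := by
  have h1 : ∀ f : ℕ → V ⊗[K] V →ₗ[K] L2 K V, coefOp f (fun i => c • Z i)
      = fun k => c • coefOp f Z k := fun f => funext fun k => coefOp_smul f c Z k
  have h2 : bc (rat23 K) (fun k => c • coefOp (expXZ Q) Z k)
        (fun i => legMap (legEquiv23 K V) (Q.braid i))
      = fun k => c • bc (rat23 K) (coefOp (expXZ Q) Z)
        (fun i => legMap (legEquiv23 K V) (Q.braid i)) k := funext fun k => bc_const_smul _ _ _ _ _
  funext k
  rw [h1, h1, h2, bc_const_smul]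
  exact congrArg (c • ·) (congrFun hZ k)

/-- The case $n=0$ is the hexagon, and the recursion in $n$ is a multiple of the translation
operator, which preserves the exchange identity. -/
theorem braidCompatible_gammaCoeff (n : ℕ) : BraidCompatible Q (gammaCoeff Q n) := by
  induction n with
  | zero => rw [gammaCoeff_zero]; exact coefOp_Y Q
  | succ n ih =>
    have h : gammaCoeff Q (n + 1)
        = fun k => (n + 1 : K)⁻¹ • translationOp Q.D (gammaCoeff Q n) k := by
      funext k
      rw [← gammaCoeff_succ, smul_smul, inv_mul_cancel₀ (Nat.cast_add_one_ne_zero n), one_smul]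
    rw [h]
    exact (braidCompatible_translationOp Q ih).smul Q _

/-- The iterate of vertex operators, as a function of `z`, `x`, `w`. -/
def iterXZ : ℕ → (V ⊗[K] V) ⊗[K] V →ₗ[K] L3 K V :=
  bc (ratL3 (matT3 K) (polesT K) matT3_ne_zero) (coefOp (expXZ Q) Q.Y)
    (fun i => legMap (LinearEquiv.refl K _) (Q.trans i))

theorem iterXZ_mem (k : ℕ) (u : (V ⊗[K] V) ⊗[K] V) :
    ((fun n => coefOp (expXZ Q) (gammaCoeff Q n) k u, iterXZ Q k u) : (ℕ → L3 K V) × L3 K V)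
      ∈ ratEval (L3 K V) (L2Ring.x (LaurentSeries K)) (L2Ring.y (LaurentSeries K)) := by
  induction u with
  | zero =>
    have e : ((fun n => coefOp (expXZ Q) (gammaCoeff Q n) k 0, iterXZ Q k 0)
        : (ℕ → L3 K V) × L3 K V) = 0 := Prod.ext (funext fun n => map_zero _) (map_zero _)
    rw [e]
    exact Submodule.zero_mem _
  | add u v hu hv =>
    have e : ((fun n => coefOp (expXZ Q) (gammaCoeff Q n) k (u + v), iterXZ Q k (u + v))
        : (ℕ → L3 K V) × L3 K V)
        = (fun n => coefOp (expXZ Q) (gammaCoeff Q n) k u, iterXZ Q k u)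
          + (fun n => coefOp (expXZ Q) (gammaCoeff Q n) k v, iterXZ Q k v) :=
      Prod.ext (funext fun n => map_add _ _ _) (map_add _ _ _)
    rw [e]
    exact Submodule.add_mem _ hu hv
  | tmul u c => exact coefOp_gammaCoeff_mem Q (expXZ Q) k u c

/-- The exchange identity, applied to each coefficient in $\gamma$, brings the braidings to the
outside; as they do not involve $\gamma$, the value at $\gamma=x$ is the braided value of the
iterate. -/
theorem braid_iterXZ_mem (k : ℕ) (u : (V ⊗[K] V) ⊗[K] V) :
    ((fun n => coefOp (expZX Q) (gammaCoeff Q n) k u,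
      bc (rat13 K) (bc (rat23 K) (iterXZ Q) (fun i => legMap (legEquiv23 K V) (Q.braid i)))
        (fun i => legMap (TensorProduct.rightComm K V V V) (Q.braid i)) k u)
      : (ℕ → L3 K V) × L3 K V)
      ∈ ratEval (L3 K V) (L2Ring.x (LaurentSeries K)) (L2Ring.y (LaurentSeries K)) := by
  have h2 := bc_mem_ratEval (rat13 K) (bc_mem_ratEval (rat23 K) (iterXZ_mem Q)
    (fun i => legMap (legEquiv23 K V) (Q.braid i)))
    (fun i => legMap (TensorProduct.rightComm K V V V) (Q.braid i)) k u
  have e : (fun n => coefOp (expZX Q) (gammaCoeff Q n) k u)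
      = fun n => bc (rat13 K) (bc (rat23 K) (coefOp (expXZ Q) (gammaCoeff Q n))
        (fun i => legMap (legEquiv23 K V) (Q.braid i)))
        (fun i => legMap (TensorProduct.rightComm K V V V) (Q.braid i)) k u :=
    funext fun n => by rw [braidCompatible_gammaCoeff Q n]
  rw [e]
  exact h2

/-- `X_{x+w,x,z}` in terms of the iterate of vertex operators. -/
theorem tripXZ_eq : tripXZ Q = iterXZ Q := by
  -- Unitarity makes composition with both braidings injective, so the identity may be proved after
  -- composing with them.
  refine bc_legMap_injective (legEquiv23 K V) Q.unitarity (rat23 K)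
    (bc_legMap_injective (TensorProduct.rightComm K V V V) Q.unitarity (rat13 K) ?_)
  funext k
  refine TensorProduct.ext_threefold fun a b c => ?_
  refine ((sum_lmap2_X Q k a b c).symm.trans (lmap2_toL2_matSum Q k a b c)).trans ?_
  -- Both are values at $\gamma=x$ of the one series $X_{z,x}(c\otimes
  -- Y_wS^{(\gamma)}_{w,0}(a\otimes b))$ in $\gamma$.
  refine ratEval_ext ?_ (coefOp_gammaCoeff_mem Q (expZX Q) k (a ⊗ₜ b) c)
    (braid_iterXZ_mem Q k ((a ⊗ₜ b) ⊗ₜ c))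
  rw [add_comm]
  exact x_add_y_ne_zero

end BraidedTranslation

/-! ### Setting $z=0$ in an expansion for $|z|>|x|>|w|$ -/

section Specialization
variable {K : Type*} [Field K] {V : Type*} [AddCommGroup V] [Module K V]

theorem exists_pole_smul {n : ℕ} {D : Set (MvPolynomial (Fin n) K)} {d : MvPolynomial (Fin n) K}
    (hd : d ∈ D) (y : Sing D V) : ∃ y', d • y' = y := by
  have h := IsLocalizedModule.map_units (LocalizedModule.mkLinearMap (dens D) (PS n V))
    ⟨d, Submonoid.subset_closure hd⟩
  exact ((Module.End.isUnit_iff _).1 h).2 y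

theorem exists_order (F : Lau K V) : ∃ N : ℤ, ∀ n < N, F.coeff n = 0 :=
  ⟨((HahnModule.of K).symm F).order, fun _ h => HahnSeries.coeff_eq_zero_of_lt_order h⟩

theorem subst_swapMat2 (F : PS 2 V) (i j : ℕ) :
    PS.subst (swapMat2 K) F (Finsupp.cons i (Finsupp.single 0 j))
      = F (Finsupp.cons j (Finsupp.single 0 i)) := by
  have hM : swapMat2 K = rowMat K ![some 1, some 0] := by
    ext i j; fin_cases i <;> fin_cases j <;> simp [rowMat]
  rw [hM]
  refine subst_rowMat _ _ _ _ fun a => ?_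
  simp [Fin.forall_fin_succ, Fin.sum_univ_succ, DFunLike.ext_iff, and_comm]

theorem flat_eval_ne_zero {d : MvPolynomial (Fin 2) K} (hd : d ∈ polesX K) :
    flatRing K (lin (![![1], ![0]] : Fin 2 → Fin 1 → K) d) ≠ 0 := by
  simp only [polesX, Set.mem_insert_iff, Set.mem_singleton_iff] at hd
  rcases hd with rfl | rfl <;> simp [lin_X, flatRing, T_ne_zero]

/-- `f(x, z)`, expanded for `|z| > |x|`. -/
def scal3 (p : MvPolynomial (Fin 2) K) : L3Ring K :=
  HahnSeries.C (expandRing K (lin (swapMat2 K) p))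

/-- `f(x, 0)`. -/
def scal2 (p : MvPolynomial (Fin 2) K) : L2Ring K :=
  HahnSeries.C (flatRing K (lin (![![1], ![0]] : Fin 2 → Fin 1 → K) p))

theorem coeff_hahnC_smul {R W : Type*} [CommRing R] [AddCommGroup W] [Module R W] (r : R)
    (F : Lau R W) (n : ℤ) : Lau.coeff ((HahnSeries.C r : LaurentSeries R) • F) n = r • F.coeff n :=
  HahnModule.coeff_single_zero_smul

theorem coeff_scal3_smul (p : MvPolynomial (Fin 2) K) (m : L3 K V) (n : ℤ) :
    (Lau.coeff (scal3 p • m) n : L2 K V) = expandRing K (lin (swapMat2 K) p) • Lau.coeff m n :=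
  coeff_hahnC_smul (R := L2Ring K) (W := L2 K V) _ m n

theorem coeff_scal2_smul (p : MvPolynomial (Fin 2) K) (m : L2 K V) (n : ℤ) :
    (Lau.coeff (scal2 p • m) n : Lau K V)
      = flatRing K (lin (![![1], ![0]] : Fin 2 → Fin 1 → K) p) • Lau.coeff m n :=
  coeff_hahnC_smul (R := LaurentSeries K) (W := Lau K V) _ m n

theorem coeff_w_smul (m : L3 K V) (n : ℤ) :
    (Lau.coeff (L2Ring.y (LaurentSeries K) • m) n : L2 K V) = Lau.coeff m (n - 1) :=
  Lau.coeff_T_smul _ _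

theorem coeff_y_smul (m : L2 K V) (n : ℤ) :
    (Lau.coeff (L2Ring.y K • m) n : Lau K V) = Lau.coeff m (n - 1) :=
  Lau.coeff_T_smul _ _

variable [CharZero K]

variable (K V) in
/-- The expansion of a function of `x`, `z` in the region `|z| > |x|`. -/
abbrev expandZX : Sing (polesX K) V →ₗ[K] L2 K V :=
  toL2 (swapMat2 K) (polesX K) (l2_ne_zero _ _ _ (swapMat2_X K))

variable (K V) in
/-- The pairs of the expansion of a function of `x`, `z` in the region `|z| > |x|`, and its value
at `z = 0`. -/
def zeroPairs : Submodule K (L2 K V × Lau K V) :=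
  LinearMap.range ((expandZX K V).prod (Sing.flat ∘ₗ Sing.subst ![![1], ![0]] (adm_eval K)))

theorem mem_zeroPairs (y : Sing (polesX K) V) :
    (expandZX K V y, Sing.flat (Sing.subst ![![1], ![0]] (adm_eval K) y)) ∈ zeroPairs K V :=
  ⟨y, rfl⟩

theorem exists_of_mem_zeroPairs {f : L2 K V} {g : Lau K V} (h : (f, g) ∈ zeroPairs K V) :
    ∃ y : Sing (polesX K) V, expandZX K V y = f ∧
      Sing.flat (Sing.subst ![![1], ![0]] (adm_eval K) y) = g := by
  obtain ⟨y, hy⟩ := h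
  exact ⟨y, congrArg Prod.fst hy, congrArg Prod.snd hy⟩

theorem zeroPairs_smul (p : MvPolynomial (Fin 2) K) {f : L2 K V} {g : Lau K V}
    (h : (f, g) ∈ zeroPairs K V) : (expandRing K (lin (swapMat2 K) p) • f,
      flatRing K (lin (![![1], ![0]] : Fin 2 → Fin 1 → K) p) • g) ∈ zeroPairs K V := by
  obtain ⟨y, rfl, rfl⟩ := exists_of_mem_zeroPairs h
  rw [← toL2_smul, ← singFlat_smul, ← Sing.subst_smul]
  exact mem_zeroPairs _

theorem zeroPairs_of_smul {d : MvPolynomial (Fin 2) K} (hd : d ∈ polesX K) {f : L2 K V} {g : Lau K V}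
    (h : (expandRing K (lin (swapMat2 K) d) • f,
      flatRing K (lin (![![1], ![0]] : Fin 2 → Fin 1 → K) d) • g) ∈ zeroPairs K V) :
    (f, g) ∈ zeroPairs K V := by
  obtain ⟨y, h1, h2⟩ := exists_of_mem_zeroPairs h
  obtain ⟨y, rfl⟩ := exists_pole_smul hd y
  rw [toL2_smul] at h1
  rw [Sing.subst_smul, singFlat_smul] at h2
  have e1 := ((l2_ne_zero _ _ _ (swapMat2_X K) d hd).isUnit.smul_left_cancel).1 h1
  have e2 := ((flat_eval_ne_zero hd).isUnit.smul_left_cancel).1 h2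
  rw [← e1, ← e2]
  exact mem_zeroPairs y

theorem expandZX_injective : Function.Injective (expandZX K V) := by
  rw [injective_iff_map_eq_zero]
  intro x hx
  induction x using LocalizedModule.induction_on with
  | _ F s =>
    have h2 : flat (K := LaurentSeries K) (peel (K := K) 1 (PS.subst (swapMat2 K) F)) = 0 := by
      rw [← toL2_mk_one (l2_ne_zero _ _ _ (swapMat2_X K)), ← mk_smul_self F s, toL2_smul, hx,
        smul_zero]
    have h3 : PS.subst (swapMat2 K) F = 0 :=
      peel_inj (K := K) 1 (flat_inj (K := LaurentSeries K) (by rw [h2, map_zero, map_zero]))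
    have h4 : F = 0 := by
      rw [← subst_id2 (K := K) F]
      have : matMul (swapMat2 K) (swapMat2 K) = ![![1, 0], ![0, 1]] := by
        funext i j; fin_cases i <;> fin_cases j <;> simp [matMul, Fin.sum_univ_succ]
      rw [← this, ← subst_subst, h3, map_zero]
    rw [h4, LocalizedModule.zero_mk]

/-- A fraction in $x$ and $z$ is determined by its expansion. So its value at $z=0$ is well defined,
even though $z=0$ lies outside the region $|z|>|x|$. -/
theorem zeroPairs_unique {g : Lau K V} (h : ((0, g) : L2 K V × Lau K V) ∈ zeroPairs K V) : g = 0 := by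
  obtain ⟨y, h1, rfl⟩ := exists_of_mem_zeroPairs h
  rw [expandZX_injective (h1.trans (map_zero (expandZX K V)).symm), map_zero, map_zero]

variable (K V) in
/-- The pairs of an expansion `f(z, x, w)` for `|z| > |x| > |w|` and `f(0, x, w)`, where the
coefficients of the powers of `w` are rational functions of `x`, `z`. -/
def specPairs : Submodule K (L3 K V × L2 K V) where
  carrier := {p | ∀ n, ((Lau.coeff p.1 n : L2 K V), (Lau.coeff p.2 n : Lau K V)) ∈ zeroPairs K V}
  zero_mem' n := Submodule.zero_mem _
  add_mem' hp hq n := Submodule.add_mem _ (hp n) (hq n)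
  smul_mem' c p hp n := by
    have h := Submodule.smul_mem _ c (hp n)
    rw [Prod.smul_mk] at h
    rw [Prod.smul_fst, Prod.smul_snd, L3_coeff_smul, L2_coeff_smul]
    exact h

theorem specPairs_unique {m' : L2 K V} (h : ((0, m') : L3 K V × L2 K V) ∈ specPairs K V) : m' = 0 :=
  Lau.ext fun n => zeroPairs_unique (h n)

theorem specPairs_ext {m : L3 K V} {m' m'' : L2 K V} (h : (m, m') ∈ specPairs K V)
    (h' : (m, m'') ∈ specPairs K V) : m' = m'' := by
  refine sub_eq_zero.1 (specPairs_unique ?_)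
  have := Submodule.sub_mem _ h h'
  rwa [Prod.mk_sub_mk, sub_self] at this

theorem specPairs_smul (p : MvPolynomial (Fin 2) K) {m : L3 K V} {m' : L2 K V}
    (h : (m, m') ∈ specPairs K V) : (scal3 p • m, scal2 p • m') ∈ specPairs K V := by
  intro n
  rw [coeff_scal3_smul, coeff_scal2_smul]
  exact zeroPairs_smul p (h n)

theorem specPairs_w_smul {m : L3 K V} {m' : L2 K V} :
    (L2Ring.y (LaurentSeries K) • m, L2Ring.y K • m') ∈ specPairs K V ↔ (m, m') ∈ specPairs K V := by
  constructor
  · intro h n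
    have := h (n + 1)
    rw [coeff_w_smul, coeff_y_smul, add_sub_cancel_right] at this
    exact this
  · intro h n
    rw [coeff_w_smul, coeff_y_smul]
    exact h (n - 1)

theorem specPairs_of_smul {d : MvPolynomial (Fin 2) K} (hd : d ∈ polesX K) {m : L3 K V} {m' : L2 K V}
    (h : (scal3 d • m, scal2 d • m') ∈ specPairs K V) : (m, m') ∈ specPairs K V := by
  intro n
  have := h n
  rw [coeff_scal3_smul, coeff_scal2_smul] at this
  exact zeroPairs_of_smul hd this

/-- The coefficient of $w^{n+1}$ in $(d+w)m$ is $dm_{n+1}+m_n$. Coefficients vanish for small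
exponents, so $d$ is cancelled from one exponent to the next. -/
theorem specPairs_of_add_smul {d : MvPolynomial (Fin 2) K} (hd : d ∈ polesX K) {m : L3 K V}
    {m' : L2 K V} (h : ((scal3 d + L2Ring.y (LaurentSeries K)) • m, (scal2 d + L2Ring.y K) • m')
      ∈ specPairs K V) : (m, m') ∈ specPairs K V := by
  obtain ⟨N, hN⟩ := exists_order m
  obtain ⟨N', hN'⟩ := exists_order m'
  intro n
  have h0 : ∀ n < min N N', ((Lau.coeff m n : L2 K V), (Lau.coeff m' n : Lau K V)) ∈ zeroPairs K V := by
    intro n hn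
    rw [hN n (lt_of_lt_of_le hn (min_le_left _ _)), hN' n (lt_of_lt_of_le hn (min_le_right _ _))]
    exact Submodule.zero_mem _
  by_cases hn : n < min N N'
  · exact h0 n hn
  · have hle : min N N' - 1 ≤ n := by omega
    induction n, hle using Int.leInduction with
    | base => exact h0 _ (by omega)
    | succ n hle ih =>
      have ih : ((Lau.coeff m n : L2 K V), (Lau.coeff m' n : Lau K V)) ∈ zeroPairs K V := by
        by_cases hn : n < min N N'
        · exact h0 n hn
        · exact ih hn
      have h1 := h (n + 1)
      rw [add_smul, add_smul, lau_coeff_add, lau_coeff_add, coeff_w_smul, coeff_y_smul,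
        coeff_scal3_smul, coeff_scal2_smul, add_sub_cancel_right] at h1
      have h2 := Submodule.sub_mem _ h1 ih
      rw [Prod.mk_sub_mk, add_sub_cancel_right, add_sub_cancel_right] at h2
      exact zeroPairs_of_smul hd h2

end Specialization

/-! ### Stability of the specialization under fractions -/

section SpecializationRational
variable {K : Type*} [Field K] {V : Type*} [AddCommGroup V] [Module K V]

theorem scal3_X0 : scal3 (MvPolynomial.X 0 : MvPolynomial (Fin 2) K) = L2Ring.x (LaurentSeries K) := by
  have h : expandRing K (lin (swapMat2 K) (MvPolynomial.X 0)) = L2Ring.y K := by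
    simp [lin_X, expandRing_X1]
  rw [scal3, h]
  rfl

theorem scal3_X1 : scal3 (MvPolynomial.X 1 : MvPolynomial (Fin 2) K)
    = algebraMap (LaurentSeries K) (L3Ring K) (Lau.T K) := by
  have h : expandRing K (lin (swapMat2 K) (MvPolynomial.X 1)) = L2Ring.x K := by
    simp [lin_X, expandRing_X0]
  rw [scal3, h]
  rfl

theorem scal2_X0 : scal2 (MvPolynomial.X 0 : MvPolynomial (Fin 2) K) = L2Ring.x K := by
  have h : flatRing K (lin (![![1], ![0]] : Fin 2 → Fin 1 → K) (MvPolynomial.X 0)) = Lau.T K := by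
    simp [lin_X, flatRing]
  rw [scal2, h]
  rfl

theorem scal2_X1 : scal2 (MvPolynomial.X 1 : MvPolynomial (Fin 2) K) = 0 := by
  have h : flatRing K (lin (![![1], ![0]] : Fin 2 → Fin 1 → K) (MvPolynomial.X 1)) = 0 := by
    simp [lin_X]
  rw [scal2, h, map_zero]

theorem scal3_sub (p q : MvPolynomial (Fin 2) K) : scal3 (p - q) = scal3 p - scal3 q := by
  simp only [scal3, map_sub]

theorem scal2_sub (p q : MvPolynomial (Fin 2) K) : scal2 (p - q) = scal2 p - scal2 q := by
  simp only [scal2, map_sub]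

variable (K) in
/-- `z_1, z_2, z_3 ↦ x + w, x, 0`. -/
abbrev matX0 : Fin 3 → Fin 2 → K := ![![1, 1], ![1, 0], ![0, 0]]

variable (K) in
/-- `z_1, z_2, γ ↦ w, 0, x`. -/
abbrev matT2 : Fin 3 → Fin 2 → K := ![![0, 1], ![0, 0], ![1, 0]]

theorem expandRing3_XZ_X0 : expandRing3 K (lin (matXZ K) (MvPolynomial.X 0))
    = scal3 (MvPolynomial.X 0) + L2Ring.y (LaurentSeries K) := by
  rw [scal3_X0, lin_X, Fin.sum_univ_three]
  simp [expandRing3_X1, expandRing3_X2]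

theorem expandRing3_XZ_X1 : expandRing3 K (lin (matXZ K) (MvPolynomial.X 1))
    = scal3 (MvPolynomial.X 0) := by
  rw [scal3_X0, lin_X, Fin.sum_univ_three]
  simp [expandRing3_X1]

theorem expandRing3_XZ_X2 : expandRing3 K (lin (matXZ K) (MvPolynomial.X 2))
    = scal3 (MvPolynomial.X 1) := by
  rw [scal3_X1, lin_X, Fin.sum_univ_three]
  simp [expandRing3_X0]

theorem expandRing_X0_X0 : expandRing K (lin (matX0 K) (MvPolynomial.X 0))
    = scal2 (MvPolynomial.X 0) + L2Ring.y K := by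
  rw [scal2_X0, lin_X, Fin.sum_univ_two]
  simp [expandRing_X1, expandRing_X0]

theorem expandRing_X0_X1 : expandRing K (lin (matX0 K) (MvPolynomial.X 1))
    = scal2 (MvPolynomial.X 0) := by
  rw [scal2_X0, lin_X, Fin.sum_univ_two]
  simp [expandRing_X0]

theorem expandRing_X0_X2 : expandRing K (lin (matX0 K) (MvPolynomial.X 2))
    = scal2 (MvPolynomial.X 1) := by
  rw [scal2_X1, lin_X, Fin.sum_univ_two]
  simp

theorem expandRing_T2_X0 : expandRing K (lin (matT2 K) (MvPolynomial.X 0)) = L2Ring.y K := by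
  rw [lin_X, Fin.sum_univ_two]
  simp [expandRing_X1]

theorem expandRing_T2_X1 : expandRing K (lin (matT2 K) (MvPolynomial.X 1)) = 0 := by
  rw [lin_X, Fin.sum_univ_two]
  simp

theorem expandRing_T2_X2 : expandRing K (lin (matT2 K) (MvPolynomial.X 2))
    = scal2 (MvPolynomial.X 0) := by
  rw [scal2_X0, lin_X, Fin.sum_univ_two]
  simp [expandRing_X0]

theorem expandRing3_T3_X2' : expandRing3 K (lin (matT3 K) (MvPolynomial.X 2))
    = scal3 (MvPolynomial.X 0) := by
  rw [scal3_X0, expandRing3_T3_X2]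

theorem matX0_ne_zero : ∀ d ∈ poles3 K, expandRing K (lin (matX0 K) d) ≠ 0 := by
  intro d hd
  have hx : L2Ring.x K ≠ 0 := x_ne_zero
  simp only [poles3, Set.mem_insert_iff, Set.mem_singleton_iff] at hd
  rcases hd with rfl | rfl | rfl | rfl | rfl <;>
  simp only [map_sub, expandRing_X0_X0, expandRing_X0_X1, expandRing_X0_X2, scal2_X0, scal2_X1,
    sub_zero, add_sub_cancel_left]
  · exact x_add_y_ne_zero
  · exact hx
  · exact y_ne_zero
  · exact x_add_y_ne_zero
  · exact hx

theorem matT2_ne_zero : ∀ d ∈ polesT K, expandRing K (lin (matT2 K) d) ≠ 0 := by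
  intro d hd
  simp only [polesT, Set.mem_insert_iff, Set.mem_singleton_iff] at hd
  rcases hd with rfl | rfl | rfl <;>
  simp only [map_sub, map_add, expandRing_T2_X0, expandRing_T2_X1, expandRing_T2_X2, scal2_X0,
    sub_zero]
  · exact y_ne_zero
  · exact y_ne_zero
  · rw [add_comm]; exact x_add_y_ne_zero

theorem X0_mem_polesX : (MvPolynomial.X 0 : MvPolynomial (Fin 2) K) ∈ polesX K := by simp [polesX]

theorem X0_sub_X1_mem_polesX :
    (MvPolynomial.X 0 - MvPolynomial.X 1 : MvPolynomial (Fin 2) K) ∈ polesX K := by simp [polesX]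

variable [CharZero K]

theorem specPairs_add_smul {m : L3 K V} {m' : L2 K V} {r s : L3Ring K} {r' s' : L2Ring K}
    (h : (r • m, r' • m') ∈ specPairs K V) (h' : (s • m, s' • m') ∈ specPairs K V) :
    ((r + s) • m, (r' + s') • m') ∈ specPairs K V := by
  rw [add_smul, add_smul, ← Prod.mk_add_mk]
  exact Submodule.add_mem _ h h'

theorem specPairs_XZ_X (i : Fin 3) (m : L3 K V) (m' : L2 K V) (h : (m, m') ∈ specPairs K V) :
    (ratL3 (matXZ K) (poles3 K) matXZ_ne_zero
        (algebraMap (MvPolynomial (Fin 3) K) (Rat (poles3 K)) (MvPolynomial.X i)) • m,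
      ratL2 (matX0 K) (poles3 K) matX0_ne_zero
        (algebraMap (MvPolynomial (Fin 3) K) (Rat (poles3 K)) (MvPolynomial.X i)) • m')
      ∈ specPairs K V := by
  rw [ratL3_algebraMap, ratL2_algebraMap]
  fin_cases i
  · simp only [Fin.zero_eta]
    rw [expandRing3_XZ_X0, expandRing_X0_X0]
    exact specPairs_add_smul (specPairs_smul _ h) (specPairs_w_smul.2 h)
  · simp only [Fin.mk_one]
    rw [expandRing3_XZ_X1, expandRing_X0_X1]
    exact specPairs_smul _ h
  · simp only [Fin.reduceFinMk]
    rw [expandRing3_XZ_X2, expandRing_X0_X2]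
    exact specPairs_smul _ h

/-- The denominators become $x+w$, $x$, $w$, $x+w-z$ and $x-z$: apart from $w$, each is one of the
poles $x$ and $x-z$, or such a pole plus $w$. -/
theorem specPairs_of_XZ (d : MvPolynomial (Fin 3) K) (hd : d ∈ poles3 K) (m : L3 K V) (m' : L2 K V)
    (h : (ratL3 (matXZ K) (poles3 K) matXZ_ne_zero
        (algebraMap (MvPolynomial (Fin 3) K) (Rat (poles3 K)) d) • m,
      ratL2 (matX0 K) (poles3 K) matX0_ne_zero
        (algebraMap (MvPolynomial (Fin 3) K) (Rat (poles3 K)) d) • m') ∈ specPairs K V) :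
    (m, m') ∈ specPairs K V := by
  rw [ratL3_algebraMap, ratL2_algebraMap] at h
  simp only [poles3, Set.mem_insert_iff, Set.mem_singleton_iff] at hd
  rcases hd with rfl | rfl | rfl | rfl | rfl
  · rw [expandRing3_XZ_X0, expandRing_X0_X0] at h
    exact specPairs_of_add_smul X0_mem_polesX h
  · rw [expandRing3_XZ_X1, expandRing_X0_X1] at h
    exact specPairs_of_smul X0_mem_polesX h
  · rw [map_sub, map_sub, map_sub, map_sub, expandRing3_XZ_X0, expandRing_X0_X0, expandRing3_XZ_X1,
      expandRing_X0_X1, add_sub_cancel_left, add_sub_cancel_left] at h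
    exact specPairs_w_smul.1 h
  · rw [map_sub, map_sub, map_sub, map_sub, expandRing3_XZ_X0, expandRing_X0_X0, expandRing3_XZ_X2,
      expandRing_X0_X2, add_sub_right_comm, add_sub_right_comm, ← scal3_sub, ← scal2_sub] at h
    exact specPairs_of_add_smul X0_sub_X1_mem_polesX h
  · rw [map_sub, map_sub, map_sub, map_sub, expandRing3_XZ_X1, expandRing_X0_X1, expandRing3_XZ_X2,
      expandRing_X0_X2, ← scal3_sub, ← scal2_sub] at h
    exact specPairs_of_smul X0_sub_X1_mem_polesX h

theorem specPairs_T_X (i : Fin 3) (m : L3 K V) (m' : L2 K V) (h : (m, m') ∈ specPairs K V) :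
    (ratL3 (matT3 K) (polesT K) matT3_ne_zero
        (algebraMap (MvPolynomial (Fin 3) K) (Rat (polesT K)) (MvPolynomial.X i)) • m,
      ratL2 (matT2 K) (polesT K) matT2_ne_zero
        (algebraMap (MvPolynomial (Fin 3) K) (Rat (polesT K)) (MvPolynomial.X i)) • m')
      ∈ specPairs K V := by
  rw [ratL3_algebraMap, ratL2_algebraMap]
  fin_cases i
  · simp only [Fin.zero_eta]
    rw [expandRing3_T3_X0, expandRing_T2_X0]
    exact specPairs_w_smul.2 h
  · simp only [Fin.mk_one]
    rw [expandRing3_T3_X1, expandRing_T2_X1, zero_smul (L3Ring K) m, zero_smul (L2Ring K) m']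
    exact Submodule.zero_mem _
  · simp only [Fin.reduceFinMk]
    rw [expandRing3_T3_X2', expandRing_T2_X2]
    exact specPairs_smul _ h

theorem specPairs_of_T (d : MvPolynomial (Fin 3) K) (hd : d ∈ polesT K) (m : L3 K V) (m' : L2 K V)
    (h : (ratL3 (matT3 K) (polesT K) matT3_ne_zero
        (algebraMap (MvPolynomial (Fin 3) K) (Rat (polesT K)) d) • m,
      ratL2 (matT2 K) (polesT K) matT2_ne_zero
        (algebraMap (MvPolynomial (Fin 3) K) (Rat (polesT K)) d) • m') ∈ specPairs K V) :
    (m, m') ∈ specPairs K V := by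
  rw [ratL3_algebraMap, ratL2_algebraMap] at h
  simp only [polesT, Set.mem_insert_iff, Set.mem_singleton_iff] at hd
  rcases hd with rfl | rfl | rfl
  · rw [expandRing3_T3_X0, expandRing_T2_X0] at h
    exact specPairs_w_smul.1 h
  · rw [map_sub, map_sub, map_sub, map_sub, expandRing3_T3_X0, expandRing_T2_X0, expandRing3_T3_X1,
      expandRing_T2_X1, sub_zero, sub_zero] at h
    exact specPairs_w_smul.1 h
  · rw [map_add, map_add, map_add, map_add, expandRing3_T3_X0, expandRing_T2_X0,
      expandRing3_T3_X2', expandRing_T2_X2, add_comm, add_comm (L2Ring.y K)] at h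
    exact specPairs_of_add_smul X0_mem_polesX h

theorem specPairs_rat_XZ (r : Rat (poles3 K)) {m : L3 K V} {m' : L2 K V}
    (h : (m, m') ∈ specPairs K V) : (ratL3 (matXZ K) (poles3 K) matXZ_ne_zero r • m,
      ratL2 (matX0 K) (poles3 K) matX0_ne_zero r • m') ∈ specPairs K V :=
  rat_smul_mem_of_X (specPairs K V) (ratL3 (matXZ K) (poles3 K) matXZ_ne_zero)
    (ratL2 (matX0 K) (poles3 K) matX0_ne_zero) specPairs_XZ_X specPairs_of_XZ r h

theorem specPairs_rat_T (r : Rat (polesT K)) {m : L3 K V} {m' : L2 K V}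
    (h : (m, m') ∈ specPairs K V) : (ratL3 (matT3 K) (polesT K) matT3_ne_zero r • m,
      ratL2 (matT2 K) (polesT K) matT2_ne_zero r • m') ∈ specPairs K V :=
  rat_smul_mem_of_X (specPairs K V) (ratL3 (matT3 K) (polesT K) matT3_ne_zero)
    (ratL2 (matT2 K) (polesT K) matT2_ne_zero) specPairs_T_X specPairs_of_T r h

end SpecializationRational

/-! ### The third formula -/

section ThirdFormula
variable {K : Type*} [Field K] {V : Type*} [AddCommGroup V] [Module K V]

theorem subst_dropFst (F : PS 3 V) (i j : ℕ) :
    PS.subst (![![0, 0], ![1, 0], ![0, 1]] : Fin 3 → Fin 2 → K) F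
      (Finsupp.cons i (Finsupp.single 0 j)) = F (Finsupp.cons 0 (Finsupp.cons i (Finsupp.single 0 j))) := by
  have hM : (![![0, 0], ![1, 0], ![0, 1]] : Fin 3 → Fin 2 → K) = rowMat K ![none, some 0, some 1] := by
    ext i j; fin_cases i <;> fin_cases j <;> simp [rowMat]
  rw [hM]
  refine subst_rowMat _ _ _ _ fun a => ?_
  simp [Fin.forall_fin_succ, Fin.sum_univ_succ, DFunLike.ext_iff]

theorem coeff_flat_peel (F : PS 2 V) (i j : ℤ) :
    Lau.coeff (Lau.coeff (flat (K := LaurentSeries K) (peel (K := K) 1 F)) j) i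
      = if 0 ≤ j ∧ 0 ≤ i then F (Finsupp.cons i.toNat (Finsupp.single 0 j.toNat)) else 0 := by
  change Lau.coeff (Lau.coeff (flatFun (LaurentSeries K) (peelFun K F)) j) i = _
  rw [flatFun_coeff]
  by_cases hj : 0 ≤ j
  · rw [if_pos hj, peelFun_coeff]
    simp [hj]
  · rw [if_neg hj, if_neg fun h => hj h.1]; rfl

theorem coeff_peel3 (F : PS 3 V) (i j n : ℤ) :
    Lau.coeff (Lau.coeff (Lau.coeff (peel3 (K := K) F) n) j) i
      = if 0 ≤ n ∧ 0 ≤ j ∧ 0 ≤ i then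
        F (Finsupp.cons i.toNat (Finsupp.cons j.toNat (Finsupp.single 0 n.toNat))) else 0 := by
  change Lau.coeff (Lau.coeff (Lau.coeff (flatFun (L2Ring K) (peelFun (LaurentSeries K)
    (peelFun K F))) n) j) i = _
  rw [flatFun_coeff]
  by_cases hn : 0 ≤ n
  · rw [if_pos hn, peelFun_coeff]
    by_cases hj : 0 ≤ j
    · rw [if_pos hj, peelFun_coeff]
      simp [hn, hj]
    · rw [if_neg hj, if_neg fun h => hj h.2.1]; rfl
  · rw [if_neg hn, if_neg fun h => hn h.1]; rfl

variable [CharZero K]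

theorem specPairs_mk_one (F : PS 3 V) :
    (toL3 (matXZ K) (poles3 K) matXZ_ne_zero (LocalizedModule.mk F 1),
      toL2 (matX0 K) (poles3 K) matX0_ne_zero (LocalizedModule.mk F 1)) ∈ specPairs K V := by
  have hM : matMul (matXZ K) ![![0, 0], ![1, 0], ![0, 1]] = matX0 K := by
    funext i j; fin_cases i <;> fin_cases j <;> simp [matMul, Fin.sum_univ_succ]
  rw [toL3_mk_one, toL2_mk_one, ← hM, ← subst_subst]
  set H := PS.subst (matXZ K) F
  intro n
  have hc : ∀ (i : ℕ) (s : Fin 1 →₀ ℕ), Finsupp.cons i s (1 : Fin 2) = s 0 := fun i s =>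
    Finsupp.cons_succ 0 i s
  -- $G$ is the coefficient of $w^n$ in $F(x+w,x,z)$, as a power series in $x$ and $z$. The
  -- exponents of $H$ are in the order $z,x,w$, hence the reversal.
  let G : PS 2 V := fun b => if 0 ≤ n then
    H (Finsupp.cons (b 1) (Finsupp.cons (b 0) (Finsupp.single 0 n.toNat))) else 0
  have h := mem_zeroPairs (LocalizedModule.mk G 1 : Sing (polesX K) V)
  rw [expandZX, toL2_mk_one, Sing.subst_mk_one, singFlat_mk_one] at h
  refine (congrArg (· ∈ zeroPairs K V) (congrArg₂ Prod.mk ?_ ?_)).mp h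
  · refine Lau.ext fun j => Lau.ext fun i => ?_
    rw [coeff_flat_peel, subst_swapMat2]
    refine Eq.trans ?_ (coeff_peel3 H i j n).symm
    by_cases hn : 0 ≤ n
    · simp [G, hn, hc]
    · simp [G, hn]
  · refine Lau.ext fun i => ?_
    refine Eq.trans ?_ (coeff_flat_peel _ i n).symm
    change Lau.coeff (flatFun K (PS.subst (![![1], ![0]] : Fin 2 → Fin 1 → K) G)) i = _
    rw [flatFun_coeff, subst_evalSnd, subst_dropFst]
    by_cases hn : 0 ≤ n
    · simp [G, hn, hc]
    · simp [G, hn]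

theorem specPairs_sing (x : Sing (poles3 K) V) :
    (toL3 (matXZ K) (poles3 K) matXZ_ne_zero x, toL2 (matX0 K) (poles3 K) matX0_ne_zero x)
      ∈ specPairs K V := by
  induction x using LocalizedModule.induction_on with
  | _ F s =>
    have h := specPairs_rat_XZ (IsLocalization.mk' (Rat (poles3 K)) 1 s) (specPairs_mk_one (K := K) F)
    rw [← toL3_rat_smul, ← toL2_rat_smul, ← mk_smul_self F s, ← algebraMap_smul (Rat (poles3 K))
      (s : MvPolynomial (Fin 3) K), smul_smul, IsLocalization.mk'_spec, map_one, one_smul] at h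
    exact h

variable (Q : HDQuantumVertexAlgebra K V)

/-- The coefficient of $w^n$ is built from $X_{x,z}(v\otimes c)$, with $v$ a coefficient of $Y_w$;
at $z=0$ this becomes $Y(v,x)c$. -/
theorem specPairs_coefOp (k : ℕ) (u : (V ⊗[K] V) ⊗[K] V) :
    (coefOp (expXZ Q) Q.Y k u, iterOp Q.Y k u) ∈ specPairs K V := by
  induction u with
  | zero => rw [map_zero, map_zero]; exact Submodule.zero_mem _
  | add u v hu hv =>
    rw [map_add, map_add, ← Prod.mk_add_mk]
    exact Submodule.add_mem _ hu hv
  | tmul u c =>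
    have e : iterOp Q.Y k (u ⊗ₜ c) = ∑ p ∈ Finset.HasAntidiagonal.antidiagonal k,
        Lau.map ((TensorProduct.curry (Q.Y p.1)).flip c) (Q.Y p.2 u) := by
      simp [iterOp]
    rw [coefOp_apply, e, prod_mk_sum]
    exact Submodule.sum_mem _ fun p _ n => mem_zeroPairs (Q.X p.1 ((Q.Y p.2 u).coeff n ⊗ₜ c))

theorem specPairs_iterXZ (k : ℕ) (u : (V ⊗[K] V) ⊗[K] V) :
    (iterXZ Q k u, bc (ratL2 (matT2 K) (polesT K) matT2_ne_zero) (iterOp Q.Y)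
      (fun i => legMap (LinearEquiv.refl K _) (Q.trans i)) k u) ∈ specPairs K V :=
  bc_mem (S := specPairs K V) (fun r _ _ h => specPairs_rat_T r h) (specPairs_coefOp Q) _ k u

/-- Both sides are values at $z=0$ of $X_{x+w,x,z}(a\otimes b\otimes c)$: one by substitution in the
triple product, the other through `tripXZ_eq`. -/
theorem expand_triple_thd (k : ℕ) (a b c : V) (x : Sing (poles3 K) V)
    (hx : evT x = tripP Q k ((a ⊗ₜ b) ⊗ₜ c)) :
    Sing.expand K (polesA K) expandA_ne_zero
        (Sing.subst ![![1, 1], ![1, 0], ![0, 0]] (adm_expand3 K) x)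
      = applySeries (iterOp Q.Y)
          (leg12 (along ((Rat.expand K (polesA K) expandA_ne_zero).comp
            (Rat.subst ![![0, 1], ![0, 0], ![1, 0]] (adm_trans K))) Q.trans))
          k ((a ⊗ₜ b) ⊗ₜ c) := by
  -- The expansion determines the element, so the identities proved for the constructed triple
  -- product are available.
  have h0 : x = tripX Q k ((a ⊗ₜ b) ⊗ₜ c) := evT_injective (hx.trans (evT_tripX Q k _).symm)
  have hρ : (Rat.expand K (polesA K) expandA_ne_zero).comp
      (Rat.subst ![![0, 1], ![0, 0], ![1, 0]] (adm_trans K))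
      = ratL2 (matT2 K) (polesT K) matT2_ne_zero := by
    refine rat_algHom_ext fun i => ?_
    rw [ratL2_algebraMap, AlgHom.comp_apply, Rat.subst_algebraMap, Rat.expand, ratLift_algebraMap]
  have h1 := specPairs_sing x
  have h2 := specPairs_iterXZ Q k ((a ⊗ₜ b) ⊗ₜ c)
  rw [← tripXZ_eq, tripXZ, LinearMap.comp_apply, ← h0] at h2
  rw [expand_subst _ _ matX0_ne_zero, leg12, leg_along, applySeries_extend_along, hρ]
  exact specPairs_ext h1 h2

end ThirdFormula

end HDQVA

theorem mainTheorem2 {V : Type*} [AddCommGroup V] [Module ℂ V]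
    (Q : HDQuantumVertexAlgebra ℂ V) :
    (∃ X₃ : ℕ → (V ⊗[ℂ] V) ⊗[ℂ] V →ₗ[ℂ] Sing (poles3 ℂ) V,
      ∀ k a b c, Sing.expand3 (X₃ k ((a ⊗ₜ b) ⊗ₜ c))
        = ∑ p ∈ Finset.HasAntidiagonal.antidiagonal k,
          singMap (D' := polesX (LaurentSeries ℂ)) (adm_const ℂ)
            (TensorProduct.curry (Q.Y p.1) a) (Q.X p.2 (b ⊗ₜ c))) ∧
    ∀ X₃ : ℕ → (V ⊗[ℂ] V) ⊗[ℂ] V →ₗ[ℂ] Sing (poles3 ℂ) V,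
      (∀ k a b c, Sing.expand3 (X₃ k ((a ⊗ₜ b) ⊗ₜ c))
        = ∑ p ∈ Finset.HasAntidiagonal.antidiagonal k,
          singMap (D' := polesX (LaurentSeries ℂ)) (adm_const ℂ)
            (TensorProduct.curry (Q.Y p.1) a) (Q.X p.2 (b ⊗ₜ c))) →
      ∀ k a b c,
        -- `i_{z₁;z₂} X_{z₁,z₂,0}(a ⊗ b ⊗ c) = Y(a,z₁) Y(b,z₂) c`, where `x = z₁`, `y = z₂`
        Sing.expand ℂ (polesS ℂ) expandS_ne_zero
            (Sing.subst ![![1, 0], ![0, 1], ![0, 0]] (adm_expand1 ℂ) (X₃ k ((a ⊗ₜ b) ⊗ₜ c)))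
          = prodOp Q.Y k ((a ⊗ₜ b) ⊗ₜ c) ∧
        -- `i_{z₂;z₁} X_{z₁,z₂,0}(a ⊗ b ⊗ c)
        --   = Y_{z₂} (1 ⊗ Y_{z₁}) i_{z₂;z₁} S^{(τ),12}_{z₂,z₁} (b ⊗ a ⊗ c)`,
        -- where `x = z₂`, `y = z₁`
        Sing.expand ℂ (polesS ℂ) expandS_ne_zero
            (Sing.subst ![![0, 1], ![1, 0], ![0, 0]] (adm_expand2 ℂ) (X₃ k ((a ⊗ₜ b) ⊗ₜ c)))
          = applySeries (prodOp Q.Y)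
              (leg12 (along (Rat.expand ℂ (polesS ℂ) expandS_ne_zero) Q.braid))
              k ((b ⊗ₜ a) ⊗ₜ c) ∧
        -- `i_{z₂;z₃} X_{z₂+z₃,z₂,0}(a ⊗ b ⊗ c)
        --   = Y_{z₂} (Y_{z₃} ⊗ 1) i_{z₂;z₃} S^{(z₂),12}_{z₃,0} (a ⊗ b ⊗ c)`,
        -- where `x = z₂`, `y = z₃`
        Sing.expand ℂ (polesA ℂ) expandA_ne_zero
            (Sing.subst ![![1, 1], ![1, 0], ![0, 0]] (adm_expand3 ℂ) (X₃ k ((a ⊗ₜ b) ⊗ₜ c)))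
          = applySeries (iterOp Q.Y)
              (leg12 (along ((Rat.expand ℂ (polesA ℂ) expandA_ne_zero).comp
                (Rat.subst ![![0, 1], ![0, 0], ![1, 0]] (adm_trans ℂ))) Q.trans))
              k ((a ⊗ₜ b) ⊗ₜ c) := by
  refine ⟨exists_triple Q, fun X₃ h k a b c => ?_⟩
  -- The defining property enters only through the full expansion, which determines $X_3$.
  have hx := fun k a b c => (expand3_eq_iff Q _ k a b c).1 (h k a b c)
  exact ⟨expand_triple_fst Q k a b c _ (hx k a b c), expand_triple_snd Q k a b c _ (hx k a b c),
    expand_triple_thd Q k a b c _ (hx k a b c)⟩
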